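/- **Theorem.** *Notation.* Let $B_n$ be Artin's braid group with generators $\sigma_1,\dots,\sigma_{n-1}$, $\rho:B_n\to S_n$ the standard homomorphism and $PB_n=\ker\rho$; in a product $gh$ the braid $h$ comes first. In $B_3$ put $x_{12}=\sigma_1^2$, $x_{23}=\sigma_2^2$, $x_{13}=\sigma_2\sigma_1^2\sigma_2^{-1}$, and $F_2=\langle x_{12},x_{23}\rangle\le PB_3$; also write $x_{i,i+1}=\sigma_i^2$ in $B_4$ and $x_{12}=\sigma_1^2$ in $B_2$. For a braid $f\in PB_3$ let $\varphi_{123}(f),\varphi_{234}(f)\in PB_4$ be obtained by adding a vertical strand on the right, respectively on the left, and let $\varphi_{12,3,4}(f),\varphi_{1,23,4}(f),\varphi_{1,2,34}(f)$ be obtained by doubling the first, second, third strand; define $\varphi_{12},\varphi_{23},\varphi_{12,3},\varphi_{1,23}:PB_2\to PB_3$ similarly. *The profinite Grothendieck–Teichmüller group.* $\mathsf{PaB}$ is the operad in groupoids of parenthesized braids: the objects of $\mathsf{PaB}(n)$ are the words of the free magma on $1,\dots,n$ in which every letter occurs exactly once (so $\mathsf{PaB}(0)$ is empty); if $\mathfrak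 p(\tau)\in S_n$ sends a position to the letter of $\tau$ at this position, the morphisms $\tau_1\to\tau_2$ are the braids $g\in B_n$ with $\rho(g)=\mathfrak p(\tau_2)^{-1}\mathfrak p(\tau_1)$, composed as braids; $S_n$ acts by renaming letters; $\gamma\circ_i\eta$ replaces the strand of $\gamma$ that starts at the letter $i$ by a thin version of $\eta$. The profinite completion $\widehat{\mathcal G}$ of a groupoid $\mathcal G$ with finitely many objects is the topological groupoid $\lim\mathcal G/\!\sim$, where $\sim$ runs over the equivalence relations on the set of morphisms that relate only parallel morphisms, are compatible with composition and have finitely many classes. Completing each $\mathsf{PaB}(n)$ gives the operad $\widehat{\mathsf{PaB}}$ in topological groupoids, and $\widehat{\mathsf{GT}}$ is the group of continuous automorphisms of $\widehat{\mathsf{PaB}}$ that are the identity on objects. *Charming GT-shadows.* Let $N\in\mathsf{NFI}_{PB_4}(B_4)$, i.e. $N$ is a normal subgroup of finite index of $B_4$ with $N\le PB_4$. Let $N_{PB_3}$ be the set of $h\in PB_3$ whose images under $\varphi_{123},\varphi_{234},\varphi_{12,3,4},\varphi_{1,23,4},\varphi_{1,2,34}$ all lie in $N$, let $N_{PB_2}$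 be the set of $h\in PB_2$ whose images under $\varphi_{12},\varphi_{23},\varphi_{12,3},\varphi_{1,23}$ all lie in $N_{PB_3}$, and $N_{\rm ord}=[PB_2:N_{PB_2}]$. A *GT-pair* for $N$ is a class $[(m,f)]\in\mathbb Z/N_{\rm ord}\mathbb Z\times PB_3/N_{PB_3}$ with $$\sigma_1x_{12}^mf^{-1}\sigma_2x_{23}^mf\equiv f^{-1}\sigma_1\sigma_2(x_{13}x_{23})^m,\qquad f^{-1}\sigma_2x_{23}^mf\sigma_1x_{12}^m\equiv\sigma_2\sigma_1(x_{12}x_{13})^mf\pmod{N_{PB_3}},$$ $$\varphi_{234}(f)\varphi_{1,23,4}(f)\varphi_{123}(f)\equiv\varphi_{1,2,34}(f)\varphi_{12,3,4}(f)\pmod N.$$ It defines homomorphisms $T^{B_2}:B_2\to B_2/N_{PB_2}$, $\sigma_1\mapsto\sigma_1x_{12}^m$; $T^{B_3}:B_3\to B_3/N_{PB_3}$, $\sigma_1\mapsto\sigma_1x_{12}^m$, $\sigma_2\mapsto f^{-1}\sigma_2x_{23}^mf$; and $T^{B_4}:B_4\to B_4/N$, $\sigma_1\mapsto\sigma_1x_{12}^m$,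 $\sigma_2\mapsto\varphi_{123}(f)^{-1}\sigma_2x_{23}^m\varphi_{123}(f)$, $\sigma_3\mapsto\varphi_{12,3,4}(f)^{-1}\sigma_3x_{34}^m\varphi_{12,3,4}(f)$. A GT-pair is a *GT-shadow* if these homomorphisms map $PB_2$, $PB_3$, $PB_4$ onto $PB_2/N_{PB_2}$, $PB_3/N_{PB_3}$, $PB_4/N$. A GT-shadow is *charming* if $fN_{PB_3}$ contains an element of $[F_2,F_2]$ and $T^{B_3}$ maps $F_2$ onto $F_2/(N_{PB_3}\cap F_2)$. Let $\mathsf{GT}^\heartsuit(N)$ be the set of charming GT-shadows. The subgroup $N$ is *isolated* if $\ker T^{B_4}_{m,f}=N$ for every $[(m,f)]\in\mathsf{GT}^\heartsuit(N)$. *Claim.* For every isolated $N$ the set $\mathsf{GT}^\heartsuit(N)$ is a finite group $\mathcal{ML}(N)$ under $$[(m_2,f_2)]\cdot[(m_1,f_1)]=[(2m_1m_2+m_1+m_2,\;f_2\,T^{B_3}_{m_2,f_2}(f_1))],$$ for isolated $K\le N$ the assignment $[(m,f)]\mapsto[(m,f)]$ is a well-defined homomorphism $\mathcal{ML}(K)\to\mathcal{ML}(N)$,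 and these make $\mathcal{ML}$ a functor from the poset of isolated elements of $\mathsf{NFI}_{PB_4}(B_4)$ (ordered by inclusion) to finite groups. The group $\widehat{\mathsf{GT}}$ is isomorphic to $\lim(\mathcal{ML})$. -/

import Mathlib

open CategoryTheory

namespace GTShadows

/-! ### Braid groups -/

/-- Artin's relators for the braid group on `n` strands. The generator with index `i : Fin (n - 1)`
is the usual `σ_{i+1}`. -/
def braidRels (n : ℕ) : Set (FreeGroup (Fin (n - 1))) :=
  {r | ∃ i j : Fin (n - 1), ((i : ℕ) + 2 ≤ j ∨ (j : ℕ) + 2 ≤ i) ∧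
      r = .of i * .of j * (.of i)⁻¹ * (.of j)⁻¹} ∪
  {r | ∃ i j : Fin (n - 1), (i : ℕ) + 1 = j ∧
      r = .of i * .of j * .of i * (.of j)⁻¹ * (.of i)⁻¹ * (.of j)⁻¹}

/-- The Artin braid group `B_n`. In a product `g * h` the braid `h` comes first. -/
abbrev Braid (n : ℕ) : Type := PresentedGroup (braidRels n)

/-- `σ n i` is the standard generator which exchanges the positions `i` and `i + 1`, where positions
are numbered `0, …, n - 1`; it is the usual `σ_{i+1}`. (By convention it is `1` if `n ≤ i + 1`.) -/
def σ (n i : ℕ) : Braid n := if h : i < n - 1 then PresentedGroup.of ⟨i, h⟩ else 1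

theorem σ_comm (n i j : ℕ) (h : i + 2 ≤ j ∨ j + 2 ≤ i) : σ n i * σ n j = σ n j * σ n i := by
  unfold σ
  split_ifs with hi hj hj
  · have : (PresentedGroup.mk (braidRels n)) (.of ⟨i, hi⟩ * .of ⟨j, hj⟩) =
        (PresentedGroup.mk (braidRels n)) (.of ⟨j, hj⟩ * .of ⟨i, hi⟩) := by
      apply PresentedGroup.mk_eq_mk_of_mul_inv_mem
      left
      exact ⟨⟨i, hi⟩, ⟨j, hj⟩, h, by group⟩
    rw [map_mul, map_mul] at this
    exact this
  all_goals simp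

theorem σ_braid (n i : ℕ) (h : i + 2 < n) :
    σ n i * σ n (i + 1) * σ n i = σ n (i + 1) * σ n i * σ n (i + 1) := by
  unfold σ
  have hi : i < n - 1 := by omega
  have hj : i + 1 < n - 1 := by omega
  rw [dif_pos hi, dif_pos hj]
  have : (PresentedGroup.mk (braidRels n)) (.of ⟨i, hi⟩ * .of ⟨i + 1, hj⟩ * .of ⟨i, hi⟩) =
      (PresentedGroup.mk (braidRels n)) (.of ⟨i + 1, hj⟩ * .of ⟨i, hi⟩ * .of ⟨i + 1, hj⟩) := by
    apply PresentedGroup.mk_eq_mk_of_mul_inv_mem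
    right
    exact ⟨⟨i, hi⟩, ⟨i + 1, hj⟩, rfl, by group⟩
  rw [map_mul, map_mul, map_mul, map_mul] at this
  exact this

/-- The universal property of the presentation of `B_n`. -/
def braidLift {G : Type*} [Group G] (n : ℕ) (s : ℕ → G)
    (hcomm : ∀ i j, i + 2 ≤ j → j + 1 < n → s i * s j = s j * s i)
    (hbraid : ∀ i, i + 2 < n → s i * s (i + 1) * s i = s (i + 1) * s i * s (i + 1)) :
    Braid n →* G :=
  PresentedGroup.toGroup (f := fun i : Fin (n - 1) => s i) (by
    rintro r (⟨i, j, hij, rfl⟩ | ⟨i, j, hij, rfl⟩)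
    · have hi := i.2
      have hj := j.2
      have : s i * s j = s j * s i := by
        rcases hij with h | h
        · exact hcomm i j h (by omega)
        · exact (hcomm j i h (by omega)).symm
      simp [this]
    · have hj := j.2
      have := hbraid i (by omega)
      rw [hij] at this
      simp [this])

theorem braidLift_σ {G : Type*} [Group G] (n : ℕ) (s : ℕ → G)
    (hcomm : ∀ i j, i + 2 ≤ j → j + 1 < n → s i * s j = s j * s i)
    (hbraid : ∀ i, i + 2 < n → s i * s (i + 1) * s i = s (i + 1) * s i * s (i + 1))
    (i : ℕ) (hi : i + 1 < n) : braidLift n s hcomm hbraid (σ n i) = s i := by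
  have hi' : i < n - 1 := by omega
  unfold σ braidLift
  rw [dif_pos hi', PresentedGroup.toGroup.of]

theorem braid_induction {n : ℕ} {P : Braid n → Prop} (one : P 1)
    (mul : ∀ g h, P g → P h → P (g * h)) (inv : ∀ g, P g → P g⁻¹)
    (gen : ∀ i, i + 1 < n → P (σ n i)) (g : Braid n) : P g := by
  let H : Subgroup (Braid n) :=
    { carrier := {g | P g}, one_mem' := one, mul_mem' := fun ha hb => mul _ _ ha hb,
      inv_mem' := fun ha => inv _ ha }
  refine PresentedGroup.generated_by (braidRels n) H (fun j => ?_) g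
  have hj := j.2
  have := gen j (by omega)
  rwa [σ, dif_pos hj] at this

/-- The transposition of the positions `i` and `i + 1`. -/
def adjSwap (n i : ℕ) : Equiv.Perm (Fin n) :=
  if h : i + 1 < n then Equiv.swap ⟨i, by omega⟩ ⟨i + 1, h⟩ else 1

theorem adjSwap_val (n i : ℕ) (h : i + 1 < n) (p : Fin n) : (adjSwap n i p : ℕ) =
    if (p : ℕ) = i then i + 1 else if (p : ℕ) = i + 1 then i else p := by
  rw [adjSwap, dif_pos h, Equiv.swap_apply_def]
  simp only [Fin.ext_iff]
  split_ifs <;> rfl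

theorem adjSwap_adjSwap (n i : ℕ) (p : Fin n) : adjSwap n i (adjSwap n i p) = p := by
  unfold adjSwap
  split_ifs <;> simp

/-- The standard homomorphism `ρ : B_n → S_n`. -/
def ρ (n : ℕ) : Braid n →* Equiv.Perm (Fin n) :=
  braidLift n (adjSwap n)
    (by
      intro i j hij hj
      ext p
      simp only [Equiv.Perm.coe_mul, Function.comp_apply]
      rw [adjSwap_val n i (by omega), adjSwap_val n j (by omega), adjSwap_val n j (by omega),
        adjSwap_val n i (by omega)]
      split_ifs <;> omega)
    (by
      intro i hi
      ext p
      simp only [Equiv.Perm.coe_mul, Function.comp_apply]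
      rw [adjSwap_val n i (by omega), adjSwap_val n (i + 1) (by omega),
        adjSwap_val n i (by omega), adjSwap_val n (i + 1) (by omega), adjSwap_val n i (by omega),
        adjSwap_val n (i + 1) (by omega)]
      split_ifs <;> omega)

theorem ρ_σ (n i : ℕ) (hi : i + 1 < n) : ρ n (σ n i) = adjSwap n i := braidLift_σ _ _ _ _ _ hi

/-- The pure braid group `PB_n`. -/
abbrev PB (n : ℕ) : Subgroup (Braid n) := (ρ n).ker

/-! ### Juxtaposition and cabling of braids -/

/-- The homomorphism `B_m → B_N` which places a braid on the `m` positions `p, …, p + m - 1` and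
completes it by vertical strands. -/
def shift (m N p : ℕ) (h : p + m ≤ N) : Braid m →* Braid N :=
  braidLift m (fun i => σ N (i + p)) (fun i j hij _ => σ_comm _ _ _ (by omega))
    (fun i hi => by
      have := σ_braid N (i + p) (by omega)
      rwa [show i + p + 1 = i + 1 + p by omega] at this)

theorem shift_σ (m N p : ℕ) (h : p + m ≤ N) (i : ℕ) (hi : i + 1 < m) :
    shift m N p h (σ m i) = σ N (i + p) := braidLift_σ _ _ _ _ _ hi

/-- `σ_a σ_{a+1} ⋯ σ_{a+m-1}`: the `m` strands at `a, …, a + m - 1` pass, in parallel, over the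
strand at `a + m`. -/
def cableUp (N a : ℕ) : ℕ → Braid N
  | 0 => 1
  | m + 1 => cableUp N a m * σ N (a + m)

/-- `σ_{a+m-1} ⋯ σ_{a+1} σ_a`: the strand at `a` passes over the `m` strands at
`a + 1, …, a + m`. -/
def cableDown (N a : ℕ) : ℕ → Braid N
  | 0 => 1
  | m + 1 => σ N (a + m) * cableDown N a m

theorem σ_comm_cableUp (N a m j : ℕ) (h : j + 2 ≤ a ∨ a + m + 1 ≤ j) :
    σ N j * cableUp N a m = cableUp N a m * σ N j := by
  induction m with
  | zero => simp [cableUp]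
  | succ m ih =>
    rw [cableUp, ← mul_assoc, ih (by omega), mul_assoc, σ_comm N j (a + m) (by omega), mul_assoc]

theorem σ_comm_cableDown (N a m j : ℕ) (h : j + 2 ≤ a ∨ a + m + 1 ≤ j) :
    σ N j * cableDown N a m = cableDown N a m * σ N j := by
  induction m with
  | zero => simp [cableDown]
  | succ m ih =>
    rw [cableDown, ← mul_assoc, σ_comm N j (a + m) (by omega), mul_assoc, ih (by omega), mul_assoc]

theorem cable_rel₁ (N a m : ℕ) (h : a + m + 1 < N) :
    σ N a * cableUp N (a + 1) m * cableUp N a m =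
      cableUp N (a + 1) m * cableUp N a m * σ N (a + m) := by
  induction m with
  | zero => simp [cableUp]
  | succ m ih =>
    have e : a + 1 + m = a + m + 1 := by omega
    have hc := σ_comm_cableUp N a m (a + m + 1) (by omega)
    have hb := σ_braid N (a + m) (by omega)
    have ih := ih (by omega)
    simp only [cableUp, e]
    calc _ = σ N a * cableUp N (a + 1) m * (σ N (a + m + 1) * cableUp N a m) * σ N (a + m) := by
          group
      _ = (σ N a * cableUp N (a + 1) m * cableUp N a m) * σ N (a + m + 1) * σ N (a + m) := by
          rw [hc]; group
      _ = cableUp N (a + 1) m * cableUp N a m *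
            (σ N (a + m) * σ N (a + m + 1) * σ N (a + m)) := by rw [ih]; group
      _ = cableUp N (a + 1) m * (cableUp N a m * σ N (a + m + 1)) * σ N (a + m) *
            σ N (a + m + 1) := by rw [hb]; group
      _ = _ := by rw [← hc]; simp only [← add_assoc]; group

theorem cable_rel₂ (N a m : ℕ) (h : a + m + 1 < N) :
    cableUp N a m * σ N (a + m) * cableDown N a m =
      cableDown N (a + 1) m * σ N a * cableUp N (a + 1) m := by
  induction m with
  | zero => simp [cableUp, cableDown]
  | succ m ih =>
    have e : a + 1 + m = a + m + 1 := by omega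
    have hc := σ_comm_cableUp N a m (a + m + 1) (by omega)
    have hc' := σ_comm_cableDown N a m (a + m + 1) (by omega)
    have hb := σ_braid N (a + m) (by omega)
    have ih := ih (by omega)
    simp only [cableUp, cableDown, e, ← add_assoc]
    calc _ = cableUp N a m * (σ N (a + m) * σ N (a + m + 1) * σ N (a + m)) *
            cableDown N a m := by group
      _ = (cableUp N a m * σ N (a + m + 1)) * σ N (a + m) *
            (σ N (a + m + 1) * cableDown N a m) := by rw [hb]; group
      _ = σ N (a + m + 1) * (cableUp N a m * σ N (a + m) * cableDown N a m) *
            σ N (a + m + 1) := by rw [hc', ← hc]; group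
      _ = _ := by rw [ih]; group

theorem cable_rel₃ (N a m : ℕ) (h : a + m + 1 < N) :
    cableDown N a m * cableDown N (a + 1) m * σ N a =
      σ N (a + m) * cableDown N a m * cableDown N (a + 1) m := by
  induction m with
  | zero => simp [cableDown]
  | succ m ih =>
    have e : a + 1 + m = a + m + 1 := by omega
    have hc := σ_comm_cableDown N a m (a + m + 1) (by omega)
    have hb := σ_braid N (a + m) (by omega)
    have ih := ih (by omega)
    simp only [cableDown, e, ← add_assoc]
    calc _ = σ N (a + m) * (cableDown N a m * σ N (a + m + 1)) * cableDown N (a + 1) m *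
            σ N a := by group
      _ = σ N (a + m) * σ N (a + m + 1) * (cableDown N a m * cableDown N (a + 1) m * σ N a) := by
          rw [← hc]; group
      _ = (σ N (a + m) * σ N (a + m + 1) * σ N (a + m)) * cableDown N a m *
            cableDown N (a + 1) m := by rw [ih]; group
      _ = σ N (a + m + 1) * σ N (a + m) * (σ N (a + m + 1) * cableDown N a m) *
            cableDown N (a + 1) m := by rw [hb]; group
      _ = _ := by rw [hc]; group

/-- The result of replacing, in the generator `σ n k`, the strand which starts at the position `p`
by `m` parallel strands; here `N = n + m - 1` is the new number of strands. -/
def cableGen (N m k p : ℕ) : Braid N :=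
  if p < k then σ N (k + m - 1)
  else if p = k then cableUp N k m
  else if p = k + 1 then cableDown N k m
  else σ N k

theorem cableGen_lt {N m k p : ℕ} (h : p < k) : cableGen N m k p = σ N (k + m - 1) := if_pos h

theorem cableGen_self (N m k : ℕ) : cableGen N m k k = cableUp N k m := by simp [cableGen]

theorem cableGen_succ (N m k : ℕ) : cableGen N m k (k + 1) = cableDown N k m := by simp [cableGen]

theorem cableGen_gt {N m k p : ℕ} (h : k + 1 < p) : cableGen N m k p = σ N k := by
  rw [cableGen, if_neg (by omega), if_neg (by omega), if_neg (by omega)]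

theorem cableGen_comm (N m i j p q r : ℕ) (hij : i + 2 ≤ j)
    (hq : q = if p = j then j + 1 else if p = j + 1 then j else p)
    (hr : r = if p = i then i + 1 else if p = i + 1 then i else p) :
    cableGen N m i q * cableGen N m j p = cableGen N m j r * cableGen N m i p := by
  rcases (show p < i ∨ p = i ∨ p = i + 1 ∨ (i + 1 < p ∧ p < j) ∨ p = j ∨ p = j + 1 ∨ j + 1 < p by
    omega) with h | h | h | h | h | h | h
  · obtain rfl : q = p := by rw [hq, if_neg (by omega), if_neg (by omega)]
    obtain rfl : r = q := by rw [hr, if_neg (by omega), if_neg (by omega)]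
    rw [cableGen_lt h, cableGen_lt (by omega)]
    exact σ_comm _ _ _ (by omega)
  · subst h
    obtain rfl : q = p := by rw [hq, if_neg (by omega), if_neg (by omega)]
    obtain rfl : r = q + 1 := by rw [hr, if_pos rfl]
    rw [cableGen_self, cableGen_lt (by omega), cableGen_lt (by omega)]
    exact (σ_comm_cableUp _ _ _ _ (by omega)).symm
  · subst h
    obtain rfl : q = i + 1 := by rw [hq, if_neg (by omega), if_neg (by omega)]
    obtain rfl : r = i := by rw [hr, if_neg (by omega), if_pos rfl]
    rw [cableGen_succ, cableGen_lt (by omega), cableGen_lt (by omega)]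
    exact (σ_comm_cableDown _ _ _ _ (by omega)).symm
  · obtain rfl : q = p := by rw [hq, if_neg (by omega), if_neg (by omega)]
    obtain rfl : r = q := by rw [hr, if_neg (by omega), if_neg (by omega)]
    rw [cableGen_lt h.2, cableGen_gt h.1]
    exact σ_comm _ _ _ (by omega)
  · subst h
    obtain rfl : q = p + 1 := by rw [hq, if_pos rfl]
    obtain rfl : r = p := by rw [hr, if_neg (by omega), if_neg (by omega)]
    rw [cableGen_self, cableGen_gt (by omega), cableGen_gt (by omega)]
    exact σ_comm_cableUp _ _ _ _ (by omega)
  · subst h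
    obtain rfl : q = j := by rw [hq, if_neg (by omega), if_pos rfl]
    obtain rfl : r = q + 1 := by rw [hr, if_neg (by omega), if_neg (by omega)]
    rw [cableGen_succ, cableGen_gt (by omega), cableGen_gt (by omega)]
    exact σ_comm_cableDown _ _ _ _ (by omega)
  · obtain rfl : q = p := by rw [hq, if_neg (by omega), if_neg (by omega)]
    obtain rfl : r = q := by rw [hr, if_neg (by omega), if_neg (by omega)]
    rw [cableGen_gt h, cableGen_gt (by omega)]
    exact σ_comm _ _ _ (by omega)

theorem cableGen_braid (N m i p q q' r r' : ℕ) (hN : i + m + 1 < N) (hi : p < i → 0 < i + m)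
    (hp : i + 2 < p → i + 2 < N)
    (hq : q = if p = i then i + 1 else if p = i + 1 then i else p)
    (hq' : q' = if q = i + 1 then i + 2 else if q = i + 2 then i + 1 else q)
    (hr : r = if p = i + 1 then i + 2 else if p = i + 2 then i + 1 else p)
    (hr' : r' = if r = i then i + 1 else if r = i + 1 then i else r) :
    cableGen N m i q' * cableGen N m (i + 1) q * cableGen N m i p =
      cableGen N m (i + 1) r' * cableGen N m i r * cableGen N m (i + 1) p := by
  rcases (show p < i ∨ p = i ∨ p = i + 1 ∨ p = i + 2 ∨ i + 2 < p by omega) with h | h | h | h | h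
  · have hi := hi h
    obtain rfl : q = p := by rw [hq]; split_ifs <;> omega
    obtain rfl : q' = q := by rw [hq']; split_ifs <;> omega
    obtain rfl : r = q' := by rw [hr]; split_ifs <;> omega
    obtain rfl : r' = r := by rw [hr']; split_ifs <;> omega
    rw [cableGen_lt h, cableGen_lt (by omega)]
    have := σ_braid N (i + m - 1) (by omega)
    rwa [show i + m - 1 + 1 = i + 1 + m - 1 by omega] at this
  · subst h
    obtain rfl : q = p + 1 := by rw [hq]; split_ifs <;> omega
    obtain rfl : q' = p + 2 := by rw [hq']; split_ifs <;> omega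
    obtain rfl : r = p := by rw [hr]; split_ifs <;> omega
    obtain rfl : r' = r + 1 := by rw [hr']; split_ifs <;> omega
    rw [cableGen_gt (by omega), cableGen_self, cableGen_self, cableGen_lt (by omega)]
    have := cable_rel₁ N r m (by omega)
    rwa [show r + 1 + m - 1 = r + m by omega]
  · subst h
    obtain rfl : q = i := by rw [hq]; split_ifs <;> omega
    obtain rfl : q' = q := by rw [hq']; split_ifs <;> omega
    obtain rfl : r = q' + 2 := by rw [hr]; split_ifs <;> omega
    obtain rfl : r' = q' + 2 := by rw [hr']; split_ifs <;> omega
    rw [cableGen_self, cableGen_lt (show q' < q' + 1 by omega), cableGen_succ, cableGen_self,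
      cableGen_gt (show q' + 1 < q' + 2 by omega),
      show cableGen N m (q' + 1) (q' + 2) = cableDown N (q' + 1) m from cableGen_succ _ _ _]
    have := cable_rel₂ N q' m (by omega)
    rwa [show q' + 1 + m - 1 = q' + m by omega]
  · subst h
    obtain rfl : q = i + 2 := by rw [hq]; split_ifs <;> omega
    obtain rfl : q' = i + 1 := by rw [hq']; split_ifs <;> omega
    obtain rfl : r = i + 1 := by rw [hr]; split_ifs <;> omega
    obtain rfl : r' = i := by rw [hr']; split_ifs <;> omega
    rw [cableGen_succ, cableGen_lt (show r' < r' + 1 by omega),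
      cableGen_gt (show r' + 1 < r' + 2 by omega),
      show cableGen N m (r' + 1) (r' + 2) = cableDown N (r' + 1) m from cableGen_succ _ _ _]
    have := cable_rel₃ N r' m (by omega)
    rwa [show r' + 1 + m - 1 = r' + m by omega]
  · obtain rfl : q = p := by rw [hq]; split_ifs <;> omega
    obtain rfl : q' = q := by rw [hq']; split_ifs <;> omega
    obtain rfl : r = q' := by rw [hr]; split_ifs <;> omega
    obtain rfl : r' = r := by rw [hr']; split_ifs <;> omega
    rw [cableGen_gt (show i + 1 < r' by omega), cableGen_gt (show i + 1 + 1 < r' by omega)]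
    exact σ_braid N i (hp h)

/-- The permutation `(p, b) ↦ (ρ(σ_k)(p), c * b)` of `{positions} × B_N`, where `c` is `σ_k` with
the strand that starts at `p` replaced by `m` parallel strands. -/
def cablePerm (n N m k : ℕ) : Equiv.Perm (Fin n × Braid N) where
  toFun x := (adjSwap n k x.1, cableGen N m k x.1 * x.2)
  invFun x := (adjSwap n k x.1, (cableGen N m k (adjSwap n k x.1))⁻¹ * x.2)
  left_inv x := by simp [adjSwap_adjSwap]
  right_inv x := by simp [adjSwap_adjSwap]

/-- The homomorphism which sends a braid `g` to the permutation
`(p, b) ↦ (ρ(g)(p), (g with the strand that starts at p replaced by m parallel strands) * b)`. -/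
def cableHom (n m : ℕ) : Braid n →* Equiv.Perm (Fin n × Braid (n + m - 1)) :=
  braidLift n (cablePerm n (n + m - 1) m)
    (by
      intro i j hij hj
      ext ⟨p, b⟩ : 1
      refine Prod.ext ?_ ?_
      · have := congrArg (ρ n) (σ_comm n i j (Or.inl hij))
        rw [map_mul, map_mul, ρ_σ n i (by omega), ρ_σ n j hj] at this
        exact DFunLike.congr_fun this p
      · change cableGen _ _ _ _ * (cableGen _ _ _ _ * b) = cableGen _ _ _ _ * (cableGen _ _ _ _ * b)
        rw [← mul_assoc, ← mul_assoc]
        exact congrArg (· * b) (cableGen_comm _ _ _ _ _ _ _ hij (adjSwap_val n j hj p)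
          (adjSwap_val n i (by omega) p)))
    (by
      intro i hi
      ext ⟨p, b⟩ : 1
      refine Prod.ext ?_ ?_
      · have := congrArg (ρ n) (σ_braid n i hi)
        simp only [map_mul, ρ_σ n i (by omega), ρ_σ n (i + 1) hi] at this
        exact DFunLike.congr_fun this p
      · have hp := p.2
        change cableGen _ _ _ _ * (cableGen _ _ _ _ * (cableGen _ _ _ _ * b)) =
          cableGen _ _ _ _ * (cableGen _ _ _ _ * (cableGen _ _ _ _ * b))
        simp only [← mul_assoc]
        exact congrArg (· * b) (cableGen_braid _ _ _ _ _ _ _ _ (by omega) (by omega) (by omega)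
          (adjSwap_val n i (by omega) p) (adjSwap_val n (i + 1) hi _)
          (adjSwap_val n (i + 1) hi p) (adjSwap_val n i (by omega) _)))

/-- The braid obtained from `g` by replacing the strand which starts at the position `p` by `m`
parallel strands. -/
def cable {n : ℕ} (m : ℕ) (p : Fin n) (g : Braid n) : Braid (n + m - 1) := (cableHom n m g (p, 1)).2

theorem cableHom_apply {n m : ℕ} (g : Braid n) (p : Fin n) (b : Braid (n + m - 1)) :
    cableHom n m g (p, b) = (ρ n g p, cable m p g * b) := by
  have key : ∀ (p : Fin n) (b : Braid (n + m - 1)),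
      cableHom n m g (p, b) = (ρ n g p, (cableHom n m g (p, 1)).2 * b) := by
    induction g using braid_induction with
    | one => intro p b; simp
    | mul g h hg hh =>
      intro p b
      rw [map_mul, map_mul, Equiv.Perm.mul_apply, Equiv.Perm.mul_apply, Equiv.Perm.mul_apply,
        hh p b, hh p 1, hg, hg _ (_ * 1)]
      simp [mul_assoc]
    | inv g hg =>
      intro p b
      have h1 : ∀ c, (cableHom n m g)⁻¹ (p, c) = ((ρ n g)⁻¹ p,
          ((cableHom n m g ((ρ n g)⁻¹ p, 1)).2)⁻¹ * c) := by
        intro c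
        rw [Equiv.Perm.inv_eq_iff_eq, hg]
        simp
      rw [map_inv, map_inv, h1, h1]
      simp
    | gen k hk =>
      intro p b
      have : cableHom n m (σ n k) = cablePerm n (n + m - 1) m k := braidLift_σ _ _ _ _ _ hk
      rw [this, ρ_σ n k hk]
      simp [cablePerm]
  exact key p b

theorem cable_one {n m : ℕ} (p : Fin n) : cable m p (1 : Braid n) = 1 := by simp [cable]

theorem cable_mul {n m : ℕ} (p : Fin n) (g h : Braid n) :
    cable m p (g * h) = cable m (ρ n h p) g * cable m p h := by
  conv_lhs => rw [cable, map_mul, Equiv.Perm.mul_apply, cableHom_apply, cableHom_apply]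
  simp

theorem cable_σ {n m : ℕ} (p : Fin n) (k : ℕ) (hk : k + 1 < n) :
    cable m p (σ n k) = cableGen (n + m - 1) m k p := by
  have : cableHom n m (σ n k) = cablePerm n (n + m - 1) m k := braidLift_σ _ _ _ _ _ hk
  rw [cable, this]
  simp [cablePerm]

theorem cable_inv {n m : ℕ} (p : Fin n) (g : Braid n) :
    cable m p g⁻¹ = (cable m ((ρ n g)⁻¹ p) g)⁻¹ := by
  have := cable_mul (m := m) p g g⁻¹
  rw [mul_inv_cancel, cable_one, map_inv] at this
  exact (inv_eq_of_mul_eq_one_right this.symm).symm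

theorem perm_apply_inv {α : Type*} (e : Equiv.Perm α) (x : α) : e (e⁻¹ x) = x :=
  e.apply_symm_apply x

theorem perm_inv_apply {α : Type*} (e : Equiv.Perm α) (x : α) : e⁻¹ (e x) = x :=
  e.symm_apply_apply x

theorem σ_cableUp (N k m j : ℕ) (hj : j + 1 < m) (hN : k + m < N) :
    σ N (j + k + 1) * cableUp N k m = cableUp N k m * σ N (j + k) := by
  induction m with
  | zero => omega
  | succ m ih =>
    rcases (show j + 1 < m ∨ m = j + 1 by omega) with h | rfl
    · rw [cableUp, ← mul_assoc, ih h (by omega), mul_assoc, σ_comm N (j + k) (k + m) (by omega),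
        mul_assoc]
    · have hc := σ_comm_cableUp N k j (j + k + 1) (by omega)
      have hb := σ_braid N (j + k) (by omega)
      rw [cableUp, cableUp, show k + j = j + k by omega, show k + (j + 1) = j + k + 1 by omega]
      calc _ = (σ N (j + k + 1) * cableUp N k j) * σ N (j + k) * σ N (j + k + 1) := by group
        _ = cableUp N k j * (σ N (j + k + 1) * σ N (j + k) * σ N (j + k + 1)) := by rw [hc]; group
        _ = _ := by rw [← hb]; group

theorem σ_cableDown (N k m j : ℕ) (hj : j + 1 < m) (hN : k + m < N) :
    σ N (j + k) * cableDown N k m = cableDown N k m * σ N (j + k + 1) := by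
  induction m with
  | zero => omega
  | succ m ih =>
    rcases (show j + 1 < m ∨ m = j + 1 by omega) with h | rfl
    · rw [cableDown, ← mul_assoc, σ_comm N (j + k) (k + m) (by omega), mul_assoc,
        ih h (by omega), mul_assoc]
    · have hc := σ_comm_cableDown N k j (j + k + 1) (by omega)
      have hb := σ_braid N (j + k) (by omega)
      rw [cableDown, cableDown, show k + j = j + k by omega, show k + (j + 1) = j + k + 1 by omega]
      calc _ = (σ N (j + k) * σ N (j + k + 1) * σ N (j + k)) * cableDown N k j := by group
        _ = σ N (j + k + 1) * σ N (j + k) * (σ N (j + k + 1) * cableDown N k j) := by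
            rw [hb]; group
        _ = _ := by rw [hc]; group

/-- A braid on the strands of a cable can be moved along the cable. -/
theorem shift_mul_cable {n m : ℕ} (p q : Fin n) (g : Braid n) (h : Braid m) :
    q = ρ n g p → shift m (n + m - 1) q (by omega) h * cable m p g =
      cable m p g * shift m (n + m - 1) p (by omega) h := by
  induction g using braid_induction generalizing p q with
  | one => intro hq; obtain rfl : q = p := by simpa using hq
           simp [cable_one]
  | mul g g' hg hg' =>
    intro hq
    rw [cable_mul, ← mul_assoc, hg (ρ n g' p) q (by rw [hq, map_mul]; rfl), mul_assoc,
      hg' p (ρ n g' p) rfl, mul_assoc]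
  | inv g hg =>
    intro hq
    have := hg q p (by rw [hq, map_inv, perm_apply_inv])
    rw [cable_inv, show (ρ n g)⁻¹ p = q by rw [hq, map_inv], eq_inv_mul_iff_mul_eq, ← mul_assoc,
      ← this, mul_inv_cancel_right]
  | gen k hk =>
    intro hq
    rw [cable_σ p k hk]
    rw [ρ_σ n k hk] at hq
    have hq' : (q : ℕ) = if (p : ℕ) = k then k + 1 else if (p : ℕ) = k + 1 then k else p := by
      rw [hq, adjSwap_val n k hk]
    clear hq
    have hp := p.2
    induction h using braid_induction with
    | one => simp
    | mul h h' ih ih' => rw [map_mul, map_mul, mul_assoc, ih', ← mul_assoc, ih, mul_assoc]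
    | inv h ih =>
      rw [map_inv, map_inv, inv_mul_eq_iff_eq_mul, ← mul_assoc, ih, mul_inv_cancel_right]
    | gen j hj =>
      rw [shift_σ _ _ _ _ _ hj, shift_σ _ _ _ _ _ hj]
      rcases (show (p : ℕ) < k ∨ (p : ℕ) = k ∨ (p : ℕ) = k + 1 ∨ k + 1 < (p : ℕ) by omega)
        with h | h | h | h
      · rw [show (q : ℕ) = p by rw [hq']; split_ifs <;> omega, cableGen_lt h]
        exact σ_comm _ _ _ (by omega)
      · rw [show (q : ℕ) = k + 1 by rw [hq']; split_ifs <;> omega, h, cableGen_self, ← add_assoc]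
        exact σ_cableUp _ _ _ _ hj (by omega)
      · rw [show (q : ℕ) = k by rw [hq']; split_ifs <;> omega, h, cableGen_succ, ← add_assoc]
        exact σ_cableDown _ _ _ _ hj (by omega)
      · rw [show (q : ℕ) = p by rw [hq']; split_ifs <;> omega, cableGen_gt h]
        exact σ_comm _ _ _ (by omega)

/-! #### The permutations of juxtaposed and cabled braids -/

theorem ρ_σ_val (N i : ℕ) (h : i + 1 < N) (x : Fin N) : (ρ N (σ N i) x : ℕ) =
    if (x : ℕ) = i then i + 1 else if (x : ℕ) = i + 1 then i else x := by
  rw [ρ_σ N i h, adjSwap_val N i h]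

theorem ρ_shift_val (m N p : ℕ) (h : p + m ≤ N) (g : Braid m) (x : Fin N) :
    (∀ j : Fin m, (x : ℕ) = p + j → (ρ N (shift m N p h g) x : ℕ) = p + ρ m g j) ∧
      ((x : ℕ) < p ∨ p + m ≤ x → (ρ N (shift m N p h g) x : ℕ) = x) := by
  induction g using braid_induction generalizing x with
  | one => simp
  | mul g g' hg hg' =>
    constructor
    · intro j hj
      rw [map_mul, map_mul, Equiv.Perm.mul_apply,
        (hg _).1 (ρ m g' j) ((hg' x).1 j hj), map_mul, Equiv.Perm.mul_apply]
    · intro hx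
      have h1 := (hg' x).2 hx
      rw [map_mul, map_mul, Equiv.Perm.mul_apply, (hg _).2 (by omega), h1]
  | inv g hg =>
    constructor
    · intro j hj
      have hlt := ((ρ m g)⁻¹ j).2
      have := (hg ⟨p + (ρ m g)⁻¹ j, by omega⟩).1 ((ρ m g)⁻¹ j) rfl
      rw [perm_apply_inv, ← hj] at this
      rw [map_inv, map_inv, map_inv, ← Fin.ext this, perm_inv_apply]
    · intro hx
      have := (hg x).2 hx
      conv_lhs => rw [← Fin.ext this, map_inv, map_inv, perm_inv_apply]
  | gen i hi =>
    constructor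
    · intro j hj
      rw [shift_σ _ _ _ _ _ hi, ρ_σ_val _ _ (by omega), ρ_σ_val _ _ hi]
      split_ifs <;> omega
    · intro hx
      rw [shift_σ _ _ _ _ _ hi, ρ_σ_val _ _ (by omega)]
      split_ifs <;> omega

theorem ρ_cableUp_val (N k m : ℕ) (hN : k + m < N) (x : Fin N) :
    (ρ N (cableUp N k m) x : ℕ) =
      if (x : ℕ) = k + m then k else if k ≤ (x : ℕ) ∧ (x : ℕ) < k + m then x + 1 else x := by
  induction m generalizing x with
  | zero => simp only [cableUp, map_one, Equiv.Perm.one_apply]; split_ifs <;> omega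
  | succ m ih =>
    rw [cableUp, map_mul, Equiv.Perm.mul_apply, ih (by omega), ρ_σ_val _ _ (by omega)]
    split_ifs <;> omega

theorem ρ_cableDown_val (N k m : ℕ) (hN : k + m < N) (x : Fin N) :
    (ρ N (cableDown N k m) x : ℕ) =
      if (x : ℕ) = k then k + m else if k < (x : ℕ) ∧ (x : ℕ) ≤ k + m then x - 1 else x := by
  induction m generalizing x with
  | zero => simp only [cableDown, map_one, Equiv.Perm.one_apply]; split_ifs <;> omega
  | succ m ih =>
    rw [cableDown, map_mul, Equiv.Perm.mul_apply, ρ_σ_val _ _ (by omega), ih (by omega)]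
    split_ifs <;> omega

/-- The new position of the strand `q ≠ p` after the strand `p` is replaced by `m` strands. -/
def spread (m p q : ℕ) : ℕ := if q < p then q else q + m - 1

theorem ρ_cable_val {n m : ℕ} (hm : 0 < m) (p : Fin n) (g : Braid n) (x : Fin (n + m - 1)) :
    (∀ q : Fin n, q ≠ p → (x : ℕ) = spread m p q →
        (ρ _ (cable m p g) x : ℕ) = spread m (ρ n g p) (ρ n g q)) ∧
      (∀ j, j < m → (x : ℕ) = p + j → (ρ _ (cable m p g) x : ℕ) = ρ n g p + j) := by
  induction g using braid_induction generalizing p x with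
  | one => simp [cable_one]
  | mul g g' hg hg' =>
    simp only [cable_mul, map_mul, Equiv.Perm.mul_apply]
    constructor
    · intro q hq hx
      exact (hg _ _).1 _ (by simpa using hq) ((hg' p x).1 q hq hx)
    · intro j hj hx
      exact (hg _ _).2 j hj ((hg' p x).2 j hj hx)
  | inv g hg =>
    rw [cable_inv, map_inv, map_inv]
    have hp' := ((ρ n g)⁻¹ p).2
    constructor
    · intro q hq hx
      have hq' := ((ρ n g)⁻¹ q).2
      have hne : (ρ n g)⁻¹ q ≠ (ρ n g)⁻¹ p := by simpa using hq
      have hlt : spread m ((ρ n g)⁻¹ p) ((ρ n g)⁻¹ q) < n + m - 1 := by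
        unfold spread; split_ifs <;> omega
      have := (hg ((ρ n g)⁻¹ p) ⟨_, hlt⟩).1 _ hne rfl
      rw [perm_apply_inv, perm_apply_inv, ← hx] at this
      rw [← Fin.ext this, perm_inv_apply]
    · intro j hj hx
      have := (hg ((ρ n g)⁻¹ p) ⟨(ρ n g)⁻¹ p + j, by omega⟩).2 j hj rfl
      rw [perm_apply_inv, ← hx] at this
      rw [← Fin.ext this, perm_inv_apply]
  | gen k hk =>
    rw [cable_σ p k hk, ρ_σ_val _ _ hk]
    have hp := p.2
    have hx' := x.2
    rcases (show (p : ℕ) < k ∨ (p : ℕ) = k ∨ (p : ℕ) = k + 1 ∨ k + 1 < (p : ℕ) by omega)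
        with h | h | h | h
    · rw [cableGen_lt h, ρ_σ_val _ _ (by omega)]
      constructor
      · intro q hq hx
        rw [ρ_σ_val _ _ hk]
        have : (q : ℕ) ≠ p := fun e => hq (Fin.ext e)
        unfold spread at *
        split_ifs at * <;> omega
      · intro j hj hx
        split_ifs <;> omega
    · rw [h, cableGen_self, ρ_cableUp_val _ _ _ (by omega)]
      constructor
      · intro q hq hx
        rw [ρ_σ_val _ _ hk]
        have : (q : ℕ) ≠ p := fun e => hq (Fin.ext e)
        unfold spread at *
        split_ifs at * <;> omega
      · intro j hj hx
        split_ifs <;> omega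
    · rw [h, cableGen_succ, ρ_cableDown_val _ _ _ (by omega)]
      constructor
      · intro q hq hx
        rw [ρ_σ_val _ _ hk]
        have : (q : ℕ) ≠ p := fun e => hq (Fin.ext e)
        unfold spread at *
        split_ifs at * <;> omega
      · intro j hj hx
        split_ifs <;> omega
    · rw [cableGen_gt h, ρ_σ_val _ _ (by omega)]
      constructor
      · intro q hq hx
        rw [ρ_σ_val _ _ hk]
        have : (q : ℕ) ≠ p := fun e => hq (Fin.ext e)
        unfold spread at *
        split_ifs at * <;> omega
      · intro j hj hx
        split_ifs <;> omega

/-! ### The operad of parenthesized braids -/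

/-- The sequence of letters of a word of the free magma. -/
def leaves : FreeMagma ℕ → List ℕ
  | .of j => [j]
  | .mul s t => leaves s ++ leaves t

/-- An object of `PaB(n)`: a word of the free magma on the letters `0, …, n - 1` in which each
letter occurs exactly once (the letter `j` is the label usually called `j + 1`). -/
structure PaB (n : ℕ) where
  word : FreeMagma ℕ
  perm : (leaves word).Perm (List.range n)

namespace PaB

variable {n m : ℕ}

theorem length_leaves (τ : PaB n) : (leaves τ.word).length = n := by
  rw [τ.perm.length_eq, List.length_range]

theorem mem_leaves (τ : PaB n) (j : ℕ) : j ∈ leaves τ.word ↔ j < n := by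
  rw [τ.perm.mem_iff, List.mem_range]

theorem nodup_leaves (τ : PaB n) : (leaves τ.word).Nodup := τ.perm.nodup_iff.2 List.nodup_range

theorem pos (τ : PaB n) : 0 < n := by
  have : 0 < (leaves τ.word).length := by
    generalize τ.word = w
    induction w with
    | ih1 j => simp [leaves]
    | ih2 s t hs ht =>
      change 0 < (leaves s ++ leaves t).length
      rw [List.length_append]; omega
  rwa [τ.length_leaves] at this

/-- The permutation underlying an object: it sends a position to the label at this position. -/
def 𝔭 (τ : PaB n) : Equiv.Perm (Fin n) where
  toFun k := ⟨(leaves τ.word)[k]'(by rw [τ.length_leaves]; exact k.2),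
    (τ.mem_leaves _).1 (List.getElem_mem _)⟩
  invFun i := ⟨(leaves τ.word).idxOf (i : ℕ), by
    have := List.idxOf_lt_length_of_mem ((τ.mem_leaves i).2 i.2)
    rwa [τ.length_leaves] at this⟩
  left_inv k := by
    ext
    exact τ.nodup_leaves.idxOf_getElem _ _
  right_inv i := by
    ext
    simp

/-- Morphisms `τ₁ ⟶ τ₂` of `PaB(n)` are the braids with permutation `𝔭(τ₂)⁻¹ ∘ 𝔭(τ₁)`. -/
structure Hom (τ₁ τ₂ : PaB n) where
  ou : Braid n
  ρ_ou : ρ n ou = (𝔭 τ₂)⁻¹ * 𝔭 τ₁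

theorem Hom.ext' {τ₁ τ₂ : PaB n} {γ η : Hom τ₁ τ₂} (h : γ.ou = η.ou) : γ = η := by
  cases γ; cases η; cases h; rfl

/-- `PaB(n)` as a groupoid: morphisms are composed by multiplying braids, and in a product of
braids the right factor comes first. -/
instance : Groupoid (PaB n) where
  Hom := Hom
  id τ := ⟨1, by simp⟩
  comp η γ := ⟨γ.ou * η.ou, by rw [map_mul, γ.ρ_ou, η.ρ_ou]; group⟩
  inv γ := ⟨γ.ou⁻¹, by rw [map_inv, γ.ρ_ou]; group⟩
  id_comp γ := Hom.ext' (mul_one _)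
  comp_id γ := Hom.ext' (one_mul _)
  assoc γ η ζ := Hom.ext' (mul_assoc _ _ _).symm
  inv_comp γ := Hom.ext' (mul_inv_cancel _)
  comp_inv γ := Hom.ext' (inv_mul_cancel _)

/-- The braid underlying a morphism of `PaB(n)`. -/
def ou {τ₁ τ₂ : PaB n} (γ : τ₁ ⟶ τ₂) : Braid n := Hom.ou γ

theorem ou_ext {τ₁ τ₂ : PaB n} {γ η : τ₁ ⟶ τ₂} (h : ou γ = ou η) : γ = η := Hom.ext' h

theorem ou_comp {τ₁ τ₂ τ₃ : PaB n} (η : τ₁ ⟶ τ₂) (γ : τ₂ ⟶ τ₃) : ou (η ≫ γ) = ou γ * ou η := rfl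

theorem ou_id (τ : PaB n) : ou (𝟙 τ) = 1 := rfl

theorem ρ_ou {τ₁ τ₂ : PaB n} (γ : τ₁ ⟶ τ₂) : ρ n (ou γ) = (𝔭 τ₂)⁻¹ * 𝔭 τ₁ := Hom.ρ_ou γ

theorem 𝔭_ρ_ou {τ₁ τ₂ : PaB n} (γ : τ₁ ⟶ τ₂) (k : Fin n) : 𝔭 τ₂ (ρ n (ou γ) k) = 𝔭 τ₁ k := by
  rw [ρ_ou, Equiv.Perm.mul_apply, perm_apply_inv]

theorem ρ_ou_symm {τ₁ τ₂ : PaB n} (γ : τ₁ ⟶ τ₂) (i : Fin n) :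
    ρ n (ou γ) ((𝔭 τ₁)⁻¹ i) = (𝔭 τ₂)⁻¹ i := by
  rw [ρ_ou, Equiv.Perm.mul_apply, perm_apply_inv]

/-! #### The action of the symmetric groups -/

theorem leaves_map (f : ℕ → ℕ) (w : FreeMagma ℕ) : leaves (FreeMagma.map f w) = (leaves w).map f := by
  induction w with
  | ih1 j => rfl
  | ih2 s t hs ht =>
    rw [map_mul]
    change leaves _ ++ leaves _ = (leaves s ++ leaves t).map f
    rw [hs, ht, List.map_append]

/-- The map on labels given by a permutation `θ ∈ S_n`. -/
def relabel (θ : Equiv.Perm (Fin n)) (j : ℕ) : ℕ := if h : j < n then θ ⟨j, h⟩ else j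

theorem map_relabel_range (θ : Equiv.Perm (Fin n)) :
    ((List.range n).map (relabel θ)).Perm (List.range n) := by
  have h1 : (List.range n).map (relabel θ) = (List.ofFn θ).map Fin.val := by
    apply List.ext_getElem
    · simp
    · intro k h1 h2
      simp at h1
      simp [relabel, h1]
  have h2 : (List.range n) = (List.ofFn (id : Fin n → Fin n)).map Fin.val := by
    apply List.ext_getElem <;> simp
  rw [h1, h2]
  exact (Equiv.Perm.ofFn_comp_perm θ id).map _

/-- The object `θ(τ)`. -/
def permObj (θ : Equiv.Perm (Fin n)) (τ : PaB n) : PaB n where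
  word := FreeMagma.map (relabel θ) τ.word
  perm := by
    rw [leaves_map]
    exact (τ.perm.map _).trans (map_relabel_range θ)

theorem 𝔭_permObj (θ : Equiv.Perm (Fin n)) (τ : PaB n) : 𝔭 (permObj θ τ) = θ * 𝔭 τ := by
  ext k
  have h : (leaves τ.word)[(k : ℕ)]'(by rw [τ.length_leaves]; exact k.2) < n :=
    (τ.mem_leaves _).1 (List.getElem_mem _)
  simp [𝔭, permObj, leaves_map, relabel, h]

/-- The action of `θ ∈ S_n` on the groupoid `PaB(n)`: labels are changed, braids are not. -/
def perm_functor (θ : Equiv.Perm (Fin n)) : PaB n ⥤ PaB n where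
  obj := permObj θ
  map γ := Hom.mk (ou γ) (by rw [ρ_ou, 𝔭_permObj, 𝔭_permObj]; group)
  map_id _ := rfl
  map_comp _ _ := rfl

/-! #### Operadic insertions -/

/-- What replaces the letter `j` of the outer word when the word `w` with `m` letters is inserted
for the letter `i`. -/
def insertLetter (i m : ℕ) (w : FreeMagma ℕ) (j : ℕ) : FreeMagma ℕ :=
  if j < i then .of j else if j = i then FreeMagma.map (· + i) w else .of (j + m - 1)

theorem leaves_lift (f : ℕ → FreeMagma ℕ) (w : FreeMagma ℕ) :
    leaves (FreeMagma.lift f w) = (leaves w).flatMap (fun j => leaves (f j)) := by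
  induction w with
  | ih1 j => simp [leaves]
  | ih2 s t hs ht =>
    rw [map_mul]
    change leaves _ ++ leaves _ = (leaves s ++ leaves t).flatMap _
    rw [hs, ht, List.flatMap_append]

/-- The new label of the label `j ≠ i`. -/
def bump (i m j : ℕ) : ℕ := if j < i then j else j + m - 1

theorem flatMap_insertLetter (i m : ℕ) (w : FreeMagma ℕ) (l : List ℕ) (hi : i ∉ l) :
    l.flatMap (fun j => leaves (insertLetter i m w j)) = l.map (bump i m) := by
  induction l with
  | nil => rfl
  | cons a l ih =>
    simp only [List.mem_cons, not_or] at hi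
    rw [List.flatMap_cons, ih hi.2, List.map_cons]
    have : leaves (insertLetter i m w a) = [bump i m a] := by
      unfold insertLetter bump
      rw [if_neg (Ne.symm hi.1)]
      split_ifs <;> rfl
    rw [this]; rfl

theorem leaves_insert_split (i m : ℕ) (w v : FreeMagma ℕ) (l₁ l₂ : List ℕ)
    (h : leaves v = l₁ ++ i :: l₂) (h₁ : i ∉ l₁) (h₂ : i ∉ l₂) :
    leaves (FreeMagma.lift (insertLetter i m w) v) =
      l₁.map (bump i m) ++ ((leaves w).map (· + i) ++ l₂.map (bump i m)) := by
  rw [leaves_lift, h, List.flatMap_append, List.flatMap_cons, flatMap_insertLetter _ _ _ _ h₁,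
    flatMap_insertLetter _ _ _ _ h₂]
  congr 2
  simp [insertLetter, leaves_map]

theorem insert_perm (τ : PaB n) (i : Fin n) (ω : PaB m) :
    (leaves (FreeMagma.lift (insertLetter i m ω.word) τ.word)).Perm (List.range (n + m - 1)) := by
  have hi := i.2
  have hm := ω.pos
  rw [leaves_lift]
  refine (τ.perm.flatMap_right _).trans ?_
  have e1 : List.range n = List.range i ++ (i : ℕ) :: List.range' (i + 1) (n - i - 1) := by
    rw [List.range_eq_range', List.range_eq_range', ← List.range'_succ]
    have := List.range'_append_1 (s := 0) (m := i) (n := n - i - 1 + 1)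
    rw [zero_add] at this
    rw [this]
    congr 1; omega
  rw [e1, List.flatMap_append, List.flatMap_cons, flatMap_insertLetter _ _ _ _ (by simp),
    flatMap_insertLetter _ _ _ _ (by simp)]
  have e2 : (List.range i).map (bump i m) = List.range' 0 i := by
    rw [List.range_eq_range']
    apply List.ext_getElem
    · simp
    · intro k h1 h2
      simp at h1
      simp [bump, h1]
  have e3 : (List.range' (i + 1) (n - i - 1)).map (bump i m) = List.range' (i + m) (n - i - 1) := by
    apply List.ext_getElem
    · simp
    · intro k h1 h2
      simp only [List.getElem_map, List.getElem_range', bump]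
      split_ifs <;> omega
  have e4 : (leaves (insertLetter i m ω.word i)).Perm (List.range' i m) := by
    have : leaves (insertLetter i m ω.word i) = (leaves ω.word).map (· + (i : ℕ)) := by
      simp [insertLetter, leaves_map]
    rw [this, List.range'_eq_map_range]
    have := ω.perm.map (· + (i : ℕ))
    simpa only [Nat.add_comm] using this
  rw [e2, e3]
  refine ((e4.append_right _).append_left _).trans ?_
  rw [List.range'_append_1]
  have := List.range'_append_1 (s := 0) (m := i) (n := m + (n - i - 1))
  rw [zero_add] at this
  rw [this, List.range_eq_range', show (i : ℕ) + (m + (n - i - 1)) = n + m - 1 by omega]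

/-- The object `τ ∘_i ω`: the word `ω` is substituted for the label `i` of `τ`, and the labels are
renumbered. -/
def insertObj (i : Fin n) (τ : PaB n) (ω : PaB m) : PaB (n + m - 1) where
  word := FreeMagma.lift (insertLetter i m ω.word) τ.word
  perm := insert_perm τ i ω

theorem 𝔭_insertObj (i : Fin n) (τ : PaB n) (ω : PaB m) (x : Fin (n + m - 1)) :
    (∀ q : Fin n, q ≠ (𝔭 τ)⁻¹ i → (x : ℕ) = spread m ((𝔭 τ)⁻¹ i) q →
        (𝔭 (insertObj i τ ω) x : ℕ) = bump i m (𝔭 τ q)) ∧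
      (∀ j : Fin m, (x : ℕ) = (𝔭 τ)⁻¹ i + j → (𝔭 (insertObj i τ ω) x : ℕ) = 𝔭 ω j + i) := by
  obtain ⟨p, hp⟩ : ∃ p : Fin n, p = (𝔭 τ)⁻¹ i := ⟨_, rfl⟩
  rw [← hp]
  have hpi : 𝔭 τ p = i := by rw [hp, perm_apply_inv]
  have hpl : (p : ℕ) < (leaves τ.word).length := by rw [τ.length_leaves]; exact p.2
  have hget : (leaves τ.word)[(p : ℕ)] = i := congrArg Fin.val hpi
  have hsplit : leaves τ.word =
      (leaves τ.word).take p ++ (i : ℕ) :: (leaves τ.word).drop (p + 1) := by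
    conv_lhs => rw [← List.take_append_drop p (leaves τ.word), List.drop_eq_getElem_cons hpl, hget]
  have hnd := τ.nodup_leaves
  rw [hsplit, List.nodup_append] at hnd
  have h₁ : (i : ℕ) ∉ (leaves τ.word).take p := fun h =>
    hnd.2.2 _ h _ (List.mem_cons_self) rfl
  have h₂ : (i : ℕ) ∉ (leaves τ.word).drop (p + 1) := (List.nodup_cons.1 hnd.2.1).1
  have hins := leaves_insert_split i m ω.word τ.word _ _ hsplit h₁ h₂
  have hval : (leaves (FreeMagma.lift (insertLetter i m ω.word) τ.word))[(x : ℕ)]? =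
      some (𝔭 (insertObj i τ ω) x : ℕ) :=
    List.getElem?_eq_getElem (lt_of_lt_of_eq x.2 (insertObj i τ ω).length_leaves.symm)
  have hτ : ∀ q : Fin n, (leaves τ.word)[(q : ℕ)]? = some (𝔭 τ q : ℕ) := fun q =>
    List.getElem?_eq_getElem (by rw [τ.length_leaves]; exact q.2)
  have hω : ∀ q : Fin m, (leaves ω.word)[(q : ℕ)]? = some (𝔭 ω q : ℕ) := fun q =>
    List.getElem?_eq_getElem (by rw [ω.length_leaves]; exact q.2)
  have hlt : ((leaves τ.word).take p).length = p := by
    rw [List.length_take]; omega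
  rw [hins] at hval
  have hm := ω.pos
  constructor
  · intro q hq hx
    have hne : (q : ℕ) ≠ p := fun e => hq (Fin.ext e)
    unfold spread at hx
    split_ifs at hx with hqp
    · rw [List.getElem?_append_left (by rw [List.length_map, hlt]; omega), List.getElem?_map,
        hx, List.getElem?_take_of_lt hqp, hτ] at hval
      simpa using hval.symm
    · rw [List.getElem?_append_right (by rw [List.length_map, hlt]; omega), List.length_map, hlt,
        List.getElem?_append_right (by rw [List.length_map, ω.length_leaves]; omega),
        List.length_map, ω.length_leaves, List.getElem?_map, List.getElem?_drop,
        show (p : ℕ) + 1 + (x - p - m) = q by omega, hτ] at hval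
      simpa using hval.symm
  · intro j hx
    rw [List.getElem?_append_right (by rw [List.length_map, hlt]; omega), List.length_map, hlt,
      List.getElem?_append_left (by rw [List.length_map, ω.length_leaves]; omega),
      List.getElem?_map, show (x : ℕ) - p = j by omega, hω] at hval
    simpa using hval.symm

/-- The braid of `γ ∘_i η`: the strand of `γ` that starts at the label `i` is replaced by a thin
version of `η`. -/
def insertBraid (i : Fin n) {τ₁ τ₂ : PaB n} (γ : τ₁ ⟶ τ₂) {ω₁ ω₂ : PaB m} (η : ω₁ ⟶ ω₂) :
    Braid (n + m - 1) :=
  cable m ((𝔭 τ₁)⁻¹ i) (ou γ) *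
    shift m (n + m - 1) ((𝔭 τ₁)⁻¹ i : Fin n) (by have := ((𝔭 τ₁)⁻¹ i).2; omega) (ou η)

theorem ρ_insertBraid (i : Fin n) {τ₁ τ₂ : PaB n} (γ : τ₁ ⟶ τ₂) {ω₁ ω₂ : PaB m} (η : ω₁ ⟶ ω₂) :
    ρ _ (insertBraid i γ η) = (𝔭 (insertObj i τ₂ ω₂))⁻¹ * 𝔭 (insertObj i τ₁ ω₁) := by
  have hm := ω₁.pos
  rw [eq_inv_mul_iff_mul_eq]
  ext x
  rw [insertBraid, map_mul, Equiv.Perm.mul_apply, Equiv.Perm.mul_apply]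
  have hx := x.2
  have hp := ((𝔭 τ₁)⁻¹ i).2
  have hγ := ρ_ou_symm γ i
  by_cases h : ((𝔭 τ₁)⁻¹ i : ℕ) ≤ x ∧ (x : ℕ) < (𝔭 τ₁)⁻¹ i + m
  · obtain ⟨j, hj⟩ : ∃ j : Fin m, (x : ℕ) = (𝔭 τ₁)⁻¹ i + j :=
      ⟨⟨x - (𝔭 τ₁)⁻¹ i, by omega⟩, by simp only; omega⟩
    have h1 := (ρ_shift_val m (n + m - 1) ((𝔭 τ₁)⁻¹ i : Fin n) (by omega) (ou η) x).1 j hj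
    have h2 := (ρ_cable_val hm ((𝔭 τ₁)⁻¹ i) (ou γ) _).2 _ (ρ m (ou η) j).2 h1
    rw [hγ] at h2
    rw [(𝔭_insertObj i τ₂ ω₂ _).2 _ h2, 𝔭_ρ_ou, (𝔭_insertObj i τ₁ ω₁ x).2 j hj]
  · obtain ⟨q, hq, hxq⟩ : ∃ q : Fin n, q ≠ (𝔭 τ₁)⁻¹ i ∧ (x : ℕ) = spread m ((𝔭 τ₁)⁻¹ i) q := by
      by_cases hlt : (x : ℕ) < (𝔭 τ₁)⁻¹ i
      · exact ⟨⟨x, by omega⟩, fun e => by have := congrArg Fin.val e; simp only at this; omega,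
          by rw [spread, if_pos hlt]⟩
      · exact ⟨⟨x - m + 1, by omega⟩,
          fun e => by have := congrArg Fin.val e; simp only at this; omega,
          by simp only [spread]; rw [if_neg (by omega)]; omega⟩
    have h1 := (ρ_shift_val m (n + m - 1) ((𝔭 τ₁)⁻¹ i : Fin n) (by omega) (ou η) x).2 (by omega)
    rw [Fin.ext h1]
    have h2 := (ρ_cable_val hm ((𝔭 τ₁)⁻¹ i) (ou γ) x).1 q hq hxq
    rw [hγ] at h2
    rw [(𝔭_insertObj i τ₂ ω₂ _).1 (ρ n (ou γ) q) (by rw [← hγ]; simpa using hq) h2, 𝔭_ρ_ou,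
      (𝔭_insertObj i τ₁ ω₁ x).1 q hq hxq]

/-- The operadic insertion `∘_i : PaB(n) × PaB(m) ⥤ PaB(n + m - 1)`. -/
def insertFunctor (n m : ℕ) (i : Fin n) : PaB n × PaB m ⥤ PaB (n + m - 1) where
  obj x := insertObj i x.1 x.2
  map f := Hom.mk (insertBraid i f.1 f.2) (ρ_insertBraid i f.1 f.2)
  map_id x := ou_ext (by
    change insertBraid i (𝟙 x.1) (𝟙 x.2) = 1
    rw [insertBraid, ou_id, ou_id, cable_one, map_one, one_mul])
  map_comp {x y z} f g := ou_ext (by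
    change insertBraid i (f.1 ≫ g.1) (f.2 ≫ g.2) = insertBraid i g.1 g.2 * insertBraid i f.1 f.2
    have h := ρ_ou_symm f.1 i
    rw [insertBraid, insertBraid, insertBraid, ou_comp, ou_comp, cable_mul, h, map_mul]
    have := shift_mul_cable ((𝔭 x.1)⁻¹ i) ((𝔭 y.1)⁻¹ i) (ou f.1) (ou g.2) h.symm
    simp only [mul_assoc]
    rw [← mul_assoc (shift _ _ _ _ _) (cable m _ _), this]
    simp only [mul_assoc])

end PaB

/-! ### Profinite completion of groupoids -/

/-- Compatible equivalence relations on a groupoid with finitely many objects: equivalence relations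
on the set of morphisms which relate only parallel morphisms, are respected by composition, and
have finitely many classes. (For finitely many objects, it is the same to ask for finitely many
classes in each set of morphisms.) -/
structure FinCongr (𝒢 : Type) [Groupoid.{0} 𝒢] where
  setoid : ∀ a b : 𝒢, Setoid (a ⟶ b)
  comp_left : ∀ {a b c : 𝒢} (f : a ⟶ b) {g g' : b ⟶ c},
    (setoid b c).r g g' → (setoid a c).r (f ≫ g) (f ≫ g')
  comp_right : ∀ {a b c : 𝒢} {f f' : a ⟶ b} (g : b ⟶ c),
    (setoid a b).r f f' → (setoid a c).r (f ≫ g) (f' ≫ g)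
  finite : ∀ a b : 𝒢, Finite (Quotient (setoid a b))

namespace FinCongr

variable {𝒢 ℋ : Type} [Groupoid.{0} 𝒢] [Groupoid.{0} ℋ]

/-- The morphisms `a → b` of the finite quotient groupoid `𝒢/∼`. -/
def QHom (s : FinCongr 𝒢) (a b : 𝒢) : Type := Quotient (s.setoid a b)

/-- The finite sets of morphisms of `𝒢/∼` are discrete. -/
instance (s : FinCongr 𝒢) (a b : 𝒢) : TopologicalSpace (s.QHom a b) := ⊥

/-- Composition in `𝒢/∼`. -/
def qcomp (s : FinCongr 𝒢) {a b c : 𝒢} (x : s.QHom a b) (y : s.QHom b c) : s.QHom a c :=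
  Quotient.map₂ (fun f g => f ≫ g)
    (fun _ f' h _ _ h' => (s.setoid a c).trans (s.comp_right _ h) (s.comp_left f' h')) x y

/-- `s ≤ t` if the relation `s` is finer than `t`. -/
def Finer (s t : FinCongr 𝒢) : Prop :=
  ∀ (a b : 𝒢) (f g : a ⟶ b), (s.setoid a b).r f g → (t.setoid a b).r f g

/-- The projection `𝒢/s → 𝒢/t`. -/
def proj {s t : FinCongr 𝒢} (h : s.Finer t) {a b : 𝒢} (x : s.QHom a b) : t.QHom a b :=
  Quotient.map id (h a b) x

/-- The pullback of a compatible equivalence relation along a functor. -/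
def pullback (F : 𝒢 ⥤ ℋ) (s : FinCongr ℋ) : FinCongr 𝒢 where
  setoid a b := (s.setoid (F.obj a) (F.obj b)).comap F.map
  comp_left f g g' h := by
    change (s.setoid _ _).r (F.map _) (F.map _)
    rw [F.map_comp, F.map_comp]
    exact s.comp_left _ h
  comp_right g h := by
    change (s.setoid _ _).r (F.map _) (F.map _)
    rw [F.map_comp, F.map_comp]
    exact s.comp_right _ h
  finite a b := by
    have := s.finite (F.obj a) (F.obj b)
    refine Finite.of_injective (β := Quotient (s.setoid (F.obj a) (F.obj b)))
      (Quotient.map F.map fun _ _ h => h) ?_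
    intro x y
    induction x using Quotient.inductionOn with | _ f
    induction y using Quotient.inductionOn with | _ g
    intro h
    exact Quotient.sound (Quotient.exact (s := s.setoid (F.obj a) (F.obj b)) h)

/-- The functor `𝒢/F^*s → ℋ/s`. -/
def push (F : 𝒢 ⥤ ℋ) (s : FinCongr ℋ) {a b : 𝒢} (x : (pullback F s).QHom a b) :
    s.QHom (F.obj a) (F.obj b) :=
  Quotient.map F.map (fun _ _ h => h) x

end FinCongr

/-- The morphisms `a → b` of the profinite completion of `𝒢`: the limit of the finite sets of
morphisms `a → b` of the groupoids `𝒢/∼`. -/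
structure HatHom {𝒢 : Type} [Groupoid.{0} 𝒢] (a b : 𝒢) where
  val : ∀ s : FinCongr 𝒢, s.QHom a b
  compat : ∀ (s t : FinCongr 𝒢) (h : s.Finer t), FinCongr.proj h (val s) = val t

namespace HatHom

variable {𝒢 ℋ 𝒦 : Type} [Groupoid.{0} 𝒢] [Groupoid.{0} ℋ] [Groupoid.{0} 𝒦]

/-- The topology of the limit: a subspace of the product of the discrete spaces of morphisms. -/
instance (a b : 𝒢) : TopologicalSpace (HatHom a b) := TopologicalSpace.induced val inferInstance

/-- Composition in the profinite completion. -/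
def comp {a b c : 𝒢} (x : HatHom a b) (y : HatHom b c) : HatHom a c :=
  ⟨fun s => s.qcomp (x.val s) (y.val s), fun s t h => by
    rw [← x.compat s t h, ← y.compat s t h]
    induction x.val s using Quotient.inductionOn
    induction y.val s using Quotient.inductionOn
    rfl⟩

/-- The profinite completion of a functor. -/
def map (F : 𝒢 ⥤ ℋ) {a b : 𝒢} (x : HatHom a b) : HatHom (F.obj a) (F.obj b) :=
  ⟨fun s => FinCongr.push F s (x.val (FinCongr.pullback F s)), fun s t h => by
    rw [← x.compat (FinCongr.pullback F s) (FinCongr.pullback F t) fun _ _ f g hfg => h _ _ _ _ hfg]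
    induction x.val (FinCongr.pullback F s) using Quotient.inductionOn
    rfl⟩

/-- The profinite completion of a functor of two variables, with the profinite completion of
`𝒢 × ℋ` identified with the product of the completions: the pair `(x, y)` is the composite of
`(id, y)` and `(x, id)`. -/
def map₂ (F : 𝒢 × ℋ ⥤ 𝒦) {a b : 𝒢} {c d : ℋ} (x : HatHom a b) (y : HatHom c d) :
    HatHom (F.obj (a, c)) (F.obj (b, d)) :=
  comp (map (Prod.sectR a ℋ ⋙ F) y) (map (Prod.sectL 𝒢 d ⋙ F) x)

end HatHom

/-! ### The profinite Grothendieck-Teichmueller group -/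

/-- The profinite Grothendieck-Teichmueller group: the continuous automorphisms, identical on
objects, of the operad in topological groupoids obtained from `PaB` by profinite completion. They
are families of self-homeomorphisms of the spaces of morphisms which respect the composition of
morphisms, the actions of the symmetric groups and the operadic insertions. -/
def GThat : Subgroup (∀ (n : ℕ) (a b : PaB n), HatHom a b ≃ₜ HatHom a b) where
  carrier := {T |
    (∀ (n : ℕ) (a b c : PaB n) (x : HatHom a b) (y : HatHom b c),
      T n a c (x.comp y) = (T n a b x).comp (T n b c y)) ∧
    (∀ (n : ℕ) (θ : Equiv.Perm (Fin n)) (a b : PaB n) (x : HatHom a b),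
      T n _ _ (HatHom.map (PaB.perm_functor θ) x) = HatHom.map (PaB.perm_functor θ) (T n a b x)) ∧
    (∀ (n m : ℕ) (i : Fin n) (a b : PaB n) (c d : PaB m) (x : HatHom a b) (y : HatHom c d),
      T (n + m - 1) _ _ (HatHom.map₂ (PaB.insertFunctor n m i) x y) =
        HatHom.map₂ (PaB.insertFunctor n m i) (T n a b x) (T m c d y))}
  one_mem' := ⟨fun _ _ _ _ _ _ => rfl, fun _ _ _ _ _ => rfl, fun _ _ _ _ _ _ _ _ _ => rfl⟩
  mul_mem' {T U} hT hU := by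
    refine ⟨fun n a b c x y => ?_, fun n θ a b x => ?_, fun n m i a b c d x y => ?_⟩
    · change T n a c (U n a c _) = _
      rw [hU.1, hT.1]; rfl
    · change T n _ _ (U n _ _ _) = _
      rw [hU.2.1, hT.2.1]; rfl
    · change T _ _ _ (U _ _ _ _) = _
      rw [hU.2.2, hT.2.2]; rfl
  inv_mem' {T} hT := by
    have h : ∀ (n : ℕ) (a b : PaB n) (x : HatHom a b), T n a b (T⁻¹ n a b x) = x :=
      fun n a b x => (T n a b).apply_symm_apply x
    refine ⟨fun n a b c x y => ?_, fun n θ a b x => ?_, fun n m i a b c d x y => ?_⟩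
    · apply (T n a c).injective
      rw [h, hT.1, h, h]
    · apply (T n _ _).injective
      rw [h, hT.2.1, h]
    · apply (T (n + m - 1) _ _).injective
      rw [h, hT.2.2, h, h]

/-! ### The poset `NFI_{PB₄}(B₄)` -/

/-- The braid obtained from `g` by doubling the strand which starts at the position `p`. -/
def double {n : ℕ} (p : Fin n) (g : Braid n) : Braid (n + 1) := cable 2 p g

theorem double_one {n : ℕ} (p : Fin n) : double p (1 : Braid n) = 1 := cable_one p

theorem double_mul {n : ℕ} (p : Fin n) (g h : Braid n) :
    double p (g * h) = double (ρ n h p) g * double p h := cable_mul p g h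

theorem double_inv {n : ℕ} (p : Fin n) (g : Braid n) :
    double p g⁻¹ = (double ((ρ n g)⁻¹ p) g)⁻¹ := cable_inv p g

/-- The braid obtained from `g` by adding a vertical strand on the right. -/
def addRight {n : ℕ} : Braid n →* Braid (n + 1) := shift n (n + 1) 0 (by omega)

/-- The braid obtained from `g` by adding a vertical strand on the left. -/
def addLeft {n : ℕ} : Braid n →* Braid (n + 1) := shift n (n + 1) 1 (by omega)

/-- The pure braids on `n` strands which are sent to `N` by the `n + 2` homomorphisms
`PB_n → PB_{n+1}` given by adding a strand on the right or on the left and by doubling a strand.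
For `n = 3` these are `φ_{123}`, `φ_{234}`, `φ_{12,3,4}`, `φ_{1,23,4}`, `φ_{1,2,34}`;
for `n = 2` these are `φ_{12}`, `φ_{23}`, `φ_{12,3}`, `φ_{1,23}`. -/
def pull {n : ℕ} (N : Subgroup (Braid (n + 1))) : Subgroup (Braid n) where
  carrier := {h | h ∈ PB n ∧ addRight h ∈ N ∧ addLeft h ∈ N ∧ ∀ p : Fin n, double p h ∈ N}
  one_mem' := by
    refine ⟨one_mem _, ?_, ?_, fun p => ?_⟩
    · rw [map_one]; exact one_mem _
    · rw [map_one]; exact one_mem _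
    · rw [double_one]; exact one_mem _
  mul_mem' {g h} hg hh := by
    refine ⟨mul_mem hg.1 hh.1, ?_, ?_, fun p => ?_⟩
    · rw [map_mul]; exact mul_mem hg.2.1 hh.2.1
    · rw [map_mul]; exact mul_mem hg.2.2.1 hh.2.2.1
    · rw [double_mul]; exact mul_mem (hg.2.2.2 _) (hh.2.2.2 _)
  inv_mem' {g} hg := by
    refine ⟨inv_mem hg.1, ?_, ?_, fun p => ?_⟩
    · rw [map_inv]; exact inv_mem hg.2.1
    · rw [map_inv]; exact inv_mem hg.2.2.1
    · rw [double_inv]; exact inv_mem (hg.2.2.2 _)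

instance pull_normal {n : ℕ} (N : Subgroup (Braid (n + 1))) [hN : N.Normal] : (pull N).Normal where
  conj_mem h hh g := by
    refine ⟨(MonoidHom.normal_ker (ρ n)).conj_mem h hh.1 g, ?_, ?_, fun p => ?_⟩
    · rw [map_mul, map_mul, map_inv]; exact hN.conj_mem _ hh.2.1 _
    · rw [map_mul, map_mul, map_inv]; exact hN.conj_mem _ hh.2.2.1 _
    · have h1 : ρ n h = 1 := hh.1
      rw [double_mul, double_mul, double_inv, map_inv, h1, Equiv.Perm.one_apply]
      exact hN.conj_mem _ (hh.2.2.2 _) _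

/-- The poset `NFI_{PB₄}(B₄)` of finite index normal subgroups `N` of `B₄` with `N ≤ PB₄`. -/
structure NFI where
  N : Subgroup (Braid 4)
  normal : N.Normal
  finiteIndex : N.FiniteIndex
  le_PB : N ≤ PB 4

namespace NFI

instance : PartialOrder NFI :=
  PartialOrder.lift NFI.N (fun K L h => by cases K; cases L; cases h; rfl)

instance (N : NFI) : N.N.Normal := N.normal

/-- `N_{PB₃}`, a normal subgroup of `B₃`. -/
def N3 (N : NFI) : Subgroup (Braid 3) := pull N.N

/-- `N_{PB₂}`, a normal subgroup of `B₂`. -/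
def N2 (N : NFI) : Subgroup (Braid 2) := pull N.N3

instance (N : NFI) : N.N3.Normal := pull_normal (n := 3) (hN := N.normal) N.N

instance (N : NFI) : N.N2.Normal :=
  pull_normal (n := 2) (hN := pull_normal (n := 3) (hN := N.normal) N.N) N.N3

/-- `N_ord`, the index of `N_{PB₂}` in `PB₂`. -/
noncomputable def Nord (N : NFI) : ℕ := N.N2.relIndex (PB 2)

end NFI

/-! ### GT-pairs -/

/-- The generator `x₁₂` of `PB₃`. -/
def x12 : Braid 3 := σ 3 0 ^ 2

/-- The generator `x₂₃` of `PB₃`. -/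
def x23 : Braid 3 := σ 3 1 ^ 2

/-- The generator `x₁₃` of `PB₃`. -/
def x13 : Braid 3 := σ 3 1 * σ 3 0 ^ 2 * (σ 3 1)⁻¹

/-- `F₂`, the subgroup of `PB₃` generated by `x₁₂` and `x₂₃`. -/
def F2 : Subgroup (Braid 3) := Subgroup.closure {x12, x23}

/-- The tuple `(m, f)` represents a GT-pair: it satisfies the two hexagon relations modulo
`N_{PB₃}` and the pentagon relation modulo `N`. -/
structure IsGTPair (N : NFI) (m : ℤ) (f : PB 3) : Prop where
  hexagon₁ : ((σ 3 0 * x12 ^ m * (f : Braid 3)⁻¹ * σ 3 1 * x23 ^ m * f : Braid 3) : Braid 3 ⧸ N.N3) =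
    ((f : Braid 3)⁻¹ * σ 3 0 * σ 3 1 * (x13 * x23) ^ m : Braid 3)
  hexagon₂ : (((f : Braid 3)⁻¹ * σ 3 1 * x23 ^ m * f * σ 3 0 * x12 ^ m : Braid 3) : Braid 3 ⧸ N.N3) =
    (σ 3 1 * σ 3 0 * (x12 * x13) ^ m * f : Braid 3)
  pentagon : ((addLeft (f : Braid 3) * double 1 (f : Braid 3) * addRight (f : Braid 3) : Braid 4) :
      Braid 4 ⧸ N.N) = (double 2 (f : Braid 3) * double 0 (f : Braid 3) : Braid 4)

/-! ### The homomorphisms `T^{B_n}` of a GT-pair -/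

theorem hexagon_braid {G : Type*} [Group G] (s t f : G) (m : ℤ) (hb : s * t * s = t * s * t)
    (h : s * (s ^ 2) ^ m * f⁻¹ * t * (t ^ 2) ^ m * f =
      f⁻¹ * s * t * (t * s ^ 2 * t⁻¹ * t ^ 2) ^ m) :
    (s * (s ^ 2) ^ m) * (f⁻¹ * t * (t ^ 2) ^ m * f) * (s * (s ^ 2) ^ m) =
      (f⁻¹ * t * (t ^ 2) ^ m * f) * (s * (s ^ 2) ^ m) * (f⁻¹ * t * (t ^ 2) ^ m * f) := by
  obtain ⟨W, hW⟩ : ∃ W, W = t * s ^ 2 * t⁻¹ * t ^ 2 := ⟨_, rfl⟩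
  have hW' : W = t * s * s * t := by rw [hW, pow_two, pow_two]; group
  rw [← hW] at h
  have hc : Commute s W := by
    change s * W = W * s
    calc s * W = (s * t * s) * s * t := by rw [hW']; group
      _ = t * s * (t * s * t) := by rw [hb]; group
      _ = W * s := by rw [← hb, hW']; group
  have hc1 : Commute s (W ^ m) := hc.zpow_right m
  have hc2 : Commute ((s ^ 2) ^ m) (W ^ m) := (hc1.pow_left 2).zpow_left m
  have hs : SemiconjBy (s * t) s t := by
    change s * t * s = t * (s * t); rw [hb]; group
  have hs2 : (s * t) * (s ^ 2) ^ m = (t ^ 2) ^ m * (s * t) := ((hs.pow_right 2).zpow_right m).eq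
  calc _ = (s * (s ^ 2) ^ m * f⁻¹ * t * (t ^ 2) ^ m * f) * s * (s ^ 2) ^ m := by group
    _ = f⁻¹ * s * t * (W ^ m * s) * (s ^ 2) ^ m := by rw [h]; group
    _ = f⁻¹ * (s * t * s) * (W ^ m * (s ^ 2) ^ m) := by rw [← hc1.eq]; group
    _ = f⁻¹ * t * (s * t * (s ^ 2) ^ m) * W ^ m := by rw [hb, ← hc2.eq]; group
    _ = f⁻¹ * t * (t ^ 2) ^ m * f * (f⁻¹ * s * t * W ^ m) := by rw [hs2]; group
    _ = _ := by rw [← h]; group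

namespace IsGTPair

variable {N : NFI} {m : ℤ} {f : PB 3}

/-- The images of the generators under `T^{B₃}`. -/
def gen3 (N : NFI) (m : ℤ) (f : PB 3) : ℕ → Braid 3 ⧸ N.N3
  | 0 => (σ 3 0 * x12 ^ m : Braid 3)
  | 1 => ((f : Braid 3)⁻¹ * (σ 3 1 * x23 ^ m) * f : Braid 3)
  | _ => 1

/-- The images of the generators under `T^{B₄}`. -/
def gen4 (N : NFI) (m : ℤ) (f : PB 3) : ℕ → Braid 4 ⧸ N.N
  | 0 => (σ 4 0 * (σ 4 0 ^ 2) ^ m : Braid 4)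
  | 1 => ((addRight (f : Braid 3))⁻¹ * (σ 4 1 * (σ 4 1 ^ 2) ^ m) * addRight (f : Braid 3) : Braid 4)
  | 2 => ((double 0 (f : Braid 3))⁻¹ * (σ 4 2 * (σ 4 2 ^ 2) ^ m) * double 0 (f : Braid 3) : Braid 4)
  | _ => 1

theorem gen3_braid (h : IsGTPair N m f) : gen3 N m f 0 * gen3 N m f 1 * gen3 N m f 0 =
    gen3 N m f 1 * gen3 N m f 0 * gen3 N m f 1 := by
  have hb : ((σ 3 0 : Braid 3) : Braid 3 ⧸ N.N3) * (σ 3 1 : Braid 3) * (σ 3 0 : Braid 3) =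
      (σ 3 1 : Braid 3) * (σ 3 0 : Braid 3) * (σ 3 1 : Braid 3) :=
    congrArg (QuotientGroup.mk' N.N3) (σ_braid 3 0 (by omega))
  have := hexagon_braid _ _ ((f : Braid 3) : Braid 3 ⧸ N.N3) m hb h.hexagon₁
  simp only [gen3, x12, x23, QuotientGroup.mk_mul, QuotientGroup.mk_inv, QuotientGroup.mk_zpow,
    QuotientGroup.mk_pow]
  simpa only [mul_assoc] using this

/-- A doubled strand of a pure braid commutes with the crossings of the two parallel strands. -/
theorem double_comm (p : Fin 3) (f : PB 3) :
    σ 4 p * double p (f : Braid 3) = double p (f : Braid 3) * σ 4 p := by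
  have h1 : ρ 3 (f : Braid 3) = 1 := f.2
  have := shift_mul_cable (m := 2) p p (f : Braid 3) (σ 2 0) (by rw [h1]; rfl)
  rw [shift_σ _ _ _ _ _ (by omega), zero_add] at this
  exact this

/-- Adding a strand on the right, modulo `N`. -/
def addRightQ (N : NFI) : Braid 3 ⧸ N.N3 →* Braid 4 ⧸ N.N :=
  QuotientGroup.map N.N3 N.N addRight (fun _ h => h.2.1)

/-- Adding a strand on the left, modulo `N`. -/
def addLeftQ (N : NFI) : Braid 3 ⧸ N.N3 →* Braid 4 ⧸ N.N :=
  QuotientGroup.map N.N3 N.N addLeft (fun _ h => h.2.2.1)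

theorem gen4_comm : gen4 N m f 0 * gen4 N m f 2 = gen4 N m f 2 * gen4 N m f 0 := by
  have h1 : Commute (σ 4 0) (double 0 (f : Braid 3)) := double_comm 0 f
  have h2 : Commute (σ 4 0) (σ 4 2) := σ_comm 4 0 2 (by omega)
  have h3 : Commute (σ 4 0) ((double 0 (f : Braid 3))⁻¹ * (σ 4 2 * (σ 4 2 ^ 2) ^ m) *
      double 0 (f : Braid 3)) :=
    (h1.inv_right.mul_right (h2.mul_right ((h2.pow_right 2).zpow_right m))).mul_right h1
  have h4 := h3.mul_left ((h3.pow_left 2).zpow_left m)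
  exact congrArg (QuotientGroup.mk' N.N) h4.eq

theorem gen4_braid₀ (h : IsGTPair N m f) : gen4 N m f 0 * gen4 N m f 1 * gen4 N m f 0 =
    gen4 N m f 1 * gen4 N m f 0 * gen4 N m f 1 := by
  have hσ : ∀ i, i + 1 < 3 → addRight (σ 3 i) = σ 4 i := fun i hi => shift_σ 3 4 0 (by omega) i hi
  have e0 : addRightQ N (gen3 N m f 0) = gen4 N m f 0 := by
    change ((addRight (σ 3 0 * x12 ^ m) : Braid 4) : Braid 4 ⧸ N.N) = _
    rw [x12, map_mul, map_zpow, map_pow, hσ 0 (by omega)]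
    rfl
  have e1 : addRightQ N (gen3 N m f 1) = gen4 N m f 1 := by
    change ((addRight ((f : Braid 3)⁻¹ * (σ 3 1 * x23 ^ m) * f) : Braid 4) : Braid 4 ⧸ N.N) = _
    rw [x23, map_mul, map_mul, map_mul, map_inv, map_zpow, map_pow, hσ 1 (by omega)]
    rfl
  have := congrArg (addRightQ N) h.gen3_braid
  rwa [map_mul, map_mul, map_mul, map_mul, e0, e1] at this

theorem gen4_braid₁ (h : IsGTPair N m f) : gen4 N m f 1 * gen4 N m f 2 * gen4 N m f 1 =
    gen4 N m f 2 * gen4 N m f 1 * gen4 N m f 2 := by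
  have hσ : ∀ i, i + 1 < 3 → addLeft (σ 3 i) = σ 4 (i + 1) :=
    fun i hi => shift_σ 3 4 1 (by omega) i hi
  obtain ⟨s, hs⟩ : ∃ s : Braid 4 ⧸ N.N, s = (σ 4 1 * (σ 4 1 ^ 2) ^ m : Braid 4) := ⟨_, rfl⟩
  obtain ⟨t, ht⟩ : ∃ t : Braid 4 ⧸ N.N, t = (σ 4 2 * (σ 4 2 ^ 2) ^ m : Braid 4) := ⟨_, rfl⟩
  obtain ⟨A, hA⟩ : ∃ A : Braid 4 ⧸ N.N, A = (addLeft (f : Braid 3) : Braid 4) := ⟨_, rfl⟩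
  obtain ⟨B, hB⟩ : ∃ B : Braid 4 ⧸ N.N, B = (double 1 (f : Braid 3) : Braid 4) := ⟨_, rfl⟩
  obtain ⟨C, hC⟩ : ∃ C : Braid 4 ⧸ N.N, C = (addRight (f : Braid 3) : Braid 4) := ⟨_, rfl⟩
  obtain ⟨D, hD⟩ : ∃ D : Braid 4 ⧸ N.N, D = (double 2 (f : Braid 3) : Braid 4) := ⟨_, rfl⟩
  obtain ⟨E, hE⟩ : ∃ E : Braid 4 ⧸ N.N, E = (double 0 (f : Braid 3) : Braid 4) := ⟨_, rfl⟩
  have hpent : A * B * C = D * E := by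
    rw [hA, hB, hC, hD, hE]; exact h.pentagon
  have e1 : gen4 N m f 1 = C⁻¹ * s * C := by rw [hC, hs]; rfl
  have e2 : gen4 N m f 2 = E⁻¹ * t * E := by rw [hE, ht]; rfl
  have hBs : s * B = B * s := by
    have h1 : Commute (σ 4 1) (double 1 (f : Braid 3)) := double_comm 1 f
    rw [hB, hs]
    exact congrArg (QuotientGroup.mk' N.N) (h1.mul_left ((h1.pow_left 2).zpow_left m)).eq
  have hDt : t * D = D * t := by
    have h1 : Commute (σ 4 2) (double 2 (f : Braid 3)) := double_comm 2 f
    rw [hD, ht]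
    exact congrArg (QuotientGroup.mk' N.N) (h1.mul_left ((h1.pow_left 2).zpow_left m)).eq
  have l0 : addLeftQ N (gen3 N m f 0) = s := by
    change ((addLeft (σ 3 0 * x12 ^ m) : Braid 4) : Braid 4 ⧸ N.N) = _
    rw [x12, map_mul, map_zpow, map_pow, hσ 0 (by omega), hs]
  have l1 : addLeftQ N (gen3 N m f 1) = A⁻¹ * t * A := by
    change ((addLeft ((f : Braid 3)⁻¹ * (σ 3 1 * x23 ^ m) * f) : Braid 4) : Braid 4 ⧸ N.N) = _
    rw [x23, map_mul, map_mul, map_mul, map_inv, map_zpow, map_pow, hσ 1 (by omega), hA, ht]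
    rfl
  have key := congrArg (addLeftQ N) h.gen3_braid
  rw [map_mul, map_mul, map_mul, map_mul, l0, l1] at key
  have hE' : E = D⁻¹ * A * (B * C) := by
    rw [mul_assoc, ← mul_assoc A, hpent, inv_mul_cancel_left]
  have c1 : C⁻¹ * s * C = (B * C)⁻¹ * s * (B * C) := by
    calc C⁻¹ * s * C = C⁻¹ * B⁻¹ * (B * s) * C := by group
      _ = _ := by rw [← hBs]; group
  have c2 : E⁻¹ * t * E = (B * C)⁻¹ * (A⁻¹ * t * A) * (B * C) := by
    calc E⁻¹ * t * E = (B * C)⁻¹ * A⁻¹ * (D * t) * D⁻¹ * A * (B * C) := by rw [hE']; group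
      _ = _ := by rw [← hDt]; group
  rw [e1, e2, c1, c2]
  calc _ = (B * C)⁻¹ * (s * (A⁻¹ * t * A) * s) * (B * C) := by group
    _ = _ := by rw [key]; group

/-- `T^{B₂} : B₂ → B₂/N_{PB₂}`. -/
def TB2 (N : NFI) (m : ℤ) : Braid 2 →* Braid 2 ⧸ N.N2 :=
  braidLift 2 (fun _ => (σ 2 0 * (σ 2 0 ^ 2) ^ m : Braid 2)) (fun _ _ _ _ => rfl) (fun _ _ => rfl)

/-- `T^{B₃} : B₃ → B₃/N_{PB₃}`. -/
def TB3 (h : IsGTPair N m f) : Braid 3 →* Braid 3 ⧸ N.N3 :=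
  braidLift 3 (gen3 N m f) (fun i j hij hj => by omega) (fun i hi => by
    obtain rfl : i = 0 := by omega
    exact h.gen3_braid)

/-- `T^{B₄} : B₄ → B₄/N`. -/
def TB4 (h : IsGTPair N m f) : Braid 4 →* Braid 4 ⧸ N.N :=
  braidLift 4 (gen4 N m f)
    (fun i j hij hj => by
      obtain rfl : i = 0 := by omega
      obtain rfl : j = 2 := by omega
      exact gen4_comm)
    (fun i hi => by
      obtain rfl | rfl : i = 0 ∨ i = 1 := by omega
      · exact h.gen4_braid₀
      · exact h.gen4_braid₁)

end IsGTPair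

/-! ### Charming GT-shadows -/

/-- The tuple `(m, f)` represents a GT-shadow: a GT-pair for which the homomorphisms
`T^{PB_n} : PB_n → PB_n/N_{PB_n}` are onto for `n = 2, 3, 4`. -/
structure IsGTShadow (N : NFI) (m : ℤ) (f : PB 3) : Prop where
  isGTPair : IsGTPair N m f
  onto2 : (PB 2).map (IsGTPair.TB2 N m) = (PB 2).map (QuotientGroup.mk' N.N2)
  onto3 : (PB 3).map isGTPair.TB3 = (PB 3).map (QuotientGroup.mk' N.N3)
  onto4 : (PB 4).map isGTPair.TB4 = (PB 4).map (QuotientGroup.mk' N.N)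

/-- The tuple `(m, f)` represents a charming GT-shadow: the coset `f N_{PB₃}` has a representative
in `[F₂, F₂]`, and the homomorphism `T^{F₂} : F₂ → F₂/(N_{PB₃} ∩ F₂)` is onto. -/
structure IsCharming (N : NFI) (m : ℤ) (f : PB 3) : Prop where
  isGTShadow : IsGTShadow N m f
  commutator : ∃ f₁ ∈ ⁅F2, F2⁆, (f : Braid 3)⁻¹ * f₁ ∈ N.N3
  ontoF2 : F2.map isGTShadow.isGTPair.TB3 = F2.map (QuotientGroup.mk' N.N3)

/-- `T^{B₃}` of a charming GT-shadow. -/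
def IsCharming.T3 {N : NFI} {m : ℤ} {f : PB 3} (h : IsCharming N m f) : Braid 3 →* Braid 3 ⧸ N.N3 :=
  h.isGTShadow.isGTPair.TB3

/-- `T^{B₄}` of a charming GT-shadow. -/
def IsCharming.T4 {N : NFI} {m : ℤ} {f : PB 3} (h : IsCharming N m f) : Braid 4 →* Braid 4 ⧸ N.N :=
  h.isGTShadow.isGTPair.TB4

/-- The set `ℤ/N_ord × PB₃/N_{PB₃}` in which GT-pairs live. -/
abbrev Pairs (N : NFI) : Type := ZMod N.Nord × (PB 3 ⧸ N.N3.subgroupOf (PB 3))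

/-- The class `[(m, f)]`. -/
noncomputable def mkPair (N : NFI) (m : ℤ) (f : PB 3) : Pairs N := ((m : ZMod N.Nord), (f : PB 3 ⧸ _))

/-- The set `GT♥(N)` of charming GT-shadows. -/
def GTcharm (N : NFI) : Type :=
  {s : Pairs N // ∃ (m : ℤ) (f : PB 3), mkPair N m f = s ∧ IsCharming N m f}

/-- An element `N` is isolated if every charming GT-shadow `[(m, f)]` is settled, i.e. the kernel
of `T^{B₄} : B₄ → B₄/N` is `N`. -/
def IsIsolated (N : NFI) : Prop :=
  ∀ (m : ℤ) (f : PB 3) (h : IsCharming N m f), h.T4.ker = N.N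

/-- The poset of isolated elements of `NFI_{PB₄}(B₄)`, a category with one morphism `K ⟶ N` for
`K ≤ N`. -/
abbrev Isolated : Type := {N : NFI // IsIsolated N}

/-- `u` is the composite `s ∘ t` of charming GT-shadows: if `s = [(m₂, f₂)]` and `t = [(m₁, f₁)]`,
then `u = [(2 m₁ m₂ + m₁ + m₂, f₂ T_{m₂,f₂}(f₁))]`. -/
def IsComposite (N : NFI) (s t u : GTcharm N) : Prop :=
  ∀ (m₂ : ℤ) (f₂ : PB 3) (h₂ : IsCharming N m₂ f₂) (m₁ : ℤ) (f₁ : PB 3),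
    IsCharming N m₁ f₁ → s.1 = mkPair N m₂ f₂ → t.1 = mkPair N m₁ f₁ →
    ∃ f : PB 3, ((f : Braid 3) : Braid 3 ⧸ N.N3) = ((f₂ : Braid 3) : Braid 3 ⧸ N.N3) * h₂.T3 f₁ ∧
      u.1 = mkPair N (2 * m₁ * m₂ + m₁ + m₂) f

/-- The charming GT-shadow `t` for `N` is the reduction of the charming GT-shadow `s` for `K`: if
`s = [(m, f)]`, then `t = [(m, f)]`. -/
def IsReduction {K N : NFI} (s : GTcharm K) (t : GTcharm N) : Prop :=
  ∀ (m : ℤ) (f : PB 3), s.1 = mkPair K m f → t.1 = mkPair N m f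

/-- The forgetful functor from finite groups to groups. -/
abbrev finToGrp : FiniteGrp.{0} ⥤ GrpCat.{0} where
  obj G := G.toGrp
  map f := f.hom

end GTShadows

open GTShadows

open CategoryTheory

namespace GTShadows

/-! The operad of parenthesized braids is generated by one associator in arity 3 and one braiding in
arity 2, subject to the pentagon and the two hexagons. A GT-pair is therefore a morphism from `PaB`
to a finite quotient of it which is the identity on objects, and the completed operad is the limit
of such quotients. The proof makes both statements precise and then passes to the limit.

The finite quotients are given by an `OpCongr`, a family of finite index normal subgroups of all
braid groups that is stable under cabling. Cabling is treated uniformly by `mc`, which replaces all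
strands at once by cables of arbitrary, possibly zero, sizes; `mc_mc` then handles iterated
operations. An element of `NFI` gives such a congruence (`NFI.oc`), and conversely every congruence
contains one of these on 2, 3 and 4 strands (`OpCongr.exists_NFI`).

From a pair `(m, f)` that satisfies the relations modulo a congruence one gets homomorphisms
`IsPair.Θ` on every braid group: `σ_i` goes to its power `2m+1`, conjugated by a cabled `f`. The
pentagon gives the braid relations and, in the form of Mac Lane coherence (`IsPair.coherence`), the
independence of rebracketing; the hexagons describe the crossing of a strand with a cable. Together
they show that `Θ` respects juxtaposition and cabling up to the coherence braids `Psi` (`Θ_shift`,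
`Θ_cable`), so that conjugation by the coherence braids `Phi` produces an operadic map
`IsPair.opMap`. Conversely, the inductive relation `Deriv` shows that an operadic map is determined
by its values on the associator and the braiding (`OpMap.ext_of_isData`), and that these values
satisfy the relations (`OpMap.isPair_of_isData`). Composing pairs is composing operadic maps, so the
relations for a composite never have to be checked.

The kernels of `Θ` form again a congruence. Intersecting the kernels of the finitely many charming
GT-shadows of `N` gives an isolated element below `N` (`NFI.isIsolated_isolate`), so isolated
elements are cofinal. For isolated `N` every shadow induces injective endomorphisms of the finite
quotients; hence composition is left cancellative on a finite set, and one obtains a group.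

A continuous automorphism of the completion induces an operadic map at each level, hence a pair.
This pair is charming. Invertibility gives surjectivity. The commutator condition holds because
`PB₃` is generated by `F₂` and the full twist, while deleting all but two strands in the pentagon
kills the exponents of `x₁₂`, `x₂₃` and the twist (`exists_commutator`). Together with invertibility
this gives surjectivity on `F₂`. So there is a homomorphism from `GThat` to each group of shadows.

It is injective in the limit because the levels of operadic congruences determine the completion
(`OpCongr.exists_finer`) and the generators determine a map on each level. It is onto because a
compatible family of shadows defines a pair modulo every congruence, hence a continuous endomorphism
`HatPair.hat` of the completed operad, and the family of inverse shadows defines the inverse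
endomorphism. -/

/-! ### Crossings of blocks of strands -/

/-- The block of `a` strands at `p, …, p + a - 1` passes over the block of the `b` strands at
`p + a, …, p + a + b - 1`. -/
def blk (N p a : ℕ) : ℕ → Braid N
  | 0 => 1
  | b + 1 => cableUp N (p + b) a * blk N p a b

theorem blk_zero_right (N p a : ℕ) : blk N p a 0 = 1 := rfl

theorem blk_zero_left (N p b : ℕ) : blk N p 0 b = 1 := by
  induction b with
  | zero => rfl
  | succ b ih => rw [blk, ih]; simp [cableUp]

theorem blk_one_right (N p a : ℕ) : blk N p a 1 = cableUp N p a := by simp [blk]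

theorem blk_one_left (N p b : ℕ) : blk N p 1 b = cableDown N p b := by
  induction b with
  | zero => rfl
  | succ b ih => rw [blk, cableDown, ih]; simp [cableUp]

theorem blk_one_one (N p : ℕ) : blk N p 1 1 = σ N p := by simp [blk, cableUp]

theorem blk_add_right (N p a b c : ℕ) :
    blk N p a (b + c) = blk N (p + b) a c * blk N p a b := by
  induction c with
  | zero => simp [blk]
  | succ c ih => rw [← add_assoc, blk, ih, blk, mul_assoc, add_assoc p b c]

theorem cableUp_add (N p a b : ℕ) :
    cableUp N p (a + b) = cableUp N p a * cableUp N (p + a) b := by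
  induction b with
  | zero => simp [cableUp]
  | succ b ih => rw [← add_assoc, cableUp, ih, cableUp, mul_assoc, add_assoc p a b]

theorem σ_comm_blk (N p a b j : ℕ) (h : j + 2 ≤ p ∨ p + a + b ≤ j) :
    Commute (σ N j) (blk N p a b) := by
  induction b with
  | zero => exact Commute.one_right _
  | succ b ih =>
    exact Commute.mul_right (σ_comm_cableUp N (p + b) a j (by omega)) (ih (by omega))

theorem cableUp_comm_blk (N p a b q c : ℕ) (h : p + a + b ≤ q) :
    Commute (cableUp N q c) (blk N p a b) := by
  induction c with
  | zero => exact Commute.one_left _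
  | succ c ih => exact ih.mul_left (σ_comm_blk _ _ _ _ _ (by omega))

theorem blk_comm_blk (N p a b q c d : ℕ) (h : p + a + b ≤ q) :
    Commute (blk N q c d) (blk N p a b) := by
  induction d with
  | zero => exact Commute.one_left _
  | succ d ih => exact (cableUp_comm_blk _ _ _ _ _ _ (by omega)).mul_left ih

theorem blk_add_left (N p a b c : ℕ) :
    blk N p (a + b) c = blk N p a c * blk N (p + a) b c := by
  induction c with
  | zero => simp [blk]
  | succ c ih =>
    have h := (cableUp_comm_blk N p a c (p + c + a) b (by omega)).eq
    rw [blk, blk, blk, ih, cableUp_add, show p + a + c = p + c + a by omega]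
    calc _ = cableUp N (p + c) a * (cableUp N (p + c + a) b * blk N p a c) *
          blk N (p + a) b c := by group
      _ = _ := by rw [h]; group

theorem σ_mul_blk_left (N p a b j : ℕ) (h₁ : p ≤ j) (h₂ : j + 1 < p + a) (hN : p + a + b ≤ N) :
    σ N (j + b) * blk N p a b = blk N p a b * σ N j := by
  induction b with
  | zero => simp [blk]
  | succ b ih =>
    have := σ_cableUp N (p + b) a (j - p) (by omega) (by omega)
    rw [show j - p + (p + b) + 1 = j + (b + 1) by omega, show j - p + (p + b) = j + b by omega]
      at this
    rw [blk, ← mul_assoc, this, mul_assoc, ih (by omega), mul_assoc]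

/-- Only two consecutive strands of the second block are involved. Splitting that block as `k + (2 +
c)` reduces the claim to `cable_rel₁`; the two outer pieces commute with the crossing before and
after it has moved. -/
theorem σ_mul_blk_right (N p a b j : ℕ) (h₁ : p ≤ j) (h₂ : j + 1 < p + b) (hN : p + a + b ≤ N) :
    σ N j * blk N p a b = blk N p a b * σ N (j + a) := by
  obtain ⟨k, rfl⟩ : ∃ k, j = p + k := ⟨j - p, by omega⟩
  obtain ⟨c, rfl⟩ : ∃ c, b = k + (2 + c) := ⟨b - k - 2, by omega⟩
  have h2 : σ N (p + k) * blk N (p + k) a 2 = blk N (p + k) a 2 * σ N (p + k + a) := by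
    have := cable_rel₁ N (p + k) a (by omega)
    simpa [blk, mul_assoc] using this
  have h3 := (σ_comm_blk N (p + k + 2) a c (p + k) (by omega)).eq
  have h1 := (σ_comm_blk N p a k (p + k + a) (by omega)).eq
  rw [blk_add_right, blk_add_right, ← mul_assoc, ← mul_assoc, h3, mul_assoc (blk _ _ _ c), h2]
  simp only [mul_assoc]
  rw [h1]

theorem blk_mul_blk_left (N p a b c q d : ℕ) (h₁ : p ≤ q) (h₂ : q + c + d ≤ p + a)
    (hN : p + a + b ≤ N) : blk N (q + b) c d * blk N p a b = blk N p a b * blk N q c d := by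
  have hu : ∀ r, p ≤ r → ∀ e, r + e < p + a →
      cableUp N (r + b) e * blk N p a b = blk N p a b * cableUp N r e := by
    intro r hr e he
    induction e with
    | zero => simp [cableUp]
    | succ e ih =>
      rw [cableUp, cableUp, mul_assoc, show r + b + e = r + e + b by omega,
        σ_mul_blk_left N p a b (r + e) (by omega) (by omega) hN, ← mul_assoc, ih (by omega),
        mul_assoc]
  induction d with
  | zero => simp [blk]
  | succ d ih =>
    rw [blk, blk, mul_assoc, ih (by omega), ← mul_assoc, show q + b + d = q + d + b by omega,
      hu (q + d) (by omega) c (by omega), mul_assoc]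

/-- The crossing of the blocks `a` and `b` is a braid inside one block of `a + b` strands, so it
slides through the crossing of this block with `c`. -/
theorem blk_yang_baxter (N p a b c : ℕ) (hN : p + a + b + c ≤ N) :
    blk N p b c * blk N (p + b) a c * blk N p a b =
      blk N (p + c) a b * blk N p a c * blk N (p + a) b c := by
  rw [← blk_add_left, mul_assoc, ← blk_add_left, add_comm b a]
  exact (blk_mul_blk_left N p (a + b) c a p b le_rfl (by omega) (by omega)).symm

/-! ### Multiple cabling -/

/-- The sum of the first `i` sizes. -/
def pos (s : ℕ → ℕ) (i : ℕ) : ℕ := ∑ j ∈ Finset.range i, s j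

theorem pos_zero (s : ℕ → ℕ) : pos s 0 = 0 := rfl

theorem pos_succ (s : ℕ → ℕ) (i : ℕ) : pos s (i + 1) = pos s i + s i := Finset.sum_range_succ _ _

theorem pos_mono (s : ℕ → ℕ) {i j : ℕ} (h : i ≤ j) : pos s i ≤ pos s j :=
  Finset.sum_le_sum_of_subset (Finset.range_mono h)

theorem pos_congr {s t : ℕ → ℕ} {i : ℕ} (h : ∀ j < i, s j = t j) : pos s i = pos t i :=
  Finset.sum_congr rfl fun j hj => h j (Finset.mem_range.1 hj)

theorem pos_one (i : ℕ) : pos (fun _ => 1) i = i := by simp [pos]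

/-- The permutation of `ℕ` underlying a braid. -/
def pn (k : ℕ) : Braid k →* Equiv.Perm ℕ :=
  braidLift k (fun i => Equiv.swap i (i + 1))
    (by
      intro i j hij _
      ext p
      simp only [Equiv.Perm.coe_mul, Function.comp_apply, Equiv.swap_apply_def]
      split_ifs <;> omega)
    (by
      intro i _
      ext p
      simp only [Equiv.Perm.coe_mul, Function.comp_apply, Equiv.swap_apply_def]
      split_ifs <;> omega)

theorem pn_σ (k i : ℕ) (hi : i + 1 < k) : pn k (σ k i) = Equiv.swap i (i + 1) :=
  braidLift_σ _ _ _ _ _ hi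

theorem pn_val {k : ℕ} (g : Braid k) (i : Fin k) : pn k g i = ρ k g i := by
  induction g using braid_induction generalizing i with
  | one => simp
  | mul g h hg hh => simp [hg, hh]
  | inv g hg =>
    rw [map_inv, map_inv, Equiv.Perm.inv_eq_iff_eq, hg, perm_apply_inv]
  | gen j hj => rw [pn_σ k j hj, ρ_σ_val k j hj, Equiv.swap_apply_def]

theorem pn_of_le {k : ℕ} (g : Braid k) (i : ℕ) (hi : k ≤ i) : pn k g i = i := by
  induction g using braid_induction with
  | one => simp
  | mul g h hg hh => simp [hg, hh]
  | inv g hg => rw [map_inv, Equiv.Perm.inv_eq_iff_eq, hg]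
  | gen j hj => rw [pn_σ k j hj, Equiv.swap_apply_of_ne_of_ne (by omega) (by omega)]

theorem pn_lt {k : ℕ} (g : Braid k) (i : ℕ) (hi : i < k) : pn k g i < k := by
  have := pn_val g ⟨i, hi⟩
  simp only at this
  rw [this]; exact Fin.isLt _

theorem pn_eq_one_iff {k : ℕ} (g : Braid k) : pn k g = 1 ↔ g ∈ PB k := by
  rw [MonoidHom.mem_ker]
  constructor
  · intro h
    ext i
    rw [← pn_val, h]; rfl
  · intro h
    ext i
    by_cases hi : i < k
    · have := pn_val g ⟨i, hi⟩
      rw [h] at this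
      exact this
    · exact pn_of_le g i (by omega)

/-- The sizes after the action of a braid. -/
def act {k : ℕ} (g : Braid k) (s : ℕ → ℕ) : ℕ → ℕ := s ∘ ⇑(pn k g)⁻¹

theorem act_one {k : ℕ} (s : ℕ → ℕ) : act (1 : Braid k) s = s := by simp [act]

theorem act_mul {k : ℕ} (g h : Braid k) (s : ℕ → ℕ) : act (g * h) s = act g (act h s) := by
  funext i; simp [act]

theorem act_of_mem {k : ℕ} {g : Braid k} (h : g ∈ PB k) (s : ℕ → ℕ) : act g s = s := by
  simp [act, (pn_eq_one_iff g).2 h]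

theorem act_pn {k : ℕ} (g : Braid k) (s : ℕ → ℕ) (i : ℕ) : act g s (pn k g i) = s i := by
  simp [act]

theorem act_σ (k i : ℕ) (hi : i + 1 < k) (s : ℕ → ℕ) :
    act (σ k i) s = s ∘ Equiv.swap i (i + 1) := by
  rw [act, pn_σ k i hi, Equiv.swap_inv]

theorem act_act_inv {k : ℕ} (g : Braid k) (s : ℕ → ℕ) : act g (act g⁻¹ s) = s := by
  rw [← act_mul, mul_inv_cancel, act_one]

theorem pos_swap (s : ℕ → ℕ) (i j : ℕ) : pos (s ∘ Equiv.swap i (i + 1)) j =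
    if j = i + 1 then pos s i + s (i + 1) else pos s j := by
  induction j with
  | zero => simp [pos_zero]
  | succ j ih =>
    rw [pos_succ, ih, Function.comp_apply, Equiv.swap_apply_def]
    have h1 := pos_succ s j
    have h2 := pos_succ s i
    rcases (show j = i ∨ j = i + 1 ∨ (j ≠ i ∧ j ≠ i + 1) by omega) with rfl | rfl | ⟨h, h'⟩
    · simp
    · simp only [if_true, if_neg (show i + 1 ≠ i by omega), if_neg (show i + 1 + 1 ≠ i + 1 by omega)]
      omega
    · simp only [if_neg h, if_neg h', if_neg (show j + 1 ≠ i + 1 by omega)]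
      omega

theorem pos_act {k : ℕ} (g : Braid k) (s : ℕ → ℕ) (j : ℕ) (hj : k ≤ j) :
    pos (act g s) j = pos s j := by
  induction g using braid_induction generalizing s with
  | one => rw [act_one]
  | mul g h hg hh => rw [act_mul, hg, hh]
  | inv g hg => conv_rhs => rw [← act_act_inv g s, hg]
  | gen i hi => rw [act_σ k i hi, pos_swap, if_neg (by omega)]

/-- The crossing of the blocks `i` and `i + 1`, for blocks with sizes `s` which start at `p`. -/
def blkGen (k N p : ℕ) (s : ℕ → ℕ) (i : ℕ) : Braid N :=
  -- The relations between block crossings need room for all strands. The default value makes the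
  -- braid relations for `mcPerm` hold for arbitrary sizes; the condition itself is not changed by
  -- swapping sizes with indices below `k`.
  if p + pos s k ≤ N then blk N (p + pos s i) (s i) (s (i + 1)) else 1

/-- The permutation `(s, b) ↦ (s ∘ (i i+1), c * b)`, where `c` is the crossing of the blocks `i` and
`i + 1`. -/
def mcPerm (k N p i : ℕ) : Equiv.Perm ((ℕ → ℕ) × Braid N) where
  toFun x := (x.1 ∘ Equiv.swap i (i + 1), blkGen k N p x.1 i * x.2)
  invFun x := (x.1 ∘ Equiv.swap i (i + 1), (blkGen k N p (x.1 ∘ Equiv.swap i (i + 1)) i)⁻¹ * x.2)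
  left_inv x := by
    have h : (x.1 ∘ Equiv.swap i (i + 1)) ∘ Equiv.swap i (i + 1) = x.1 := by funext; simp
    simp [h]
  right_inv x := by
    have h : (x.1 ∘ Equiv.swap i (i + 1)) ∘ Equiv.swap i (i + 1) = x.1 := by funext; simp
    simp [h]

theorem mcPerm_comm (k N p i j : ℕ) (hij : i + 2 ≤ j) (hj : j + 1 < k) :
    mcPerm k N p i * mcPerm k N p j = mcPerm k N p j * mcPerm k N p i := by
  ext ⟨s, b⟩ : 1
  refine Prod.ext ?_ ?_
  · change (s ∘ _) ∘ _ = (s ∘ _) ∘ _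
    funext l
    simp only [Function.comp_apply, Equiv.swap_apply_def]
    congr 1
    split_ifs <;> omega
  · change blkGen k N p (s ∘ _) i * (blkGen k N p s j * b) =
      blkGen k N p (s ∘ _) j * (blkGen k N p s i * b)
    unfold blkGen
    simp only [pos_swap, if_neg (show k ≠ j + 1 by omega), if_neg (show k ≠ i + 1 by omega),
      if_neg (show i ≠ j + 1 by omega), if_neg (show j ≠ i + 1 by omega)]
    split_ifs with h
    · simp only [Function.comp_apply, Equiv.swap_apply_of_ne_of_ne (show i ≠ j by omega)
        (show i ≠ j + 1 by omega), Equiv.swap_apply_of_ne_of_ne (show i + 1 ≠ j by omega)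
        (show i + 1 ≠ j + 1 by omega), Equiv.swap_apply_of_ne_of_ne (show j ≠ i by omega)
        (show j ≠ i + 1 by omega), Equiv.swap_apply_of_ne_of_ne (show j + 1 ≠ i by omega)
        (show j + 1 ≠ i + 1 by omega)]
      have h1 := pos_mono s hij
      rw [pos_succ, pos_succ] at h1
      rw [← mul_assoc, ← mul_assoc,
        (blk_comm_blk N (p + pos s i) (s i) (s (i + 1)) (p + pos s j) _ _ (by omega)).eq]
    · rfl

theorem mcPerm_braid (k N p i : ℕ) (hi : i + 2 < k) :
    mcPerm k N p i * mcPerm k N p (i + 1) * mcPerm k N p i =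
      mcPerm k N p (i + 1) * mcPerm k N p i * mcPerm k N p (i + 1) := by
  ext ⟨s, b⟩ : 1
  refine Prod.ext ?_ ?_
  · change ((s ∘ _) ∘ _) ∘ _ = ((s ∘ _) ∘ _) ∘ _
    funext l
    simp only [Function.comp_apply, Equiv.swap_apply_def]
    congr 1
    split_ifs <;> omega
  · change blkGen k N p ((s ∘ _) ∘ _) i * (blkGen k N p (s ∘ _) (i + 1) * (blkGen k N p s i * b)) =
      blkGen k N p ((s ∘ _) ∘ _) (i + 1) * (blkGen k N p (s ∘ _) i * (blkGen k N p s (i + 1) * b))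
    unfold blkGen
    have e1 : Equiv.swap i (i + 1) (i + 1 + 1) = i + 1 + 1 :=
      Equiv.swap_apply_of_ne_of_ne (by omega) (by omega)
    have e2 : Equiv.swap (i + 1) (i + 1 + 1) i = i :=
      Equiv.swap_apply_of_ne_of_ne (by omega) (by omega)
    simp only [pos_swap, if_neg (show k ≠ i + 1 + 1 by omega), if_neg (show k ≠ i + 1 by omega),
      if_neg (show i ≠ i + 1 by omega), if_neg (show i ≠ i + 1 + 1 by omega),
      if_neg (show i + 1 ≠ i + 1 + 1 by omega), if_true,
      Function.comp_apply, Equiv.swap_apply_left, Equiv.swap_apply_right, e1, e2]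
    split_ifs with h
    · have h1 := pos_mono s (show i + 3 ≤ k by omega)
      rw [pos_succ, pos_succ, pos_succ] at h1
      have := blk_yang_baxter N (p + pos s i) (s i) (s (i + 1)) (s (i + 1 + 1))
        (by simp only [show i + 1 + 1 = i + 2 by omega]; omega)
      rw [pos_succ]
      simp only [← mul_assoc, ← add_assoc]
      rw [this]
    · rfl

/-- The homomorphism which sends a braid `g` to the permutation
`(s, b) ↦ (g s, (g with its strands replaced by cables of sizes s) * b)`. -/
def mcHom (k N p : ℕ) : Braid k →* Equiv.Perm ((ℕ → ℕ) × Braid N) :=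
  braidLift k (mcPerm k N p) (fun i j h h' => mcPerm_comm k N p i j h h')
    (fun i h => mcPerm_braid k N p i h)

/-- The braid obtained from `g` by replacing the strand that starts at the position `i` by `s i`
parallel strands, for all `i`, and by adding vertical strands: `p` strands on the left, and on the
right as many as needed to obtain `N` strands. (By convention it is `1` if there is no room.) -/
def mc {k : ℕ} (N p : ℕ) (s : ℕ → ℕ) (g : Braid k) : Braid N := (mcHom k N p g (s, 1)).2

/-- Each generator acts on the second component by a left translation that depends only on the
sizes, hence so does every braid. This makes `mc` a cocycle over the action on sizes, which is the
content of `mc_mul`. -/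
theorem mcHom_apply {k N p : ℕ} (g : Braid k) (s : ℕ → ℕ) (b : Braid N) :
    mcHom k N p g (s, b) = (act g s, mc N p s g * b) := by
  have key : ∀ (s : ℕ → ℕ) (b : Braid N),
      mcHom k N p g (s, b) = (act g s, (mcHom k N p g (s, 1)).2 * b) := by
    induction g using braid_induction with
    | one => intro s b; simp [act_one]
    | mul g h hg hh =>
      intro s b
      rw [map_mul, Equiv.Perm.mul_apply, Equiv.Perm.mul_apply, hh s b, hh s 1, hg, hg _ (_ * 1),
        act_mul]
      simp [mul_assoc]
    | inv g hg =>
      intro s b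
      have h1 : ∀ c, (mcHom k N p g)⁻¹ (s, c) = (act g⁻¹ s,
          ((mcHom k N p g (act g⁻¹ s, 1)).2)⁻¹ * c) := by
        intro c
        rw [Equiv.Perm.inv_eq_iff_eq, hg, act_act_inv]
        simp
      rw [map_inv, h1, h1]
      simp
    | gen i hi =>
      intro s b
      have : mcHom k N p (σ k i) = mcPerm k N p i := braidLift_σ _ _ _ _ _ hi
      rw [this, act_σ k i hi]
      simp [mcPerm]
  exact key s b

theorem mc_one {k N p : ℕ} (s : ℕ → ℕ) : mc N p s (1 : Braid k) = 1 := by simp [mc]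

theorem mc_mul {k N p : ℕ} (s : ℕ → ℕ) (g h : Braid k) :
    mc N p s (g * h) = mc N p (act h s) g * mc N p s h := by
  conv_lhs => rw [mc, map_mul, Equiv.Perm.mul_apply, mcHom_apply, mcHom_apply]
  simp

theorem mc_inv {k N p : ℕ} (s : ℕ → ℕ) (g : Braid k) :
    mc N p s g⁻¹ = (mc N p (act g⁻¹ s) g)⁻¹ := by
  have := mc_mul (N := N) (p := p) s g g⁻¹
  rw [mul_inv_cancel, mc_one] at this
  exact (inv_eq_of_mul_eq_one_right this.symm).symm

theorem mc_σ {k N p : ℕ} (s : ℕ → ℕ) (i : ℕ) (hi : i + 1 < k) (hN : p + pos s k ≤ N) :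
    mc N p s (σ k i) = blk N (p + pos s i) (s i) (s (i + 1)) := by
  have : mcHom k N p (σ k i) = mcPerm k N p i := braidLift_σ _ _ _ _ _ hi
  rw [mc, this]
  simp [mcPerm, blkGen, if_pos hN]

theorem act_congr {k : ℕ} (g : Braid k) {s t : ℕ → ℕ} (h : ∀ i < k, s i = t i) (i : ℕ)
    (hi : i < k) : act g s i = act g t i := by
  apply h
  rw [← map_inv]
  exact pn_lt _ _ hi

theorem mc_congr {k N p : ℕ} (g : Braid k) {s t : ℕ → ℕ} (h : ∀ i < k, s i = t i) :
    mc N p s g = mc N p t g := by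
  induction g using braid_induction generalizing s t with
  | one => rw [mc_one, mc_one]
  | mul g g' hg hg' => rw [mc_mul, mc_mul, hg (act_congr g' h), hg' h]
  | inv g hg => rw [mc_inv, mc_inv, hg (act_congr g⁻¹ h)]
  | gen i hi =>
    have : mcHom k N p (σ k i) = mcPerm k N p i := braidLift_σ _ _ _ _ _ hi
    simp only [mc, this, mcPerm, blkGen, Equiv.coe_fn_mk]
    rw [pos_congr h, pos_congr (fun j hj => h j (by omega : j < k)), h i (by omega), h (i + 1) hi]

/-- The sum of the `b` sizes with indices `a, …, a + b - 1`. -/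
def seg (s : ℕ → ℕ) (a b : ℕ) : ℕ := ∑ j ∈ Finset.range b, s (a + j)

theorem seg_zero (s : ℕ → ℕ) (a : ℕ) : seg s a 0 = 0 := rfl

theorem seg_succ (s : ℕ → ℕ) (a b : ℕ) : seg s a (b + 1) = seg s a b + s (a + b) :=
  Finset.sum_range_succ _ _

theorem seg_one (s : ℕ → ℕ) (a : ℕ) : seg s a 1 = s a := by simp [seg]

theorem pos_add (s : ℕ → ℕ) (a b : ℕ) : pos s (a + b) = pos s a + seg s a b :=
  Finset.sum_range_add _ _ _

theorem seg_congr {s t : ℕ → ℕ} {a a' b : ℕ} (h : ∀ j < b, s (a + j) = t (a' + j)) :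
    seg s a b = seg t a' b :=
  Finset.sum_congr rfl fun j hj => h j (Finset.mem_range.1 hj)

theorem pn_cableUp (N q a x : ℕ) (hN : q + a < N) : pn N (cableUp N q a) x =
    if x < q then x else if x < q + a then x + 1 else if x = q + a then q else x := by
  induction a generalizing x with
  | zero => simp only [cableUp, map_one, Equiv.Perm.one_apply]; split_ifs <;> omega
  | succ a ih =>
    rw [cableUp, map_mul, Equiv.Perm.mul_apply, pn_σ _ _ (by omega), ih _ (by omega),
      Equiv.swap_apply_def]
    split_ifs <;> omega

theorem pn_blk (N q a b x : ℕ) (hN : q + a + b ≤ N) : pn N (blk N q a b) x =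
    if x < q then x else if x < q + a then x + b else if x < q + a + b then x - a else x := by
  induction b generalizing x with
  | zero => simp only [blk, map_one, Equiv.Perm.one_apply]; split_ifs <;> omega
  | succ b ih =>
    rw [blk, map_mul, Equiv.Perm.mul_apply, ih _ (by omega), pn_cableUp _ _ _ _ (by omega)]
    split_ifs <;> omega

/-- A cabled braid moves each cable rigidly, in parallel. This is what makes the sizes of blocks of
blocks transform correctly in `agg_act`. -/
theorem pn_mc {k N p : ℕ} (g : Braid k) (s : ℕ → ℕ) (hN : p + pos s k ≤ N) :
    (∀ i < k, ∀ j < s i, pn N (mc N p s g) (p + pos s i + j) =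
      p + pos (act g s) (pn k g i) + j) ∧
    ∀ x, (x < p ∨ p + pos s k ≤ x) → pn N (mc N p s g) x = x := by
  induction g using braid_induction generalizing s with
  | one => simp [mc_one, act_one]
  | mul g h hg hh =>
    have hN' : p + pos (act h s) k ≤ N := by rwa [pos_act _ _ _ le_rfl]
    constructor
    · intro i hi j hj
      rw [mc_mul, map_mul, Equiv.Perm.mul_apply, (hh s hN).1 i hi j hj,
        (hg _ hN').1 _ (pn_lt h i hi) j (by rwa [act_pn]), act_mul, map_mul, Equiv.Perm.mul_apply]
    · intro x hx
      rw [mc_mul, map_mul, Equiv.Perm.mul_apply, (hh s hN).2 x hx,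
        (hg _ hN').2 x (by rwa [pos_act _ _ _ le_rfl])]
  | inv g hg =>
    have hN' : p + pos (act g⁻¹ s) k ≤ N := by rwa [pos_act _ _ _ le_rfl]
    constructor
    · intro i hi j hj
      rw [mc_inv, map_inv, Equiv.Perm.inv_eq_iff_eq,
        (hg _ hN').1 _ (pn_lt g⁻¹ i hi) j (by rwa [act_pn]), act_act_inv, map_inv, perm_apply_inv]
    · intro x hx
      rw [mc_inv, map_inv, Equiv.Perm.inv_eq_iff_eq, (hg _ hN').2 x (by rwa [pos_act _ _ _ le_rfl])]
  | gen l hl =>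
    have h3 := pos_mono s (show l + 2 ≤ k by omega)
    rw [pos_succ, pos_succ] at h3
    constructor
    · intro i hi j hj
      rw [mc_σ s l hl hN, pn_blk _ _ _ _ _ (by omega), pn_σ k l hl, act_σ k l hl, pos_swap,
        Equiv.swap_apply_def]
      rcases (show i < l ∨ i = l ∨ i = l + 1 ∨ l + 1 < i by omega) with h | rfl | rfl | h
      · have := pos_mono s (show i + 1 ≤ l by omega)
        rw [pos_succ] at this
        simp only [if_neg (show i ≠ l by omega), if_neg (show i ≠ l + 1 by omega)]
        split_ifs <;> omega
      · simp only [if_true]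
        split_ifs <;> omega
      · have := pos_succ s l
        simp only [if_true, if_neg (show l + 1 ≠ l by omega), if_neg (show l ≠ l + 1 by omega)]
        split_ifs <;> omega
      · have := pos_mono s (show l + 2 ≤ i by omega)
        rw [pos_succ, pos_succ] at this
        simp only [if_neg (show i ≠ l by omega), if_neg (show i ≠ l + 1 by omega)]
        split_ifs <;> omega
    · intro x hx
      rw [mc_σ s l hl hN, pn_blk _ _ _ _ _ (by omega)]
      split_ifs <;> omega

theorem exists_block {k : ℕ} (s : ℕ → ℕ) (x : ℕ) (h : x < pos s k) :
    ∃ i < k, ∃ j < s i, x = pos s i + j := by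
  induction k with
  | zero => simp [pos_zero] at h
  | succ k ih =>
    by_cases hx : x < pos s k
    · obtain ⟨i, hi, j, hj, e⟩ := ih hx
      exact ⟨i, by omega, j, hj, e⟩
    · rw [pos_succ] at h
      exact ⟨k, by omega, x - pos s k, by omega, by omega⟩

theorem mc_mem_PB {k N p : ℕ} {g : Braid k} (hg : g ∈ PB k) (s : ℕ → ℕ) (hN : p + pos s k ≤ N) :
    mc N p s g ∈ PB N := by
  rw [← pn_eq_one_iff]
  ext x
  by_cases hx : x < p ∨ p + pos s k ≤ x
  · exact (pn_mc g s hN).2 x hx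
  · obtain ⟨i, hi, j, hj, e⟩ := exists_block (k := k) s (x - p) (by omega)
    have := (pn_mc g s hN).1 i hi j hj
    rw [act_of_mem hg, (pn_eq_one_iff g).2 hg, Equiv.Perm.one_apply] at this
    obtain rfl : x = p + pos s i + j := by omega
    exact this

theorem mc_cableUp {N R p : ℕ} (s : ℕ → ℕ) (q a : ℕ) (h : q + a < N) (hR : p + pos s N ≤ R) :
    mc R p s (cableUp N q a) = blk R (p + pos s q) (seg s q a) (s (q + a)) := by
  induction a generalizing s with
  | zero => rw [cableUp, mc_one, seg_zero, blk_zero_left]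
  | succ a ih =>
    have hR' : p + pos (act (σ N (q + a)) s) N ≤ R := by rwa [pos_act _ _ _ le_rfl]
    rw [cableUp, mc_mul, ih _ (by omega) hR', mc_σ s _ (by omega) hR, act_σ _ _ (by omega), pos_swap,
      if_neg (by omega), seg_succ, blk_add_left, pos_add, ← add_assoc]
    have h1 : seg (s ∘ Equiv.swap (q + a) (q + a + 1)) q a = seg s q a := by
      apply seg_congr
      intro j hj
      rw [Function.comp_apply, Equiv.swap_apply_of_ne_of_ne (by omega) (by omega)]
    rw [h1, Function.comp_apply, Equiv.swap_apply_left]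
    simp only [← add_assoc]

theorem act_blk {N : ℕ} (s : ℕ → ℕ) (q a b x : ℕ) (hN : q + a + b ≤ N) :
    act (blk N q a b) s x = if x < q then s x else if x < q + b then s (x + a)
      else if x < q + a + b then s (x - b) else s x := by
  have h := fun y => act_pn (blk N q a b) s y
  simp only [pn_blk _ _ _ _ _ hN] at h
  split_ifs with h1 h2 h3
  · have := h x
    rwa [if_pos h1] at this
  · have := h (x + a)
    rwa [if_neg (by omega), if_neg (by omega), if_pos (by omega), Nat.add_sub_cancel] at this
  · have := h (x - b)
    rwa [if_neg (by omega), if_pos (by omega), Nat.sub_add_cancel (by omega)] at this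
  · have := h x
    rwa [if_neg (by omega), if_neg (by omega), if_neg (by omega)] at this

theorem mc_blk {N R p : ℕ} (s : ℕ → ℕ) (q a b : ℕ) (h : q + a + b ≤ N) (hR : p + pos s N ≤ R) :
    mc R p s (blk N q a b) = blk R (p + pos s q) (seg s q a) (seg s (q + a) b) := by
  induction b with
  | zero => rw [blk, mc_one, seg_zero]; rfl
  | succ b ih =>
    have hR' : p + pos (act (blk N q a b) s) N ≤ R := by rwa [pos_act _ _ _ le_rfl]
    have e := fun x => act_blk s q a b x (show q + a + b ≤ N by omega)
    rw [blk, mc_mul, ih (by omega), mc_cableUp _ _ _ (by omega) hR', seg_succ, blk_add_right, pos_add]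
    have h1 : pos (act (blk N q a b) s) q = pos s q :=
      pos_congr fun j hj => by rw [e, if_pos hj]
    have h2 : seg (act (blk N q a b) s) q b = seg s (q + a) b := by
      apply seg_congr
      intro j hj
      rw [e, if_neg (by omega), if_pos (by omega)]
      congr 1; omega
    have h3 : seg (act (blk N q a b) s) (q + b) a = seg s q a := by
      apply seg_congr
      intro j hj
      rw [e, if_neg (by omega), if_neg (by omega), if_pos (by omega)]
      congr 1; omega
    rw [h1, h2, h3, e, if_neg (by omega), if_neg (by omega), if_neg (by omega), ← add_assoc,
      show q + b + a = q + a + b by omega]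

/-- The sizes of the blocks of blocks: the blocks with sizes `t` start at `q`, and the strand `j` is
replaced by `s j` strands. -/
def agg (q : ℕ) (t s : ℕ → ℕ) (i : ℕ) : ℕ := seg s (q + pos t i) (t i)

theorem pos_agg (q : ℕ) (t s : ℕ → ℕ) (i : ℕ) : pos s q + pos (agg q t s) i = pos s (q + pos t i) := by
  induction i with
  | zero => simp [pos_zero]
  | succ i ih => rw [pos_succ, ← add_assoc, ih, agg, ← pos_add, pos_succ, ← add_assoc]

theorem agg_act {k N q : ℕ} (g : Braid k) (t s : ℕ → ℕ) (hN : q + pos t k ≤ N) (i : ℕ) (hi : i < k) :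
    agg q (act g t) (act (mc N q t g) s) i = act g (agg q t s) i := by
  obtain ⟨i', hi', rfl⟩ : ∃ i' < k, i = pn k g i' :=
    ⟨pn k g⁻¹ i, pn_lt _ _ hi, by rw [map_inv, perm_apply_inv]⟩
  rw [act_pn, agg, agg, act_pn]
  apply seg_congr
  intro j hj
  rw [← (pn_mc g t hN).1 i' hi' j hj, act_pn]

theorem pos_act_mc {k N q : ℕ} (g : Braid k) (t s : ℕ → ℕ) (hN : q + pos t k ≤ N) :
    pos (act (mc N q t g) s) q = pos s q :=
  pos_congr fun j hj => by
    conv_lhs => rw [← (pn_mc g t hN).2 j (Or.inl hj), act_pn]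

/-- Cabling a cabled braid. -/
theorem mc_mc {k N R p q : ℕ} (g : Braid k) (t s : ℕ → ℕ) (hN : q + pos t k ≤ N)
    (hR : p + pos s N ≤ R) :
    mc R p s (mc N q t g) = mc R (p + pos s q) (agg q t s) g := by
  induction g using braid_induction generalizing s t with
  | one => rw [mc_one, mc_one, mc_one]
  | mul g h hg hh =>
    rw [mc_mul, mc_mul, hh t s hN hR, hg _ _ (by rwa [pos_act _ _ _ le_rfl])
      (by rwa [pos_act _ _ _ le_rfl]), pos_act_mc h t s hN, mc_mul, mc_congr g (agg_act h t s hN)]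
  | inv g hg =>
    have hN' : q + pos (act g⁻¹ t) k ≤ N := by rwa [pos_act _ _ _ le_rfl]
    have e : mc N q t g⁻¹ = (mc N q (act g⁻¹ t) g)⁻¹ := mc_inv t g
    rw [e, mc_inv, ← e, hg _ _ hN' (by rwa [pos_act _ _ _ le_rfl]), pos_act_mc g⁻¹ t s hN,
      mc_congr g (agg_act g⁻¹ t s hN), mc_inv (agg q t s)]
  | gen i hi =>
    have h3 := pos_mono t (show i + 2 ≤ k by omega)
    rw [pos_succ, pos_succ] at h3
    have hR' : p + pos s q + pos (agg q t s) k ≤ R := by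
      rw [add_assoc, pos_agg]
      have := pos_mono s hN
      omega
    rw [mc_σ t i hi hN, mc_blk s _ _ _ (by omega) hR, mc_σ _ _ hi hR', add_assoc p, pos_agg, agg, agg,
      pos_succ, add_assoc q]

/-- Together with `cable_eq_mc` this writes both ingredients of an operadic insertion as instances
of `mc`, so that `mc_mc` computes all their iterates. -/
theorem shift_eq_mc {m N p : ℕ} (h : p + m ≤ N) (g : Braid m) :
    shift m N p h g = mc N p (fun _ => 1) g := by
  have ha : ∀ g : Braid m, act g (fun _ => 1) = fun _ => 1 := fun g => rfl
  induction g using braid_induction with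
  | one => rw [map_one, mc_one]
  | mul g g' hg hg' => rw [map_mul, mc_mul, hg, hg', ha]
  | inv g hg => rw [map_inv, mc_inv, hg, ha]
  | gen i hi =>
    rw [shift_σ _ _ _ _ _ hi, mc_σ _ _ hi (by rwa [pos_one]), blk_one_one, pos_one, add_comm]

theorem mc_ones_self {n : ℕ} (g : Braid n) : mc n 0 (fun _ => 1) g = g := by
  rw [← shift_eq_mc (by omega)]
  induction g using braid_induction with
  | one => rw [map_one]
  | mul g g' hg hg' => rw [map_mul, hg, hg']
  | inv g hg => rw [map_inv, hg]
  | gen i hi => rw [shift_σ _ _ _ _ _ hi, add_zero]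

/-- The sizes for the cabling of the single strand `p`. -/
def single (m p : ℕ) (j : ℕ) : ℕ := if j = p then m else 1

theorem pos_single (m p i : ℕ) : pos (single m p) i = if i ≤ p then i else i + m - 1 := by
  induction i with
  | zero => simp [pos_zero]
  | succ i ih => rw [pos_succ, ih, single]; split_ifs <;> omega

theorem act_single {k : ℕ} (g : Braid k) (m p : ℕ) : act g (single m p) = single m (pn k g p) := by
  funext i
  simp only [act, Function.comp_apply, single, Equiv.Perm.inv_eq_iff_eq]

theorem cable_eq_mc {n m : ℕ} (p : Fin n) (g : Braid n) :
    cable m p g = mc (n + m - 1) 0 (single m p) g := by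
  induction g using braid_induction generalizing p with
  | one => rw [cable_one, mc_one]
  | mul g h hg hh => rw [cable_mul, mc_mul, hg, hh, act_single, pn_val]
  | inv g hg => rw [cable_inv, mc_inv, hg, act_single, pn_val, map_inv]
  | gen k hk =>
    have hp := p.2
    rw [cable_σ p k hk, mc_σ _ _ hk (by rw [pos_single]; split_ifs <;> omega), pos_single, single,
      single]
    rcases (show (p : ℕ) < k ∨ (p : ℕ) = k ∨ (p : ℕ) = k + 1 ∨ k + 1 < (p : ℕ) by omega)
        with h | h | h | h
    · rw [cableGen_lt h, if_neg (by omega), if_neg (by omega), if_neg (by omega), blk_one_one, zero_add]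
    · rw [h, cableGen_self, if_pos le_rfl, if_pos rfl, if_neg (by omega), blk_one_right, zero_add]
    · rw [h, cableGen_succ, if_pos (by omega), if_neg (by omega), if_pos rfl, blk_one_left, zero_add]
    · rw [cableGen_gt h, if_pos (by omega), if_neg (by omega), if_neg (by omega), blk_one_one, zero_add]

/-! ### Braids on consecutive strands -/

/-- The subgroup of the braids on the strands `p, …, p + a - 1`. -/
def loc (N p a : ℕ) : Subgroup (Braid N) := Subgroup.closure {g | ∃ x, p ≤ x ∧ x + 1 < p + a ∧ g = σ N x}

theorem σ_mem_loc {N p a x : ℕ} (h₁ : p ≤ x) (h₂ : x + 1 < p + a) : σ N x ∈ loc N p a :=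
  Subgroup.subset_closure ⟨x, h₁, h₂, rfl⟩

theorem loc_mono {N p a p' a' : ℕ} (h₁ : p' ≤ p) (h₂ : p + a ≤ p' + a') : loc N p a ≤ loc N p' a' := by
  apply Subgroup.closure_mono
  rintro g ⟨x, hx, hx', rfl⟩
  exact ⟨x, by omega, by omega, rfl⟩

theorem commute_of_mem_loc {N p a : ℕ} {g : Braid N}
    (h : ∀ x, p ≤ x → x + 1 < p + a → Commute (σ N x) g) {l : Braid N} (hl : l ∈ loc N p a) :
    Commute l g := by
  have : loc N p a ≤ Subgroup.centralizer {g} := by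
    rw [loc, Subgroup.closure_le]
    rintro _ ⟨x, hx, hx', rfl⟩
    rw [SetLike.mem_coe, Subgroup.mem_centralizer_singleton_iff]
    exact h x hx hx'
  exact Subgroup.mem_centralizer_singleton_iff.1 (this hl)

theorem loc_commute {N p a q b : ℕ} (h : p + a ≤ q) {l l' : Braid N} (hl : l ∈ loc N p a)
    (hl' : l' ∈ loc N q b) : Commute l l' :=
  commute_of_mem_loc (fun x _ hx' => (commute_of_mem_loc (fun y hy _ =>
    σ_comm N y x (by omega)) hl').symm) hl

theorem cableUp_mem_loc {N p a : ℕ} : cableUp N p a ∈ loc N p (a + 1) := by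
  induction a with
  | zero => exact one_mem _
  | succ a ih =>
    exact mul_mem (loc_mono le_rfl (by omega) ih) (σ_mem_loc (by omega) (by omega))

theorem blk_mem_loc {N p a b : ℕ} : blk N p a b ∈ loc N p (a + b) := by
  induction b with
  | zero => exact one_mem _
  | succ b ih =>
    exact mul_mem (loc_mono (by omega) (by omega) cableUp_mem_loc) (loc_mono le_rfl (by omega) ih)

theorem mc_mem_loc {k N p : ℕ} (s : ℕ → ℕ) (g : Braid k) (hN : p + pos s k ≤ N) :
    mc N p s g ∈ loc N p (pos s k) := by
  induction g using braid_induction generalizing s with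
  | one => rw [mc_one]; exact one_mem _
  | mul g h hg hh =>
    have h1 := hg (act h s) (by rwa [pos_act _ _ _ le_rfl])
    rw [pos_act _ _ _ le_rfl] at h1
    rw [mc_mul]
    exact mul_mem h1 (hh s hN)
  | inv g hg =>
    have h1 := hg (act g⁻¹ s) (by rwa [pos_act _ _ _ le_rfl])
    rw [pos_act _ _ _ le_rfl] at h1
    rw [mc_inv]
    exact inv_mem h1
  | gen i hi =>
    have h3 := pos_mono s (show i + 2 ≤ k by omega)
    rw [pos_succ, pos_succ] at h3
    rw [mc_σ s i hi hN]
    exact loc_mono (by omega) (by omega) blk_mem_loc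

theorem σ_mul_mc {k N p : ℕ} (s : ℕ → ℕ) (g : Braid k) (hN : p + pos s k ≤ N) (i j : ℕ) (hi : i < k)
    (hj : j + 1 < s i) : σ N (p + pos (act g s) (pn k g i) + j) * mc N p s g =
      mc N p s g * σ N (p + pos s i + j) := by
  induction g using braid_induction generalizing s i with
  | one => simp [act_one, mc_one]
  | mul g h hg hh =>
    rw [mc_mul, act_mul, map_mul, Equiv.Perm.mul_apply, ← mul_assoc,
      hg (act h s) (by rwa [pos_act _ _ _ le_rfl]) _ (pn_lt h i hi) (by rwa [act_pn]), mul_assoc,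
      hh s hN i hi hj, mul_assoc]
  | inv g hg =>
    have := hg (act g⁻¹ s) (by rwa [pos_act _ _ _ le_rfl]) (pn k g⁻¹ i) (pn_lt _ i hi)
      (by rwa [act_pn])
    rw [act_act_inv, map_inv, perm_apply_inv] at this
    rw [mc_inv, eq_inv_mul_iff_mul_eq, ← mul_assoc, map_inv, ← this, mul_inv_cancel_right]
  | gen l hl =>
    have h3 := pos_mono s (show l + 2 ≤ k by omega)
    rw [pos_succ, pos_succ] at h3
    rw [mc_σ s l hl hN, act_σ k l hl, pn_σ k l hl, pos_swap, Equiv.swap_apply_def]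
    rcases (show i < l ∨ i = l ∨ i = l + 1 ∨ l + 1 < i by omega) with h | rfl | rfl | h
    · have := pos_mono s (show i + 1 ≤ l by omega)
      rw [pos_succ] at this
      rw [if_neg (show i ≠ l by omega), if_neg (show i ≠ l + 1 by omega),
        if_neg (show i ≠ l + 1 by omega)]
      exact σ_comm_blk _ _ _ _ _ (by omega)
    · rw [if_pos rfl, if_pos rfl, ← σ_mul_blk_left _ _ _ _ _ (by omega) (by omega) (by omega)]
      congr 2; omega
    · rw [if_neg (show l + 1 ≠ l by omega), if_pos rfl, if_neg (show l ≠ l + 1 by omega),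
        σ_mul_blk_right _ _ _ _ _ (by omega) (by omega) (by omega), pos_succ]
      congr 2; omega
    · have := pos_mono s (show l + 2 ≤ i by omega)
      rw [pos_succ, pos_succ] at this
      rw [if_neg (show i ≠ l by omega), if_neg (show i ≠ l + 1 by omega),
        if_neg (show i ≠ l + 1 by omega)]
      exact σ_comm_blk _ _ _ _ _ (by omega)

/-- A pure braid with cabled strands commutes with the braids on the strands of a cable. -/
theorem mc_commute_loc {k N p : ℕ} {g : Braid k} (hg : g ∈ PB k) (s : ℕ → ℕ) (hN : p + pos s k ≤ N)
    {i : ℕ} (hi : i < k) {l : Braid N} (hl : l ∈ loc N (p + pos s i) (s i)) :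
    Commute l (mc N p s g) := by
  refine commute_of_mem_loc (fun x hx hx' => ?_) hl
  obtain ⟨j, rfl⟩ : ∃ j, x = p + pos s i + j := ⟨x - (p + pos s i), by omega⟩
  have := σ_mul_mc s g hN i j hi (by omega)
  rwa [act_of_mem hg, (pn_eq_one_iff g).2 hg] at this

/-! ### Operadic congruences -/

/-- A family of finite index normal subgroups of the braid groups, contained in the pure braid
groups, which is stable under cabling and the addition of vertical strands. -/
structure OpCongr where
  N : ∀ n, Subgroup (Braid n)
  normal : ∀ n, (N n).Normal
  finiteIndex : ∀ n, (N n).FiniteIndex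
  le_PB : ∀ n, N n ≤ PB n
  -- Empty cables are excluded: `PaB(0)` is empty, and `pull` asks for no condition about deleted
  -- strands.
  mc_mem : ∀ {k n p : ℕ} {s : ℕ → ℕ} {g : Braid k}, g ∈ N k → (∀ i < k, 1 ≤ s i) →
    p + pos s k ≤ n → mc n p s g ∈ N n

namespace OpCongr

instance (𝒩 : OpCongr) (n : ℕ) : (𝒩.N n).Normal := 𝒩.normal n

instance (𝒩 : OpCongr) (n : ℕ) : (𝒩.N n).FiniteIndex := 𝒩.finiteIndex n

variable (𝒩 : OpCongr)

/-- The projection `B_n → B_n/N_n`. -/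
def q (n : ℕ) : Braid n →* Braid n ⧸ 𝒩.N n := QuotientGroup.mk' (𝒩.N n)

theorem q_eq_iff {n : ℕ} {x y : Braid n} : 𝒩.q n x = 𝒩.q n y ↔ x⁻¹ * y ∈ 𝒩.N n := QuotientGroup.eq

theorem q_eq_one_iff {n : ℕ} {x : Braid n} : 𝒩.q n x = 1 ↔ x ∈ 𝒩.N n :=
  QuotientGroup.eq_one_iff x

theorem q_surjective (n : ℕ) : Function.Surjective (𝒩.q n) := QuotientGroup.mk'_surjective _

theorem q_mc {k n p : ℕ} {s : ℕ → ℕ} {x y : Braid k} (h : 𝒩.q k x = 𝒩.q k y)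
    (hs : ∀ i < k, 1 ≤ s i) (hn : p + pos s k ≤ n) : 𝒩.q n (mc n p s x) = 𝒩.q n (mc n p s y) := by
  have h1 := 𝒩.q_eq_iff.1 h
  have e : y = x * (x⁻¹ * y) := by group
  rw [e, mc_mul, act_of_mem (𝒩.le_PB k h1), map_mul,
    𝒩.q_eq_one_iff.2 (𝒩.mc_mem h1 hs hn), mul_one]

theorem q_cable {n m : ℕ} (hm : 1 ≤ m) (p : Fin n) {x y : Braid n} (h : 𝒩.q n x = 𝒩.q n y) :
    𝒩.q _ (cable m p x) = 𝒩.q _ (cable m p y) := by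
  have hp := p.2
  rw [cable_eq_mc, cable_eq_mc]
  exact 𝒩.q_mc h (fun i _ => by unfold single; split_ifs <;> omega)
    (by rw [pos_single]; split_ifs <;> omega)

theorem q_shift {m n p : ℕ} (hp : p + m ≤ n) {x y : Braid m} (h : 𝒩.q m x = 𝒩.q m y) :
    𝒩.q n (shift m n p hp x) = 𝒩.q n (shift m n p hp y) := by
  rw [shift_eq_mc, shift_eq_mc]
  exact 𝒩.q_mc h (fun _ _ => le_rfl) (by rwa [pos_one])

end OpCongr

/-! ### Pairs modulo an operadic congruence and their cabled relations -/

/-- The element `x^{2m+1}`. -/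
def lam {G : Type*} [Group G] (m : ℤ) (x : G) : G := x * (x ^ 2) ^ m

theorem map_lam {G H : Type*} [Group G] [Group H] (φ : G →* H) (m : ℤ) (x : G) :
    φ (lam m x) = lam m (φ x) := by simp [lam]

theorem lam_mem {G : Type*} [Group G] {H : Subgroup G} {m : ℤ} {x : G} (h : x ∈ H) : lam m x ∈ H :=
  mul_mem h (zpow_mem (pow_mem h 2) m)

/-- The tuple `(m, f)` satisfies the hexagon and pentagon relations modulo an operadic congruence. -/
structure IsPair (𝒩 : OpCongr) (m : ℤ) (f : PB 3) : Prop where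
  hexagon₁ : 𝒩.q 3 (lam m (σ 3 0) * (f : Braid 3)⁻¹ * lam m (σ 3 1) * f) =
    𝒩.q 3 ((f : Braid 3)⁻¹ * cable (n := 2) 2 0 (lam m (σ 2 0)))
  hexagon₂ : 𝒩.q 3 ((f : Braid 3)⁻¹ * lam m (σ 3 1) * f * lam m (σ 3 0)) =
    𝒩.q 3 (cable (n := 2) 2 1 (lam m (σ 2 0)) * f)
  pentagon : 𝒩.q 4 (addLeft (f : Braid 3) * double 1 (f : Braid 3) * addRight (f : Braid 3)) =
    𝒩.q 4 (double 2 (f : Braid 3) * double 0 (f : Braid 3))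

/-- Two sizes. -/
def sz2 (a b : ℕ) : ℕ → ℕ
  | 0 => a
  | 1 => b
  | _ => 0

/-- Three sizes. -/
def sz3 (a b c : ℕ) : ℕ → ℕ
  | 0 => a
  | 1 => b
  | 2 => c
  | _ => 0

/-- Four sizes. -/
def sz4 (a b c d : ℕ) : ℕ → ℕ
  | 0 => a
  | 1 => b
  | 2 => c
  | 3 => d
  | _ => 0

theorem pos_sz2 (a b : ℕ) : pos (sz2 a b) 2 = a + b := by simp [pos, Finset.sum_range_succ, sz2]

theorem pos_sz3 (a b c : ℕ) : pos (sz3 a b c) 3 = a + b + c := by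
  simp [pos, Finset.sum_range_succ, sz3]

theorem pos_sz4 (a b c d : ℕ) : pos (sz4 a b c d) 4 = a + b + c + d := by
  simp [pos, Finset.sum_range_succ, sz4]

theorem seg_single (m x u v : ℕ) :
    seg (single m x) u v = if u ≤ x ∧ x < u + v then v + m - 1 else v := by
  induction v with
  | zero => rw [seg_zero]; split_ifs <;> omega
  | succ v ih => rw [seg_succ, ih, single]; split_ifs <;> omega

theorem seg_ones (u v : ℕ) : seg (fun _ => 1) u v = v := by simp [seg]

theorem agg_ones (q : ℕ) (t : ℕ → ℕ) : agg q t (fun _ => 1) = t := by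
  funext i; rw [agg, seg_ones]

theorem cable_mc {k N m p : ℕ} {s : ℕ → ℕ} (g : Braid k) (hN : p + pos s k ≤ N) (x : Fin N) :
    cable m x (mc N p s g) =
      mc (N + m - 1) (if p ≤ x then p else p + m - 1) (agg p s (single m x)) g := by
  have := x.2
  rw [cable_eq_mc, mc_mc g s _ hN (by rw [pos_single]; split_ifs <;> omega), pos_single, zero_add]

theorem shift_mc {k n N p r : ℕ} {s : ℕ → ℕ} (g : Braid k) (hn : p + pos s k ≤ n) (h : r + n ≤ N) :
    shift n N r h (mc n p s g) = mc N (r + p) s g := by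
  rw [shift_eq_mc, mc_mc g s _ hn (by rwa [pos_one]), agg_ones, pos_one]

theorem mc_of_mem_mul {k N p : ℕ} {s : ℕ → ℕ} {h : Braid k} (hh : h ∈ PB k) (g : Braid k) :
    mc N p s (g * h) = mc N p s g * mc N p s h := by rw [mc_mul, act_of_mem hh]

theorem mc_of_mem_inv {k N p : ℕ} {s : ℕ → ℕ} {h : Braid k} (hh : h ∈ PB k) :
    mc N p s h⁻¹ = (mc N p s h)⁻¹ := by rw [mc_inv, act_of_mem (inv_mem hh)]

theorem cable_of_mem_mul {n m : ℕ} {h : Braid n} (hh : h ∈ PB n) (p : Fin n) (g : Braid n) :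
    cable m p (g * h) = cable m p g * cable m p h := by
  have : ρ n h = 1 := hh
  rw [cable_mul, this, Equiv.Perm.one_apply]

theorem cable_of_mem_inv {n m : ℕ} {h : Braid n} (hh : h ∈ PB n) (p : Fin n) :
    cable m p h⁻¹ = (cable m p h)⁻¹ := by
  have : ρ n h = 1 := hh
  rw [cable_inv, this, inv_one, Equiv.Perm.one_apply]

theorem act_lam_σ (k i : ℕ) (m : ℤ) (hi : i + 1 < k) (s : ℕ → ℕ) :
    act (lam m (σ k i)) s = s ∘ Equiv.swap i (i + 1) := by
  have : pn k (lam m (σ k i)) = Equiv.swap i (i + 1) := by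
    rw [map_lam, pn_σ k i hi, lam, pow_two, Equiv.swap_mul_self, one_zpow, mul_one]
  rw [act, this, Equiv.swap_inv]

/-- The crossing of a cable of `a` strands with a cable of `b` strands, to the power `2m+1`. -/
def cab (m : ℤ) (N p a b : ℕ) : Braid N := mc N p (sz2 a b) (lam m (σ 2 0))

/-- A braid on three strands with the strands replaced by cables; it is replaced by `1` if one of
the cables is empty. -/
def tri (f : Braid 3) (N p a b c : ℕ) : Braid N :=
  -- A strand deleted from `f` need not leave a trivial braid, so the value for empty cables is
  -- imposed. With it the cabled pentagon `IsPair.pent` also holds when some sizes vanish, and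
  -- inductions can start at zero.
  if a = 0 ∨ b = 0 ∨ c = 0 then 1 else mc N p (sz3 a b c) f

theorem tri_of_ne {f : Braid 3} {N p a b c : ℕ} (h : ¬(a = 0 ∨ b = 0 ∨ c = 0)) :
    tri f N p a b c = mc N p (sz3 a b c) f := if_neg h

theorem tri_of_eq {f : Braid 3} {N p a b c : ℕ} (h : a = 0 ∨ b = 0 ∨ c = 0) :
    tri f N p a b c = 1 := if_pos h

section tri

variable {f : Braid 3} (hf : f ∈ PB 3) {N p a b c : ℕ}

include hf

theorem tri_mem_PB (hN : p + a + b + c ≤ N) : tri f N p a b c ∈ PB N := by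
  unfold tri
  split_ifs
  · exact one_mem _
  · exact mc_mem_PB hf _ (by rw [pos_sz3]; omega)

omit hf in
theorem tri_mem_loc (hN : p + a + b + c ≤ N) : tri f N p a b c ∈ loc N p (a + b + c) := by
  unfold tri
  split_ifs
  · exact one_mem _
  · have := mc_mem_loc (p := p) (N := N) (sz3 a b c) f (by rw [pos_sz3]; omega)
    rwa [pos_sz3] at this

theorem tri_comm₁ (hN : p + a + b + c ≤ N) {l : Braid N} (hl : l ∈ loc N p a) :
    Commute l (tri f N p a b c) := by
  unfold tri
  split_ifs
  · exact Commute.one_right _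
  · exact mc_commute_loc hf _ (by rw [pos_sz3]; omega) (i := 0) (by omega) (by simpa [pos, sz3] using hl)

theorem tri_comm₂ (hN : p + a + b + c ≤ N) {l : Braid N} (hl : l ∈ loc N (p + a) b) :
    Commute l (tri f N p a b c) := by
  unfold tri
  split_ifs
  · exact Commute.one_right _
  · exact mc_commute_loc hf _ (by rw [pos_sz3]; omega) (i := 1) (by omega)
      (by simpa [pos, sz3] using hl)

theorem tri_comm₃ (hN : p + a + b + c ≤ N) {l : Braid N} (hl : l ∈ loc N (p + a + b) c) :
    Commute l (tri f N p a b c) := by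
  unfold tri
  split_ifs
  · exact Commute.one_right _
  · exact mc_commute_loc hf _ (by rw [pos_sz3]; omega) (i := 2) (by omega)
      (by simpa [pos, sz3, Finset.sum_range_succ, add_assoc] using hl)

end tri

theorem cable_tri (f : Braid 3) {N m p a b c : ℕ} (hm : 1 ≤ m) (hN : p + a + b + c ≤ N) (x : Fin N) :
    cable m x (tri f N p a b c) = tri f (N + m - 1) (if p ≤ x then p else p + m - 1)
      (if p ≤ x ∧ (x : ℕ) < p + a then a + m - 1 else a)
      (if p + a ≤ x ∧ (x : ℕ) < p + a + b then b + m - 1 else b)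
      (if p + a + b ≤ x ∧ (x : ℕ) < p + a + b + c then c + m - 1 else c) := by
  by_cases h : a = 0 ∨ b = 0 ∨ c = 0
  · rw [tri_of_eq h, cable_one, tri_of_eq]
    rcases h with rfl | rfl | rfl
    · left; rw [if_neg (by omega)]
    · right; left; rw [if_neg (by omega)]
    · right; right; rw [if_neg (by omega)]
  · rw [tri_of_ne h, tri_of_ne (by split_ifs <;> omega), cable_mc f (by rw [pos_sz3]; omega)]
    apply mc_congr
    intro i hi
    rw [agg, seg_single]
    interval_cases i <;> simp only [pos, sz3, Finset.sum_range_succ, Finset.sum_range_zero, add_zero,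
      zero_add, ← add_assoc]

theorem shift_tri (f : Braid 3) {n N r p a b c : ℕ} (hn : p + a + b + c ≤ n) (h : r + n ≤ N) :
    shift n N r h (tri f n p a b c) = tri f N (r + p) a b c := by
  unfold tri
  split_ifs
  · exact map_one _
  · exact shift_mc f (by rw [pos_sz3]; omega) h

theorem mc_shift {k n N p r : ℕ} {s : ℕ → ℕ} (g : Braid k) (hn : p + k ≤ n) (h : r + pos s n ≤ N) :
    mc N r s (shift k n p hn g) = mc N (r + pos s p) (fun i => s (p + i)) g := by
  rw [shift_eq_mc, mc_mc g _ _ (by rwa [pos_one]) h]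
  congr 1
  funext i
  rw [agg, seg_one, pos_one]

section doubles

variable {R p a b c d : ℕ} (f : Braid 3) (hR : p + a + b + c + d ≤ R)

include hR

theorem mc_addRight : mc R p (sz4 a b c d) (addRight f) = mc R p (sz3 a b c) f := by
  rw [addRight, mc_shift f _ (by rw [pos_sz4]; omega)]
  apply mc_congr
  intro i hi
  interval_cases i <;> rfl

theorem mc_addLeft : mc R p (sz4 a b c d) (addLeft f) = mc R (p + a) (sz3 b c d) f := by
  rw [addLeft, mc_shift f _ (by rw [pos_sz4]; omega), show pos (sz4 a b c d) 1 = a by simp [pos, sz4]]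
  apply mc_congr
  intro i hi
  interval_cases i <;> rfl

theorem mc_double₀ : mc R p (sz4 a b c d) (double 0 f) = mc R p (sz3 (a + b) c d) f := by
  rw [double, cable_eq_mc, mc_mc f _ _ (by rw [pos_single]; split_ifs <;> simp at *)
    (by rw [pos_sz4]; omega)]
  apply mc_congr
  intro i hi
  interval_cases i <;> simp [agg, seg, single, pos, Finset.sum_range_succ, sz4, sz3]

theorem mc_double₁ : mc R p (sz4 a b c d) (double 1 f) = mc R p (sz3 a (b + c) d) f := by
  rw [double, cable_eq_mc, mc_mc f _ _ (by rw [pos_single]; split_ifs <;> simp at *)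
    (by rw [pos_sz4]; omega)]
  apply mc_congr
  intro i hi
  interval_cases i <;> simp [agg, seg, single, pos, Finset.sum_range_succ, sz4, sz3]

theorem mc_double₂ : mc R p (sz4 a b c d) (double 2 f) = mc R p (sz3 a b (c + d)) f := by
  rw [double, cable_eq_mc, mc_mc f _ _ (by rw [pos_single]; split_ifs <;> simp at *)
    (by rw [pos_sz4]; omega)]
  apply mc_congr
  intro i hi
  interval_cases i <;> simp [agg, seg, single, pos, Finset.sum_range_succ, sz4, sz3]

end doubles

theorem addRight_mem {n : ℕ} {f : Braid n} (hf : f ∈ PB n) : addRight f ∈ PB (n + 1) := by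
  rw [addRight, shift_eq_mc]
  exact mc_mem_PB hf _ (by rw [pos_one]; omega)

theorem addLeft_mem {n : ℕ} {f : Braid n} (hf : f ∈ PB n) : addLeft f ∈ PB (n + 1) := by
  rw [addLeft, shift_eq_mc]
  exact mc_mem_PB hf _ (by rw [pos_one]; omega)

theorem cable_mem {n m : ℕ} {f : Braid n} (hf : f ∈ PB n) (p : Fin n) : cable m p f ∈ PB (n + m - 1) := by
  have := p.2
  rw [cable_eq_mc]
  exact mc_mem_PB hf _ (by rw [pos_single]; split_ifs <;> omega)

theorem double_mem {n : ℕ} {f : Braid n} (hf : f ∈ PB n) (p : Fin n) : double p f ∈ PB (n + 1) := by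
  unfold double
  exact cable_mem (m := 2) hf p

theorem lam_σ_eq_shift (m : ℤ) (i : ℕ) (hi : i < 2) :
    lam m (σ 3 i) = shift 2 3 i (by omega) (lam m (σ 2 0)) := by
  rw [map_lam, shift_σ _ _ _ _ _ (by omega), zero_add]

theorem sz3_swap₀ (a b c : ℕ) : sz3 a b c ∘ Equiv.swap 0 (0 + 1) = sz3 b a c := by
  funext i
  rcases i with _ | _ | _ | i
  · rfl
  · rfl
  · rw [Function.comp_apply, Equiv.swap_apply_of_ne_of_ne (by omega) (by omega)]; rfl
  · rw [Function.comp_apply, Equiv.swap_apply_of_ne_of_ne (by omega) (by omega)]; rfl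

theorem sz3_swap₁ (a b c : ℕ) : sz3 a b c ∘ Equiv.swap 1 (1 + 1) = sz3 a c b := by
  funext i
  rcases i with _ | _ | _ | i
  · rw [Function.comp_apply, Equiv.swap_apply_of_ne_of_ne (by omega) (by omega)]; rfl
  · rfl
  · rfl
  · rw [Function.comp_apply, Equiv.swap_apply_of_ne_of_ne (by omega) (by omega)]; rfl

section cabled

variable (m : ℤ) {R p a b c : ℕ} (hR : p + a + b + c ≤ R)

include hR

theorem mc_lam₀ : mc R p (sz3 a b c) (lam m (σ 3 0)) = cab m R p a b := by
  rw [lam_σ_eq_shift m 0 (by omega), mc_shift _ _ (by rw [pos_sz3]; omega)]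
  apply mc_congr
  intro i hi
  interval_cases i <;> rfl

theorem mc_lam₁ : mc R p (sz3 a b c) (lam m (σ 3 1)) = cab m R (p + a) b c := by
  rw [lam_σ_eq_shift m 1 (by omega), mc_shift _ _ (by rw [pos_sz3]; omega),
    show pos (sz3 a b c) 1 = a by simp [pos, sz3]]
  apply mc_congr
  intro i hi
  interval_cases i <;> rfl

theorem mc_cable_lam₀ :
    mc R p (sz3 a b c) (cable (n := 2) 2 0 (lam m (σ 2 0))) = cab m R p (a + b) c := by
  rw [cable_eq_mc, mc_mc _ _ _ (by rw [pos_single]; split_ifs <;> simp at *) (by rw [pos_sz3]; omega)]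
  apply mc_congr
  intro i hi
  interval_cases i <;> simp [agg, seg, single, pos, Finset.sum_range_succ, sz2, sz3]

theorem mc_cable_lam₁ :
    mc R p (sz3 a b c) (cable (n := 2) 2 1 (lam m (σ 2 0))) = cab m R p a (b + c) := by
  rw [cable_eq_mc, mc_mc _ _ _ (by rw [pos_single]; split_ifs <;> simp at *) (by rw [pos_sz3]; omega)]
  apply mc_congr
  intro i hi
  interval_cases i <;> simp [agg, seg, single, pos, Finset.sum_range_succ, sz2, sz3]

end cabled

theorem act_cable_lam₀ (m : ℤ) (a b c : ℕ) (i : ℕ) :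
    act (cable (n := 2) 2 0 (lam m (σ 2 0)) : Braid 3) (sz3 a b c) i = sz3 c a b i := by
  have h : act (cable (n := 2) 2 0 (lam m (σ 2 0)) : Braid 3) (sz3 a b c) =
      act (σ 3 0 * σ 3 1) (sz3 a b c) := by
    have e : pn 3 (cable (n := 2) 2 0 (lam m (σ 2 0)) : Braid 3) = pn 3 (σ 3 0 * σ 3 1) := by
      have : (σ 2 0 ^ 2) ^ m ∈ PB 2 := by
        refine zpow_mem ?_ m
        rw [MonoidHom.mem_ker, map_pow, ρ_σ 2 0 (by omega), pow_two]
        ext x : 1; exact adjSwap_adjSwap 2 0 x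
      rw [lam, cable_of_mem_mul this, cable_σ _ _ (by omega),
        show cableGen (2 + 2 - 1) 2 0 ((0 : Fin 2) : ℕ) = σ 3 0 * σ 3 1 by
          simp [cableGen, cableUp]]
      have h2 := (pn_eq_one_iff _).2 (cable_mem (m := 2) this 0)
      rw [map_mul]
      erw [h2]
      rw [mul_one]
    unfold act
    rw [e]
  rw [h, act_mul, act_σ _ _ (by omega), act_σ _ _ (by omega), sz3_swap₁, sz3_swap₀]

theorem loc_one (N p : ℕ) : loc N p 1 = ⊥ := by
  rw [loc, Subgroup.closure_eq_bot_iff]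
  rintro _ ⟨x, hx, hx', -⟩
  omega

theorem cab_mem_loc (m : ℤ) {N p a b : ℕ} (h : p + a + b ≤ N) : cab m N p a b ∈ loc N p (a + b) := by
  have := mc_mem_loc (p := p) (N := N) (sz2 a b) (lam m (σ 2 0)) (by rw [pos_sz2]; omega)
  rwa [pos_sz2] at this

theorem cab_zero_one (m : ℤ) {N p : ℕ} (h : p + 1 ≤ N) : cab m N p 0 1 = 1 := by
  have := cab_mem_loc m (N := N) (p := p) (a := 0) (b := 1) (by omega)
  rwa [zero_add, loc_one, Subgroup.mem_bot] at this

theorem cab_one_zero (m : ℤ) {N p : ℕ} (h : p + 1 ≤ N) : cab m N p 1 0 = 1 := by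
  have := cab_mem_loc m (N := N) (p := p) (a := 1) (b := 0) (by omega)
  rwa [add_zero, loc_one, Subgroup.mem_bot] at this

theorem lam_σ_eq_mc (m : ℤ) {N p : ℕ} (h : p + 2 ≤ N) :
    lam m (σ N p) = mc N p (fun _ => 1) (lam m (σ 2 0)) := by
  rw [← shift_eq_mc h, map_lam, shift_σ _ _ _ _ _ (by omega), zero_add]

theorem cab_one_one (m : ℤ) {N p : ℕ} (h : p + 2 ≤ N) : cab m N p 1 1 = lam m (σ N p) := by
  rw [lam_σ_eq_mc m h]
  apply mc_congr
  intro i hi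
  interval_cases i <;> rfl

theorem shift_cab (m : ℤ) {n N r p a b : ℕ} (hn : p + a + b ≤ n) (h : r + n ≤ N) :
    shift n N r h (cab m n p a b) = cab m N (r + p) a b :=
  shift_mc _ (by rw [pos_sz2]; omega) h

theorem shift_cableUp {n N r p a : ℕ} (hn : p + a + 1 ≤ n) (h : r + n ≤ N) :
    shift n N r h (cableUp n p a) = cableUp N (r + p) a := by
  induction a with
  | zero => exact map_one _
  | succ a ih =>
    rw [cableUp, cableUp, map_mul, ih (by omega), shift_σ _ _ _ _ _ (by omega)]
    congr 2; omega

theorem shift_cableDown {n N r p a : ℕ} (hn : p + a + 1 ≤ n) (h : r + n ≤ N) :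
    shift n N r h (cableDown n p a) = cableDown N (r + p) a := by
  induction a with
  | zero => exact map_one _
  | succ a ih =>
    rw [cableDown, cableDown, map_mul, ih (by omega), shift_σ _ _ _ _ _ (by omega)]
    congr 2; omega

theorem sq_σ_mem_PB (n i : ℕ) (hi : i + 1 < n) : σ n i ^ 2 ∈ PB n := by
  rw [MonoidHom.mem_ker, map_pow, ρ_σ n i hi, pow_two]
  ext x : 1; exact adjSwap_adjSwap n i x

theorem ρ_lam_σ (n i : ℕ) (hi : i + 1 < n) (m : ℤ) : ρ n (lam m (σ n i)) = ρ n (σ n i) := by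
  have : ρ n ((σ n i ^ 2) ^ m) = 1 := zpow_mem (sq_σ_mem_PB n i hi) m
  rw [lam, map_mul, this, mul_one]

/-- Cabling as a homomorphism on pure braids. -/
def cablePB {n : ℕ} (m : ℕ) (p : Fin n) : PB n →* Braid (n + m - 1) where
  toFun g := cable m p g
  map_one' := cable_one p
  map_mul' g h := cable_of_mem_mul h.2 p g

/-- Doubling the first strand of `σ₁²` gives `x₁₃ x₂₃`, and cabling is multiplicative on pure
braids. This matches the operadic form of the first hexagon in `IsPair` with the explicit one of
`IsGTPair`. -/
theorem cable_lam₀ (m : ℤ) : (cable (n := 2) 2 0 (lam m (σ 2 0)) : Braid 3) =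
    σ 3 0 * σ 3 1 * (σ 3 1 * σ 3 0 ^ 2 * (σ 3 1)⁻¹ * σ 3 1 ^ 2) ^ m := by
  have h2 := sq_σ_mem_PB 2 0 (by omega)
  have e0 : (ρ 2 (σ 2 0)) 0 = 1 := by
    apply Fin.ext; rw [ρ_σ_val 2 0 (by omega)]; rfl
  have e1 : (cable (n := 2) 2 0 (σ 2 0) : Braid 3) = σ 3 0 * σ 3 1 := by
    rw [cable_σ _ _ (by omega)]; simp [cableGen, cableUp]
  have e2 : (cable (n := 2) 2 1 (σ 2 0) : Braid 3) = σ 3 1 * σ 3 0 := by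
    rw [cable_σ _ _ (by omega)]; simp [cableGen, cableDown]
  have e3 : (cable (n := 2) 2 0 (σ 2 0 ^ 2) : Braid 3) =
      σ 3 1 * σ 3 0 ^ 2 * (σ 3 1)⁻¹ * σ 3 1 ^ 2 := by
    rw [pow_two, cable_mul, e0]
    refine (congrArg₂ (fun x y : Braid 3 => x * y) e2 e1).trans ?_
    rw [pow_two, pow_two]; group
  have e4 : (cable (n := 2) 2 0 ((σ 2 0 ^ 2) ^ m) : Braid 3) = (cable (n := 2) 2 0 (σ 2 0 ^ 2)) ^ m :=
    map_zpow (cablePB 2 (0 : Fin 2)) ⟨_, h2⟩ m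
  rw [lam, cable_of_mem_mul (zpow_mem h2 m)]
  refine (congrArg₂ (fun x y : Braid 3 => x * y) e1 e4).trans ?_
  rw [e3]

/-- The analogue for the second hexagon: doubling the second strand of `σ₁²` gives `x₁₂ x₁₃`, after
two applications of the braid relation. -/
theorem cable_lam₁ (m : ℤ) : (cable (n := 2) 2 1 (lam m (σ 2 0)) : Braid 3) =
    σ 3 1 * σ 3 0 * (σ 3 0 ^ 2 * (σ 3 1 * σ 3 0 ^ 2 * (σ 3 1)⁻¹)) ^ m := by
  have h2 := sq_σ_mem_PB 2 0 (by omega)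
  have e0 : (ρ 2 (σ 2 0)) 1 = 0 := by
    apply Fin.ext; rw [ρ_σ_val 2 0 (by omega)]; rfl
  have e1 : (cable (n := 2) 2 0 (σ 2 0) : Braid 3) = σ 3 0 * σ 3 1 := by
    rw [cable_σ _ _ (by omega)]; simp [cableGen, cableUp]
  have e2 : (cable (n := 2) 2 1 (σ 2 0) : Braid 3) = σ 3 1 * σ 3 0 := by
    rw [cable_σ _ _ (by omega)]; simp [cableGen, cableDown]
  have hb := σ_braid 3 0 (by omega)
  rw [zero_add] at hb
  have e3 : (cable (n := 2) 2 1 (σ 2 0 ^ 2) : Braid 3) =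
      σ 3 0 ^ 2 * (σ 3 1 * σ 3 0 ^ 2 * (σ 3 1)⁻¹) := by
    rw [pow_two, cable_mul, e0]
    refine (congrArg₂ (fun x y : Braid 3 => x * y) e1 e2).trans ?_
    rw [pow_two]
    calc _ = σ 3 0 * σ 3 1 * (σ 3 1 * σ 3 0 * σ 3 1) * (σ 3 1)⁻¹ := by group
      _ = σ 3 0 * σ 3 1 * (σ 3 0 * σ 3 1 * σ 3 0) * (σ 3 1)⁻¹ := by rw [hb]
      _ = σ 3 0 * (σ 3 1 * σ 3 0 * σ 3 1) * σ 3 0 * (σ 3 1)⁻¹ := by group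
      _ = _ := by rw [← hb]; group
  have e4 : (cable (n := 2) 2 1 ((σ 2 0 ^ 2) ^ m) : Braid 3) = (cable (n := 2) 2 1 (σ 2 0 ^ 2)) ^ m :=
    map_zpow (cablePB 2 (1 : Fin 2)) ⟨_, h2⟩ m
  rw [lam, cable_of_mem_mul (zpow_mem h2 m)]
  refine (congrArg₂ (fun x y : Braid 3 => x * y) e2 e4).trans ?_
  rw [e3]

/-! ### Coherence for products of left-normed words -/

/-- The coherence isomorphism from the product of left-normed words of lengths `a` and `b` to the
left-normed word. -/
def Psi (f : Braid 3) (N p a : ℕ) : ℕ → Braid N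
  | 0 => 1
  | b + 1 => Psi f N p a b * (tri f N p a b 1)⁻¹

section Psi

variable {f : Braid 3}

theorem Psi_zero_left (N p b : ℕ) : Psi f N p 0 b = 1 := by
  induction b with
  | zero => rfl
  | succ b ih => rw [Psi, ih, tri_of_eq (by simp)]; simp

theorem Psi_one_right (N p a : ℕ) : Psi f N p a 1 = 1 := by
  rw [Psi, Psi, tri_of_eq (by simp)]; simp

theorem Psi_mem_PB (hf : f ∈ PB 3) {N p a b : ℕ} (hN : p + a + b ≤ N) : Psi f N p a b ∈ PB N := by
  induction b with
  | zero => exact one_mem _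
  | succ b ih => exact mul_mem (ih (by omega)) (inv_mem (tri_mem_PB hf (by omega)))

theorem Psi_mem_loc {N p a b : ℕ} (hN : p + a + b ≤ N) : Psi f N p a b ∈ loc N p (a + b) := by
  induction b with
  | zero => exact one_mem _
  | succ b ih =>
    exact mul_mem (loc_mono le_rfl (by omega) (ih (by omega)))
      (inv_mem (loc_mono le_rfl (by omega) (tri_mem_loc (a := a) (b := b) (c := 1) (by omega))))

theorem Psi_comm (hf : f ∈ PB 3) {N p a b : ℕ} (hN : p + a + b ≤ N) {l : Braid N}
    (hl : l ∈ loc N p a) : Commute l (Psi f N p a b) := by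
  induction b with
  | zero => exact Commute.one_right _
  | succ b ih => exact (ih (by omega)).mul_right (tri_comm₁ hf (by omega) hl).inv_right

theorem shift_Psi {n N r p a b : ℕ} (hn : p + a + b ≤ n) (h : r + n ≤ N) :
    shift n N r h (Psi f n p a b) = Psi f N (r + p) a b := by
  induction b with
  | zero => exact map_one _
  | succ b ih => rw [Psi, Psi, map_mul, map_inv, ih (by omega), shift_tri f (by omega)]

/-- Each factor that is added when `b` grows to `b + c` is a cabled associator whose second cable
contains the strands of `l`; it commutes with `l` and drops out of the conjugation. -/
theorem Psi_conj (hf : f ∈ PB 3) {N p a b c : ℕ} (hN : p + a + (b + c) ≤ N) {l : Braid N}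
    (hl : l ∈ loc N (p + a) b) : Psi f N p a (b + c) * l * (Psi f N p a (b + c))⁻¹ =
      Psi f N p a b * l * (Psi f N p a b)⁻¹ := by
  induction c with
  | zero => rfl
  | succ c ih =>
    have h1 := tri_comm₂ (N := N) (p := p) (a := a) (b := b + c) (c := 1) hf (by omega)
      (loc_mono le_rfl (by omega) hl)
    rw [← ih (by omega), ← add_assoc, Psi]
    have := h1.inv_right.eq
    calc _ = Psi f N p a (b + c) * ((tri f N p a (b + c) 1)⁻¹ * l) * tri f N p a (b + c) 1 *
          (Psi f N p a (b + c))⁻¹ := by group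
      _ = _ := by rw [← this]; group

end Psi

theorem coherence_algebra {G : Type*} [Group G] {P₁ P₂ P₃ P₄ t₁ t₂ t₃ t₄ t₅ : G}
    (c₁ : Commute P₂ t₁) (c₂ : Commute P₄ t₃) (ih : P₁ * P₂ = P₃ * P₄ * t₂)
    (pent : t₄ * t₃ * t₂ = t₅ * t₁) :
    P₁ * t₁⁻¹ * P₂ = P₃ * t₃⁻¹ * (P₄ * t₄⁻¹) * t₅ := by
  have h5 : t₅ = t₄ * t₃ * t₂ * t₁⁻¹ := by rw [pent]; group
  calc _ = P₁ * (t₁⁻¹ * P₂) := by group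
    _ = P₃ * P₄ * t₂ * t₁⁻¹ := by rw [← c₁.inv_right.eq, ← ih]; group
    _ = P₃ * (P₄ * t₃⁻¹) * t₃ * t₂ * t₁⁻¹ := by group
    _ = _ := by rw [c₂.inv_right.eq, h5]; group

namespace IsPair

variable {𝒩 : OpCongr} {m : ℤ} {f : PB 3} (h : IsPair 𝒩 m f)

include h

theorem pent {R p a b c d : ℕ} (hR : p + a + b + c + d ≤ R) :
    𝒩.q R (tri f R (p + a) b c d * tri f R p a (b + c) d * tri f R p a b c) =
      𝒩.q R (tri f R p a b (c + d) * tri f R p (a + b) c d) := by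
  by_cases ha : a = 0
  · subst ha; simp [tri_of_eq]
  by_cases hb : b = 0
  · subst hb; simp [tri_of_eq]
  by_cases hc : c = 0
  · subst hc; simp [tri_of_eq]
  by_cases hd : d = 0
  · subst hd; simp [tri_of_eq]
  rw [tri_of_ne (by omega), tri_of_ne (by omega), tri_of_ne (by omega), tri_of_ne (by omega),
    tri_of_ne (by omega)]
  have := 𝒩.q_mc (n := R) (p := p) (s := sz4 a b c d) h.pentagon
    (by intro i hi; interval_cases i <;> simp only [sz4] <;> omega) (by rw [pos_sz4]; omega)
  rwa [mc_of_mem_mul (addRight_mem f.2), mc_of_mem_mul (double_mem f.2 _),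
    mc_of_mem_mul (double_mem f.2 _), mc_addRight _ hR, mc_addLeft _ hR, mc_double₀ _ hR,
    mc_double₁ _ hR, mc_double₂ _ hR] at this

/-- The first hexagon cabled with sizes `k, 1, 1` peels one strand off a cable of `k + 1` strands.
It is the induction step of `Θ_cableUp`. -/
theorem hexUp {R p k : ℕ} (hR : p + k + 2 ≤ R) :
    𝒩.q R (cab m R p (k + 1) 1) = 𝒩.q R (tri f R p 1 k 1 * cab m R p k 1 * (tri f R p k 1 1)⁻¹ *
      lam m (σ R (p + k)) * tri f R p k 1 1) := by
  by_cases hk : k = 0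
  · subst hk
    rw [tri_of_eq (by simp), tri_of_eq (by simp), cab_zero_one m (by omega), zero_add,
      cab_one_one m (by omega)]
    simp
  have := 𝒩.q_mc (n := R) (p := p) (s := sz3 k 1 1) h.hexagon₁
    (by intro i hi; interval_cases i <;> simp only [sz3] <;> omega) (by rw [pos_sz3]; omega)
  rw [mc_of_mem_mul f.2, mc_mul _ _ (lam m (σ 3 1)), act_lam_σ _ _ _ (by omega), sz3_swap₁,
    mc_of_mem_mul (inv_mem f.2), mc_of_mem_inv f.2, mc_lam₀ m (by omega), mc_lam₁ m (by omega),
    mc_mul _ (f : Braid 3)⁻¹ _, mc_congr _ (fun i _ => act_cable_lam₀ m k 1 1 i), mc_of_mem_inv f.2,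
    mc_cable_lam₀ m (by omega), cab_one_one m (by omega)] at this
  rw [tri_of_ne (by omega), tri_of_ne (by omega)]
  simp only [map_mul, map_inv] at this ⊢
  rw [eq_inv_mul_iff_mul_eq] at this
  rw [← this]
  group

/-- The second hexagon cabled with sizes `1, k, 1`; it is the induction step of `Θ_cableDown`. -/
theorem hexDown {R p k : ℕ} (hR : p + k + 2 ≤ R) :
    𝒩.q R ((tri f R p k 1 1)⁻¹ * lam m (σ R (p + k)) * tri f R p k 1 1 * cab m R p 1 k) =
      𝒩.q R (cab m R p 1 (k + 1) * tri f R p 1 k 1) := by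
  by_cases hk : k = 0
  · subst hk
    rw [tri_of_eq (by simp), tri_of_eq (by simp), cab_one_zero m (by omega), zero_add,
      cab_one_one m (by omega)]
    simp
  have := 𝒩.q_mc (n := R) (p := p) (s := sz3 1 k 1) h.hexagon₂
    (by intro i hi; interval_cases i <;> simp only [sz3] <;> omega) (by rw [pos_sz3]; omega)
  rw [mc_mul _ _ (lam m (σ 3 0)), act_lam_σ _ _ _ (by omega), sz3_swap₀, mc_of_mem_mul f.2,
    mc_mul _ _ (lam m (σ 3 1)), act_lam_σ _ _ _ (by omega), sz3_swap₁,
    mc_of_mem_inv f.2, mc_lam₀ m (by omega), mc_lam₁ m (by omega), mc_of_mem_mul f.2,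
    mc_cable_lam₁ m (by omega), cab_one_one m (by omega)] at this
  rwa [tri_of_ne (by omega), tri_of_ne (by omega)]

/-- The part of Mac Lane coherence that is needed: two ways to rebracket a product of three
left-normed words agree. By induction on `c`, the step is the pentagon with sizes `a, b, c, 1`; the
other factors commute because an associator commutes with braids inside its cables. -/
theorem coherence {N p a b c : ℕ} (hN : p + a + b + c ≤ N) :
    𝒩.q N (Psi f N p (a + b) c * Psi f N p a b) =
      𝒩.q N (Psi f N p a (b + c) * Psi f N (p + a) b c * tri f N p a b c) := by
  induction c with
  | zero => rw [tri_of_eq (by simp)]; simp [Psi]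
  | succ c ih =>
    have c1 := (tri_comm₁ (N := N) (p := p) (a := a + b) (b := c) (c := 1) f.2 (by omega)
      (Psi_mem_loc (f := f) (N := N) (p := p) (a := a) (b := b) (by omega))).map (𝒩.q N)
    have c2 := (tri_comm₂ (N := N) (p := p) (a := a) (b := b + c) (c := 1) f.2 (by omega)
      (Psi_mem_loc (f := f) (N := N) (p := p + a) (a := b) (b := c) (by omega))).map (𝒩.q N)
    have hp := h.pent (R := N) (p := p) (a := a) (b := b) (c := c) (d := 1) (by omega)
    have ih := ih (by omega)
    rw [← add_assoc, Psi, Psi, Psi]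
    simp only [map_mul, map_inv] at *
    exact coherence_algebra c1 c2 ih hp

/-- The braid relation on the first two generators. -/
theorem braid₃ : 𝒩.q 3 (lam m (σ 3 0) * ((f : Braid 3)⁻¹ * lam m (σ 3 1) * f) * lam m (σ 3 0)) =
    𝒩.q 3 (((f : Braid 3)⁻¹ * lam m (σ 3 1) * f) * lam m (σ 3 0) *
      ((f : Braid 3)⁻¹ * lam m (σ 3 1) * f)) := by
  have hb := congrArg (𝒩.q 3) (σ_braid 3 0 (by omega))
  have h1 := h.hexagon₁
  rw [cable_lam₀] at h1
  simp only [lam, map_mul, map_inv, map_zpow, map_pow] at hb h1 ⊢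
  have := hexagon_braid _ _ (𝒩.q 3 f) m hb (by simpa only [mul_assoc] using h1)
  simpa only [mul_assoc] using this

end IsPair

/-! ### The homomorphisms of a pair on all braid groups -/

theorem braid_algebra {G : Type*} [Group G] {s t A B C D E : G} (pent : A * B * C = D * E)
    (hB : Commute s B) (hD : Commute t D)
    (key : s * (A⁻¹ * t * A) * s = (A⁻¹ * t * A) * s * (A⁻¹ * t * A)) :
    (C⁻¹ * s * C) * (E⁻¹ * t * E) * (C⁻¹ * s * C) =
      (E⁻¹ * t * E) * (C⁻¹ * s * C) * (E⁻¹ * t * E) := by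
  have hE' : E = D⁻¹ * A * (B * C) := by
    rw [mul_assoc, ← mul_assoc A, pent, inv_mul_cancel_left]
  have c1 : C⁻¹ * s * C = (B * C)⁻¹ * s * (B * C) := by
    calc C⁻¹ * s * C = C⁻¹ * B⁻¹ * (B * s) * C := by group
      _ = _ := by rw [← hB.eq]; group
  have c2 : E⁻¹ * t * E = (B * C)⁻¹ * (A⁻¹ * t * A) * (B * C) := by
    calc E⁻¹ * t * E = (B * C)⁻¹ * A⁻¹ * (D * t) * D⁻¹ * A * (B * C) := by rw [hE']; group
      _ = _ := by rw [← hD.eq]; group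
  rw [c1, c2]
  calc _ = (B * C)⁻¹ * (s * (A⁻¹ * t * A) * s) * (B * C) := by group
    _ = _ := by rw [key]; group

/-- A representative of the image of the generator `σ_i` under the homomorphism given by `(m, f)`. -/
def tgen (m : ℤ) (f : Braid 3) (n i : ℕ) : Braid n :=
  (tri f n 0 i 1 1)⁻¹ * lam m (σ n i) * tri f n 0 i 1 1

theorem tgen_mem_loc (m : ℤ) (f : Braid 3) {n i : ℕ} (hi : i + 2 ≤ n) : tgen m f n i ∈ loc n 0 (i + 2) := by
  have := tri_mem_loc (f := f) (N := n) (p := 0) (a := i) (b := 1) (c := 1) (by omega)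
  exact mul_mem (mul_mem (inv_mem this) (lam_mem (σ_mem_loc (by omega) (by omega)))) this

theorem σ_commute_of_loc {N p a x : ℕ} {l : Braid N} (hl : l ∈ loc N p a)
    (hx : x + 2 ≤ p ∨ p + a ≤ x) : Commute l (σ N x) :=
  commute_of_mem_loc (fun y _ _ => σ_comm N y x (by omega)) hl

theorem lam_commute {G : Type*} [Group G] {l x : G} (h : Commute l x) (m : ℤ) : Commute l (lam m x) :=
  h.mul_right ((h.pow_right 2).zpow_right m)

theorem commute_tgen (m : ℤ) {f : Braid 3} (hf : f ∈ PB 3) {n i : ℕ} (hi : i + 2 ≤ n) {l : Braid n}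
    (hl : l ∈ loc n 0 i) : Commute l (tgen m f n i) := by
  have h1 := tri_comm₁ (N := n) (p := 0) (a := i) (b := 1) (c := 1) hf (by omega) hl
  have h2 : Commute l (lam m (σ n i)) := lam_commute (σ_commute_of_loc hl (by omega)) m
  exact (h1.inv_right.mul_right h2).mul_right h1

theorem braidHom_ext {n : ℕ} {G : Type*} [Group G] {φ ψ : Braid n →* G}
    (h : ∀ i, i + 1 < n → φ (σ n i) = ψ (σ n i)) : φ = ψ := by
  refine MonoidHom.ext fun g => ?_
  induction g using braid_induction with
  | one => rw [map_one, map_one]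
  | mul g g' hg hg' => rw [map_mul, map_mul, hg, hg']
  | inv g hg => rw [map_inv, map_inv, hg]
  | gen i hi => exact h i hi

namespace IsPair

variable {𝒩 : OpCongr} {m : ℤ} {f : PB 3}

theorem q_tgen_comm (𝒩 : OpCongr) (m : ℤ) (f : PB 3) {n i j : ℕ} (hij : i + 2 ≤ j) (hj : j + 1 < n) :
    𝒩.q n (tgen m f n i) * 𝒩.q n (tgen m f n j) = 𝒩.q n (tgen m f n j) * 𝒩.q n (tgen m f n i) :=
  ((commute_tgen m f.2 (by omega) (loc_mono le_rfl (by omega)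
    (tgen_mem_loc m f (show i + 2 ≤ n by omega)))).map (𝒩.q n)).eq

theorem tri_ones (f : Braid 3) {N p : ℕ} (h : p + 3 ≤ N) : tri f N p 1 1 1 = shift 3 N p h f := by
  rw [tri_of_ne (by omega), shift_eq_mc]
  apply mc_congr
  intro i hi
  interval_cases i <;> rfl

/-- The pentagon with sizes `i, 1, 1, 1` conjugates the two generators simultaneously into the
images under the shift by `i` of those on three strands, for which the relation is `braid₃`. This
conjugation is the content of `braid_algebra`. -/
theorem q_tgen_braid (h : IsPair 𝒩 m f) {n i : ℕ} (hi : i + 2 < n) :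
    𝒩.q n (tgen m f n i) * 𝒩.q n (tgen m f n (i + 1)) * 𝒩.q n (tgen m f n i) =
      𝒩.q n (tgen m f n (i + 1)) * 𝒩.q n (tgen m f n i) * 𝒩.q n (tgen m f n (i + 1)) := by
  have hp := h.pent (R := n) (p := 0) (a := i) (b := 1) (c := 1) (d := 1) (by omega)
  have hB : Commute (lam m (σ n i)) (tri f n 0 i (1 + 1) 1) :=
    tri_comm₂ f.2 (by omega) (lam_mem (σ_mem_loc (by omega) (by omega)))
  have hD : Commute (lam m (σ n (i + 1))) (tri f n 0 i 1 (1 + 1)) :=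
    tri_comm₃ f.2 (by omega) (lam_mem (σ_mem_loc (by omega) (by omega)))
  have key := 𝒩.q_shift (n := n) (p := i) (by omega) h.braid₃
  simp only [map_mul, map_inv, map_lam, shift_σ 3 n i _ 0 (by omega), shift_σ 3 n i _ 1 (by omega),
    ← tri_ones] at key hp
  simp only [zero_add] at hp key
  rw [add_comm 1 i] at key
  have := braid_algebra hp (hB.map (𝒩.q n)) (hD.map (𝒩.q n)) (by simpa only [map_lam] using key)
  simpa only [tgen, map_mul, map_inv, map_lam] using this

/-- The homomorphism `B_n → B_n/N_n` given by `(m, f)`. -/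
def Θ (h : IsPair 𝒩 m f) (n : ℕ) : Braid n →* Braid n ⧸ 𝒩.N n :=
  braidLift n (fun i => 𝒩.q n (tgen m f n i)) (fun _ _ hij hj => q_tgen_comm 𝒩 m f hij hj)
    (fun _ hi => h.q_tgen_braid hi)

theorem Θ_σ (h : IsPair 𝒩 m f) {n i : ℕ} (hi : i + 1 < n) : h.Θ n (σ n i) = 𝒩.q n (tgen m f n i) :=
  braidLift_σ _ _ _ _ _ hi

end IsPair

namespace OpCongr

variable (𝒩 : OpCongr)

/-- The permutation of a class of braids. -/
def ρQ (n : ℕ) : Braid n ⧸ 𝒩.N n →* Equiv.Perm (Fin n) :=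
  QuotientGroup.lift (𝒩.N n) (ρ n) (fun _ h => 𝒩.le_PB n h)

theorem ρQ_q {n : ℕ} (x : Braid n) : 𝒩.ρQ n (𝒩.q n x) = ρ n x := rfl

/-- The juxtaposition with vertical strands, modulo the congruence. -/
def shiftQ (k n p : ℕ) (h : p + k ≤ n) : Braid k ⧸ 𝒩.N k →* Braid n ⧸ 𝒩.N n :=
  QuotientGroup.map (𝒩.N k) (𝒩.N n) (shift k n p h) (fun g hg => by
    rw [Subgroup.mem_comap, shift_eq_mc]
    exact 𝒩.mc_mem hg (fun _ _ => le_rfl) (by rwa [pos_one]))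

theorem shiftQ_q {k n p : ℕ} (h : p + k ≤ n) (x : Braid k) :
    𝒩.shiftQ k n p h (𝒩.q k x) = 𝒩.q n (shift k n p h x) := rfl

end OpCongr

/-! ### Compatibility of the homomorphisms with juxtaposition and cabling -/

theorem shift_tgen_algebra {G : Type*} [Group G] {P ta tb y s D E : G} (pent : y * tb * ta = D * E)
    (hD : Commute s D) (hs : Commute P s) (hE : Commute P E) :
    P * ta⁻¹ * tb⁻¹ * (y⁻¹ * s * y) * (P * ta⁻¹ * tb⁻¹)⁻¹ = E⁻¹ * s * E := by
  have h1 : Commute P (E⁻¹ * s * E) := (hE.inv_right.mul_right hs).mul_right hE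
  calc _ = P * ((y * tb * ta)⁻¹ * s * (y * tb * ta)) * P⁻¹ := by group
    _ = P * (E⁻¹ * D⁻¹ * (s * D) * E) * P⁻¹ := by rw [pent]; group
    _ = P * (E⁻¹ * s * E) * P⁻¹ := by rw [hD.eq]; group
    _ = _ := by rw [h1.eq]; group

namespace IsPair

variable {𝒩 : OpCongr} {m : ℤ} {f : PB 3} (h : IsPair 𝒩 m f)

include h

theorem ρQ_Θ {n : ℕ} (g : Braid n) : 𝒩.ρQ n (h.Θ n g) = ρ n g := by
  have : (𝒩.ρQ n).comp (h.Θ n) = ρ n := by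
    apply braidHom_ext
    intro i hi
    have ht : ρ n (tri f n 0 i 1 1) = 1 := tri_mem_PB f.2 (by omega)
    rw [MonoidHom.comp_apply, h.Θ_σ hi, 𝒩.ρQ_q, tgen, map_mul, map_mul, map_inv, ht, ρ_lam_σ n i hi]
    simp
  exact DFunLike.congr_fun this g

theorem ρ_of_Θ {n : ℕ} {g y : Braid n} (hy : h.Θ n g = 𝒩.q n y) : ρ n y = ρ n g := by
  rw [← h.ρQ_Θ g, hy, 𝒩.ρQ_q]

/-- `Θ` describes the operadic map on left-normed words. Putting a left-normed word of length `k`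
after one of length `p` gives a word that is not left-normed, and `Psi` accounts for the
rebracketing. On a generator the claim is the pentagon with sizes `p, j, 1, 1`. -/
theorem Θ_shift {k n p : ℕ} (hp : p + k ≤ n) (g : Braid k) :
    h.Θ n (shift k n p hp g) = 𝒩.q n (Psi f n 0 p k) * 𝒩.shiftQ k n p hp (h.Θ k g) *
      (𝒩.q n (Psi f n 0 p k))⁻¹ := by
  have : (h.Θ n).comp (shift k n p hp) =
      (MulAut.conj (𝒩.q n (Psi f n 0 p k))).toMonoidHom.comp
        ((𝒩.shiftQ k n p hp).comp (h.Θ k)) := by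
    apply braidHom_ext
    intro j hj
    change h.Θ n (shift k n p hp (σ k j)) =
      𝒩.q n (Psi f n 0 p k) * 𝒩.shiftQ k n p hp (h.Θ k (σ k j)) * (𝒩.q n (Psi f n 0 p k))⁻¹
    obtain ⟨c, rfl⟩ : ∃ c, k = j + 2 + c := ⟨k - j - 2, by omega⟩
    rw [shift_σ _ _ _ _ _ hj, h.Θ_σ (by omega), h.Θ_σ hj, 𝒩.shiftQ_q]
    have e : shift (j + 2 + c) n p hp (tgen m f (j + 2 + c) j) =
        (tri f n p j 1 1)⁻¹ * lam m (σ n (p + j)) * tri f n p j 1 1 := by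
      rw [tgen, map_mul, map_mul, map_inv, shift_tri _ (by omega), map_lam, shift_σ _ _ _ _ _ hj,
        add_zero, add_comm j p]
    have hloc : shift (j + 2 + c) n p hp (tgen m f (j + 2 + c) j) ∈ loc n p (j + 2) := by
      have ht := tri_mem_loc (f := f) (N := n) (p := p) (a := j) (b := 1) (c := 1) (by omega)
      rw [e]
      exact mul_mem (mul_mem (inv_mem ht) (lam_mem (σ_mem_loc (by omega) (by omega)))) ht
    -- The image of `σ_j` lives on the first `j + 2` of the `k` strands, so `Psi` may be shortened
    -- to these before the pentagon is applied.
    rw [← map_mul, ← map_inv, ← map_mul, Psi_conj f.2 (b := j + 2) (c := c) (by omega)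
      (loc_mono (by omega) (by omega) hloc), e]
    have hp := h.pent (R := n) (p := 0) (a := p) (b := j) (c := 1) (d := 1) (by omega)
    have hD : Commute (lam m (σ n (p + j))) (tri f n 0 p j (1 + 1)) :=
      tri_comm₃ f.2 (by omega) (lam_mem (σ_mem_loc (by omega) (by omega)))
    have hP := Psi_mem_loc (f := f) (N := n) (p := 0) (a := p) (b := j) (by omega)
    have hs := lam_commute (σ_commute_of_loc hP (x := p + j) (by omega)) m
    have hE := tri_comm₁ (N := n) (p := 0) (a := p + j) (b := 1) (c := 1) f.2 (by omega) hP
    rw [zero_add] at hp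
    rw [Psi, Psi, tgen, add_comm j p]
    simp only [map_mul, map_inv] at hp ⊢
    exact (shift_tgen_algebra hp (hD.map (𝒩.q n)) (hs.map (𝒩.q n)) (hE.map (𝒩.q n))).symm
  exact DFunLike.congr_fun this g

/-- The image of a strand crossing a cable is the cabled power `2m+1` of one crossing, up to
rebracketing; the hexagon adds one strand to the cable at a time. -/
theorem Θ_cableUp {N l : ℕ} (hN : l + 1 ≤ N) :
    h.Θ N (cableUp N 0 l) = 𝒩.q N (Psi f N 0 1 l * cab m N 0 l 1) := by
  induction l with
  | zero => rw [cab_zero_one m (by omega)]; simp [cableUp, Psi]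
  | succ l ih =>
    have hx := h.hexUp (R := N) (p := 0) (k := l) (by omega)
    rw [cableUp, map_mul, ih (by omega), Psi, zero_add, h.Θ_σ (by omega), tgen]
    simp only [map_mul, map_inv, zero_add] at hx ⊢
    rw [hx]
    group

theorem Θ_cableDown {N l : ℕ} (hN : l + 1 ≤ N) :
    h.Θ N (cableDown N 0 l) = 𝒩.q N (cab m N 0 1 l * (Psi f N 0 1 l)⁻¹) := by
  induction l with
  | zero => rw [cab_one_zero m (by omega)]; simp [cableDown, Psi]
  | succ l ih =>
    have hx := h.hexDown (R := N) (p := 0) (k := l) (by omega)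
    rw [cableDown, map_mul, ih (by omega), Psi, zero_add, h.Θ_σ (by omega), tgen]
    simp only [map_mul, map_inv, zero_add] at hx ⊢
    rw [← mul_assoc, hx]
    group

/-- This is `coherence` with a middle word of one letter. It compares the two bracketings on either
side of a crossing in `Θ_cable_σ`. -/
theorem Psi_succ_left {N p a b : ℕ} (hN : p + a + b + 1 ≤ N) :
    𝒩.q N (Psi f N p (a + 1) b * (tri f N p a 1 b)⁻¹) =
      𝒩.q N (Psi f N p a (b + 1) * Psi f N (p + a) 1 b) := by
  have := h.coherence (N := N) (p := p) (a := a) (b := 1) (c := b) (by omega)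
  rw [Psi_one_right, mul_one, add_comm 1 b] at this
  rw [map_mul, this, map_mul, map_inv, mul_inv_cancel_right]

end IsPair

theorem cable_lam_σ (m : ℤ) {n l k : ℕ} (hl : 1 ≤ l) (hk : k + 1 < n) (p : Fin n) :
    cable l p (lam m (σ n k)) =
      if (p : ℕ) < k then lam m (σ (n + l - 1) (k + l - 1))
      else if (p : ℕ) = k then cab m (n + l - 1) k l 1
      else if (p : ℕ) = k + 1 then cab m (n + l - 1) k 1 l
      else lam m (σ (n + l - 1) k) := by
  rw [lam_σ_eq_mc m (by omega), cable_mc _ (by rw [pos_one]; omega)]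
  have e : ∀ t : ℕ → ℕ, (∀ i < 2, agg k (fun _ => 1) (single l p) i = t i) → ∀ r,
      mc (n + l - 1) r (agg k (fun _ => 1) (single l p)) (lam m (σ 2 0)) =
        mc (n + l - 1) r t (lam m (σ 2 0)) := fun t ht r => mc_congr _ ht
  have e' : ∀ i, agg k (fun _ => 1) (single l p) i = if k + i ≤ p ∧ (p : ℕ) < k + i + 1 then l else 1 := by
    intro i
    rw [agg, seg_single, pos_one, show 1 + l - 1 = l by omega]
  rcases (show (p : ℕ) < k ∨ (p : ℕ) = k ∨ (p : ℕ) = k + 1 ∨ k + 1 < (p : ℕ) by omega)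
        with h1 | h1 | h1 | h1
  · rw [if_pos h1, if_neg (by omega), lam_σ_eq_mc m (N := n + l - 1) (by omega)]
    exact e _ (fun i hi => by rw [e', if_neg (by omega)]) _
  · rw [if_pos (by omega), if_neg (by omega), if_pos h1, cab]
    refine e _ (fun i hi => ?_) _
    rw [e', h1]
    interval_cases i <;> simp [sz2]
  · rw [if_pos (by omega), if_neg (by omega), if_neg (by omega), if_pos h1, cab]
    refine e _ (fun i hi => ?_) _
    rw [e', h1]
    interval_cases i <;> simp [sz2]
  · rw [if_pos (by omega), if_neg (by omega), if_neg (by omega), if_neg (by omega),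
      lam_σ_eq_mc m (N := n + l - 1) (by omega)]
    exact e _ (fun i hi => by rw [e', if_neg (by omega)]) _

theorem cable_tgen (m : ℤ) {f : Braid 3} (hf : f ∈ PB 3) {n l k : ℕ} (hk : k + 1 < n) (p : Fin n) :
    cable l p (tgen m f n k) = (cable l (ρ n (σ n k) p) (tri f n 0 k 1 1))⁻¹ *
      cable l p (lam m (σ n k)) * cable l p (tri f n 0 k 1 1) := by
  have ht := tri_mem_PB hf (N := n) (p := 0) (a := k) (b := 1) (c := 1) (by omega)
  rw [tgen, cable_of_mem_mul ht, cable_mul, cable_of_mem_inv ht, ρ_lam_σ n k hk]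

namespace IsPair

variable {𝒩 : OpCongr} {m : ℤ} {f : PB 3} (h : IsPair 𝒩 m f)

include h

/-- If the cabled strand does not take part in the crossing, `Psi` commutes with the image of the
generator. If it does, the crossing with the cable is a shift of `cableUp` or `cableDown`, so that
`Θ_shift` and the hexagon computations apply, and `Psi_succ_left` reconciles the rebracketings. -/
theorem Θ_cable_σ {n l k : ℕ} (hl : 1 ≤ l) (hk : k + 1 < n) (p : Fin n) :
    h.Θ _ (cable l p (σ n k)) = 𝒩.q _ (Psi f _ 0 (ρ n (σ n k) p) l * cable l p (tgen m f n k) *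
      (Psi f _ 0 p l)⁻¹) := by
  have hp := p.2
  have hp' : ((ρ n (σ n k) p : Fin n) : ℕ) = if (p : ℕ) = k then k + 1 else
    if (p : ℕ) = k + 1 then k else p := ρ_σ_val n k hk p
  rw [cable_tgen m f.2 hk, cable_lam_σ m hl hk, cable_tri _ hl (by omega), cable_tri _ hl (by omega),
    cable_σ p k hk, hp']
  simp only [Nat.zero_le, true_and, if_true, zero_add]
  rcases (show (p : ℕ) < k ∨ (p : ℕ) = k ∨ (p : ℕ) = k + 1 ∨ k + 1 < (p : ℕ) by omega)
        with h1 | h1 | h1 | h1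
  · rw [cableGen_lt h1, h.Θ_σ (by omega)]
    simp only [if_neg (show (p : ℕ) ≠ k by omega), if_neg (show (p : ℕ) ≠ k + 1 by omega), if_pos h1,
      if_neg (show ¬(k ≤ (p : ℕ) ∧ (p : ℕ) < k + 1) by omega),
      if_neg (show ¬(k + 1 ≤ (p : ℕ) ∧ (p : ℕ) < k + 1 + 1) by omega)]
    congr 1
    have hc := commute_tgen m f.2 (n := n + l - 1) (i := k + l - 1) (by omega)
      (loc_mono le_rfl (by omega) (Psi_mem_loc (f := f) (N := n + l - 1) (p := 0) (a := p) (b := l)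
        (by omega)))
    exact (mul_inv_eq_of_eq_mul hc.eq).symm
  · simp only [h1, cableGen_self, if_true, lt_irrefl, if_false, if_neg (show ¬ k + 1 < k by omega),
      le_refl, if_pos (show k < k + 1 by omega), true_and, if_pos (show k + 1 < k + 1 + 1 by omega), and_false,
      if_neg (show ¬(k + 1 ≤ k ∧ k < k + 1 + 1) by omega)]
    have e : cableUp (n + l - 1) k l = shift (l + 1) (n + l - 1) k (by omega) (cableUp (l + 1) 0 l) := by
      rw [shift_cableUp (by omega), add_zero]
    rw [e, h.Θ_shift, h.Θ_cableUp le_rfl, 𝒩.shiftQ_q, map_mul, shift_Psi (by omega),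
      shift_cab m (by omega), add_zero]
    have e2 := h.Psi_succ_left (N := n + l - 1) (p := 0) (a := k) (b := l) (by omega)
    rw [zero_add] at e2
    rw [show 1 + l - 1 = l by omega]
    simp only [map_mul, map_inv] at e2 ⊢
    simp only [← mul_assoc] at e2 ⊢
    rw [e2, Psi]
    simp only [map_mul, map_inv]
    group
  · simp only [h1, cableGen_succ, if_true, lt_irrefl, if_false, if_neg (show ¬ k + 1 < k by omega),
      if_neg (show ¬ k + 1 = k by omega),
      le_refl, if_pos (show k < k + 1 by omega), true_and, if_pos (show k + 1 < k + 1 + 1 by omega), and_false,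
      if_neg (show ¬(k + 1 ≤ k ∧ k < k + 1 + 1) by omega)]
    have e : cableDown (n + l - 1) k l =
        shift (l + 1) (n + l - 1) k (by omega) (cableDown (l + 1) 0 l) := by
      rw [shift_cableDown (by omega), add_zero]
    rw [e, h.Θ_shift, h.Θ_cableDown le_rfl, 𝒩.shiftQ_q, map_mul, map_inv, shift_Psi (by omega),
      shift_cab m (by omega), add_zero]
    have e2 := h.Psi_succ_left (N := n + l - 1) (p := 0) (a := k) (b := l) (by omega)
    rw [zero_add] at e2
    have e3 := congrArg (fun x => x⁻¹) e2
    rw [show 1 + l - 1 = l by omega]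
    simp only [map_mul, map_inv, mul_inv_rev, inv_inv] at e3 ⊢
    simp only [mul_assoc] at e3 ⊢
    rw [e3, Psi]
    simp only [map_mul, map_inv]
    group
  · rw [cableGen_gt h1, h.Θ_σ (by omega)]
    simp only [if_neg (show (p : ℕ) ≠ k by omega), if_neg (show (p : ℕ) ≠ k + 1 by omega),
      if_neg (show ¬ (p : ℕ) < k by omega),
      if_neg (show ¬(k ≤ (p : ℕ) ∧ (p : ℕ) < k + 1) by omega),
      if_neg (show ¬(k + 1 ≤ (p : ℕ) ∧ (p : ℕ) < k + 1 + 1) by omega)]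
    congr 1
    have hc := Psi_comm f.2 (N := n + l - 1) (p := 0) (a := p) (b := l) (by omega)
      (loc_mono le_rfl (by omega) (tgen_mem_loc m f (n := n + l - 1) (i := k) (by omega)))
    exact (mul_inv_eq_of_eq_mul hc.symm.eq).symm

/-- Both sides obey the cocycle rule of `cable_mul`: in a product the `Psi` at the intermediate
position of the strand cancels. So the case of generators suffices. -/
theorem Θ_cable {n l : ℕ} (hl : 1 ≤ l) (g : Braid n) (p : Fin n) {y : Braid n}
    (hy : h.Θ n g = 𝒩.q n y) :
    h.Θ _ (cable l p g) = 𝒩.q _ (Psi f _ 0 (ρ n g p) l * cable l p y * (Psi f _ 0 p l)⁻¹) := by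
  induction g using braid_induction generalizing p y with
  | one =>
    have := 𝒩.q_cable hl p ((map_one (𝒩.q n)).trans ((map_one (h.Θ n)).symm.trans hy))
    rw [cable_one, map_one, map_one, Equiv.Perm.one_apply]
    rw [cable_one, map_one] at this
    rw [map_mul, map_mul, ← this, mul_one, map_inv, mul_inv_cancel]
  | mul g g' hg hg' =>
    obtain ⟨z, hz⟩ := 𝒩.q_surjective n (h.Θ n g)
    obtain ⟨z', hz'⟩ := 𝒩.q_surjective n (h.Θ n g')
    have hyz : 𝒩.q n y = 𝒩.q n (z * z') := by rw [← hy, map_mul, map_mul, hz, hz']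
    have := 𝒩.q_cable hl p hyz
    rw [cable_mul, h.ρ_of_Θ hz'.symm] at this
    rw [cable_mul, map_mul, hg _ hz.symm, hg' p hz'.symm, map_mul (ρ n), Equiv.Perm.mul_apply]
    simp only [map_mul, map_inv] at this ⊢
    rw [this]
    group
  | inv g hg =>
    have hy' : h.Θ n g = 𝒩.q n y⁻¹ := by rw [map_inv, ← hy, map_inv, inv_inv]
    rw [cable_inv, map_inv, hg _ hy', perm_apply_inv, cable_inv, ← map_inv (ρ n), map_inv (ρ n) y,
      h.ρ_of_Θ hy, map_inv (ρ n) g, inv_inv, perm_apply_inv]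
    simp only [map_mul, map_inv]
    group
  | gen k hk =>
    rw [h.Θ_σ hk] at hy
    have := 𝒩.q_cable hl p hy
    rw [h.Θ_cable_σ hl hk]
    simp only [map_mul, map_inv] at this ⊢
    rw [this]

end IsPair

/-! ### Constructions of operadic congruences -/

theorem le_pos {s : ℕ → ℕ} {k : ℕ} (hs : ∀ i < k, 1 ≤ s i) : k ≤ pos s k := by
  conv_lhs => rw [← pos_one k]
  exact Finset.sum_le_sum fun i hi => hs i (Finset.mem_range.1 hi)

theorem eq_one_of_pos_le {s : ℕ → ℕ} {k : ℕ} (hs : ∀ i < k, 1 ≤ s i) (h : pos s k ≤ k) {i : ℕ}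
    (hi : i < k) : s i = 1 := by
  by_contra hne
  have : pos (fun _ => 1) k < pos s k := Finset.sum_lt_sum
    (fun j hj => hs j (Finset.mem_range.1 hj)) ⟨i, Finset.mem_range.2 hi, by have := hs i hi; omega⟩
  rw [pos_one] at this
  omega

/-- A family of subgroups which is stable under the addition of one vertical strand and under the
doubling of one strand is stable under cabling. -/
theorem mc_mem_of_le_pull {N : ∀ n, Subgroup (Braid n)} (hN : ∀ n, N n ≤ pull (N (n + 1)))
    {k n p : ℕ} {s : ℕ → ℕ} {g : Braid k} (hg : g ∈ N k) (hs : ∀ i < k, 1 ≤ s i)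
    (h : p + pos s k ≤ n) : mc n p s g ∈ N n := by
  have hk := le_pos hs
  obtain ⟨d, hd⟩ : ∃ d, n = k + d := ⟨n - k, by omega⟩
  -- Induction on the number `d` of strands to be added; each step realizes one of them by an
  -- operation that occurs in `pull`.
  induction d generalizing k p s with
  | zero =>
    obtain rfl : n = k := hd
    obtain rfl : p = 0 := by omega
    rw [mc_congr g (t := fun _ => 1) fun i hi => eq_one_of_pos_le hs (by omega) hi, mc_ones_self]
    exact hg
  | succ d ih =>
    obtain ⟨-, hR, hL, hD⟩ := hN k hg
    by_cases hp : p = 0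
    · subst hp
      by_cases hlt : pos s k < n
      · have h1 : pos (fun i => if i < k then s i else 1) (k + 1) = pos s k + 1 := by
          rw [pos_succ, if_neg (lt_irrefl k)]
          congr 1
          exact pos_congr fun j hj => if_pos hj
        have := ih (p := 0) (s := fun i => if i < k then s i else 1) hR
          (fun i _ => by split_ifs with h2; exacts [hs i h2, le_rfl])
          (by rw [h1]; omega) (by rw [h1]; omega) (by omega)
        rw [addRight, mc_shift g _ (by rw [h1]; omega), pos_zero] at this
        rwa [mc_congr g (t := s) fun i hi => by simp [hi]] at this
      -- There is no vertical strand, so some cable has at least two strands. Strand `j` is doubled,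
      -- and its two copies get the sizes `1` and `s j - 1`.
      · obtain ⟨j, hj, hj2⟩ : ∃ j < k, 2 ≤ s j := by
          by_contra hcon
          push Not at hcon
          have : pos s k ≤ pos (fun _ => 1) k := Finset.sum_le_sum fun i hi => by
            have := hcon i (Finset.mem_range.1 hi); omega
          rw [pos_one] at this
          omega
        obtain ⟨s', hs'⟩ : ∃ s' : ℕ → ℕ, s' = fun i =>
          if i < j then s i else if i = j then 1 else if i = j + 1 then s j - 1 else s (i - 1) := ⟨_, rfl⟩
        have hagg : ∀ i < k, agg 0 (single 2 j) s' i = s i := by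
          intro i hi
          rw [agg, pos_single, single, zero_add]
          rcases lt_trichotomy i j with h2 | rfl | h2
          · rw [if_pos (by omega), if_neg (by omega), seg_one, hs']
            simp [h2]
          · rw [if_pos rfl, if_pos le_rfl, seg_succ, seg_one, hs']
            simp
            omega
          · rw [if_neg (by omega), if_neg (by omega), seg_one, hs']
            simp only
            rw [if_neg (by omega), if_neg (by omega), if_neg (by omega)]
            rfl
        have hpos : pos s' (k + 1) = pos s k := by
          have := pos_agg 0 (single 2 j) s' k
          rw [pos_congr hagg, pos_single, if_neg (by omega), pos_zero] at this
          rw [zero_add, zero_add] at this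
          exact this.symm
        have hs1 : ∀ i < k + 1, 1 ≤ s' i := by
          intro i hi
          rw [hs']
          simp only
          split_ifs
          · exact hs i (by omega)
          · exact le_rfl
          · omega
          · exact hs _ (by omega)
        have := ih (p := 0) (s := s') (hD ⟨j, hj⟩) hs1 (by rw [hpos]; omega)
          (by rw [hpos]; omega) (by omega)
        rw [double, cable_eq_mc] at this
        rw [mc_mc (N := k + 2 - 1) g (single 2 j) s' (by rw [pos_single]; split_ifs <;> omega)
          (by rw [show k + 2 - 1 = k + 1 by omega, hpos]; omega), mc_congr g hagg] at this
        exact this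
    -- One of the vertical strands on the left is added to `g`, as a new first strand of size `1`.
    · obtain ⟨p, rfl⟩ : ∃ p', p = p' + 1 := ⟨p - 1, by omega⟩
      obtain ⟨s', hs'⟩ : ∃ s' : ℕ → ℕ, s' = fun i => if i = 0 then 1 else s (i - 1) := ⟨_, rfl⟩
      have h1 : pos s' (k + 1) = pos s k + 1 := by
        rw [pos, Finset.sum_range_succ', hs']
        simp [pos]
      have := ih (p := p) (s := s') hL
        (fun i hi => by
          rw [hs']; simp only; split_ifs
          exacts [le_rfl, hs _ (by omega)])
        (by rw [h1]; omega) (by rw [h1]; omega) (by omega)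
      rw [addLeft, mc_shift g _ (by rw [h1]; omega)] at this
      rwa [mc_congr g (t := s) fun i hi => by simp [hs'], show pos s' 1 = 1 by simp [pos, hs']] at this

theorem PB_le_pull (n : ℕ) : PB n ≤ pull (PB (n + 1)) := fun _ hg =>
  ⟨hg, addRight_mem hg, addLeft_mem hg, fun p => double_mem hg p⟩

instance PB_finiteIndex (n : ℕ) : (PB n).FiniteIndex := Subgroup.finiteIndex_ker (ρ n)

/-- Cabling as a homomorphism on pure braids. -/
def mcPB {n : ℕ} (R p : ℕ) (s : ℕ → ℕ) : PB n →* Braid R where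
  toFun g := mc R p s (g : Braid n)
  map_one' := mc_one s
  map_mul' g h := mc_of_mem_mul h.2 g

section ofTop

variable (R : ℕ) (L : Subgroup (Braid R))

/-- The pure braids all of whose cablings with `R` strands are in `L`. -/
def topSubgroup (n : ℕ) : Subgroup (Braid n) where
  -- Zero sizes are allowed. The resulting stability under the deletion of strands is used in
  -- `mc_pentagon` and in `OpCongr.exists_NFI`.
  carrier := {g | g ∈ PB n ∧ ∀ p s, p + pos s n ≤ R → mc R p s g ∈ L}
  one_mem' := ⟨one_mem _, fun p s _ => by rw [mc_one]; exact one_mem _⟩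
  mul_mem' {g h} hg hh := ⟨mul_mem hg.1 hh.1, fun p s hR => by
    rw [mc_of_mem_mul hh.1]; exact mul_mem (hg.2 p s hR) (hh.2 p s hR)⟩
  inv_mem' {g} hg := ⟨inv_mem hg.1, fun p s hR => by
    rw [mc_of_mem_inv hg.1]; exact inv_mem (hg.2 p s hR)⟩

theorem mem_of_mem_topSubgroup {g : Braid R} (hg : g ∈ topSubgroup R L R) : g ∈ L := by
  have := hg.2 0 (fun _ => 1) (by rw [pos_one]; omega)
  rwa [mc_ones_self] at this

theorem topSubgroup_normal [hL : L.Normal] (n : ℕ) : (topSubgroup R L n).Normal where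
  conj_mem h hh g := by
    refine ⟨(MonoidHom.normal_ker (ρ n)).conj_mem h hh.1 g, fun p s hR => ?_⟩
    rw [mc_mul, mc_mul, act_of_mem hh.1, mc_inv]
    exact hL.conj_mem _ (hh.2 p _ (by rwa [pos_act _ _ _ le_rfl])) _

/-- Only `p` and the first `n` sizes matter, and all of them are at most `R`. So inside `PB n` this
is a finite intersection of preimages of `L` under homomorphisms. -/
theorem topSubgroup_finiteIndex [hL : L.FiniteIndex] (n : ℕ) : (topSubgroup R L n).FiniteIndex := by
  let e : (Fin n → Fin (R + 1)) → ℕ → ℕ := fun s i => if h : i < n then s ⟨i, h⟩ else 1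
  let M : Subgroup (PB n) :=
    ⨅ x : Fin (R + 1) × (Fin n → Fin (R + 1)), L.comap (mcPB R x.1 (e x.2))
  have hM : M.FiniteIndex := Subgroup.finiteIndex_iInf fun x => ⟨by
    rw [Subgroup.index_comap]
    exact (Subgroup.isFiniteRelIndex_of_finiteIndex).relIndex_ne_zero⟩
  have h2 : (M.map (PB n).subtype).FiniteIndex := ⟨by
    rw [Subgroup.index_map_subtype]
    exact mul_ne_zero hM.index_ne_zero (PB_finiteIndex n).index_ne_zero⟩
  refine Subgroup.finiteIndex_of_le (H := M.map (PB n).subtype) ?_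
  rintro _ ⟨g, hg, rfl⟩
  refine ⟨g.2, fun p s hR => ?_⟩
  have hlt : ∀ i < n, s i < R + 1 := fun i hi => by
    have := Finset.single_le_sum (f := s) (fun j _ => Nat.zero_le (s j)) (Finset.mem_range.2 hi)
    change s i ≤ pos s n at this
    omega
  have := (Subgroup.mem_iInf.1 hg) (⟨p, by omega⟩, fun i => ⟨s i, hlt i i.2⟩)
  change mc R p _ (g : Braid n) ∈ L at this
  rwa [mc_congr (t := s) _ fun i hi => by simp [e, hi]] at this

theorem mc_mem_topSubgroup {k n p : ℕ} {s : ℕ → ℕ} {g : Braid k} (hg : g ∈ topSubgroup R L k)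
    (h : p + pos s k ≤ n) : mc n p s g ∈ topSubgroup R L n := by
  refine ⟨mc_mem_PB hg.1 s h, fun p' s' h' => ?_⟩
  have hk := pos_mono s' h
  have e := pos_agg p s s' k
  rw [mc_mc g s s' h h']
  exact hg.2 _ _ (by omega)

/-- The operadic congruence given by a normal subgroup of finite index of `B_R`. -/
def OpCongr.ofTop [L.Normal] [L.FiniteIndex] : OpCongr where
  N := topSubgroup R L
  normal := topSubgroup_normal R L
  finiteIndex := topSubgroup_finiteIndex R L
  le_PB _ _ h := h.1
  mc_mem hg _ h := mc_mem_topSubgroup R L hg h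

end ofTop

/-- The conditions that define `pull` are among those of `topSubgroup`, whose index is finite. -/
theorem pull_finiteIndex {n : ℕ} (N : Subgroup (Braid (n + 1))) [N.FiniteIndex] :
    (pull N).FiniteIndex := by
  have := topSubgroup_finiteIndex (n + 1) N n
  refine Subgroup.finiteIndex_of_le (H := topSubgroup (n + 1) N n) fun g hg => ⟨hg.1, ?_, ?_, fun p => ?_⟩
  · rw [addRight, shift_eq_mc]
    exact hg.2 _ _ (by rw [pos_one]; omega)
  · rw [addLeft, shift_eq_mc]
    exact hg.2 _ _ (by rw [pos_one]; omega)
  · have := p.2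
    rw [double, cable_eq_mc]
    exact hg.2 0 (single 2 p) (by rw [pos_single]; split_ifs <;> omega)

theorem pull_le_PB {n : ℕ} (N : Subgroup (Braid (n + 1))) : pull N ≤ PB n := fun _ h => h.1

theorem braid_eq_one {n : ℕ} (hn : n ≤ 1) (g : Braid n) : g = 1 := by
  induction g using braid_induction with
  | one => rfl
  | mul g h hg hh => rw [hg, hh, mul_one]
  | inv g hg => rw [hg, inv_one]
  | gen i hi => omega

theorem le_pull_of_le_one {n : ℕ} (hn : n ≤ 1) (K : Subgroup (Braid n)) (N : Subgroup (Braid (n + 1))) :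
    K ≤ pull N := fun g _ => by rw [braid_eq_one hn g]; exact one_mem _

/-- The family of normal subgroups given by an element of `NFI`. -/
def NFI.fam (N : NFI) : ∀ n, Subgroup (Braid n)
  | 2 => N.N2
  | 3 => N.N3
  | 4 => N.N
  -- No condition beyond purity is imposed on other numbers of strands: the relations and the data
  -- of a pair only involve 2, 3 and 4 strands.
  | n => PB n

theorem NFI.fam_le_pull (N : NFI) : ∀ n, N.fam n ≤ pull (N.fam (n + 1))
  | 0 | 1 => le_pull_of_le_one (by omega) _ _
  | 2 => le_refl N.N2
  | 3 => le_refl N.N3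
  | 4 => N.le_PB.trans (PB_le_pull 4)
  | _ + 5 => PB_le_pull _

/-- The operadic congruence given by an element of `NFI`. -/
def NFI.oc (N : NFI) : OpCongr where
  N := N.fam
  normal
    | 0 | 1 => inferInstanceAs (PB _).Normal
    | 2 => inferInstanceAs N.N2.Normal
    | 3 => inferInstanceAs N.N3.Normal
    | 4 => N.normal
    | _ + 5 => inferInstanceAs (PB _).Normal
  finiteIndex
    | 0 | 1 => PB_finiteIndex _
    | 2 =>
      have := N.finiteIndex
      have : N.N3.FiniteIndex := pull_finiteIndex N.N
      pull_finiteIndex N.N3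
    | 3 =>
      have := N.finiteIndex
      pull_finiteIndex N.N
    | 4 => N.finiteIndex
    | _ + 5 => PB_finiteIndex _
  le_PB
    | 0 | 1 => le_rfl
    | 2 => pull_le_PB _
    | 3 => pull_le_PB _
    | 4 => N.le_PB
    | _ + 5 => le_rfl
  mc_mem := mc_mem_of_le_pull N.fam_le_pull

/-- The intersection of two operadic congruences. -/
instance : Min OpCongr where
  min 𝒩 ℳ :=
    { N := fun n => 𝒩.N n ⊓ ℳ.N n
      normal := fun _ => inferInstance
      finiteIndex := fun _ => inferInstance
      le_PB := fun n => inf_le_left.trans (𝒩.le_PB n)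
      mc_mem := fun hg hs h => ⟨𝒩.mc_mem hg.1 hs h, ℳ.mc_mem hg.2 hs h⟩ }

/-! ### Kernels of the homomorphisms of a pair -/

namespace IsPair

variable {𝒩 : OpCongr} {m : ℤ} {f : PB 3} (h : IsPair 𝒩 m f)

theorem shift_mem_ker {k n p : ℕ} (hp : p + k ≤ n) {g : Braid k} (hg : g ∈ (h.Θ k).ker) :
    shift k n p hp g ∈ (h.Θ n).ker := by
  rw [MonoidHom.mem_ker] at hg ⊢
  rw [h.Θ_shift, hg, map_one, mul_one, mul_inv_cancel]

theorem ker_le_PB (n : ℕ) : (h.Θ n).ker ≤ PB n := fun g hg => by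
  rw [MonoidHom.mem_ker] at hg ⊢
  rw [← h.ρQ_Θ, hg, map_one]

theorem cable_mem_ker {n l : ℕ} (hl : 1 ≤ l) (p : Fin n) {g : Braid n} (hg : g ∈ (h.Θ n).ker) :
    cable l p g ∈ (h.Θ _).ker := by
  have h1 : ρ n g = 1 := h.ker_le_PB n hg
  rw [MonoidHom.mem_ker] at hg ⊢
  rw [h.Θ_cable hl g p (y := 1) (by rw [hg, map_one]), h1, Equiv.Perm.one_apply, cable_one, mul_one,
    mul_inv_cancel, map_one]

/-- The kernels of the homomorphisms `Θ` form an operadic congruence. -/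
def ker : OpCongr where
  N n := (h.Θ n).ker
  normal _ := inferInstance
  finiteIndex n := Subgroup.finiteIndex_ker (h.Θ n)
  le_PB := h.ker_le_PB
  mc_mem := mc_mem_of_le_pull fun n _ hg => ⟨h.ker_le_PB n hg, h.shift_mem_ker _ hg,
    h.shift_mem_ker _ hg, fun p => h.cable_mem_ker (l := 2) (by omega) p hg⟩

/-- The kernel of `Θ` is determined by the kernel for one more strand. -/
theorem ker_eq_pull {n : ℕ} (hn : pull (𝒩.N (n + 1)) ≤ 𝒩.N n) :
    h.ker.N n = pull (h.ker.N (n + 1)) := by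
  apply le_antisymm
  · exact fun g hg => ⟨h.ker_le_PB n hg, h.shift_mem_ker _ hg,
      h.shift_mem_ker _ hg, fun p => h.cable_mem_ker (l := 2) (by omega) p hg⟩
  · rintro g ⟨hg, hR, hL, hD⟩
    obtain ⟨y, hy⟩ := 𝒩.q_surjective n (h.Θ n g)
    have hρ : ρ n y = 1 := by rw [h.ρ_of_Θ hy.symm]; exact hg
    have hρg : ρ n g = 1 := hg
    change h.Θ n g = 1
    rw [← hy, 𝒩.q_eq_one_iff]
    -- Here `y` represents the image of `g`. By `Θ_shift` and `Θ_cable` the images of the enlarged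
    -- braids are conjugate to the enlarged `y`; as the former are trivial, `y` lies in `pull`.
    refine hn ⟨hρ, ?_, ?_, fun p => ?_⟩
    · have h1 : h.Θ (n + 1) (addRight g) = 1 := hR
      rw [addRight, h.Θ_shift, ← hy, 𝒩.shiftQ_q, conj_eq_one_iff, 𝒩.q_eq_one_iff] at h1
      exact h1
    · have h1 : h.Θ (n + 1) (addLeft g) = 1 := hL
      rw [addLeft, h.Θ_shift, ← hy, 𝒩.shiftQ_q, conj_eq_one_iff, 𝒩.q_eq_one_iff] at h1
      exact h1
    · have h1 : h.Θ (n + 2 - 1) (cable 2 p g) = 1 := hD p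
      rw [h.Θ_cable (by omega) g p hy.symm, hρg, Equiv.Perm.one_apply, map_mul, map_mul, map_inv,
        conj_eq_one_iff, 𝒩.q_eq_one_iff] at h1
      exact h1

end IsPair

/-! ### Shapes of parenthesized words -/

/-- The shape of a word of the free magma. -/
inductive Shape : Type
  | leaf : Shape
  | node : Shape → Shape → Shape

namespace Shape

/-- The number of letters. -/
def size : Shape → ℕ
  | leaf => 1
  | node u v => size u + size v

theorem size_pos (w : Shape) : 0 < w.size := by
  induction w with
  | leaf => exact Nat.one_pos
  | node u v hu hv => rw [size]; omega

/-- The result of replacing the letter at the position `p` of `w` by `u`. -/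
def ins (p : ℕ) (w u : Shape) : Shape :=
  match w with
  | leaf => u
  | node v v' => if p < v.size then node (ins p v u) v' else node v (ins (p - v.size) v' u)

theorem size_ins (p : ℕ) (w u : Shape) (hp : p < w.size) : (ins p w u).size = w.size + u.size - 1 := by
  have hu := u.size_pos
  induction w generalizing p with
  | leaf => rw [ins, size]; omega
  | node v v' hv hv' =>
    rw [size] at hp ⊢
    have h1 := v.size_pos
    have h2 := v'.size_pos
    rw [ins]
    split_ifs with h
    · rw [size, hv p h]; omega
    · rw [size, hv' _ (by omega)]; omega

end Shape

/-- The shape of a word. -/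
def shape : FreeMagma ℕ → Shape
  | .of _ => .leaf
  | .mul u v => .node (shape u) (shape v)

theorem shape_mul (u v : FreeMagma ℕ) : shape (u * v) = .node (shape u) (shape v) := rfl

theorem leaves_mul (u v : FreeMagma ℕ) : leaves (u * v) = leaves u ++ leaves v := rfl

theorem size_shape (w : FreeMagma ℕ) : (shape w).size = (leaves w).length := by
  induction w with
  | ih1 j => rfl
  | ih2 u v hu hv => rw [shape_mul, leaves_mul, Shape.size, hu, hv, List.length_append]

theorem shape_map (g : ℕ → ℕ) (w : FreeMagma ℕ) : shape (FreeMagma.map g w) = shape w := by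
  induction w with
  | ih1 j => rfl
  | ih2 u v hu hv => rw [map_mul, shape_mul, shape_mul, hu, hv]

theorem shape_insert_of_notMem (i m : ℕ) (w v : FreeMagma ℕ) (h : i ∉ leaves v) :
    shape (FreeMagma.lift (PaB.insertLetter i m w) v) = shape v := by
  induction v with
  | ih1 j =>
    have : j ≠ i := fun e => h (by rw [e]; exact List.mem_singleton_self i)
    rw [FreeMagma.lift_of, PaB.insertLetter, if_neg this]
    split_ifs <;> rfl
  | ih2 u v hu hv =>
    rw [leaves_mul, List.mem_append, not_or] at h
    rw [map_mul, shape_mul, hu h.1, hv h.2, shape_mul]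

theorem shape_insert (i m : ℕ) (w v : FreeMagma ℕ) (h : i ∈ leaves v) (hv : (leaves v).Nodup) :
    shape (FreeMagma.lift (PaB.insertLetter i m w) v) =
      Shape.ins ((leaves v).idxOf i) (shape v) (shape w) := by
  induction v with
  | ih1 j =>
    obtain rfl : i = j := List.mem_singleton.1 h
    rw [FreeMagma.lift_of, PaB.insertLetter, if_neg (lt_irrefl _), if_pos rfl, shape_map]
    rfl
  | ih2 u v hu hv' =>
    rw [leaves_mul] at h hv
    rw [map_mul, shape_mul, shape_mul, Shape.ins, leaves_mul, List.idxOf_append, size_shape]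
    rw [List.nodup_append] at hv
    by_cases hiu : i ∈ leaves u
    · have hiv : i ∉ leaves v := fun hiv => hv.2.2 _ hiu _ hiv rfl
      rw [if_pos hiu, if_pos (List.idxOf_lt_length_of_mem hiu), hu hiu hv.1,
        shape_insert_of_notMem _ _ _ _ hiv]
    · have hiv : i ∈ leaves v := (List.mem_append.1 h).resolve_left hiu
      rw [if_neg hiu, if_neg (by omega), hv' hiv hv.2.1, shape_insert_of_notMem _ _ _ _ hiu,
        Nat.add_sub_cancel]

namespace PaB

variable {n m : ℕ}

/-- The shape of an object. -/
def sh (a : PaB n) : Shape := shape a.word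

theorem size_sh (a : PaB n) : a.sh.size = n := by rw [sh, size_shape, a.length_leaves]

theorem sh_permObj (θ : Equiv.Perm (Fin n)) (a : PaB n) : (permObj θ a).sh = a.sh := shape_map _ _

theorem sh_insertObj (i : Fin n) (a : PaB n) (c : PaB m) :
    (insertObj i a c).sh = Shape.ins ((𝔭 a)⁻¹ i : Fin n) a.sh c.sh :=
  shape_insert _ _ _ _ ((a.mem_leaves i).2 i.2) a.nodup_leaves

/-- The morphism `γ ∘_i η`. -/
def insMor (i : Fin n) {a b : PaB n} (γ : a ⟶ b) {c d : PaB m} (η : c ⟶ d) :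
    insertObj i a c ⟶ insertObj i b d := Hom.mk (insertBraid i γ η) (ρ_insertBraid i γ η)

theorem ou_insMor (i : Fin n) {a b : PaB n} (γ : a ⟶ b) {c d : PaB m} (η : c ⟶ d) :
    ou (insMor i γ η) = insertBraid i γ η := rfl

end PaB

/-! ### Coherence for arbitrary words and insertions -/

/-- The coherence isomorphism from a word to the left-normed word. -/
def Phi (f : Braid 3) (N r : ℕ) : Shape → Braid N
  | .leaf => 1
  | .node u v => Psi f N r u.size v.size * Phi f N r u * Phi f N (r + u.size) v

section Phi

variable {f : Braid 3} (hf : f ∈ PB 3) {N r : ℕ}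

include hf

theorem Phi_mem_PB (w : Shape) (hN : r + w.size ≤ N) : Phi f N r w ∈ PB N := by
  induction w generalizing r with
  | leaf => exact one_mem _
  | node u v hu hv =>
    rw [Shape.size] at hN
    exact mul_mem (mul_mem (Psi_mem_PB hf (by omega)) (hu (by omega))) (hv (by omega))

omit hf in
theorem Phi_mem_loc (w : Shape) (hN : r + w.size ≤ N) : Phi f N r w ∈ loc N r w.size := by
  induction w generalizing r with
  | leaf => exact one_mem _
  | node u v hu hv =>
    rw [Shape.size] at hN ⊢
    exact mul_mem (mul_mem (Psi_mem_loc (by omega)) (loc_mono le_rfl (by omega) (hu (by omega))))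
      (loc_mono (by omega) (by omega) (hv (by omega)))

/-- As long as the cabled strand is outside the second word, the factors of `Psi` correspond one to
one. Cabling a strand of the second word changes their number; this is `IsPair.Psi_ins`, which needs
the pentagon. -/
theorem cable_Psi {m p a b : ℕ} (hm : 1 ≤ m) (hN : p + a + b ≤ N) (x : Fin N)
    (hx : (x : ℕ) < p + a ∨ p + a + b ≤ x) : cable m x (Psi f N p a b) =
      Psi f (N + m - 1) (if p ≤ x then p else p + m - 1)
        (if p ≤ x ∧ (x : ℕ) < p + a then a + m - 1 else a) b := by
  induction b with
  | zero => exact cable_one x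
  | succ b ih =>
    have ht := tri_mem_PB hf (N := N) (p := p) (a := a) (b := b) (c := 1) (by omega)
    rw [Psi, Psi, cable_of_mem_mul (inv_mem ht), cable_of_mem_inv ht, ih (by omega) (by omega),
      cable_tri f hm (by omega)]
    congr 2
    rw [if_neg (c := p + a ≤ (x : ℕ) ∧ (x : ℕ) < p + a + b) (by omega),
      if_neg (c := p + a + b ≤ (x : ℕ) ∧ (x : ℕ) < p + a + b + 1) (by omega)]

theorem cable_Phi {m : ℕ} (hm : 1 ≤ m) (w : Shape) (hN : r + w.size ≤ N) (x : Fin N)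
    (hx : (x : ℕ) < r ∨ r + w.size ≤ x) : cable m x (Phi f N r w) =
      Phi f (N + m - 1) (if r ≤ x then r else r + m - 1) w := by
  induction w generalizing r with
  | leaf => exact cable_one x
  | node u v hu hv =>
    rw [Shape.size] at hN hx
    have := u.size_pos
    have := v.size_pos
    rw [Phi, Phi, cable_of_mem_mul (Phi_mem_PB hf _ (by omega)),
      cable_of_mem_mul (Phi_mem_PB hf _ (by omega)), hu (by omega) (by omega),
      hv (by omega) (by omega), cable_Psi hf hm (by omega) x (by omega),
      if_neg (c := r ≤ (x : ℕ) ∧ (x : ℕ) < r + u.size) (by omega)]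
    congr 2
    split_ifs <;> omega

end Phi

theorem shift_Phi {f : Braid 3} {n N r p : ℕ} (w : Shape) (hn : p + w.size ≤ n) (h : r + n ≤ N) :
    shift n N r h (Phi f n p w) = Phi f N (r + p) w := by
  induction w generalizing p with
  | leaf => exact map_one _
  | node u v hu hv =>
    rw [Shape.size] at hn
    rw [Phi, Phi, map_mul, map_mul, shift_Psi (by omega), hu (by omega), hv (by omega), add_assoc]

theorem ins_algebra {G : Type*} [Group G] {X A W B Q' : G} (h₁ : Commute X Q') (h₂ : Commute W B) :
    Q' * (X * A * W) * B = X * (Q' * A * B) * W := by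
  calc _ = Q' * X * A * (W * B) := by group
    _ = (X * Q') * A * (B * W) := by rw [h₁.eq, h₂.eq]
    _ = _ := by group

namespace IsPair

variable {𝒩 : OpCongr} {m : ℤ} {f : PB 3} (h : IsPair 𝒩 m f)

include h

/-- By induction on `b`, removing the last associator. If the cabled strand is the last one of the
second word, the statement is `coherence`; otherwise the last associator commutes with the inner
`Psi`. -/
theorem Psi_ins {N p a b l y : ℕ} (hl : 1 ≤ l) (hy : y < b) (hN : p + a + b ≤ N) :
    𝒩.q (N + l - 1) (Psi f (N + l - 1) p a (b + l - 1) * Psi f (N + l - 1) (p + a) y l) =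
      𝒩.q (N + l - 1) (Psi f (N + l - 1) p (a + y) l *
        cable l ⟨p + a + y, by omega⟩ (Psi f N p a b)) := by
  induction b with
  | zero => omega
  | succ b ih =>
    have ht := tri_mem_PB f.2 (N := N) (p := p) (a := a) (b := b) (c := 1) (by omega)
    rw [Psi, cable_of_mem_mul (inv_mem ht), cable_of_mem_inv ht, cable_tri _ hl (by omega),
      if_pos (c := p ≤ _) (by simp only; omega), if_neg (c := p ≤ _ ∧ _) (by simp only; omega)]
    rcases (show y = b ∨ y < b by omega) with rfl | hlt
    · rw [cable_Psi f.2 hl (by omega) _ (by simp only; omega), if_pos (by simp only; omega),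
        if_neg (by simp only; omega), if_neg (by simp only; omega), if_pos (by simp only; omega)]
      have := h.coherence (N := N + l - 1) (p := p) (a := a) (b := y) (c := l) (by omega)
      rw [show y + 1 + l - 1 = y + l by omega, show 1 + l - 1 = l by omega]
      simp only [map_mul, map_inv] at this ⊢
      rw [← mul_assoc, this, mul_inv_cancel_right]
    · have ih := ih hlt (by omega)
      rw [if_pos (by simp only; omega), if_neg (by simp only; omega),
        show b + 1 + l - 1 = b + l - 1 + 1 by omega, Psi]
      have hc := ((tri_comm₂ (N := N + l - 1) (p := p) (a := a) (b := b + l - 1) (c := 1) f.2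
        (by omega) (loc_mono le_rfl (by omega) (Psi_mem_loc (f := f) (N := N + l - 1) (p := p + a)
          (a := y) (b := l) (by omega)))).map (𝒩.q _)).inv_right
      simp only [map_mul, map_inv] at ih ⊢
      rw [mul_assoc, ← hc.eq, ← mul_assoc, ih, mul_assoc]

/-- To left-normalize a word with `u` inserted, one may left-normalize `u`, then the outer word with
`u` carried along as a cable, and finally merge the two by `Psi`. In the induction on `w`, an
insertion in the left factor only needs commutations, one in the right factor needs `Psi_ins`. -/
theorem Phi_ins {N r p : ℕ} (w u : Shape) (hp : p < w.size) (hN : r + w.size ≤ N) :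
    𝒩.q (N + u.size - 1) (Phi f (N + u.size - 1) r (Shape.ins p w u)) =
      𝒩.q (N + u.size - 1) (Psi f (N + u.size - 1) r p u.size *
        cable u.size ⟨r + p, by omega⟩ (Phi f N r w) * Phi f (N + u.size - 1) (r + p) u) := by
  have hl := u.size_pos
  induction w generalizing r p with
  | leaf =>
    obtain rfl : p = 0 := by rw [Shape.size] at hp; omega
    rw [Shape.ins, Phi, cable_one, Psi_zero_left, mul_one, one_mul, add_zero]
  | node v v' hv hv' =>
    rw [Shape.size] at hp hN
    have h1 := v.size_pos
    have h2 := v'.size_pos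
    have e1 := cable_of_mem_mul (m := u.size) (Phi_mem_PB f.2 (N := N) (r := r + v.size) v' (by omega))
      ⟨r + p, by omega⟩ (Psi f N r v.size v'.size * Phi f N r v)
    have e2 := cable_of_mem_mul (m := u.size) (Phi_mem_PB f.2 (N := N) (r := r) v (by omega))
      ⟨r + p, by omega⟩ (Psi f N r v.size v'.size)
    rw [Shape.ins, Phi, e1, e2]
    split_ifs with hlt
    · have ih := hv hlt (r := r) (by omega)
      rw [Phi, Shape.size_ins _ _ _ hlt, cable_Psi f.2 hl (by omega) _ (by simp only; omega),
        if_pos (by simp only; omega), if_pos (by simp only; omega),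
        cable_Phi f.2 hl v' (by omega) _ (by simp only; omega), if_neg (by simp only; omega),
        show r + (v.size + u.size - 1) = r + v.size + u.size - 1 by omega]
      have c1 := (Psi_comm f.2 (N := N + u.size - 1) (p := r) (a := v.size + u.size - 1)
        (b := v'.size) (by omega) (loc_mono le_rfl (by omega) (Psi_mem_loc (f := f)
          (N := N + u.size - 1) (p := r) (a := p) (b := u.size) (by omega)))).map (𝒩.q _)
      have c2 := (loc_commute (N := N + u.size - 1) (by omega)
        (Phi_mem_loc (f := f) (N := N + u.size - 1) (r := r + p) u (by omega))
        (Phi_mem_loc (f := f) (N := N + u.size - 1) (r := r + v.size + u.size - 1) v'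
          (by omega))).map (𝒩.q _)
      simp only [map_mul] at ih ⊢
      rw [ih]
      exact ins_algebra c1 c2
    · obtain ⟨y, rfl⟩ : ∃ y, p = v.size + y := ⟨p - v.size, by omega⟩
      rw [Nat.add_sub_cancel_left]
      have ih := hv' (p := y) (by omega) (r := r + v.size) (by omega)
      have hP := h.Psi_ins (N := N) (p := r) (a := v.size) (b := v'.size) (l := u.size) (y := y) hl
        (by omega) (by omega)
      rw [Phi, Shape.size_ins _ _ _ (by omega), cable_Phi f.2 hl v (by omega) _ (by simp only; omega),
        if_pos (by simp only; omega)]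
      have c1 := (loc_commute (N := N + u.size - 1) (by omega)
        (Phi_mem_loc (f := f) (N := N + u.size - 1) (r := r) v (by omega))
        (Psi_mem_loc (f := f) (N := N + u.size - 1) (p := r + v.size) (a := y) (b := u.size)
          (by omega))).map (𝒩.q _)
      simp only [← add_assoc] at ih hP ⊢
      simp only [map_mul] at ih hP ⊢
      rw [ih, ← mul_assoc, ← mul_assoc, mul_assoc _ (𝒩.q _ (Phi f _ r v)), c1.eq, ← mul_assoc, hP]
      group

theorem Phi_ins_of_size {N r p l : ℕ} (w u : Shape) (hu : u.size = l) (hp : p < w.size)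
    (hN : r + w.size ≤ N) :
    𝒩.q (N + l - 1) (Phi f (N + l - 1) r (Shape.ins p w u)) =
      𝒩.q (N + l - 1) (Psi f (N + l - 1) r p l *
        cable l ⟨r + p, by omega⟩ (Phi f N r w) * Phi f (N + l - 1) (r + p) u) := by
  subst hu
  exact h.Phi_ins w u hp hN

end IsPair

/-! ### Operadic maps -/

open PaB

/-- A map from the operad of parenthesized braids to its quotient by an operadic congruence, which
is the identity on objects. -/
structure OpMap (𝒩 : OpCongr) where
  T : ∀ {n : ℕ} {a b : PaB n}, (a ⟶ b) → Braid n ⧸ 𝒩.N n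
  ρ_T : ∀ {n : ℕ} {a b : PaB n} (γ : a ⟶ b), 𝒩.ρQ n (T γ) = ρ n (ou γ)
  T_comp : ∀ {n : ℕ} {a b c : PaB n} (γ : a ⟶ b) (η : b ⟶ c), T (γ ≫ η) = T η * T γ
  T_perm : ∀ {n : ℕ} (θ : Equiv.Perm (Fin n)) {a b : PaB n} (γ : a ⟶ b),
    T ((perm_functor θ).map γ) = T γ
  T_insert : ∀ {n m : ℕ} (i : Fin n) {a b : PaB n} (γ : a ⟶ b) {c d : PaB m} (η : c ⟶ d)
    {x : Braid n} {y : Braid m}, T γ = 𝒩.q n x → T η = 𝒩.q m y →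
    T (insMor i γ η) = 𝒩.q (n + m - 1) (cable m ((𝔭 a)⁻¹ i) x *
      shift m (n + m - 1) ((𝔭 a)⁻¹ i : Fin n) (by have := ((𝔭 a)⁻¹ i).2; omega) y)

/-- The projection to the quotient. -/
def OpMap.proj (𝒩 : OpCongr) : OpMap 𝒩 where
  T {n _ _} γ := 𝒩.q n (ou γ)
  ρ_T _ := rfl
  T_comp _ _ := rfl
  T_perm _ _ _ _ := rfl
  T_insert {n l} i a b γ c d η x y hx hy := by
    rw [ou_insMor, insertBraid, map_mul, map_mul, 𝒩.q_cable c.pos _ hx, 𝒩.q_shift _ hy]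

theorem insert_algebra {G : Type*} [Group G] {X X' A B C D D' z z' : G} (h₁ : D' * z = z * D)
    (h₂ : D⁻¹ * A = A * D⁻¹) (h₃ : z' * A = A * z') (h₄ : D' * B = B * D') :
    (X' * B * D')⁻¹ * (X' * z * X⁻¹ * (X * z' * X⁻¹)) * (X * A * C) =
      B⁻¹ * z * A * (D⁻¹ * z' * C) := by
  have h₅ : D'⁻¹ * z = z * D⁻¹ := by
    rw [inv_mul_eq_iff_eq_mul, ← mul_assoc, h₁, mul_inv_cancel_right]
  calc _ = (B * D')⁻¹ * z * (z' * A) * C := by group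
    _ = B⁻¹ * (D'⁻¹ * z) * A * z' * C := by rw [← h₄, h₃]; group
    _ = B⁻¹ * z * (D⁻¹ * A) * z' * C := by rw [h₅]; group
    _ = _ := by rw [h₂]; group

namespace IsPair

variable {𝒩 : OpCongr} {m : ℤ} {f : PB 3} (h : IsPair 𝒩 m f)

/-- The homomorphism `Θ` on a quotient of the braid group. -/
def ΘQ {𝒦 : OpCongr} (hK : ∀ n, 𝒦.N n ≤ (h.Θ n).ker) (n : ℕ) :
    Braid n ⧸ 𝒦.N n →* Braid n ⧸ 𝒩.N n := QuotientGroup.lift (𝒦.N n) (h.Θ n) (hK n)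

theorem ΘQ_q {𝒦 : OpCongr} (hK : ∀ n, 𝒦.N n ≤ (h.Θ n).ker) {n : ℕ} (x : Braid n) :
    h.ΘQ hK n (𝒦.q n x) = h.Θ n x := rfl

/-- The composite of an operadic map with the operadic map given by `(m, f)`. -/
def comp {𝒦 : OpCongr} (hK : ∀ n, 𝒦.N n ≤ (h.Θ n).ker) (U : OpMap 𝒦) : OpMap 𝒩 where
  T {n a b} γ := (𝒩.q n (Phi f n 0 b.sh))⁻¹ * h.ΘQ hK n (U.T γ) * 𝒩.q n (Phi f n 0 a.sh)
  ρ_T {n a b} γ := by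
    have h1 : ∀ c : PaB n, 𝒩.ρQ n (𝒩.q n (Phi f n 0 c.sh)) = 1 := fun c =>
      Phi_mem_PB f.2 _ (by rw [c.size_sh]; omega)
    obtain ⟨z, hz⟩ := 𝒦.q_surjective n (U.T γ)
    rw [map_mul, map_mul, map_inv, h1, h1, ← hz, h.ΘQ_q, h.ρQ_Θ, ← U.ρ_T, ← hz, 𝒦.ρQ_q]
    simp
  T_comp γ η := by rw [U.T_comp, map_mul]; group
  T_perm θ a b γ := by
    change (𝒩.q _ (Phi f _ 0 (permObj θ b).sh))⁻¹ * _ * 𝒩.q _ (Phi f _ 0 (permObj θ a).sh) = _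
    rw [sh_permObj, sh_permObj, U.T_perm]
  T_insert {n l} i a b γ c d η x y hx hy := by
    obtain ⟨u, hu⟩ := 𝒦.q_surjective n (U.T γ)
    obtain ⟨v, hv⟩ := 𝒦.q_surjective l (U.T η)
    rw [← hu, h.ΘQ_q] at hx
    rw [← hv, h.ΘQ_q] at hy
    obtain ⟨z, hz⟩ := 𝒩.q_surjective n (h.Θ n u)
    obtain ⟨z', hz'⟩ := 𝒩.q_surjective l (h.Θ l v)
    have hl := c.pos
    have hp := ((𝔭 a)⁻¹ i).2
    have hp2 := ((𝔭 b)⁻¹ i).2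
    have hγ : ρ n u ((𝔭 a)⁻¹ i) = (𝔭 b)⁻¹ i := by
      rw [← ρ_ou_symm γ i, ← U.ρ_T, ← hu, 𝒦.ρQ_q]
    have Pa := Phi_mem_PB f.2 (N := n) (r := 0) a.sh (by rw [a.size_sh]; omega)
    have Pb := Phi_mem_PB f.2 (N := n) (r := 0) b.sh (by rw [b.size_sh]; omega)
    have ex : 𝒩.q n x = 𝒩.q n ((Phi f n 0 b.sh)⁻¹ * z * Phi f n 0 a.sh) := by
      rw [← hx, ← hz]; simp
    have ey : 𝒩.q l y = 𝒩.q l ((Phi f l 0 d.sh)⁻¹ * z' * Phi f l 0 c.sh) := by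
      rw [← hy, ← hz']; simp
    have e1 := 𝒩.q_cable hl ((𝔭 a)⁻¹ i) ex
    have e2 := 𝒩.q_shift (p := ((𝔭 a)⁻¹ i : Fin n)) (n := n + l - 1) (by omega) ey
    rw [cable_of_mem_mul Pa, cable_mul, h.ρ_of_Θ hz.symm, hγ, cable_of_mem_inv Pb] at e1
    rw [map_mul (shift _ _ _ _), map_mul (shift _ _ _ _), map_inv (shift _ _ _ _),
      shift_Phi _ (by rw [d.size_sh]; omega), shift_Phi _ (by rw [c.size_sh]; omega),
      add_zero] at e2
    rw [U.T_insert i γ η hu.symm hv.symm, h.ΘQ_q, map_mul (h.Θ _), h.Θ_cable hl u _ hz.symm, h.Θ_shift, ← hz', 𝒩.shiftQ_q,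
      sh_insertObj, sh_insertObj, hγ]
    have I1 := h.Phi_ins_of_size (N := n) (r := 0) (p := ((𝔭 a)⁻¹ i : Fin n)) a.sh c.sh c.size_sh
      (by rw [a.size_sh]; omega) (by rw [a.size_sh]; omega)
    have I2 := h.Phi_ins_of_size (N := n) (r := 0) (p := ((𝔭 b)⁻¹ i : Fin n)) b.sh d.sh d.size_sh
      (by rw [b.size_sh]; omega) (by rw [b.size_sh]; omega)
    simp only [zero_add, Fin.eta] at I1 I2
    rw [I1, I2, map_mul _ (cable l _ x), e1, e2]
    -- What remains is that braids on the strands of the inserted word slide along the cable;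
    -- `insert_algebra` then rearranges the factors.
    have hs := shift_mul_cable (m := l) ((𝔭 a)⁻¹ i) ((𝔭 b)⁻¹ i) z (Phi f l 0 d.sh)
      (by rw [h.ρ_of_Θ hz.symm, hγ])
    have hs' := shift_mul_cable (m := l) ((𝔭 a)⁻¹ i) ((𝔭 a)⁻¹ i) (Phi f n 0 a.sh)
      (Phi f l 0 d.sh)⁻¹ (by rw [show ρ n (Phi f n 0 a.sh) = 1 from Pa]; rfl)
    have hs2 := shift_mul_cable (m := l) ((𝔭 a)⁻¹ i) ((𝔭 a)⁻¹ i) (Phi f n 0 a.sh)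
      z' (by rw [show ρ n (Phi f n 0 a.sh) = 1 from Pa]; rfl)
    rw [shift_Phi _ (by rw [d.size_sh]; omega), shift_Phi _ (by rw [d.size_sh]; omega), add_zero,
      add_zero] at hs
    rw [map_inv, shift_Phi _ (by rw [d.size_sh]; omega), add_zero] at hs'
    have hs3 := shift_mul_cable (m := l) ((𝔭 b)⁻¹ i) ((𝔭 b)⁻¹ i) (Phi f n 0 b.sh)
      (Phi f l 0 d.sh) (by rw [show ρ n (Phi f n 0 b.sh) = 1 from Pb]; rfl)
    rw [shift_Phi _ (by rw [d.size_sh]; omega), add_zero] at hs3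
    have hs := congrArg (𝒩.q _) hs
    have hs3 := congrArg (𝒩.q _) hs3
    have hs' := congrArg (𝒩.q _) hs'
    have hs2 := congrArg (𝒩.q _) hs2
    simp only [map_mul, map_inv] at hs hs' hs2 hs3 ⊢
    exact insert_algebra hs hs' hs2 hs3

/-- The operadic map given by `(m, f)`. -/
def opMap : OpMap 𝒩 := h.comp (𝒦 := h.ker) (fun _ => le_rfl) (OpMap.proj h.ker)

theorem opMap_T {n : ℕ} {a b : PaB n} (γ : a ⟶ b) : h.opMap.T γ =
    (𝒩.q n (Phi f n 0 b.sh))⁻¹ * h.Θ n (ou γ) * 𝒩.q n (Phi f n 0 a.sh) := rfl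

end IsPair

open PaB

/-! ### Objects with a given shape -/

theorem word_ext {w w' : FreeMagma ℕ} (h₁ : shape w = shape w') (h₂ : leaves w = leaves w') :
    w = w' := by
  induction w generalizing w' with
  | ih1 j =>
    cases w' with
    | of i => rw [List.singleton_inj.1 h₂]
    | mul u v => exact absurd h₁ (by rintro ⟨⟩)
  | ih2 u v hu hv =>
    cases w' with
    | of i => exact absurd h₁ (by rintro ⟨⟩)
    | mul u' v' =>
      injection h₁ with h₃ h₄
      have h5 := List.append_inj (show leaves u ++ leaves v = leaves u' ++ leaves v' from h₂)
        (by rw [← size_shape, ← size_shape]; exact congrArg Shape.size h₃)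
      rw [hu h₃ h5.1, hv h₄ h5.2]
      rfl

theorem PaB.obj_ext {n : ℕ} {a b : PaB n} (h₁ : a.sh = b.sh) (h₂ : 𝔭 a = 𝔭 b) : a = b := by
  have : a.word = b.word := by
    refine word_ext h₁ (List.ext_getElem (by rw [a.length_leaves, b.length_leaves]) ?_)
    intro k h3 h4
    exact congrArg Fin.val (DFunLike.congr_fun h₂ ⟨k, by rwa [a.length_leaves] at h3⟩)
  cases a; cases b; cases this; rfl

/-- The word of a given shape with the letters `r, r + 1, …` in increasing order. -/
def stdWord (r : ℕ) : Shape → FreeMagma ℕ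
  | .leaf => .of r
  | .node u v => stdWord r u * stdWord (r + u.size) v

theorem leaves_stdWord (r : ℕ) (w : Shape) : leaves (stdWord r w) = List.range' r w.size := by
  induction w generalizing r with
  | leaf => rfl
  | node u v hu hv => rw [stdWord, leaves_mul, hu, hv, Shape.size, List.range'_append_1]

theorem shape_stdWord (r : ℕ) (w : Shape) : shape (stdWord r w) = w := by
  induction w generalizing r with
  | leaf => rfl
  | node u v hu hv => rw [stdWord, shape_mul, hu, hv]

theorem PaB.exists_obj {n : ℕ} {w : Shape} (hw : w.size = n) (π : Equiv.Perm (Fin n)) :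
    ∃ a : PaB n, a.sh = w ∧ 𝔭 a = π := by
  have h1 : leaves (stdWord 0 w) = List.range n := by
    rw [leaves_stdWord, hw, List.range_eq_range']
  let a : PaB n := ⟨stdWord 0 w, by rw [h1]⟩
  have ha : 𝔭 a = 1 := by
    ext k
    have : ∀ (l : List ℕ) (hl : l = List.range n) (hk : (k : ℕ) < l.length), l[(k : ℕ)] = k := by
      intro l hl hk
      subst hl
      exact List.getElem_range hk
    exact this _ h1 _
  refine ⟨permObj π a, ?_, ?_⟩
  · rw [sh_permObj]; exact shape_stdWord 0 w
  · rw [𝔭_permObj, ha, mul_one]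

theorem PaB.exists_mor {n : ℕ} {w w' : Shape} (hw : w.size = n) (hw' : w'.size = n)
    (π : Equiv.Perm (Fin n)) (g : Braid n) :
    ∃ (a b : PaB n) (γ : a ⟶ b), a.sh = w ∧ b.sh = w' ∧ ou γ = g ∧ 𝔭 a = π := by
  obtain ⟨a, ha, ha'⟩ := exists_obj hw π
  obtain ⟨b, hb, hb'⟩ := exists_obj hw' (π * (ρ n g)⁻¹)
  exact ⟨a, b, Hom.mk g (by rw [ha', hb']; group), ha, hb, rfl, ha'⟩

namespace OpMap

variable {𝒩 : OpCongr} (T : OpMap 𝒩)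

/-- An object is determined by its shape and its permutation of letters, so two such morphisms
differ by a renaming of letters, under which `T` is invariant. -/
theorem T_eq_of_shape {n : ℕ} {a b a' b' : PaB n} (γ : a ⟶ b) (γ' : a' ⟶ b') (ha : a.sh = a'.sh)
    (hb : b.sh = b'.sh) (h : ou γ = ou γ') : T.T γ = T.T γ' := by
  obtain ⟨θ, hθ⟩ : ∃ θ, θ = 𝔭 a * (𝔭 a')⁻¹ := ⟨_, rfl⟩
  have h1 : permObj θ a' = a := obj_ext (by rw [sh_permObj, ha])
    (by rw [𝔭_permObj, hθ, inv_mul_cancel_right])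
  have h2 : permObj θ b' = b := obj_ext (by rw [sh_permObj, hb]) (by
    have e1 := ρ_ou γ
    have e2 := ρ_ou γ'
    rw [h, e2, eq_inv_mul_iff_mul_eq] at e1
    rw [𝔭_permObj, hθ, ← e1]
    group)
  subst h1 h2
  rw [← T.T_perm θ γ']
  exact congrArg _ (ou_ext h)

theorem T_id {n : ℕ} (a : PaB n) : T.T (𝟙 a) = 1 := by
  have := T.T_comp (𝟙 a) (𝟙 a)
  rw [Category.comp_id] at this
  exact mul_eq_left.1 this.symm

/-- The value of `T` on the morphisms between words of given shapes with a given braid. -/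
def Val (n : ℕ) (w w' : Shape) (g x : Braid n) : Prop :=
  ∀ ⦃a b : PaB n⦄ (γ : a ⟶ b), a.sh = w → b.sh = w' → ou γ = g → T.T γ = 𝒩.q n x

/-- The operadic map `T` is given by `(m, f)` on the associativity and the braiding. -/
structure IsData (m : ℤ) (f : Braid 3) : Prop where
  alpha : T.Val 3 (.node (.node .leaf .leaf) .leaf) (.node .leaf (.node .leaf .leaf)) 1 f
  beta : T.Val 2 (.node .leaf .leaf) (.node .leaf .leaf) (σ 2 0) (lam m (σ 2 0))

end OpMap

/-! ### Generation of the operad by the associativity and the braiding -/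

/-- The braids which the operations of the operad produce from `(m, f)`. -/
inductive Deriv (m : ℤ) (f : Braid 3) : (n : ℕ) → Shape → Shape → Braid n → Braid n → Prop
  | alpha : Deriv m f 3 (.node (.node .leaf .leaf) .leaf) (.node .leaf (.node .leaf .leaf)) 1 f
  | beta : Deriv m f 2 (.node .leaf .leaf) (.node .leaf .leaf) (σ 2 0) (lam m (σ 2 0))
  | one {n : ℕ} {w : Shape} (hw : w.size = n) : Deriv m f n w w 1 1
  | comp {n : ℕ} {w w' w'' : Shape} {g x g' x' : Braid n} : Deriv m f n w w' g x →
      Deriv m f n w' w'' g' x' → Deriv m f n w w'' (g' * g) (x' * x)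
  | inv {n : ℕ} {w w' : Shape} {g x : Braid n} : Deriv m f n w w' g x → Deriv m f n w' w g⁻¹ x⁻¹
  -- The number of strands is a variable with an equation, and cabling is expressed by `mc`; thus `n
  -- + l - 1` may be replaced by an equal number without transport.
  | insert {n l N : ℕ} {w w' u u' : Shape} {g x : Braid n} {k y : Braid l} (p : Fin n)
      (hN : N = n + l - 1) (h : p + l ≤ N) : Deriv m f n w w' g x → Deriv m f l u u' k y →
      Deriv m f N (.ins p w u) (.ins (ρ n g p) w' u') (mc N 0 (single l p) g * shift l N p h k)
        (mc N 0 (single l p) x * shift l N p h y)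

namespace Deriv

variable {m : ℤ} {f : Braid 3}

theorem size {n : ℕ} {w w' : Shape} {g x : Braid n} (h : Deriv m f n w w' g x) :
    w.size = n ∧ w'.size = n := by
  induction h with
  | alpha => exact ⟨rfl, rfl⟩
  | beta => exact ⟨rfl, rfl⟩
  | one hw => exact ⟨hw, hw⟩
  | comp _ _ h h' => exact ⟨h.1, h'.2⟩
  | inv _ h => exact ⟨h.2, h.1⟩
  | insert p hN h _ _ h₁ h₂ =>
    rw [Shape.size_ins _ _ _ (by rw [h₁.1]; exact p.2),
      Shape.size_ins _ _ _ (by rw [h₁.2]; exact (ρ _ _ p).2), h₁.1, h₁.2, h₂.1, h₂.2]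
    exact ⟨hN.symm, hN.symm⟩

/-- Soundness of `Deriv`: each of its rules is an operation that an operadic map respects, so the
data on associator and braiding force the value on every derived morphism. -/
theorem val {𝒩 : OpCongr} {T : OpMap 𝒩} (hT : T.IsData m f) {n : ℕ} {w w' : Shape} {g x : Braid n}
    (h : Deriv m f n w w' g x) : T.Val n w w' g x := by
  induction h with
  | alpha => exact hT.alpha
  | beta => exact hT.beta
  | one hw =>
    intro a b γ ha hb hγ
    rw [T.T_eq_of_shape γ (𝟙 a) rfl (by rw [ha, hb]) (by rw [hγ, ou_id]), T.T_id, map_one]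
  | @comp n w w' w'' g x g' x' h h' hv hv' =>
    intro a b γ ha hb hγ
    obtain ⟨c, d, η, hc, hd, hη, -⟩ := exists_mor h.size.1 h.size.2 1 g
    obtain ⟨e, hs, hp⟩ := exists_obj h'.size.2 (𝔭 d * (ρ _ g')⁻¹)
    let η' : d ⟶ e := Hom.mk g' (by rw [hp]; group)
    rw [T.T_eq_of_shape γ (η ≫ η') (by rw [ha, hc]) (by rw [hb, hs])
      (by rw [hγ, ou_comp, hη]; rfl), T.T_comp, hv η hc hd hη, hv' η' hd hs rfl, map_mul]
  | inv h hv =>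
    intro a b γ ha hb hγ
    have h1 := T.T_comp γ (Groupoid.inv γ)
    rw [Groupoid.comp_inv, T.T_id, hv (Groupoid.inv γ) hb ha
      (by change (ou γ)⁻¹ = _; rw [hγ, inv_inv])] at h1
    rw [map_inv]
    exact eq_inv_of_mul_eq_one_right h1.symm
  | @insert n l N w w' u u' g x k y p hN h h₁ h₂ hv₁ hv₂ =>
    subst hN
    intro a b γ ha hb hγ
    obtain ⟨a₁, b₁, γ₁, ha₁, hb₁, hγ₁, hp⟩ := exists_mor h₁.size.1 h₁.size.2 1 g
    obtain ⟨a₂, b₂, γ₂, ha₂, hb₂, hγ₂, -⟩ := exists_mor h₂.size.1 h₂.size.2 1 k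
    have hpa : (𝔭 a₁)⁻¹ p = p := by rw [hp]; rfl
    have hpb : (𝔭 b₁)⁻¹ p = ρ n g p := by rw [← ρ_ou_symm γ₁, hpa, hγ₁]
    rw [T.T_eq_of_shape γ (insMor p γ₁ γ₂) (by rw [ha, sh_insertObj, hpa, ha₁, ha₂])
      (by rw [hb, sh_insertObj, hpb, hb₁, hb₂]) ?_,
      T.T_insert p γ₁ γ₂ (hv₁ γ₁ ha₁ hb₁ hγ₁) (hv₂ γ₂ ha₂ hb₂ hγ₂)]
    · simp only [hpa, cable_eq_mc]
    · rw [hγ, ou_insMor, insertBraid]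
      simp only [hpa, cable_eq_mc, hγ₁, hγ₂]

theorem tensorLeft {a b N : ℕ} {w w' u : Shape} {g x : Braid a} (hu : u.size = b) (hN : N = a + b)
    (h : Deriv m f a w w' g x) : Deriv m f N (.node w u) (.node w' u)
      (shift a N 0 (by omega) g) (shift a N 0 (by omega) x) := by
  have := insert (N := N) (⟨0, by omega⟩ : Fin (1 + b)) (by omega) (by simp only; omega)
    (one (m := m) (f := f) (w := .node .leaf u) (n := 1 + b) (by rw [Shape.size, Shape.size, hu])) h
  simpa [Shape.ins, Shape.size, mc_one] using this

theorem tensorRight {a b N : ℕ} {w w' u : Shape} {g x : Braid a} (hu : u.size = b) (hN : N = b + a)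
    (h : Deriv m f a w w' g x) : Deriv m f N (.node u w) (.node u w')
      (shift a N b (by omega) g) (shift a N b (by omega) x) := by
  have := insert (N := N) (⟨b, by omega⟩ : Fin (b + 1)) (by omega) (by simp only; omega)
    (one (m := m) (f := f) (w := .node u .leaf) (n := b + 1) (by rw [Shape.size, Shape.size, hu])) h
  simpa [Shape.ins, hu, mc_one] using this

theorem cabled {n l N : ℕ} {w w' u : Shape} {g x : Braid n} (p : Fin n) (hu : u.size = l)
    (hN : N = n + l - 1) (h : Deriv m f n w w' g x) :
    Deriv m f N (.ins p w u) (.ins (ρ n g p) w' u) (mc N 0 (single l p) g)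
      (mc N 0 (single l p) x) := by
  have hp := p.2
  have hl := u.size_pos
  have := insert p hN (by omega) h (one (m := m) (f := f) hu)
  simpa using this

/-- The general associator is obtained from the basic one by inserting the three words, from the
last letter to the first so that the positions still to be used are not shifted. -/
theorem exists_assoc {N : ℕ} (u v w : Shape) (hN : u.size + v.size + w.size = N) :
    ∃ x, Deriv m f N (.node (.node u v) w) (.node u (.node v w)) 1 x := by
  have hu := u.size_pos
  have hv := v.size_pos
  have hw := w.size_pos
  have h1 := cabled (N := 2 + w.size) (u := w) (2 : Fin 3) rfl (by omega) (alpha (m := m) (f := f))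
  have h2 := cabled (N := 1 + v.size + w.size) (u := v) ⟨1, by omega⟩ rfl (by omega) h1
  have h3 := cabled (N := N) (u := u) ⟨0, by omega⟩ rfl (by omega) h2
  simp only [mc_one, map_one, Equiv.Perm.one_apply] at h3
  exact ⟨_, by simpa [Shape.ins, Shape.size] using h3⟩

end Deriv

/-- The left-normed shape with `n + 1` letters. -/
def Shape.comb : ℕ → Shape
  | 0 => .leaf
  | n + 1 => .node (comb n) .leaf

theorem Shape.size_comb (n : ℕ) : (Shape.comb n).size = n + 1 := by
  induction n with
  | zero => rfl
  | succ n ih => rw [comb, size, ih]; rfl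

namespace Deriv

variable {m : ℤ} {f : Braid 3}

theorem exists_comb_comb (a b N : ℕ) (hN : N = a + b + 2) :
    ∃ x, Deriv m f N (.node (.comb a) (.comb b)) (.comb (a + b + 1)) 1 x := by
  induction b generalizing N with
  | zero => exact ⟨1, one (by rw [Shape.size, Shape.size_comb, Shape.size_comb]; omega)⟩
  | succ b ih =>
    obtain ⟨x, hx⟩ := exists_assoc (m := m) (f := f) (N := N) (.comb a) (.comb b) .leaf
      (by rw [Shape.size_comb, Shape.size_comb, Shape.size]; omega)
    obtain ⟨y, hy⟩ := ih (a + b + 2) rfl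
    have := hx.inv.comp (hy.tensorLeft (u := .leaf) (b := 1) rfl (by omega))
    simp only [map_one, inv_one, mul_one] at this
    exact ⟨_, this⟩

theorem exists_to_comb {n : ℕ} (w : Shape) (hw : w.size = n + 1) :
    ∃ x, Deriv m f (n + 1) w (.comb n) 1 x := by
  induction w generalizing n with
  | leaf =>
    obtain rfl : n = 0 := by rw [Shape.size] at hw; omega
    exact ⟨1, one rfl⟩
  | node u v hu hv =>
    have h1 := u.size_pos
    have h2 := v.size_pos
    rw [Shape.size] at hw
    obtain ⟨a, ha⟩ : ∃ a, u.size = a + 1 := ⟨u.size - 1, by omega⟩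
    obtain ⟨b, hb⟩ : ∃ b, v.size = b + 1 := ⟨v.size - 1, by omega⟩
    obtain ⟨x, hx⟩ := hu ha
    obtain ⟨y, hy⟩ := hv hb
    obtain rfl : n = a + b + 1 := by omega
    obtain ⟨z, hz⟩ := exists_comb_comb (m := m) (f := f) a b (a + b + 1 + 1) (by omega)
    have := ((hx.tensorLeft (N := a + b + 1 + 1) hb (by omega)).comp
      (hy.tensorRight (N := a + b + 1 + 1) (Shape.size_comb a) (by omega))).comp hz
    simp only [map_one, mul_one] at this
    exact ⟨_, this⟩

/-- A generator that does not involve the last strand comes from fewer strands. For the last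
generator one brackets the last two letters together, applies the braiding to them and brackets
back. -/
theorem exists_σ {n k : ℕ} (hk : k < n) : ∃ x, Deriv m f (n + 1) (.comb n) (.comb n) (σ (n + 1) k) x := by
  induction n with
  | zero => omega
  | succ n ih =>
    rcases (show k < n ∨ k = n by omega) with h | rfl
    · obtain ⟨x, hx⟩ := ih h
      have := hx.tensorLeft (u := .leaf) (b := 1) (N := n + 1 + 1) rfl rfl
      rw [shift_σ _ _ _ _ _ (by omega), add_zero] at this
      exact ⟨_, this⟩
    · cases k with
      | zero => exact ⟨_, beta⟩
      | succ k =>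
        obtain ⟨x, hx⟩ := exists_assoc (m := m) (f := f) (N := k + 3) (.comb k) .leaf .leaf
          (by rw [Shape.size_comb]; rfl)
        have := (hx.comp (beta.tensorRight (Shape.size_comb k) (by omega))).comp hx.inv
        rw [shift_σ _ _ _ _ _ (by omega), zero_add, inv_one, one_mul, mul_one] at this
        exact ⟨_, this⟩

/-- Completeness of `Deriv`: every morphism factors through left-normed words, between which the
generators of the braid group are derivable. Hence associator and braiding generate the operad. -/
theorem exists_deriv {n : ℕ} {w w' : Shape} (hw : w.size = n) (hw' : w'.size = n) (g : Braid n) :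
    ∃ x, Deriv m f n w w' g x := by
  obtain ⟨k, rfl⟩ : ∃ k, n = k + 1 := ⟨n - 1, by have := w.size_pos; omega⟩
  obtain ⟨x, hx⟩ := exists_to_comb (m := m) (f := f) w hw
  obtain ⟨y, hy⟩ := exists_to_comb (m := m) (f := f) w' hw'
  obtain ⟨z, hz⟩ : ∃ z, Deriv m f (k + 1) (.comb k) (.comb k) g z := by
    induction g using braid_induction with
    | one => exact ⟨1, one (Shape.size_comb k)⟩
    | mul g g' h h' =>
      obtain ⟨z, hz⟩ := h
      obtain ⟨z', hz'⟩ := h'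
      exact ⟨_, hz'.comp hz⟩
    | inv g h =>
      obtain ⟨z, hz⟩ := h
      exact ⟨_, hz.inv⟩
    | gen i hi => exact exists_σ (by omega)
  have := (hx.comp hz).comp hy.inv
  rw [inv_one, one_mul, mul_one] at this
  exact ⟨_, this⟩

end Deriv

namespace OpMap

variable {𝒩 : OpCongr} {T T' : OpMap 𝒩} {m : ℤ} {f : PB 3}

theorem ext_of_isData (h : T.IsData m f) (h' : T'.IsData m f) {n : ℕ} {a b : PaB n} (γ : a ⟶ b) :
    T.T γ = T'.T γ := by
  obtain ⟨x, hx⟩ := Deriv.exists_deriv (m := m) (f := f) a.size_sh b.size_sh (ou γ)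
  rw [hx.val h γ rfl rfl rfl, hx.val h' γ rfl rfl rfl]

/-- Two derivations of the same morphism have to give the same class, since the operadic map has one
value there. All relations for `(m, f)` arise in this way. -/
theorem _root_.GTShadows.Deriv.q_eq (hT : T.IsData m f) {n : ℕ} {w w' : Shape} {g g' x y : Braid n}
    (hx : Deriv m f n w w' g x) (hy : Deriv m f n w w' g' y) (h : g = g') : 𝒩.q n x = 𝒩.q n y := by
  subst h
  obtain ⟨a, b, γ, ha, hb, hγ, -⟩ := exists_mor hx.size.1 hx.size.2 1 g
  rw [← hx.val hT γ ha hb hγ, hy.val hT γ ha hb hγ]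

/-- Each relation compares two derivations: for the hexagons, a strand crosses a pair of strands
either one at a time or as a doubled strand; for the pentagon, the two routes between the extreme
bracketings of four letters. -/
theorem isPair_of_isData (h : T.IsData m f) : IsPair 𝒩 m f := by
  have hα := Deriv.alpha (m := m) (f := f)
  have hβ := Deriv.beta (m := m) (f := f)
  have b0 := hβ.tensorLeft (u := .leaf) (b := 1) (N := 3) rfl rfl
  have b1 := hβ.tensorRight (u := .leaf) (b := 1) (N := 3) rfl rfl
  rw [map_lam, shift_σ _ _ _ _ _ (by omega)] at b0 b1
  have c0 := hβ.cabled (u := .node .leaf .leaf) (l := 2) (N := 3) 0 rfl rfl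
  have c1 := hβ.cabled (u := .node .leaf .leaf) (l := 2) (N := 3) 1 rfl rfl
  have r0 : ρ 2 (σ 2 0) 0 = 1 := Fin.ext (by rw [ρ_σ_val _ _ (by omega)]; rfl)
  have r1 : ρ 2 (σ 2 0) 1 = 0 := Fin.ext (by rw [ρ_σ_val _ _ (by omega)]; rfl)
  have k0 : mc 3 0 (single 2 0) (σ 2 0) = σ 3 0 * σ 3 1 := by
    have := cable_eq_mc (m := 2) (0 : Fin 2) (σ 2 0)
    rw [cable_σ _ _ (by omega)] at this
    exact this.symm.trans (by simp [cableGen, cableUp])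
  have k1 : mc 3 0 (single 2 1) (σ 2 0) = σ 3 1 * σ 3 0 := by
    have := cable_eq_mc (m := 2) (1 : Fin 2) (σ 2 0)
    rw [cable_σ _ _ (by omega)] at this
    exact this.symm.trans (by simp [cableGen, cableDown])
  rw [r0] at c0
  rw [r1] at c1
  refine ⟨?_, ?_, ?_⟩
  · have d1 := ((hα.comp b1).comp hα.inv).comp b0
    have d2 := c0.comp hα.inv
    have e := cable_eq_mc (m := 2) (0 : Fin 2) (lam m (σ 2 0))
    have := d1.q_eq h d2 (by simpa using k0.symm)
    rw [e]
    simpa [mul_assoc] using this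
  · have d1 := ((b0.comp hα).comp b1).comp hα.inv
    have d2 := hα.comp c1
    have e := cable_eq_mc (m := 2) (1 : Fin 2) (lam m (σ 2 0))
    have := d1.q_eq h d2 (by simpa using k1.symm)
    rw [e]
    simpa [mul_assoc] using this
  · have d1 := ((hα.tensorLeft (u := .leaf) (b := 1) (N := 4) rfl rfl).comp
      (hα.cabled (u := .node .leaf .leaf) (l := 2) (N := 4) 1 rfl rfl)).comp
        (hα.tensorRight (u := .leaf) (b := 1) (N := 4) rfl rfl)
    have d2 := (hα.cabled (u := .node .leaf .leaf) (l := 2) (N := 4) 0 rfl rfl).comp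
      (hα.cabled (u := .node .leaf .leaf) (l := 2) (N := 4) 2 rfl rfl)
    have e0 := cable_eq_mc (m := 2) (0 : Fin 3) f
    have e1 := cable_eq_mc (m := 2) (1 : Fin 3) f
    have e2 := cable_eq_mc (m := 2) (2 : Fin 3) f
    simp only [mc_one, map_one, mul_one] at d1 d2
    have := d1.q_eq h d2 rfl
    rw [double, double, double, e0, e1, e2, addLeft, addRight, mul_assoc]
    exact this

end OpMap

/-! ### Braids on two strands and the data of an operadic map -/

theorem exists_zpow_braid_two (g : Braid 2) : ∃ k : ℤ, g = σ 2 0 ^ k := by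
  induction g using braid_induction with
  | one => exact ⟨0, (zpow_zero _).symm⟩
  | mul g h hg hh =>
    obtain ⟨a, rfl⟩ := hg
    obtain ⟨b, rfl⟩ := hh
    exact ⟨a + b, (zpow_add _ _ _).symm⟩
  | inv g hg =>
    obtain ⟨a, rfl⟩ := hg
    exact ⟨-a, (zpow_neg _ _).symm⟩
  | gen i hi =>
    obtain rfl : i = 0 := by omega
    exact ⟨1, (zpow_one _).symm⟩

theorem ρ_σ_two_ne : ρ 2 (σ 2 0) ≠ 1 := by
  intro h
  have : ((ρ 2 (σ 2 0) 0 : Fin 2) : ℕ) = 1 := by rw [ρ_σ_val _ _ (by omega)]; rfl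
  rw [h] at this
  exact absurd this (by decide)

theorem σ_two_sq_mem : σ 2 0 ^ 2 ∈ PB 2 := sq_σ_mem_PB 2 0 (by omega)

theorem σ_two_zpow_mem_iff (k : ℤ) : σ 2 0 ^ k ∈ PB 2 ↔ Even k := by
  rcases Int.even_or_odd k with ⟨a, ha⟩ | ⟨a, ha⟩
  · refine ⟨fun _ => ⟨a, ha⟩, fun _ => ?_⟩
    rw [ha, ← two_mul, zpow_mul]
    exact zpow_mem σ_two_sq_mem a
  · refine ⟨fun h => ?_, fun h => absurd h (Int.not_even_iff_odd.2 ⟨a, ha⟩)⟩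
    rw [ha, zpow_add, zpow_mul, zpow_one] at h
    have := (mul_mem_cancel_left (zpow_mem σ_two_sq_mem a)).1 h
    exact absurd this ρ_σ_two_ne

theorem lam_eq_zpow {G : Type*} [Group G] (m : ℤ) (x : G) : lam m x = x ^ (2 * m + 1) := by
  rw [lam, add_comm, zpow_add, zpow_one, zpow_mul, zpow_ofNat]

/-- The braiding goes to the class of a power of `σ₁`. As operadic maps preserve permutations, this
power can be taken odd, which gives `m`, and the associator goes to the class of a pure braid, which
gives `f`. -/
theorem OpMap.exists_isData {𝒩 : OpCongr} (T : OpMap 𝒩) : ∃ (m : ℤ) (f : PB 3), T.IsData m f := by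
  obtain ⟨a, b, α, ha, hb, hα, -⟩ := exists_mor (n := 3)
    (w := .node (.node .leaf .leaf) .leaf) (w' := .node .leaf (.node .leaf .leaf)) rfl rfl 1 1
  obtain ⟨c, d, β, hc, hd, hβ, -⟩ := exists_mor (n := 2)
    (w := .node .leaf .leaf) (w' := .node .leaf .leaf) rfl rfl 1 (σ 2 0)
  obtain ⟨f, hf⟩ := 𝒩.q_surjective 3 (T.T α)
  obtain ⟨y, hy⟩ := 𝒩.q_surjective 2 (T.T β)
  have h1 := T.ρ_T α
  rw [← hf, 𝒩.ρQ_q, hα, map_one] at h1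
  have h2 := T.ρ_T β
  rw [← hy, 𝒩.ρQ_q, hβ] at h2
  obtain ⟨k, rfl⟩ := exists_zpow_braid_two y
  have hk : Even (k - 1) := by
    rw [← σ_two_zpow_mem_iff, zpow_sub, zpow_one, MonoidHom.mem_ker, map_mul, h2, map_inv,
      mul_inv_cancel]
  obtain ⟨m, hm⟩ := hk
  refine ⟨m, ⟨f, h1⟩, fun _ _ γ hs ht hγ => ?_, fun _ _ γ hs ht hγ => ?_⟩
  · rw [T.T_eq_of_shape γ α (by rw [hs, ha]) (by rw [ht, hb]) (by rw [hγ, hα]), hf]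
  · rw [T.T_eq_of_shape γ β (by rw [hs, hc]) (by rw [ht, hd]) (by rw [hγ, hβ]), ← hy, lam_eq_zpow,
      show k = 2 * m + 1 by omega]

open PaB

/-! ### Composition of operadic maps -/

theorem Phi_comb (f : Braid 3) (N r n : ℕ) : Phi f N r (.comb n) = 1 := by
  induction n with
  | zero => rfl
  | succ n ih => rw [Shape.comb, Phi, ih, Shape.size, Psi_one_right, Phi, mul_one, mul_one]

theorem Phi_alpha (f : Braid 3) : Phi f 3 0 (.node .leaf (.node .leaf .leaf)) = f⁻¹ := by
  have : tri f 3 0 1 1 1 = f := by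
    rw [IsPair.tri_ones f (by omega), shift_eq_mc, mc_ones_self]
  simp [Phi, Shape.size, Psi_one_right]
  rw [Psi, Psi_one_right, one_mul, this]

theorem Phi_node_node_leaf (f : Braid 3) (N r : ℕ) :
    Phi f N r (.node (.node .leaf .leaf) .leaf) = 1 := Phi_comb f N r 2

theorem Phi_node_leaf (f : Braid 3) (N r : ℕ) : Phi f N r (.node .leaf .leaf) = 1 := Phi_comb f N r 1

theorem tgen_zero (m : ℤ) (f : Braid 3) (n : ℕ) : tgen m f n 0 = lam m (σ n 0) := by
  rw [tgen, tri_of_eq (by simp)]; simp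

theorem tgen_three (m : ℤ) (f : Braid 3) : tgen m f 3 1 = f⁻¹ * lam m (σ 3 1) * f := by
  rw [tgen, IsPair.tri_ones f (by omega), shift_eq_mc, mc_ones_self]

/-- The identity `(2a+1)(2b+1) = 2(2ab+a+b)+1` is the source of the first component in the
composition of GT-shadows. -/
theorem lam_lam {G : Type*} [Group G] (a b : ℤ) (x : G) :
    lam a (lam b x) = lam (2 * a * b + a + b) x := by
  rw [lam_eq_zpow, lam_eq_zpow, lam_eq_zpow, ← zpow_mul]
  ring_nf

namespace IsPair

variable {𝒩 𝒦 : OpCongr} {m m₁ : ℤ} {f f₁ : PB 3} (h : IsPair 𝒩 m f)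

/-- Evaluating a composite on the two generators yields the composition law. The associator ends at
a word whose coherence braid is `f⁻¹`, whence the factor `f`; all other coherence braids here are
trivial. -/
theorem comp_isData (hK : ∀ n, 𝒦.N n ≤ (h.Θ n).ker) {U : OpMap 𝒦} (hU : U.IsData m₁ f₁)
    {g : Braid 3} (hg : 𝒩.q 3 g = 𝒩.q 3 f * h.Θ 3 f₁) :
    (h.comp hK U).IsData (2 * m₁ * m + m₁ + m) g := by
  refine ⟨fun a b γ ha hb hγ => ?_, fun a b γ ha hb hγ => ?_⟩
  · change (𝒩.q 3 (Phi f 3 0 b.sh))⁻¹ * h.ΘQ hK 3 (U.T γ) * 𝒩.q 3 (Phi f 3 0 a.sh) = _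
    rw [hU.alpha γ ha hb hγ, h.ΘQ_q, ha, hb, Phi_alpha, map_inv, inv_inv, hg,
      Phi_node_node_leaf, map_one, mul_one]
  · change (𝒩.q 2 (Phi f 2 0 b.sh))⁻¹ * h.ΘQ hK 2 (U.T γ) * 𝒩.q 2 (Phi f 2 0 a.sh) = _
    rw [hU.beta γ ha hb hγ, h.ΘQ_q, ha, hb, Phi_node_leaf, map_one, inv_one, one_mul, mul_one,
      map_lam, h.Θ_σ (by omega), tgen_zero, ← map_lam, lam_lam]

theorem opMap_isData : h.opMap.IsData m f := by
  refine ⟨fun a b γ ha hb hγ => ?_, fun a b γ ha hb hγ => ?_⟩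
  · rw [h.opMap_T, hγ, ha, hb, Phi_alpha, map_inv, inv_inv, map_one, mul_one,
      Phi_node_node_leaf, map_one, mul_one]
  · rw [h.opMap_T, hγ, ha, hb, Phi_node_leaf, map_one, inv_one, one_mul, mul_one, h.Θ_σ (by omega),
      tgen_zero]

theorem T_eq {T : OpMap 𝒩} (hT : T.IsData m f) {n : ℕ} {a b : PaB n} (γ : a ⟶ b) : T.T γ =
    (𝒩.q n (Phi f n 0 b.sh))⁻¹ * h.Θ n (ou γ) * 𝒩.q n (Phi f n 0 a.sh) := by
  rw [← h.opMap_T]; exact OpMap.ext_of_isData hT h.opMap_isData γ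

theorem T_comb {T : OpMap 𝒩} (hT : T.IsData m f) {n : ℕ} {a b : PaB (n + 1)} (γ : a ⟶ b)
    (ha : a.sh = .comb n) (hb : b.sh = .comb n) : T.T γ = h.Θ (n + 1) (ou γ) := by
  rw [h.T_eq hT γ, ha, hb, Phi_comb, map_one, inv_one, one_mul, mul_one]

theorem exists_comb_mor {n : ℕ} (g : Braid (n + 1)) :
    ∃ (a b : PaB (n + 1)) (γ : a ⟶ b), a.sh = .comb n ∧ b.sh = .comb n ∧ ou γ = g := by
  obtain ⟨a, b, γ, ha, hb, hγ, -⟩ := exists_mor (Shape.size_comb n) (Shape.size_comb n) 1 g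
  exact ⟨a, b, γ, ha, hb, hγ⟩

/-- The relations for the composite pair hold because an operadic map with these data exists. On
left-normed words operadic maps coincide with `Θ`, which gives the formula for the composite
homomorphism. -/
theorem exists_comp (hK : ∀ n, 𝒦.N n ≤ (h.Θ n).ker) (h₁ : IsPair 𝒦 m₁ f₁)
    {g : PB 3} (hg : 𝒩.q 3 g = 𝒩.q 3 f * h.Θ 3 f₁) :
    ∃ h' : IsPair 𝒩 (2 * m₁ * m + m₁ + m) g, ∀ n, h'.Θ n = (h.ΘQ hK n).comp (h₁.Θ n) := by
  have hd := h.comp_isData hK h₁.opMap_isData hg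
  have h' := OpMap.isPair_of_isData hd
  refine ⟨h', fun n => ?_⟩
  refine MonoidHom.ext fun g => ?_
  cases n with
  -- There are no words without letters, so zero strands are treated apart.
  | zero => rw [braid_eq_one (by omega) g, map_one, map_one]
  | succ n =>
    obtain ⟨a, b, γ, ha, hb, rfl⟩ := exists_comb_mor g
    rw [← h'.T_comb hd γ ha hb]
    change (𝒩.q _ (Phi f _ 0 b.sh))⁻¹ * h.ΘQ hK _ (h₁.opMap.T γ) * 𝒩.q _ (Phi f _ 0 a.sh) = _
    rw [h₁.T_comb h₁.opMap_isData γ ha hb, ha, hb, Phi_comb, map_one, inv_one, one_mul, mul_one]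
    rfl

theorem isData_congr {T : OpMap 𝒩} (hT : T.IsData m f)
    (hm : 𝒩.q 2 (lam m (σ 2 0)) = 𝒩.q 2 (lam m₁ (σ 2 0))) (hf : 𝒩.q 3 f = 𝒩.q 3 f₁) :
    T.IsData m₁ f₁ :=
  ⟨fun _ _ γ ha hb hγ => by rw [hT.alpha γ ha hb hγ, hf],
    fun _ _ γ ha hb hγ => by rw [hT.beta γ ha hb hγ, hm]⟩

theorem Θ_congr (h₁ : IsPair 𝒩 m₁ f₁) (hm : 𝒩.q 2 (lam m (σ 2 0)) = 𝒩.q 2 (lam m₁ (σ 2 0)))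
    (hf : 𝒩.q 3 f = 𝒩.q 3 f₁) (n : ℕ) : h.Θ n = h₁.Θ n := by
  refine MonoidHom.ext fun g => ?_
  cases n with
  | zero => rw [braid_eq_one (by omega) g, map_one, map_one]
  | succ n =>
    obtain ⟨a, b, γ, ha, hb, rfl⟩ := exists_comb_mor g
    rw [← h₁.T_comb (isData_congr h.opMap_isData hm hf) γ ha hb, h.T_comb h.opMap_isData γ ha hb]

theorem mono (h3 : 𝒦.N 3 ≤ 𝒩.N 3) (h4 : 𝒦.N 4 ≤ 𝒩.N 4) (h : IsPair 𝒦 m f) : IsPair 𝒩 m f :=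
  ⟨𝒩.q_eq_iff.2 (h3 (𝒦.q_eq_iff.1 h.hexagon₁)), 𝒩.q_eq_iff.2 (h3 (𝒦.q_eq_iff.1 h.hexagon₂)),
    𝒩.q_eq_iff.2 (h4 (𝒦.q_eq_iff.1 h.pentagon))⟩

end IsPair

/-! ### Reduction of pairs, and charming pairs -/

/-- The projection between quotients of the braid group. -/
def OpCongr.red {𝒦 𝒩 : OpCongr} {n : ℕ} (hn : 𝒦.N n ≤ 𝒩.N n) : Braid n ⧸ 𝒦.N n →* Braid n ⧸ 𝒩.N n :=
  QuotientGroup.map _ _ (MonoidHom.id _) hn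

theorem OpCongr.red_q {𝒦 𝒩 : OpCongr} {n : ℕ} (hn : 𝒦.N n ≤ 𝒩.N n) (x : Braid n) :
    OpCongr.red hn (𝒦.q n x) = 𝒩.q n x := rfl

namespace IsPair

variable {𝒩 𝒦 : OpCongr} {m m₁ : ℤ} {f f₁ : PB 3}

theorem red_Θ (h : IsPair 𝒦 m f) (h' : IsPair 𝒩 m f) {n : ℕ} (hn : 𝒦.N n ≤ 𝒩.N n) :
    (OpCongr.red hn).comp (h.Θ n) = h'.Θ n := by
  apply braidHom_ext
  intro i hi
  rw [MonoidHom.comp_apply, h.Θ_σ hi, h'.Θ_σ hi, OpCongr.red_q]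

/-- The properties of a charming GT-shadow. -/
structure Charm (h : IsPair 𝒩 m f) : Prop where
  surj : ∀ n, Function.Surjective (h.Θ n)
  commutator : ∃ c ∈ ⁅F2, F2⁆, 𝒩.q 3 f = 𝒩.q 3 c
  mapF2 : F2.map (h.Θ 3) = F2.map (𝒩.q 3)

theorem Charm.comp {h : IsPair 𝒩 m f} (hc : h.Charm) (hK : ∀ n, 𝒦.N n ≤ (h.Θ n).ker)
    {h₁ : IsPair 𝒦 m₁ f₁} (hc₁ : h₁.Charm) {m' : ℤ} {g : PB 3} {h' : IsPair 𝒩 m' g}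
    (hg : 𝒩.q 3 g = 𝒩.q 3 f * h.Θ 3 f₁) (hΘ : ∀ n, h'.Θ n = (h.ΘQ hK n).comp (h₁.Θ n)) :
    h'.Charm := by
  have hq : ∀ n, (h.ΘQ hK n).comp (𝒦.q n) = h.Θ n := fun n => rfl
  refine ⟨fun n => ?_, ?_, ?_⟩
  · rw [hΘ n]
    refine Function.Surjective.comp (g := h.ΘQ hK n) (fun x => ?_) (hc₁.surj n)
    obtain ⟨y, rfl⟩ := hc.surj n x
    exact ⟨𝒦.q n y, rfl⟩
  · obtain ⟨c, hc2, hfc⟩ := hc.commutator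
    obtain ⟨c₁, hc1, hfc1⟩ := hc₁.commutator
    -- `Θ` and the projection have the same image of `F₂`, hence also the same image of its
    -- commutator subgroup.
    have h1 : h.Θ 3 c₁ ∈ ⁅F2, F2⁆.map (𝒩.q 3) := by
      rw [Subgroup.map_commutator, ← hc.mapF2, ← Subgroup.map_commutator]
      exact Subgroup.mem_map_of_mem _ hc1
    obtain ⟨d, hd, hd2⟩ := h1
    refine ⟨c * d, mul_mem hc2 hd, ?_⟩
    rw [hg, map_mul, hfc, hd2, ← h.ΘQ_q hK, ← h.ΘQ_q hK, hfc1]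
  · rw [hΘ, ← Subgroup.map_map, hc₁.mapF2, Subgroup.map_map, hq, hc.mapF2]

theorem Charm.mono {h : IsPair 𝒦 m f} (hc : h.Charm) (hn : ∀ n, 𝒦.N n ≤ 𝒩.N n)
    (h' : IsPair 𝒩 m f) : h'.Charm := by
  refine ⟨fun n x => ?_, ?_, ?_⟩
  · obtain ⟨y, rfl⟩ := 𝒩.q_surjective n x
    obtain ⟨z, hz⟩ := hc.surj n (𝒦.q n y)
    exact ⟨z, by rw [← h.red_Θ h' (hn n), MonoidHom.comp_apply, hz, OpCongr.red_q]⟩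
  · obtain ⟨c, hc2, hfc⟩ := hc.commutator
    exact ⟨c, hc2, by rw [← OpCongr.red_q (hn 3), hfc, OpCongr.red_q]⟩
  · rw [← h.red_Θ h' (hn 3), ← Subgroup.map_map, hc.mapF2, Subgroup.map_map]
    rfl

/-- `Θ` preserves the underlying permutations, so surjectivity can be tested on pure braids. -/
theorem map_PB_eq_iff (h : IsPair 𝒩 m f) (n : ℕ) :
    (PB n).map (h.Θ n) = (PB n).map (𝒩.q n) ↔ Function.Surjective (h.Θ n) := by
  constructor
  · intro H x
    obtain ⟨x, rfl⟩ := 𝒩.q_surjective n x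
    obtain ⟨y, hy⟩ := 𝒩.q_surjective n (h.Θ n x)
    have h1 : y⁻¹ * x ∈ PB n := by
      rw [MonoidHom.mem_ker, map_mul, map_inv, h.ρ_of_Θ hy.symm, inv_mul_cancel]
    have h2 : 𝒩.q n (y⁻¹ * x) ∈ (PB n).map (h.Θ n) := by
      rw [H]; exact Subgroup.mem_map_of_mem _ h1
    obtain ⟨z, -, hz⟩ := h2
    exact ⟨x * z, by rw [map_mul, hz, ← hy, ← map_mul, mul_inv_cancel_left]⟩
  · intro H
    apply le_antisymm
    · rintro _ ⟨x, hx, rfl⟩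
      obtain ⟨y, hy⟩ := 𝒩.q_surjective n (h.Θ n x)
      refine ⟨y, ?_, hy⟩
      rw [SetLike.mem_coe, MonoidHom.mem_ker, h.ρ_of_Θ hy.symm]; exact hx
    · rintro _ ⟨y, hy, rfl⟩
      obtain ⟨x, hx⟩ := H (𝒩.q n y)
      refine ⟨x, ?_, hx⟩
      rw [SetLike.mem_coe, MonoidHom.mem_ker, ← h.ρ_of_Θ hx]; exact hy

end IsPair

/-! ### The congruences of elements of `NFI` -/

namespace NFI

variable {K N : NFI}

theorem oc_mono (h : K ≤ N) (n : ℕ) : K.oc.N n ≤ N.oc.N n := by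
  have h4 : K.N ≤ N.N := h
  have h3 : K.N3 ≤ N.N3 := fun g hg => ⟨hg.1, h4 hg.2.1, h4 hg.2.2.1, fun p => h4 (hg.2.2.2 p)⟩
  have h2 : K.N2 ≤ N.N2 := fun g hg => ⟨hg.1, h3 hg.2.1, h3 hg.2.2.1, fun p => h3 (hg.2.2.2 p)⟩
  match n with
  | 0 | 1 => exact le_rfl
  | 2 => exact h2
  | 3 => exact h3
  | 4 => exact h4
  | _ + 5 => exact le_rfl

variable {m : ℤ} {f : PB 3}

/-- The kernel of `Θ`, as an element of `NFI`. -/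
def ker (h : IsPair N.oc m f) : NFI := ⟨(h.Θ 4).ker, inferInstance, h.ker.finiteIndex 4, h.ker_le_PB 4⟩

/-- On 3 and 2 strands the kernel is determined by the one on 4 strands through `pull`; elsewhere it
is the pure braid group. So the congruence of kernels comes from an element of `NFI` again, for
which GT-shadows make sense. -/
theorem ker_oc (h : IsPair N.oc m f) (n : ℕ) : (ker h).oc.N n = (h.Θ n).ker := by
  have h3 : (ker h).N3 = (h.Θ 3).ker := (h.ker_eq_pull (n := 3) le_rfl).symm
  have h2 : (ker h).N2 = (h.Θ 2).ker := by
    rw [NFI.N2, h3]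
    exact (h.ker_eq_pull (n := 2) le_rfl).symm
  have hPB : ∀ n, N.oc.N n = PB n → PB n = (h.Θ n).ker := by
    intro n hn
    refine le_antisymm (fun g hg => ?_) (h.ker_le_PB n)
    obtain ⟨y, hy⟩ := N.oc.q_surjective n (h.Θ n g)
    rw [MonoidHom.mem_ker, ← hy, N.oc.q_eq_one_iff, hn, MonoidHom.mem_ker, h.ρ_of_Θ hy.symm]
    exact hg
  match n with
  | 0 | 1 => exact hPB _ rfl
  | 2 => exact h2
  | 3 => exact h3
  | 4 => rfl
  | _ + 5 => exact hPB _ rfl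

end NFI

/-! ### GT-pairs as operadic maps -/

section GTPair

variable {N : NFI} {m : ℤ} {f : PB 3}

theorem isGTPair_iff : IsGTPair N m f ↔ IsPair N.oc m f := by
  have e0 : (cable (n := 2) 2 0 (lam m (σ 2 0)) : Braid 3) = σ 3 0 * σ 3 1 * (x13 * x23) ^ m := cable_lam₀ m
  have e1 : (cable (n := 2) 2 1 (lam m (σ 2 0)) : Braid 3) = σ 3 1 * σ 3 0 * (x12 * x13) ^ m := cable_lam₁ m
  constructor
  · intro h
    refine ⟨?_, ?_, h.pentagon⟩
    · have := h.hexagon₁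
      rw [e0]
      simp only [lam, ← mul_assoc] at this ⊢
      exact this
    · have := h.hexagon₂
      rw [e1]
      simp only [lam, ← mul_assoc] at this ⊢
      exact this
  · intro h
    refine ⟨?_, ?_, h.pentagon⟩
    · have := h.hexagon₁
      rw [e0] at this
      simp only [lam, ← mul_assoc] at this ⊢
      exact this
    · have := h.hexagon₂
      rw [e1] at this
      simp only [lam, ← mul_assoc] at this ⊢
      exact this

theorem TB2_eq (h : IsPair N.oc m f) : IsGTPair.TB2 N m = h.Θ 2 := by
  apply braidHom_ext
  intro i hi
  obtain rfl : i = 0 := by omega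
  refine Eq.trans ?_ (h.Θ_σ hi).symm
  rw [tgen_zero]
  exact braidLift_σ _ _ _ _ _ hi

theorem TB3_eq (h : IsPair N.oc m f) (h' : IsGTPair N m f) : h'.TB3 = h.Θ 3 := by
  apply braidHom_ext
  intro i hi
  refine Eq.trans (braidLift_σ _ _ _ _ _ hi) (Eq.trans ?_ (h.Θ_σ hi).symm)
  obtain rfl | rfl : i = 0 ∨ i = 1 := by omega
  · rw [tgen_zero]; rfl
  · rw [tgen_three]; rfl

theorem TB4_eq (h : IsPair N.oc m f) (h' : IsGTPair N m f) : h'.TB4 = h.Θ 4 := by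
  apply braidHom_ext
  intro i hi
  refine Eq.trans (braidLift_σ _ _ _ _ _ hi) (Eq.trans ?_ (h.Θ_σ hi).symm)
  obtain rfl | rfl | rfl : i = 0 ∨ i = 1 ∨ i = 2 := by omega
  · rw [tgen_zero]; rfl
  · rw [tgen, IsPair.tri_ones _ (by omega)]; rfl
  · have : tri (f : Braid 3) 4 0 2 1 1 = double 0 (f : Braid 3) := by
      rw [tri_of_ne (by omega), double, cable_eq_mc]
      apply mc_congr
      intro i hi
      interval_cases i <;> rfl
    rw [tgen, this]; rfl

theorem surjective_of_N_eq_PB {𝒩 : OpCongr} (h : IsPair 𝒩 m f) {n : ℕ} (hn : 𝒩.N n = PB n) :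
    Function.Surjective (h.Θ n) := by
  rw [← h.map_PB_eq_iff]
  have h1 : (PB n).map (𝒩.q n) = ⊥ := by
    rw [Subgroup.map_eq_bot_iff, ← hn]
    exact fun x hx => 𝒩.q_eq_one_iff.2 hx
  rw [h1, Subgroup.map_eq_bot_iff]
  intro x hx
  obtain ⟨y, hy⟩ := 𝒩.q_surjective n (h.Θ n x)
  rw [MonoidHom.mem_ker, ← hy, 𝒩.q_eq_one_iff, hn, MonoidHom.mem_ker, h.ρ_of_Θ hy.symm]
  exact hx

theorem isCharming_iff : IsCharming N m f ↔ ∃ h : IsPair N.oc m f, h.Charm := by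
  constructor
  · intro H
    have h := isGTPair_iff.1 H.isGTShadow.isGTPair
    refine ⟨h, fun n => ?_, ?_, ?_⟩
    · match n with
      | 0 | 1 => exact surjective_of_N_eq_PB h rfl
      | 2 => rw [← h.map_PB_eq_iff, ← TB2_eq h]; exact H.isGTShadow.onto2
      | 3 => rw [← h.map_PB_eq_iff, ← TB3_eq h H.isGTShadow.isGTPair]; exact H.isGTShadow.onto3
      | 4 => rw [← h.map_PB_eq_iff, ← TB4_eq h H.isGTShadow.isGTPair]; exact H.isGTShadow.onto4
      | _ + 5 => exact surjective_of_N_eq_PB h rfl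
    · obtain ⟨c, hc, hfc⟩ := H.commutator
      exact ⟨c, hc, N.oc.q_eq_iff.2 hfc⟩
    · rw [← TB3_eq h H.isGTShadow.isGTPair]; exact H.ontoF2
  · rintro ⟨h, hc⟩
    have h' := isGTPair_iff.2 h
    refine ⟨⟨h', ?_, ?_, ?_⟩, ?_, ?_⟩
    · rw [TB2_eq h]; exact (h.map_PB_eq_iff 2).2 (hc.surj 2)
    · rw [TB3_eq h]; exact (h.map_PB_eq_iff 3).2 (hc.surj 3)
    · rw [TB4_eq h]; exact (h.map_PB_eq_iff 4).2 (hc.surj 4)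
    · obtain ⟨c, hc, hfc⟩ := hc.commutator
      exact ⟨c, hc, N.oc.q_eq_iff.1 hfc⟩
    · rw [TB3_eq h]; exact hc.mapF2

end GTPair

/-! ### Classes of GT-pairs -/

theorem mem_PB_two_iff (g : Braid 2) : g ∈ PB 2 ↔ ∃ k : ℤ, g = (σ 2 0 ^ 2) ^ k := by
  constructor
  · intro hg
    obtain ⟨k, rfl⟩ := exists_zpow_braid_two g
    obtain ⟨a, rfl⟩ := (σ_two_zpow_mem_iff k).1 hg
    exact ⟨a, by rw [← zpow_natCast, ← zpow_mul]; congr 1; push_cast; ring⟩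
  · rintro ⟨k, rfl⟩
    exact zpow_mem σ_two_sq_mem k

/-- The quotient `PB₂/N_{PB₂}` is cyclic and generated by the class of `x₁₂`, so `N_ord` is the
order of this class. -/
theorem zpow_mem_N2_iff (N : NFI) (k : ℤ) : (σ 2 0 ^ 2) ^ k ∈ N.N2 ↔ (N.Nord : ℤ) ∣ k := by
  let x : PB 2 := ⟨σ 2 0 ^ 2, σ_two_sq_mem⟩
  have h1 : ∀ y : PB 2 ⧸ N.N2.subgroupOf (PB 2), y ∈ Subgroup.zpowers (x : PB 2 ⧸ N.N2.subgroupOf (PB 2)) := by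
    intro y
    induction y using QuotientGroup.induction_on with | _ z
    obtain ⟨k, hk⟩ := (mem_PB_two_iff z).1 z.2
    have : z = x ^ k := Subtype.ext (by rw [hk]; rfl)
    exact ⟨k, by rw [this]; rfl⟩
  have h2 := orderOf_eq_card_of_forall_mem_zpowers h1
  have h3 : N.Nord = Nat.card (PB 2 ⧸ N.N2.subgroupOf (PB 2)) := rfl
  rw [h3, ← h2, orderOf_dvd_iff_zpow_eq_one, ← QuotientGroup.mk_zpow, QuotientGroup.eq_one_iff,
    Subgroup.mem_subgroupOf]
  rfl

theorem q_lam_eq_iff (N : NFI) (m m' : ℤ) :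
    N.oc.q 2 (lam m (σ 2 0)) = N.oc.q 2 (lam m' (σ 2 0)) ↔ (m : ZMod N.Nord) = m' := by
  rw [ZMod.intCast_eq_intCast_iff_dvd_sub, ← zpow_mem_N2_iff, N.oc.q_eq_iff]
  have : (lam m (σ 2 0))⁻¹ * lam m' (σ 2 0) = (σ 2 0 ^ 2) ^ (m' - m) := by
    rw [lam, lam, sub_eq_neg_add, zpow_add, zpow_neg]; group
  rw [this]
  rfl

theorem mkPair_eq_iff {N : NFI} {m m' : ℤ} {f f' : PB 3} : mkPair N m f = mkPair N m' f' ↔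
    N.oc.q 2 (lam m (σ 2 0)) = N.oc.q 2 (lam m' (σ 2 0)) ∧ N.oc.q 3 f = N.oc.q 3 f' := by
  rw [q_lam_eq_iff, N.oc.q_eq_iff, mkPair, mkPair, Prod.mk.injEq, QuotientGroup.eq,
    Subgroup.mem_subgroupOf]
  rfl

theorem NFI.Nord_ne_zero (N : NFI) : N.Nord ≠ 0 :=
  have : N.N2.FiniteIndex := N.oc.finiteIndex 2
  (Subgroup.isFiniteRelIndex_of_finiteIndex).relIndex_ne_zero

instance (N : NFI) : Finite (Pairs N) := by
  have : NeZero N.Nord := ⟨N.Nord_ne_zero⟩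
  have : N.N3.FiniteIndex := N.oc.finiteIndex 3
  infer_instance

instance (N : NFI) : Finite (GTcharm N) := inferInstanceAs (Finite (Subtype _))

namespace GTcharm

variable {N : NFI}

/-- The class of a charming GT-shadow. -/
noncomputable def mk {m : ℤ} {f : PB 3} (h : IsPair N.oc m f) (hc : h.Charm) : GTcharm N :=
  ⟨mkPair N m f, m, f, rfl, isCharming_iff.2 ⟨h, hc⟩⟩

/-- The first component of a representative. -/
noncomputable def m (s : GTcharm N) : ℤ := s.2.choose

/-- The second component of a representative. -/
noncomputable def f (s : GTcharm N) : PB 3 := s.2.choose_spec.choose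

theorem mkPair_rep (s : GTcharm N) : mkPair N s.m s.f = s.1 := s.2.choose_spec.choose_spec.1

theorem exists_charm (s : GTcharm N) : ∃ h : IsPair N.oc s.m s.f, h.Charm :=
  isCharming_iff.1 s.2.choose_spec.choose_spec.2

theorem isPair (s : GTcharm N) : IsPair N.oc s.m s.f := s.exists_charm.choose

theorem charm (s : GTcharm N) : s.isPair.Charm := s.exists_charm.choose_spec

/-- The braiding, transformed by `s`. -/
noncomputable def L (s : GTcharm N) : Braid 2 ⧸ N.oc.N 2 := N.oc.q 2 (lam s.m (σ 2 0))

/-- The class of the second component. -/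
noncomputable def F (s : GTcharm N) : Braid 3 ⧸ N.oc.N 3 := N.oc.q 3 s.f

/-- The homomorphism given by `s`. -/
noncomputable def Θ (s : GTcharm N) (n : ℕ) : Braid n →* Braid n ⧸ N.oc.N n := s.isPair.Θ n

theorem val_eq_iff (s : GTcharm N) {m : ℤ} {f : PB 3} :
    s.1 = mkPair N m f ↔ s.L = N.oc.q 2 (lam m (σ 2 0)) ∧ s.F = N.oc.q 3 f := by
  rw [← s.mkPair_rep, mkPair_eq_iff]; rfl

theorem ext {s t : GTcharm N} (h₁ : s.L = t.L) (h₂ : s.F = t.F) : s = t :=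
  Subtype.ext (by rw [← t.mkPair_rep, s.val_eq_iff]; exact ⟨h₁, h₂⟩)

section mk

variable {m : ℤ} {f : PB 3} (h : IsPair N.oc m f) (hc : h.Charm)

theorem L_mk : (mk h hc).L = N.oc.q 2 (lam m (σ 2 0)) := ((mk h hc).val_eq_iff.1 rfl).1

theorem F_mk : (mk h hc).F = N.oc.q 3 f := ((mk h hc).val_eq_iff.1 rfl).2

theorem Θ_mk (n : ℕ) : (mk h hc).Θ n = h.Θ n :=
  IsPair.Θ_congr _ h (L_mk h hc) (F_mk h hc) n

end mk

theorem Θ_σ (s : GTcharm N) : s.Θ 2 (σ 2 0) = s.L := by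
  rw [Θ, s.isPair.Θ_σ (by omega), tgen_zero]; rfl

theorem Θ_lam (s : GTcharm N) (m : ℤ) : s.Θ 2 (lam m (σ 2 0)) = lam m s.L := by
  rw [map_lam, Θ_σ]

end GTcharm

theorem IsPair.exists_rep {𝒩 : OpCongr} {m : ℤ} {f : PB 3} (h : IsPair 𝒩 m f) (f₁ : PB 3) :
    ∃ g : PB 3, 𝒩.q 3 g = 𝒩.q 3 f * h.Θ 3 f₁ := by
  obtain ⟨y, hy⟩ := 𝒩.q_surjective 3 (h.Θ 3 f₁)
  refine ⟨f * ⟨y, ?_⟩, by rw [Subgroup.coe_mul, map_mul, hy]⟩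
  rw [MonoidHom.mem_ker, h.ρ_of_Θ hy.symm]
  exact f₁.2

/-! ### The trivial GT-shadow -/

theorem OpMap.proj_isData (𝒩 : OpCongr) : (OpMap.proj 𝒩).IsData 0 ((1 : PB 3) : Braid 3) :=
  ⟨fun _ _ γ _ _ hγ => by change 𝒩.q 3 (PaB.ou γ) = _; rw [hγ]; rfl,
    fun _ _ γ _ _ hγ => by change 𝒩.q 2 (PaB.ou γ) = _; rw [hγ]; simp [lam]⟩

/-- The trivial GT-pair. -/
theorem isPair_one (𝒩 : OpCongr) : IsPair 𝒩 0 1 := OpMap.isPair_of_isData (OpMap.proj_isData 𝒩)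

theorem isPair_one_Θ (𝒩 : OpCongr) (n : ℕ) : (isPair_one 𝒩).Θ n = 𝒩.q n := by
  apply braidHom_ext
  intro i hi
  have : tri ((1 : PB 3) : Braid 3) n 0 i 1 1 = 1 := by
    rcases em (i = 0 ∨ 1 = 0 ∨ 1 = 0) with h | h
    · exact tri_of_eq h
    · rw [tri_of_ne h]; exact mc_one _
  rw [(isPair_one 𝒩).Θ_σ hi, tgen, this]
  simp [lam]

theorem isPair_one_charm (𝒩 : OpCongr) : (isPair_one 𝒩).Charm := by
  refine ⟨fun n => ?_, ⟨1, one_mem _, rfl⟩, ?_⟩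
  · rw [isPair_one_Θ]; exact 𝒩.q_surjective n
  · rw [isPair_one_Θ]

namespace GTcharm

variable {N : NFI}

/-- The trivial GT-shadow. -/
noncomputable instance : One (GTcharm N) := ⟨mk (isPair_one N.oc) (isPair_one_charm N.oc)⟩

theorem L_one : (1 : GTcharm N).L = N.oc.q 2 (σ 2 0) := by
  rw [show (1 : GTcharm N) = mk _ _ from rfl, L_mk]; simp [lam]

theorem F_one : (1 : GTcharm N).F = 1 := by
  rw [show (1 : GTcharm N) = mk _ _ from rfl, F_mk]; exact map_one _

theorem Θ_one (n : ℕ) : (1 : GTcharm N).Θ n = N.oc.q n := by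
  rw [show (1 : GTcharm N) = mk _ _ from rfl, Θ_mk, isPair_one_Θ]

end GTcharm

theorem NFI.ext' {K N : NFI} (h : K.N = N.N) : K = N := by
  cases K; cases N; cases h; rfl

/-! ### Existence of isolated elements -/

/-- The intersection of the kernels of all charming GT-shadows. -/
noncomputable def NFI.isolate (N : NFI) : NFI where
  N := ⨅ s : GTcharm N, (s.Θ 4).ker
  normal := Subgroup.normal_iInf_normal fun _ => inferInstance
  finiteIndex := Subgroup.finiteIndex_iInf fun s => s.isPair.ker.finiteIndex 4
  le_PB := (iInf_le _ (1 : GTcharm N)).trans ((1 : GTcharm N).isPair.ker_le_PB 4)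

theorem NFI.isolate_le_ker (N : NFI) (s : GTcharm N) : N.isolate ≤ NFI.ker s.isPair :=
  iInf_le (fun s : GTcharm N => (s.Θ 4).ker) s

theorem NFI.isolate_le (N : NFI) : N.isolate ≤ N := by
  intro g hg
  have := Subgroup.mem_iInf.1 hg 1
  rw [GTcharm.Θ_one, MonoidHom.mem_ker] at this
  exact N.oc.q_eq_one_iff.1 this

/-- Since `φ` is onto, its kernel has the same finite index as `I`, so an inclusion is an equality.
-/
theorem ker_eq_of_le {G : Type*} [Group G] {I : Subgroup G} [I.Normal] [I.FiniteIndex] (φ : G →* G ⧸ I)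
    (hφ : Function.Surjective φ) (h : I ≤ φ.ker) : φ.ker = I := by
  refine le_antisymm ?_ h
  have h1 : φ.ker.index = I.index := by
    rw [Subgroup.index_ker, MonoidHom.range_eq_top.2 hφ]
    exact Nat.card_congr Subgroup.topEquiv.toEquiv
  have h2 := Subgroup.relIndex_mul_index h
  rw [h1] at h2
  have h3 : I.index ≠ 0 := Subgroup.FiniteIndex.index_ne_zero
  exact Subgroup.relIndex_eq_one.1 (by
    have : I.relIndex φ.ker * I.index = 1 * I.index := by rw [h2, one_mul]
    exact Nat.eq_of_mul_eq_mul_right (Nat.pos_of_ne_zero h3) this)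

/-- Let `(m, f)` be charming for the intersection. Reduced modulo the kernel of a charming shadow
`s` of `N` and composed with `s`, it is a charming shadow of `N` again, and so its kernel contains
the intersection. Thus `Θ` of `(m, f)` sends the intersection into the kernel of every `s`, that is,
kills it modulo the intersection; `ker_eq_of_le` concludes. -/
theorem NFI.isIsolated_isolate (N : NFI) : IsIsolated N.isolate := by
  intro m f H
  obtain ⟨h, hc⟩ := isCharming_iff.1 H
  rw [IsCharming.T4, TB4_eq h]
  have : N.isolate.N.FiniteIndex := N.isolate.finiteIndex
  refine ker_eq_of_le _ (hc.surj 4) fun g hg => ?_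
  obtain ⟨y, hy⟩ := N.isolate.oc.q_surjective 4 (h.Θ 4 g)
  rw [MonoidHom.mem_ker]
  change h.Θ 4 g = 1
  rw [← hy, OpCongr.q_eq_one_iff]
  refine Subgroup.mem_iInf.2 fun s => ?_
  have hle := NFI.oc_mono (N.isolate_le_ker s)
  have hs : IsPair (NFI.ker s.isPair).oc m f := h.mono (hle 3) (hle 4)
  have hK : ∀ n, (NFI.ker s.isPair).oc.N n ≤ (s.isPair.Θ n).ker := fun n => (NFI.ker_oc s.isPair n).le
  obtain ⟨f', hf'⟩ := s.isPair.exists_rep f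
  obtain ⟨h', hΘ⟩ := s.isPair.exists_comp hK hs hf'
  have hc' := s.charm.comp hK (hc.mono hle hs) hf' hΘ
  have hg' := Subgroup.mem_iInf.1 hg (GTcharm.mk h' hc')
  rw [GTcharm.Θ_mk, hΘ, MonoidHom.mem_ker, MonoidHom.comp_apply, ← h.red_Θ hs (hle 4),
    MonoidHom.comp_apply, ← hy, OpCongr.red_q, IsPair.ΘQ_q] at hg'
  exact hg'

/-! ### The group of charming GT-shadows of an isolated element -/

namespace GTcharm

variable {N : NFI} (hN : IsIsolated N)

include hN

/-- Isolation is a condition on four strands only; `NFI.ker_oc` extends it to all numbers of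
strands. -/
theorem ker_Θ (s : GTcharm N) (n : ℕ) : (s.Θ n).ker = N.oc.N n := by
  have h1 : NFI.ker s.isPair = N := by
    have := hN s.m s.f (isCharming_iff.2 s.exists_charm)
    rw [IsCharming.T4, TB4_eq s.isPair] at this
    exact NFI.ext' this
  have := NFI.ker_oc s.isPair n
  rw [h1] at this
  exact this.symm

/-- The automorphism given by `s`. -/
noncomputable def ΘQ (s : GTcharm N) (n : ℕ) : Braid n ⧸ N.oc.N n →* Braid n ⧸ N.oc.N n :=
  s.isPair.ΘQ (fun n => (ker_Θ hN s n).ge) n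

theorem ΘQ_q (s : GTcharm N) (n : ℕ) (x : Braid n) : s.ΘQ hN n (N.oc.q n x) = s.Θ n x := rfl

theorem ΘQ_injective (s : GTcharm N) (n : ℕ) : Function.Injective (s.ΘQ hN n) := by
  rw [injective_iff_map_eq_one]
  intro x hx
  obtain ⟨x, rfl⟩ := N.oc.q_surjective n x
  rw [N.oc.q_eq_one_iff, ← ker_Θ hN s n]
  exact hx

/-- A representative of the composite. -/
theorem exists_mul (s t : GTcharm N) : ∃ u : GTcharm N, u.L = s.ΘQ hN 2 t.L ∧
    u.F = s.F * s.ΘQ hN 3 t.F ∧ ∀ n, u.Θ n = (s.ΘQ hN n).comp (t.Θ n) := by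
  obtain ⟨g, hg⟩ := s.isPair.exists_rep t.f
  obtain ⟨h', hΘ⟩ := s.isPair.exists_comp (fun n => (ker_Θ hN s n).ge) t.isPair hg
  refine ⟨mk h' (s.charm.comp _ t.charm hg hΘ), ?_, ?_, fun n => ?_⟩
  · rw [L_mk, L, ΘQ_q, Θ_lam, L, ← map_lam, lam_lam]
  · rw [F_mk, hg]; rfl
  · rw [Θ_mk, hΘ]; rfl

/-- The composite of charming GT-shadows. -/
noncomputable def mul (s t : GTcharm N) : GTcharm N := (exists_mul hN s t).choose

theorem L_mul (s t : GTcharm N) : (mul hN s t).L = s.ΘQ hN 2 t.L := (exists_mul hN s t).choose_spec.1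

theorem F_mul (s t : GTcharm N) : (mul hN s t).F = s.F * s.ΘQ hN 3 t.F :=
  (exists_mul hN s t).choose_spec.2.1

theorem ΘQ_mul (s t : GTcharm N) (n : ℕ) (x : Braid n ⧸ N.oc.N n) :
    (mul hN s t).ΘQ hN n x = s.ΘQ hN n (t.ΘQ hN n x) := by
  obtain ⟨x, rfl⟩ := N.oc.q_surjective n x
  rw [ΘQ_q, ΘQ_q]
  exact DFunLike.congr_fun ((exists_mul hN s t).choose_spec.2.2 n) x

theorem mul_assoc' (s t u : GTcharm N) : mul hN (mul hN s t) u = mul hN s (mul hN t u) := by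
  apply ext
  · rw [L_mul, L_mul, L_mul, ΘQ_mul]
  · rw [F_mul, F_mul, F_mul, F_mul, ΘQ_mul, map_mul, mul_assoc]

theorem mul_one' (s : GTcharm N) : mul hN s 1 = s := by
  apply ext
  · rw [L_mul, L_one, ΘQ_q, Θ_σ]
  · rw [F_mul, F_one, map_one, mul_one]

theorem mul_left_injective' (s : GTcharm N) : Function.Injective (mul hN s) := by
  intro t u h
  apply ext
  · apply ΘQ_injective hN s 2
    rw [← L_mul, h, L_mul]
  · apply ΘQ_injective hN s 3
    have : (mul hN s t).F = (mul hN s u).F := by rw [h]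
    rwa [F_mul, F_mul, mul_right_inj] at this

/-- Left multiplication is injective on a finite set, hence onto. -/
theorem exists_inv (s : GTcharm N) : ∃ t, mul hN s t = 1 :=
  (Finite.surjective_of_injective (mul_left_injective' hN s)) 1

/-- The group of charming GT-shadows of an isolated element. -/
noncomputable abbrev group : Group (GTcharm N) :=
  letI : Mul (GTcharm N) := ⟨mul hN⟩
  letI : Inv (GTcharm N) := ⟨fun s => (exists_inv hN s).choose⟩
  Group.ofRightAxioms (mul_assoc' hN) (mul_one' hN) (fun s => (exists_inv hN s).choose_spec)

end GTcharm

noncomputable instance (N : Isolated) : Group (GTcharm N.1) := GTcharm.group N.2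

namespace GTcharm

theorem mul_eq (N : Isolated) (s t : GTcharm N.1) : s * t = mul N.2 s t := rfl

theorem isComposite_mul (N : Isolated) (s t : GTcharm N.1) : IsComposite N.1 s t (s * t) := by
  intro m₂ f₂ h₂ m₁ f₁ h₁ hs ht
  obtain ⟨k₂, c₂⟩ := isCharming_iff.1 h₂
  obtain ⟨k₁, c₁⟩ := isCharming_iff.1 h₁
  obtain ⟨g, hg⟩ := k₂.exists_rep f₁
  have hs' : s = mk k₂ c₂ := Subtype.ext hs
  have ht' : t = mk k₁ c₁ := Subtype.ext ht
  have hΘ : ∀ n, s.Θ n = k₂.Θ n := fun n => by rw [hs', Θ_mk]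
  refine ⟨g, ?_, ?_⟩
  · rw [IsCharming.T3, TB3_eq k₂]; exact hg
  · rw [val_eq_iff, mul_eq, L_mul, F_mul]
    constructor
    · rw [ht', L_mk, ΘQ_q, Θ_lam, hs', L_mk, ← map_lam, lam_lam]
    · rw [hg, ht', F_mk, ΘQ_q, hΘ, hs', F_mk]

/-! ### Reduction -/

variable {K N : NFI} (hKN : K ≤ N)

/-- The reduction of charming GT-shadows. -/
noncomputable def red (s : GTcharm K) : GTcharm N :=
  mk (s.isPair.mono (NFI.oc_mono hKN 3) (NFI.oc_mono hKN 4)) (s.charm.mono (NFI.oc_mono hKN) _)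

theorem L_red (s : GTcharm K) : (red hKN s).L = OpCongr.red (NFI.oc_mono hKN 2) s.L := L_mk _ _

theorem F_red (s : GTcharm K) : (red hKN s).F = OpCongr.red (NFI.oc_mono hKN 3) s.F := F_mk _ _

theorem Θ_red (s : GTcharm K) (n : ℕ) :
    (red hKN s).Θ n = (OpCongr.red (NFI.oc_mono hKN n)).comp (s.Θ n) := by
  rw [red, Θ_mk]; exact (s.isPair.red_Θ _ _).symm

theorem isReduction_red (s : GTcharm K) : IsReduction s (red hKN s) := by
  intro m f hs
  rw [val_eq_iff] at hs ⊢
  rw [L_red, F_red, hs.1, hs.2]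
  exact ⟨rfl, rfl⟩

theorem red_refl (s : GTcharm N) : red le_rfl s = s := ext ((L_red _ s).trans
  (OpCongr.red_q (𝒦 := N.oc) (𝒩 := N.oc) le_rfl _)) ((F_red _ s).trans
    (OpCongr.red_q (𝒦 := N.oc) (𝒩 := N.oc) le_rfl _))

theorem red_red {M : NFI} (hNM : N ≤ M) (s : GTcharm K) :
    red hNM (red hKN s) = red (hKN.trans hNM) s := by
  apply ext
  · rw [L_red, L_red, L_red]; rfl
  · rw [F_red, F_red, F_red]; rfl

end GTcharm

/-- The reduction as a homomorphism. -/
noncomputable def GTcharm.redHom {K N : Isolated} (hKN : K ≤ N) : GTcharm K.1 →* GTcharm N.1 :=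
  MonoidHom.mk' (GTcharm.red hKN) fun s t => by
    have key : ∀ n x, OpCongr.red (NFI.oc_mono hKN n) (s.ΘQ K.2 n x) =
        (red hKN s).ΘQ N.2 n (OpCongr.red (NFI.oc_mono hKN n) x) := by
      intro n x
      obtain ⟨x, rfl⟩ := K.1.oc.q_surjective n x
      rw [ΘQ_q, OpCongr.red_q, ΘQ_q, Θ_red]
      rfl
    rw [mul_eq, mul_eq]
    apply GTcharm.ext
    · rw [L_red, L_mul, L_mul, key, L_red]
    · rw [F_red, F_mul, F_mul, map_mul, key, F_red, F_red]

/-- The functor which assigns to an isolated element its group of charming GT-shadows. -/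
noncomputable def ML : Isolated ⥤ FiniteGrp.{0} where
  obj N := FiniteGrp.of (GTcharm N.1)
  map h := FiniteGrp.ofHom (GTcharm.redHom (leOfHom h))
  map_id N := by
    ext s
    exact GTcharm.red_refl s
  map_comp {K M N} h k := by
    ext s
    exact (GTcharm.red_red (leOfHom h) (leOfHom k) s).symm

/-! ### The structure of the pure braid group on three strands -/

section BraidRelation

variable {G : Type*} [Group G] {s t : G} (hb : s * t * s = t * s * t)

include hb

theorem delta_mul_left : s * t * s * s = t * (s * t * s) := by
  calc _ = (t * s * t) * s := by rw [hb]
    _ = _ := by group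

theorem delta_mul_right : s * t * s * t = s * (s * t * s) := by
  calc _ = s * (t * s * t) := by group
    _ = _ := by rw [hb]

theorem twist_comm_left : Commute (s * t * s * (s * t * s)) s := by
  change s * t * s * (s * t * s) * s = _
  rw [mul_assoc, delta_mul_left hb, ← mul_assoc, delta_mul_right hb, mul_assoc]

theorem twist_comm_right : Commute (s * t * s * (s * t * s)) t := by
  change s * t * s * (s * t * s) * t = _
  rw [mul_assoc, delta_mul_right hb, ← mul_assoc, delta_mul_left hb, mul_assoc]

theorem twist_eq : s * t * s * (s * t * s) = s ^ 2 * (t * s ^ 2 * t⁻¹) * t ^ 2 := by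
  calc _ = s * t * s * (t * s * t) := by rw [hb]
    _ = s * (t * s * t) * s * t := by simp only [mul_assoc]
    _ = s * (s * t * s) * s * t := by rw [hb]
    _ = _ := by simp only [pow_two, mul_assoc, inv_mul_cancel_left]

theorem conj_sq_eq : s * t ^ 2 * s⁻¹ = t⁻¹ * s ^ 2 * t := by
  have h : t * s * t * t = s * s * t * s := by
    rw [← hb, mul_assoc, mul_assoc, ← mul_assoc t, ← hb]
    simp only [mul_assoc]
  calc s * t ^ 2 * s⁻¹ = t⁻¹ * (t * s * t * t) * s⁻¹ := by
        simp only [pow_two, mul_assoc, inv_mul_cancel_left]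
    _ = _ := by
        rw [h]
        simp only [pow_two, mul_assoc, mul_inv_cancel, mul_one]

theorem conj_sq_eq' : s⁻¹ * t ^ 2 * s = t * s ^ 2 * t⁻¹ := by
  have h : t * (t * s * t) = s * t * s * s := by
    rw [← hb, delta_mul_left hb]
  calc s⁻¹ * t ^ 2 * s = s⁻¹ * (t * (t * s * t)) * t⁻¹ := by
        simp only [pow_two, mul_assoc, mul_inv_cancel, mul_one]
    _ = _ := by
        rw [h]
        simp only [pow_two, mul_assoc, inv_mul_cancel_left]

end BraidRelation

theorem σ_braid_three : σ 3 0 * σ 3 1 * σ 3 0 = σ 3 1 * σ 3 0 * σ 3 1 := σ_braid 3 0 (by omega)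

/-- The full twist of three strands. -/
def twist : Braid 3 := σ 3 0 * σ 3 1 * σ 3 0 * (σ 3 0 * σ 3 1 * σ 3 0)

theorem twist_comm (g : Braid 3) : Commute twist g := by
  induction g using braid_induction with
  | one => exact Commute.one_right _
  | mul g h hg hh => exact hg.mul_right hh
  | inv g hg => exact hg.inv_right
  | gen i hi =>
    obtain rfl | rfl : i = 0 ∨ i = 1 := by omega
    · exact twist_comm_left σ_braid_three
    · exact twist_comm_right σ_braid_three

theorem twist_eq_x : twist = x12 * x13 * x23 := twist_eq σ_braid_three

theorem x12_mem_PB : x12 ∈ PB 3 := sq_σ_mem_PB 3 0 (by omega)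

theorem x23_mem_PB : x23 ∈ PB 3 := sq_σ_mem_PB 3 1 (by omega)

theorem x13_mem_PB : x13 ∈ PB 3 := (MonoidHom.normal_ker (ρ 3)).conj_mem _ x12_mem_PB _

theorem twist_mem_PB : twist ∈ PB 3 := by
  rw [twist_eq_x]
  exact mul_mem (mul_mem x12_mem_PB x13_mem_PB) x23_mem_PB

theorem F2_le_PB : F2 ≤ PB 3 := by
  rw [F2, Subgroup.closure_le]
  rintro g (rfl | rfl)
  exacts [x12_mem_PB, x23_mem_PB]

theorem x12_mem_F2 : x12 ∈ F2 := Subgroup.subset_closure (Or.inl rfl)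

theorem x23_mem_F2 : x23 ∈ F2 := Subgroup.subset_closure (Or.inr rfl)

instance : (Subgroup.zpowers twist).Normal where
  conj_mem := by
    rintro _ ⟨k, rfl⟩ g
    refine ⟨k, ?_⟩
    simp only
    rw [← ((twist_comm g).zpow_left k).eq, mul_inv_cancel_right]

/-- The subgroup generated by `F₂` and the full twist. -/
def F2Z : Subgroup (Braid 3) := F2 ⊔ Subgroup.zpowers twist

theorem F2_le_F2Z : F2 ≤ F2Z := le_sup_left

theorem twist_mem_F2Z : twist ∈ F2Z :=
  (le_sup_right : Subgroup.zpowers twist ≤ F2Z) (Subgroup.mem_zpowers _)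

theorem F2Z_le_PB : F2Z ≤ PB 3 :=
  sup_le F2_le_PB ((Subgroup.zpowers_le).2 twist_mem_PB)

theorem x13_mem_F2Z : x13 ∈ F2Z := by
  have : x13 = x12⁻¹ * twist * x23⁻¹ := by rw [twist_eq_x]; group
  rw [this]
  exact mul_mem (mul_mem (inv_mem (F2_le_F2Z x12_mem_F2)) twist_mem_F2Z)
    (inv_mem (F2_le_F2Z x23_mem_F2))

theorem conj_x12_mem_F2Z : (σ 3 1)⁻¹ * x12 * σ 3 1 ∈ F2Z := by
  have : (σ 3 1)⁻¹ * x12 * σ 3 1 = twist * x23⁻¹ * x12⁻¹ := by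
    have h1 : twist = (σ 3 1)⁻¹ * twist * σ 3 1 := by
      rw [mul_assoc, (twist_comm _).eq, inv_mul_cancel_left]
    rw [h1, twist_eq_x, x12, x13, x23]; group
  rw [this]
  exact mul_mem (mul_mem twist_mem_F2Z (inv_mem (F2_le_F2Z x23_mem_F2)))
    (inv_mem (F2_le_F2Z x12_mem_F2))

theorem conj_mem_F2Z (g h : Braid 3) (hh : h ∈ F2Z) : g * h * g⁻¹ ∈ F2Z := by
  have key : ∀ a : Braid 3, a * x12 * a⁻¹ ∈ F2Z → a * x23 * a⁻¹ ∈ F2Z →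
      ∀ h ∈ F2Z, a * h * a⁻¹ ∈ F2Z := by
    intro a h1 h2 h hh
    have hle : F2Z ≤ F2Z.comap (MulAut.conj a).toMonoidHom := by
      refine sup_le ?_ ?_
      · rw [F2, Subgroup.closure_le]
        rintro _ (rfl | rfl)
        exacts [h1, h2]
      · rw [Subgroup.zpowers_le]
        change a * twist * a⁻¹ ∈ F2Z
        rw [← (twist_comm a).eq, mul_inv_cancel_right]
        exact twist_mem_F2Z
    exact hle hh
  have hb := σ_braid_three
  have m12 := F2_le_F2Z x12_mem_F2
  have m23 := F2_le_F2Z x23_mem_F2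
  -- Conjugation by the inverse generator is checked as well: that a subgroup is mapped into itself
  -- by one conjugation says nothing about the inverse conjugation.
  have hgen : ∀ i, i + 1 < 3 → (∀ h ∈ F2Z, σ 3 i * h * (σ 3 i)⁻¹ ∈ F2Z) ∧
      ∀ h ∈ F2Z, (σ 3 i)⁻¹ * h * (σ 3 i)⁻¹⁻¹ ∈ F2Z := by
    intro i hi
    obtain rfl | rfl : i = 0 ∨ i = 1 := by omega
    · refine ⟨key _ ?_ ?_, key _ ?_ ?_⟩
      · rw [show σ 3 0 * x12 * (σ 3 0)⁻¹ = x12 by rw [x12]; group]; exact m12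
      · rw [x23, conj_sq_eq hb]; exact conj_x12_mem_F2Z
      · rw [show (σ 3 0)⁻¹ * x12 * (σ 3 0)⁻¹⁻¹ = x12 by rw [x12]; group]; exact m12
      · rw [x23, inv_inv, conj_sq_eq' hb]; exact x13_mem_F2Z
    · refine ⟨key _ ?_ ?_, key _ ?_ ?_⟩
      · exact x13_mem_F2Z
      · rw [show σ 3 1 * x23 * (σ 3 1)⁻¹ = x23 by rw [x23]; group]; exact m23
      · rw [inv_inv]; exact conj_x12_mem_F2Z
      · rw [show (σ 3 1)⁻¹ * x23 * (σ 3 1)⁻¹⁻¹ = x23 by rw [x23]; group]; exact m23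
  have : (∀ h ∈ F2Z, g * h * g⁻¹ ∈ F2Z) ∧ ∀ h ∈ F2Z, g⁻¹ * h * g⁻¹⁻¹ ∈ F2Z := by
    clear hh
    induction g using braid_induction with
    | one => simp
    | mul a b ha hb =>
      refine ⟨fun h hh => ?_, fun h hh => ?_⟩
      · have := ha.1 _ (hb.1 h hh)
        simpa [mul_assoc] using this
      · have := hb.2 _ (ha.2 h hh)
        simpa [mul_assoc] using this
    | inv a ha => exact ⟨ha.2, by simpa using ha.1⟩
    | gen i hi => exact hgen i hi
  exact this.1 h hh

instance : F2Z.Normal := ⟨fun h hh g => conj_mem_F2Z g h hh⟩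

/-- The six elements of a group generated by two involutions which satisfy the braid relation. -/
def sixElements {G : Type*} [Group G] (s t : G) : Set G := {1, s, t, s * t, t * s, s * t * s}

theorem mul_mem_sixElements {G : Type*} [Group G] {s t : G} (hs : s * s = 1) (ht : t * t = 1)
    (hb : s * t * s = t * s * t) {x : G} (hx : x ∈ sixElements s t) :
    s * x ∈ sixElements s t ∧ t * x ∈ sixElements s t := by
  have h1 : ∀ y, s * (s * y) = y := fun y => by rw [← mul_assoc, hs, one_mul]
  have h2 : ∀ y, t * (t * y) = y := fun y => by rw [← mul_assoc, ht, one_mul]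
  have e1 : t * (s * t) = s * t * s := by rw [hb, mul_assoc]
  have e2 : t * (s * t * s) = s * t := by rw [hb, mul_assoc, h2]
  have e3 : s * (s * t * s) = t * s := by rw [mul_assoc, h1]
  have e4 : s * (t * s) = s * t * s := (mul_assoc _ _ _).symm
  rcases hx with rfl | rfl | rfl | rfl | rfl | rfl
  · simp [sixElements]
  · simp [sixElements, hs]
  · simp [sixElements, ht]
  · simp [sixElements, h1, e1]
  · simp [sixElements, h2, e4]
  · simp [sixElements, e2, e3]

/-- The quotient of `B₃` by this normal subgroup is generated by two involutions with the braid
relation, so it has at most the six elements of `sixElements`. Since the subgroup consists of pure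
braids, the class of a pure braid cannot be one of the five words with non-trivial permutation. -/
theorem mem_F2Z_of_mem_PB {g : Braid 3} (hg : g ∈ PB 3) : g ∈ F2Z := by
  let q := QuotientGroup.mk' F2Z
  have hq : ∀ x : Braid 3, q x = 1 ↔ x ∈ F2Z := fun x => QuotientGroup.eq_one_iff x
  have hs : q (σ 3 0) * q (σ 3 0) = 1 := by
    rw [← map_mul, ← pow_two, hq]; exact F2_le_F2Z x12_mem_F2
  have ht : q (σ 3 1) * q (σ 3 1) = 1 := by
    rw [← map_mul, ← pow_two, hq]; exact F2_le_F2Z x23_mem_F2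
  have hb : q (σ 3 0) * q (σ 3 1) * q (σ 3 0) = q (σ 3 1) * q (σ 3 0) * q (σ 3 1) := by
    simp only [← map_mul, σ_braid_three]
  have key : ∀ x, x ∈ sixElements (q (σ 3 0)) (q (σ 3 1)) ↔
      q g * x ∈ sixElements (q (σ 3 0)) (q (σ 3 1)) := by
    clear hg
    induction g using braid_induction with
    | one => simp
    | mul a b ha hb => intro x; rw [hb, ha, map_mul, mul_assoc]
    | inv a ha => intro x; rw [ha (q a⁻¹ * x), map_inv, mul_inv_cancel_left]
    | gen i hi =>
      intro x
      obtain rfl | rfl : i = 0 ∨ i = 1 := by omega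
      · refine ⟨fun h => (mul_mem_sixElements hs ht hb h).1, fun h => ?_⟩
        have := (mul_mem_sixElements hs ht hb h).1
        rwa [← mul_assoc, hs, one_mul] at this
      · refine ⟨fun h => (mul_mem_sixElements hs ht hb h).2, fun h => ?_⟩
        have := (mul_mem_sixElements hs ht hb h).2
        rwa [← mul_assoc, ht, one_mul] at this
  have h1 := (key 1).1 (Or.inl rfl)
  rw [mul_one] at h1
  have hne : ∀ (b : Braid 3) (i : Fin 3), ρ 3 b i ≠ i → q g ≠ q b := by
    intro b i hi h
    have h2 : ρ 3 (g⁻¹ * b) = 1 := F2Z_le_PB (QuotientGroup.eq.1 h)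
    rw [map_mul, map_inv, show ρ 3 g = 1 from hg, inv_one, one_mul] at h2
    exact hi (by rw [h2]; rfl)
  have hv := fun i hi x => ρ_σ_val 3 i hi x
  rcases h1 with h | h | h | h | h | h
  · exact (hq g).1 h
  · refine absurd h (hne (σ 3 0) 0 fun e => ?_)
    have := congrArg Fin.val e
    rw [hv 0 (by omega)] at this
    simp at this
  · refine absurd h (hne (σ 3 1) 1 fun e => ?_)
    have := congrArg Fin.val e
    rw [hv 1 (by omega)] at this
    simp at this
  · refine absurd h (hne (σ 3 0 * σ 3 1) 2 fun e => ?_)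
    have := congrArg Fin.val e
    rw [map_mul, Equiv.Perm.mul_apply, hv 0 (by omega), hv 1 (by omega)] at this
    simp at this
  · refine absurd h (hne (σ 3 1 * σ 3 0) 0 fun e => ?_)
    have := congrArg Fin.val e
    rw [map_mul, Equiv.Perm.mul_apply, hv 1 (by omega), hv 0 (by omega)] at this
    simp at this
  · refine absurd h (hne (σ 3 0 * σ 3 1 * σ 3 0) 0 fun e => ?_)
    have := congrArg Fin.val e
    rw [map_mul, map_mul, Equiv.Perm.mul_apply, Equiv.Perm.mul_apply, hv 0 (by omega),
      hv 1 (by omega), hv 0 (by omega)] at this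
    simp at this

/-- The class of `w` in the abelianization of `F₂` is a product of powers of the classes of the two
generators. -/
theorem exists_eq_of_mem_F2 {w : Braid 3} (hw : w ∈ F2) :
    ∃ (a b : ℤ) (d : Braid 3), d ∈ ⁅F2, F2⁆ ∧ w = x12 ^ a * x23 ^ b * d := by
  let X : F2 := ⟨x12, x12_mem_F2⟩
  let Y : F2 := ⟨x23, x23_mem_F2⟩
  have key : ∀ (w : Braid 3) (hw : w ∈ Subgroup.closure {x12, x23}), ∃ a b : ℤ,
      Abelianization.of (⟨w, hw⟩ : F2) = Abelianization.of X ^ a * Abelianization.of Y ^ b := by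
    intro w hw
    induction hw using Subgroup.closure_induction with
    | mem x hx =>
      rcases hx with rfl | rfl
      · exact ⟨1, 0, by rw [zpow_one, zpow_zero, mul_one]⟩
      · exact ⟨0, 1, by rw [zpow_one, zpow_zero, one_mul]⟩
    | one => exact ⟨0, 0, by rw [zpow_zero, zpow_zero, mul_one]; exact map_one _⟩
    | mul x y hx hy h1 h2 =>
      obtain ⟨a, b, h1⟩ := h1
      obtain ⟨a', b', h2⟩ := h2
      refine ⟨a + a', b + b', ?_⟩
      refine (map_mul Abelianization.of (⟨x, hx⟩ : F2) ⟨y, hy⟩).trans ?_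
      rw [h1, h2, zpow_add, zpow_add, mul_mul_mul_comm]
    | inv x hx h1 =>
      obtain ⟨a, b, h1⟩ := h1
      refine ⟨-a, -b, ?_⟩
      refine (map_inv Abelianization.of (⟨x, hx⟩ : F2)).trans ?_
      rw [h1, mul_inv, zpow_neg, zpow_neg]
  obtain ⟨a, b, h⟩ := key w hw
  refine ⟨a, b, (x12 ^ a * x23 ^ b)⁻¹ * w, ?_, by group⟩
  have h2 : (X ^ a * Y ^ b)⁻¹ * ⟨w, hw⟩ ∈ commutator F2 := by
    rw [← Abelianization.ker_of, MonoidHom.mem_ker, map_mul, map_inv, map_mul, map_zpow, map_zpow, ← h]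
    exact inv_mul_cancel _
  rw [← Subgroup.map_subtype_commutator]
  exact ⟨_, h2, rfl⟩

/-- Every pure braid on three strands is a product of powers of `x₁₂`, `x₂₃` and the full twist, and
an element of `[F₂, F₂]`. -/
theorem exists_eq_of_mem_PB {g : Braid 3} (hg : g ∈ PB 3) :
    ∃ (a b k : ℤ) (d : Braid 3), d ∈ ⁅F2, F2⁆ ∧ g = x12 ^ a * x23 ^ b * d * twist ^ k := by
  obtain ⟨w, hw, _, ⟨k, rfl⟩, rfl⟩ := Subgroup.mem_sup_of_normal_right.1 (mem_F2Z_of_mem_PB hg)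
  obtain ⟨a, b, d, hd, rfl⟩ := exists_eq_of_mem_F2 hw
  exact ⟨a, b, k, d, hd, rfl⟩

/-! ### The commutator condition -/

/-- If at most one cable is non-empty, no crossing is left. -/
theorem mc_eq_one {k N p : ℕ} (g : Braid k) {s : ℕ → ℕ} (hN : p + pos s k ≤ N)
    (hs : ∀ i j, i ≠ j → s i = 0 ∨ s j = 0) : mc N p s g = 1 := by
  have hact : ∀ (g : Braid k) (s : ℕ → ℕ), (∀ i j, i ≠ j → s i = 0 ∨ s j = 0) →
      ∀ i j, i ≠ j → act g s i = 0 ∨ act g s j = 0 := fun g s hs i j hij =>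
    hs _ _ fun h => hij ((pn k g)⁻¹.injective h)
  induction g using braid_induction generalizing s with
  | one => exact mc_one s
  | mul g h hg hh =>
    rw [mc_mul, hh hN hs, hg (by rwa [pos_act _ _ _ le_rfl]) (hact h s hs), mul_one]
  | inv g hg =>
    rw [mc_inv, hg (by rwa [pos_act _ _ _ le_rfl]) (hact g⁻¹ s hs), inv_one]
  | gen i hi =>
    rw [mc_σ s i hi hN]
    rcases hs i (i + 1) (by omega) with h | h
    · rw [h, blk_zero_left]
    · rw [h, blk_zero_right]

theorem mc_σ₀ {N p a b c : ℕ} (h : p + a + b + c ≤ N) :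
    mc N p (sz3 a b c) (σ 3 0) = blk N p a b := by
  rw [mc_σ _ _ (by omega) (by rw [pos_sz3]; omega)]; rfl

theorem mc_σ₁ {N p a b c : ℕ} (h : p + a + b + c ≤ N) :
    mc N p (sz3 a b c) (σ 3 1) = blk N (p + a) b c := by
  rw [mc_σ _ _ (by omega) (by rw [pos_sz3]; omega), show pos (sz3 a b c) 1 = a by simp [pos, sz3]]; rfl

theorem mc_x12 {N p a b c : ℕ} (h : p + a + b + c ≤ N) :
    mc N p (sz3 a b c) x12 = blk N p b a * blk N p a b := by
  rw [x12, pow_two, mc_mul, act_σ _ _ (by omega), sz3_swap₀, mc_σ₀ (by omega), mc_σ₀ h]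

theorem mc_x23 {N p a b c : ℕ} (h : p + a + b + c ≤ N) :
    mc N p (sz3 a b c) x23 = blk N (p + a) c b * blk N (p + a) b c := by
  rw [x23, pow_two, mc_mul, act_σ _ _ (by omega), sz3_swap₁, mc_σ₁ (by omega), mc_σ₁ h]

theorem mc_twist {N p a b c : ℕ} (h : p + a + b + c ≤ N) :
    mc N p (sz3 a b c) twist = blk N p b a * blk N (p + b) c a * blk N p c b *
      (blk N p b c * blk N (p + b) a c * blk N p a b) := by
  simp only [twist, mc_mul, act_mul, act_σ 3 0 (by omega), act_σ 3 1 (by omega), sz3_swap₀, sz3_swap₁]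
  rw [mc_σ₀, mc_σ₀, mc_σ₀, mc_σ₀, mc_σ₁, mc_σ₁] <;> omega

theorem commute_braid_two (g h : Braid 2) : Commute g h := by
  obtain ⟨a, rfl⟩ := exists_zpow_braid_two g
  obtain ⟨b, rfl⟩ := exists_zpow_braid_two h
  exact ((Commute.refl _).zpow_left a).zpow_right b

/-- Cabling pure braids into `B₂` is a homomorphism to an abelian group. -/
theorem mc_commutator_F2 {p : ℕ} {s : ℕ → ℕ} {d : Braid 3} (hd : d ∈ ⁅F2, F2⁆) : mc 2 p s d = 1 := by
  have hle : ⁅F2, F2⁆ ≤ ((mcPB (n := 3) 2 p s).ker).map (PB 3).subtype := by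
    rw [Subgroup.commutator_le]
    intro g hg h hh
    let g' : PB 3 := ⟨g, F2_le_PB hg⟩
    let h' : PB 3 := ⟨h, F2_le_PB hh⟩
    refine ⟨g' * h' * g'⁻¹ * h'⁻¹, ?_, rfl⟩
    rw [SetLike.mem_coe, MonoidHom.mem_ker, map_mul, map_mul, map_mul, map_inv, map_inv,
      (commute_braid_two (mcPB 2 p s g') _).eq, mul_inv_cancel_right, mul_inv_cancel]
  obtain ⟨e, he, rfl⟩ := hle hd
  exact he

theorem mc_normalForm {p : ℕ} {s : ℕ → ℕ} {d : Braid 3} (hd : d ∈ ⁅F2, F2⁆) (a b k : ℤ) :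
    mc 2 p s (x12 ^ a * x23 ^ b * d * twist ^ k) =
      mc 2 p s x12 ^ a * mc 2 p s x23 ^ b * mc 2 p s twist ^ k := by
  have hd' : d ∈ PB 3 := F2_le_PB (Subgroup.commutator_le_self _ hd)
  have h := map_zpow (mcPB (n := 3) 2 p s)
  have h1 := h ⟨x12, x12_mem_PB⟩ a
  have h2 := h ⟨x23, x23_mem_PB⟩ b
  have h3 := h ⟨twist, twist_mem_PB⟩ k
  change mc 2 p s (x12 ^ a) = mc 2 p s x12 ^ a at h1
  change mc 2 p s (x23 ^ b) = mc 2 p s x23 ^ b at h2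
  change mc 2 p s (twist ^ k) = mc 2 p s twist ^ k at h3
  rw [mc_of_mem_mul (zpow_mem twist_mem_PB k), mc_of_mem_mul hd',
    mc_of_mem_mul (zpow_mem x23_mem_PB b), h1, h2, h3, mc_commutator_F2 hd, mul_one]

/-- The pentagon relation implies that `f` becomes trivial when all but two strands are deleted. -/
theorem mc_pentagon {R : ℕ} {L : Subgroup (Braid R)} [L.Normal] [L.FiniteIndex] {m : ℤ} {f : PB 3}
    (h : IsPair (OpCongr.ofTop R L) m f) {a b c d : ℕ} (hs : a + b + c + d ≤ 2) :
    (OpCongr.ofTop R L).q 2 (mc 2 a (sz3 b c d) (f : Braid 3) * mc 2 0 (sz3 a (b + c) d) (f : Braid 3) *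
        mc 2 0 (sz3 a b c) (f : Braid 3)) =
      (OpCongr.ofTop R L).q 2 (mc 2 0 (sz3 a b (c + d)) (f : Braid 3) * mc 2 0 (sz3 (a + b) c d) (f : Braid 3)) := by
  have h4 := (OpCongr.ofTop R L).q_eq_iff.1 h.pentagon
  have hf := f.2
  have hX : addLeft (f : Braid 3) * double 1 (f : Braid 3) * addRight (f : Braid 3) ∈ PB 4 :=
    mul_mem (mul_mem (addLeft_mem hf) (double_mem hf 1)) (addRight_mem hf)
  have h5 := mc_mem_topSubgroup R L (n := 2) (p := 0) (s := sz4 a b c d) h4 (by rw [pos_sz4]; omega)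
  have h0 : double 0 (f : Braid 3) ∈ PB 4 := double_mem hf 0
  have h1 : double 1 (f : Braid 3) ∈ PB 4 := double_mem hf 1
  rw [mc_of_mem_mul (mul_mem (double_mem hf 2) h0), mc_of_mem_inv hX, mc_of_mem_mul (addRight_mem hf),
    mc_of_mem_mul h1, mc_of_mem_mul h0, mc_addLeft _ (by omega), mc_double₁ _ (by omega),
    mc_addRight _ (by omega), mc_double₂ _ (by omega), mc_double₀ _ (by omega), zero_add] at h5
  exact (OpCongr.ofTop R L).q_eq_iff.2 h5

theorem sz3_eq_zero {a b c : ℕ} (h : (a = 0 ∧ b = 0) ∨ (b = 0 ∧ c = 0) ∨ (a = 0 ∧ c = 0)) (i j : ℕ)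
    (hij : i ≠ j) : sz3 a b c i = 0 ∨ sz3 a b c j = 0 := by
  rcases i with _ | _ | _ | i <;> rcases j with _ | _ | _ | j <;> simp [sz3] <;> simp at hij <;> omega

/-- Write `f` as `x₁₂^a x₂₃^b d` times the `k`-th power of the twist, with `d` in `[F₂, F₂]`.
Deleting strands in the pentagon shows that the corresponding powers of `σ₁²` are trivial at the
level of two strands. Cabling these back to three strands, the powers of `x₁₂`, `x₂₃` and the twist
lie in `𝒩.N 3`, so `f` is congruent to `d`. The congruence `ofTop` is used because it is stable
under deletions. -/
theorem exists_commutator {𝒩 : OpCongr} {m : ℤ} {f : PB 3}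
    (h : IsPair (OpCongr.ofTop 3 (𝒩.N 3)) m f) : ∃ c ∈ ⁅F2, F2⁆, 𝒩.q 3 f = 𝒩.q 3 c := by
  obtain ⟨a, b, k, d, hd, hf⟩ := exists_eq_of_mem_PB f.2
  have e : ∀ (p x y z : ℕ), p + x + y + z ≤ 2 →
      ((x = 0 ∧ y = 0) ∨ (y = 0 ∧ z = 0) ∨ (x = 0 ∧ z = 0)) → mc 2 p (sz3 x y z) (f : Braid 3) = 1 :=
    fun p x y z h1 h2 => mc_eq_one _ (by rw [pos_sz3]; omega) (sz3_eq_zero h2)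
  -- With two strands left, each of the three pentagons becomes an equation `y * y = y`, where `y`
  -- is `f` with one strand deleted. In normal form the three `y` have exponents `a + k`, `b + k`
  -- and `k`.
  have p12 := mc_pentagon h (a := 1) (b := 1) (c := 0) (d := 0) (by omega)
  have p23 := mc_pentagon h (a := 0) (b := 0) (c := 1) (d := 1) (by omega)
  have p13 := mc_pentagon h (a := 1) (b := 0) (c := 0) (d := 1) (by omega)
  rw [e 1 1 0 0 (by omega) (by omega), e 0 (1 + 1) 0 0 (by omega) (by omega), one_mul, mul_one, map_mul]
    at p12
  rw [e 0 0 0 1 (by omega) (by omega), e 0 0 0 (1 + 1) (by omega) (by omega), one_mul, mul_one, map_mul]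
    at p23
  rw [e 1 0 0 1 (by omega) (by omega), e 0 1 0 0 (by omega) (by omega), one_mul, mul_one, map_mul] at p13
  simp only [Nat.zero_add, Nat.add_zero] at p12 p23 p13
  rw [left_eq_mul, OpCongr.q_eq_one_iff] at p13
  rw [mul_eq_left, OpCongr.q_eq_one_iff] at p12
  rw [mul_eq_left, OpCongr.q_eq_one_iff] at p23
  rw [hf, mc_normalForm hd, mc_x12 (by omega), mc_x23 (by omega), mc_twist (by omega)] at p12 p23 p13
  simp only [blk_zero_left, blk_zero_right, blk_one_one, one_zpow, one_mul, mul_one, Nat.add_zero]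
    at p12 p23 p13
  simp only [← pow_two] at p12 p23 p13
  have hx12 : ∀ k : ℤ, (σ 2 0 ^ 2) ^ k ∈ topSubgroup 3 (𝒩.N 3) 2 → x12 ^ k ∈ 𝒩.N 3 := by
    intro k hk
    have := hk.2 0 (fun _ => 1) (by rw [pos_one]; omega)
    rwa [← shift_eq_mc (by omega), map_zpow, map_pow, shift_σ _ _ _ _ _ (by omega)] at this
  have hx23 : ∀ k : ℤ, (σ 2 0 ^ 2) ^ k ∈ topSubgroup 3 (𝒩.N 3) 2 → x23 ^ k ∈ 𝒩.N 3 := by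
    intro k hk
    have := hk.2 1 (fun _ => 1) (by rw [pos_one])
    rwa [← shift_eq_mc (by omega), map_zpow, map_pow, shift_σ _ _ _ _ _ (by omega)] at this
  have htw : ∀ k : ℤ, (σ 2 0 ^ 2) ^ k ∈ topSubgroup 3 (𝒩.N 3) 2 → twist ^ k ∈ 𝒩.N 3 := by
    intro k hk
    have h1 := hk.2 0 (sz2 2 1) (by rw [pos_sz2])
    have h2 : mc 3 0 (sz2 2 1) ((σ 2 0 ^ 2) ^ k) = mc 3 0 (sz2 2 1) (σ 2 0 ^ 2) ^ k :=
      map_zpow (mcPB (n := 2) 3 0 (sz2 2 1)) ⟨_, σ_two_sq_mem⟩ k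
    -- Doubling the first strand of `σ₁²` gives `x₁₃ x₂₃`, which is the full twist without its
    -- factor `x₁₂`.
    have h3 : mc 3 0 (sz2 2 1) (σ 2 0 ^ 2) = x12⁻¹ * twist := by
      have h4 : sz2 2 1 ∘ Equiv.swap 0 (0 + 1) = sz2 1 2 := by
        funext i
        rcases i with _ | _ | i
        · rfl
        · rfl
        · rw [Function.comp_apply, Equiv.swap_apply_of_ne_of_ne (by omega) (by omega)]; rfl
      rw [pow_two, mc_mul, act_σ _ _ (by omega), h4, mc_σ _ _ (by omega) (by rw [pos_sz2]),
        mc_σ _ _ (by omega) (by rw [pos_sz2])]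
      change blk 3 0 1 2 * blk 3 0 2 1 = _
      rw [blk_one_left, blk_one_right, twist_eq_x, x12, x13, x23]
      simp [cableUp, cableDown, pow_two, mul_assoc]
    rw [h2, h3, ((twist_comm _).symm).mul_zpow, inv_zpow] at h1
    have h4 := mul_mem (hx12 k hk) h1
    rwa [mul_inv_cancel_left] at h4
  have ha := (Subgroup.mul_mem_cancel_right _ p13).1 p12
  have hb := (Subgroup.mul_mem_cancel_right _ p13).1 p23
  refine ⟨d, hd, ?_⟩
  rw [hf, map_mul, map_mul, map_mul, 𝒩.q_eq_one_iff.2 (hx12 a ha), 𝒩.q_eq_one_iff.2 (hx23 b hb),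
    𝒩.q_eq_one_iff.2 (htw k p13), one_mul, one_mul, mul_one]

/-! ### Invertible pairs are charming -/

/-- Since `f` is congruent to an element of `F₂`, the images of `x₁₂` and `x₂₃` are classes of
powers of these generators, the second one conjugated within `F₂`. -/
theorem map_F2_le {𝒩 : OpCongr} {m : ℤ} {f : PB 3} (h : IsPair 𝒩 m f)
    (hc : ∃ c ∈ ⁅F2, F2⁆, 𝒩.q 3 f = 𝒩.q 3 c) : F2.map (h.Θ 3) ≤ F2.map (𝒩.q 3) := by
  obtain ⟨c, hc, hf⟩ := hc
  have hc' : c ∈ F2 := Subgroup.commutator_le_self _ hc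
  have key : ∀ x : Braid 3, x ^ 2 ∈ F2 → lam m x ^ 2 ∈ F2 := by
    intro x hx
    have : lam m x ^ 2 = (x ^ 2) ^ (2 * m + 1) := by
      rw [lam, ← zpow_natCast, ← zpow_natCast, ← zpow_mul, ← zpow_mul, ← zpow_one_add, ← zpow_mul]
      congr 1
      push_cast
      ring
    rw [this]
    exact zpow_mem hx _
  rw [Subgroup.map_le_iff_le_comap, F2, Subgroup.closure_le]
  rintro _ (rfl | rfl)
  · refine ⟨lam m (σ 3 0) ^ 2, key _ x12_mem_F2, ?_⟩
    rw [x12, map_pow, map_pow, h.Θ_σ (by omega), tgen_zero]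
  · refine ⟨c⁻¹ * lam m (σ 3 1) ^ 2 * c, mul_mem (mul_mem (inv_mem hc') (key _ x23_mem_F2)) hc', ?_⟩
    rw [x23, map_pow, h.Θ_σ (by omega), tgen_three]
    simp only [map_mul, map_inv, hf, pow_two]
    group

/-- A right inverse makes `Θ` onto. Applying the inclusion of `map_F2_le` to the inverse pair yields
the reverse inclusion for the images of `F₂`. -/
theorem IsPair.charm_of_inverse {𝒩 𝒦 : OpCongr} {m m₁ : ℤ} {f f₁ : PB 3} (h : IsPair 𝒩 m f)
    (hK : ∀ n, 𝒦.N n ≤ (h.Θ n).ker) (h₁ : IsPair 𝒦 m₁ f₁)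
    (hΘ : ∀ n, (h.ΘQ hK n).comp (h₁.Θ n) = 𝒩.q n) (hc : ∃ c ∈ ⁅F2, F2⁆, 𝒩.q 3 f = 𝒩.q 3 c)
    (hc₁ : ∃ c ∈ ⁅F2, F2⁆, 𝒦.q 3 f₁ = 𝒦.q 3 c) : h.Charm := by
  refine ⟨fun n x => ?_, hc, le_antisymm (map_F2_le h hc) ?_⟩
  · obtain ⟨y, rfl⟩ := 𝒩.q_surjective n x
    obtain ⟨z, hz⟩ := 𝒦.q_surjective n (h₁.Θ n y)
    exact ⟨z, by rw [← h.ΘQ_q hK, hz, ← hΘ n]; rfl⟩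
  · rw [← hΘ 3, ← Subgroup.map_map]
    refine (Subgroup.map_mono (map_F2_le h₁ hc₁)).trans ?_
    rw [Subgroup.map_map]
    exact le_rfl

/-! ### Small elements of `NFI` -/

/-- Every operadic congruence contains, for two, three and four strands, the one given by an element
of `NFI`. -/
theorem OpCongr.exists_NFI (𝒩 : OpCongr) :
    ∃ N : NFI, N.oc.N 2 ≤ 𝒩.N 2 ∧ N.oc.N 3 ≤ 𝒩.N 3 ∧ N.oc.N 4 ≤ 𝒩.N 4 := by
  have := topSubgroup_normal 3 (𝒩.N 3) 4
  have := topSubgroup_normal 2 (𝒩.N 2) 4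
  have := topSubgroup_finiteIndex 3 (𝒩.N 3) 4
  have := topSubgroup_finiteIndex 2 (𝒩.N 2) 4
  refine ⟨⟨𝒩.N 4 ⊓ (topSubgroup 3 (𝒩.N 3) 4 ⊓ topSubgroup 2 (𝒩.N 2) 4), inferInstance, inferInstance,
    inf_le_left.trans (𝒩.le_PB 4)⟩, ?_, ?_, inf_le_left⟩
  · rintro g ⟨-, ⟨-, ⟨-, -, hg⟩, -⟩, -⟩
    -- The braid in question is `g` with two vertical strands added on the right. The sizes `0`
    -- delete them again, so the condition of `topSubgroup` for two strands applies to `g` itself.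
    have h1 := hg.2 0 (sz4 1 1 0 0) (by rw [pos_sz4])
    rw [mc_addRight _ (by omega), addRight, mc_shift _ _ (by rw [pos_sz3]),
      mc_congr g (t := fun _ => 1) (fun i hi => by interval_cases i <;> rfl)] at h1
    rwa [show pos (sz3 1 1 0) 0 = 0 from rfl, mc_ones_self] at h1
  · rintro g ⟨-, ⟨-, hg, -⟩, -⟩
    have h1 := hg.2 0 (sz4 1 1 1 0) (by rw [pos_sz4])
    rw [mc_addRight _ (by omega),
      mc_congr g (t := fun _ => 1) (fun i hi => by interval_cases i <;> rfl)] at h1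
    rwa [mc_ones_self] at h1

open PaB

/-! ### Elements of the profinite completion -/

namespace HatHom

variable {𝒢 ℋ : Type} [Groupoid.{0} 𝒢] [Groupoid.{0} ℋ]

theorem ext' {a b : 𝒢} {x y : HatHom a b} (h : ∀ s, x.val s = y.val s) : x = y := by
  cases x; cases y; congr; exact funext h

/-- The image of a morphism in the profinite completion. -/
def ι {a b : 𝒢} (γ : a ⟶ b) : HatHom a b := ⟨fun s => Quotient.mk (s.setoid a b) γ, fun _ _ _ => rfl⟩

theorem exists_rep {a b : 𝒢} (x : HatHom a b) (s : FinCongr 𝒢) :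
    ∃ γ : a ⟶ b, x.val s = (ι γ).val s := by
  obtain ⟨γ, hγ⟩ := Quotient.exists_rep (x.val s)
  exact ⟨γ, hγ.symm⟩

theorem val_eq_of_finer {a b : 𝒢} {x y : HatHom a b} {s t : FinCongr 𝒢} (h : s.Finer t)
    (hxy : x.val s = y.val s) : x.val t = y.val t := by
  rw [← x.compat s t h, hxy, y.compat s t h]

theorem ι_comp {a b c : 𝒢} (γ : a ⟶ b) (η : b ⟶ c) : ι (γ ≫ η) = (ι γ).comp (ι η) := rfl

theorem map_ι (F : 𝒢 ⥤ ℋ) {a b : 𝒢} (γ : a ⟶ b) : map F (ι γ) = ι (F.map γ) := rfl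

end HatHom

open HatHom

/-- The completed functor is defined one variable at a time; on actual morphisms functoriality
combines the two factors into one insertion. -/
theorem ι_insMor {n m : ℕ} (i : Fin n) {a b : PaB n} (γ : a ⟶ b) {c d : PaB m} (η : c ⟶ d) :
    map₂ (insertFunctor n m i) (ι γ) (ι η) = ι (insMor i γ η) := by
  refine congrArg (ι (𝒢 := PaB (n + m - 1))) ?_
  change (insertFunctor n m i).map (Prod.mkHom (𝟙 a) η) ≫ (insertFunctor n m i).map (Prod.mkHom γ (𝟙 d)) = _
  rw [← Functor.map_comp]
  simp only [Prod.mkHom, prod_comp, Category.id_comp, Category.comp_id]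
  rfl

/-! ### The levels of the profinite completion given by operadic congruences -/

namespace OpCongr

variable (𝒩 𝒦 : OpCongr)

/-- The compatible equivalence relation on `PaB(n)` given by an operadic congruence. -/
def congr (n : ℕ) : FinCongr (PaB n) where
  setoid a b :=
    { r := fun γ η => 𝒩.q n (ou γ) = 𝒩.q n (ou η)
      iseqv := ⟨fun _ => rfl, Eq.symm, Eq.trans⟩ }
  comp_left f g g' h := by
    change 𝒩.q n (ou (f ≫ g)) = 𝒩.q n (ou (f ≫ g'))
    rw [ou_comp, ou_comp, map_mul, map_mul, show 𝒩.q n (ou g) = 𝒩.q n (ou g') from h]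
  comp_right {a b c f f'} g h := by
    change 𝒩.q n (ou (f ≫ g)) = 𝒩.q n (ou (f' ≫ g))
    rw [ou_comp, ou_comp, map_mul, map_mul, show 𝒩.q n (ou f) = 𝒩.q n (ou f') from h]
  finite a b := by
    refine Finite.of_injective (β := Braid n ⧸ 𝒩.N n)
      (Quotient.lift (fun γ : a ⟶ b => 𝒩.q n (ou γ)) fun _ _ h => h) fun x y h => ?_
    induction x using Quotient.inductionOn
    induction y using Quotient.inductionOn
    exact Quotient.sound h

variable {n : ℕ} {a b c : PaB n}

/-- The image in `B_n/𝒩` of an element of the profinite completion. -/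
def lev (x : HatHom a b) : Braid n ⧸ 𝒩.N n :=
  Quotient.lift (s := (𝒩.congr n).setoid a b) (fun γ : a ⟶ b => 𝒩.q n (ou γ)) (fun _ _ h => h)
    (x.val (𝒩.congr n))

theorem lev_ι (γ : a ⟶ b) : 𝒩.lev (ι γ) = 𝒩.q n (ou γ) := rfl

variable {𝒩 𝒦}

theorem val_eq_of_lev_eq {x y : HatHom a b} (h : 𝒩.lev x = 𝒩.lev y) :
    x.val (𝒩.congr n) = y.val (𝒩.congr n) := by
  obtain ⟨γ, hγ⟩ := x.exists_rep (𝒩.congr n)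
  obtain ⟨η, hη⟩ := y.exists_rep (𝒩.congr n)
  rw [lev, lev, hγ, hη] at h
  rw [hγ, hη]
  exact Quotient.sound (s := (𝒩.congr n).setoid a b) h

theorem lev_eq_of_val_eq {x y : HatHom a b} (h : x.val (𝒩.congr n) = y.val (𝒩.congr n)) :
    𝒩.lev x = 𝒩.lev y := by rw [lev, h, lev]

theorem congr_finer (h : 𝒦.N n ≤ 𝒩.N n) : (𝒦.congr n).Finer (𝒩.congr n) := fun _ _ _ _ hfg =>
  𝒩.q_eq_iff.2 (h (𝒦.q_eq_iff.1 hfg))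

theorem lev_eq_of_le (h : 𝒦.N n ≤ 𝒩.N n) {x y : HatHom a b} (hxy : 𝒦.lev x = 𝒦.lev y) :
    𝒩.lev x = 𝒩.lev y :=
  lev_eq_of_val_eq (val_eq_of_finer (congr_finer h) (val_eq_of_lev_eq hxy))

theorem inf_le_left' (n : ℕ) : (𝒩 ⊓ 𝒦).N n ≤ 𝒩.N n := fun _ h => h.1

theorem inf_le_right' (n : ℕ) : (𝒩 ⊓ 𝒦).N n ≤ 𝒦.N n := fun _ h => h.2

variable (𝒩 𝒦)

theorem exists_lev_ι (x : HatHom a b) : ∃ γ : a ⟶ b, 𝒩.lev x = 𝒩.lev (ι γ) := by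
  obtain ⟨γ, hγ⟩ := x.exists_rep (𝒩.congr n)
  exact ⟨γ, lev_eq_of_val_eq hγ⟩

/-- Approximation at the intersection of two congruences serves both levels. -/
theorem exists_lev_ι₂ (x : HatHom a b) :
    ∃ γ : a ⟶ b, 𝒩.lev x = 𝒩.lev (ι γ) ∧ 𝒦.lev x = 𝒦.lev (ι γ) := by
  obtain ⟨γ, hγ⟩ := (𝒩 ⊓ 𝒦).exists_lev_ι x
  exact ⟨γ, lev_eq_of_le (inf_le_left' n) hγ, lev_eq_of_le (inf_le_right' n) hγ⟩

theorem red_lev (h : 𝒦.N n ≤ 𝒩.N n) (x : HatHom a b) : OpCongr.red h (𝒦.lev x) = 𝒩.lev x := by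
  obtain ⟨γ, hγ⟩ := 𝒦.exists_lev_ι x
  rw [hγ, lev_eq_of_le h hγ]; rfl

theorem ρQ_lev (x : HatHom a b) : 𝒩.ρQ n (𝒩.lev x) = (𝔭 b)⁻¹ * 𝔭 a := by
  obtain ⟨γ, hγ⟩ := 𝒩.exists_lev_ι x
  rw [hγ, lev_ι, ρQ_q, ρ_ou]

theorem lev_comp (x : HatHom a b) (y : HatHom b c) : 𝒩.lev (x.comp y) = 𝒩.lev y * 𝒩.lev x := by
  obtain ⟨γ, hγ⟩ := x.exists_rep (𝒩.congr n)
  obtain ⟨η, hη⟩ := y.exists_rep (𝒩.congr n)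
  have h : (x.comp y).val (𝒩.congr n) = (ι (γ ≫ η)).val (𝒩.congr n) := by
    change (𝒩.congr n).qcomp _ _ = _
    rw [hγ, hη]; rfl
  rw [lev_eq_of_val_eq h, lev_eq_of_val_eq hγ, lev_eq_of_val_eq hη, lev_ι, ou_comp, map_mul]; rfl

theorem lev_map {k : ℕ} (F : PaB k ⥤ PaB n) {a b : PaB k} {x : HatHom a b}
    (hF : (𝒩.congr k).Finer (FinCongr.pullback F (𝒩.congr n))) {γ : a ⟶ b}
    (hx : 𝒩.lev x = 𝒩.q k (ou γ)) : 𝒩.lev (map F x) = 𝒩.q n (ou (F.map γ)) := by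
  have h1 : x.val (𝒩.congr k) = (ι γ).val (𝒩.congr k) := val_eq_of_lev_eq hx
  have h2 := val_eq_of_finer hF h1
  have h3 : (map F x).val (𝒩.congr n) = (ι (F.map γ)).val (𝒩.congr n) := by
    change FinCongr.push F _ _ = _
    rw [h2]; rfl
  exact lev_eq_of_val_eq h3

theorem lev_perm (θ : Equiv.Perm (Fin n)) (x : HatHom a b) :
    𝒩.lev (map (perm_functor θ) x) = 𝒩.lev x := by
  obtain ⟨γ, hγ⟩ := 𝒩.exists_lev_ι x
  rw [𝒩.lev_map (perm_functor θ) (fun _ _ _ _ h => h) hγ, hγ]; rfl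

theorem lev_map₂ {m : ℕ} (i : Fin n) {c d : PaB m} {x : HatHom a b} {y : HatHom c d} {u : Braid n}
    {v : Braid m} (hx : 𝒩.lev x = 𝒩.q n u) (hy : 𝒩.lev y = 𝒩.q m v) :
    𝒩.lev (map₂ (insertFunctor n m i) x y) = 𝒩.q (n + m - 1) (cable m ((𝔭 a)⁻¹ i) u *
      shift m (n + m - 1) ((𝔭 a)⁻¹ i : Fin n) (by have := ((𝔭 a)⁻¹ i).2; omega) v) := by
  obtain ⟨γ, hγ⟩ := 𝒩.exists_lev_ι x
  obtain ⟨η, hη⟩ := 𝒩.exists_lev_ι y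
  have key : ∀ {a b : PaB n} {γ γ' : a ⟶ b} {c d : PaB m} {η η' : c ⟶ d}, 𝒩.q n (ou γ) = 𝒩.q n (ou γ') →
      𝒩.q m (ou η) = 𝒩.q m (ou η') →
      𝒩.q (n + m - 1) (ou (insMor i γ η)) = 𝒩.q (n + m - 1) (ou (insMor i γ' η')) := by
    intro a b γ γ' c d η η' h1 h2
    exact ((OpMap.proj 𝒩).T_insert i γ η h1 h2).trans ((OpMap.proj 𝒩).T_insert i γ' η' rfl rfl).symm
  have h1 := 𝒩.lev_map (Prod.sectL (PaB n) d ⋙ insertFunctor n m i) (x := x) (γ := γ)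
    (fun _ _ f g h => key h rfl) hγ
  have h2 := 𝒩.lev_map (Prod.sectR a (PaB m) ⋙ insertFunctor n m i) (x := y) (γ := η)
    (fun _ _ f g h => key rfl h) hη
  refine (𝒩.lev_comp _ _).trans ((congrArg₂ (· * ·) h1 h2).trans ?_)
  refine Eq.trans ?_ ((OpMap.proj 𝒩).T_insert i γ η (hγ.symm.trans hx) (hη.symm.trans hy))
  exact congrArg 𝒩.lev (ι_insMor i γ η)

end OpCongr

/-! ### The levels given by operadic congruences determine the profinite completion -/

theorem ρ_surjective (n : ℕ) : Function.Surjective (ρ n) := by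
  rcases n with _ | n
  · exact fun π => ⟨1, Subsingleton.elim _ _⟩
  · rw [← MonoidHom.mrange_eq_top, eq_top_iff, ← Equiv.Perm.mclosure_swap_castSucc_succ,
      Submonoid.closure_le]
    rintro _ ⟨i, rfl⟩
    refine ⟨σ (n + 1) i, ?_⟩
    rw [ρ_σ _ _ (by omega), adjSwap, dif_pos (by omega)]
    rfl

/-- The endomorphism given by a pure braid. -/
def PaB.pure {n : ℕ} (a : PaB n) (g : PB n) : a ⟶ a :=
  Hom.mk g (by rw [inv_mul_cancel]; exact g.2)

/-- The pure braids which are equivalent to the identity of `a`. -/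
def FinCongr.stab {n : ℕ} (s : FinCongr (PaB n)) (a : PaB n) : Subgroup (PB n) where
  carrier := {g | (s.setoid a a).r (a.pure g) (𝟙 a)}
  one_mem' := (s.setoid a a).refl _
  mul_mem' {g h} hg hh := by
    have h1 := s.comp_left (a.pure h) hg
    rw [Category.comp_id] at h1
    exact (s.setoid a a).trans h1 hh
  inv_mem' {g} hg := by
    have h1 := s.comp_left (a.pure g⁻¹) hg
    rw [Category.comp_id, show a.pure g⁻¹ ≫ a.pure g = 𝟙 a from ou_ext (mul_inv_cancel _)] at h1
    exact (s.setoid a a).symm h1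

theorem FinCongr.stab_finiteIndex {n : ℕ} (s : FinCongr (PaB n)) (a : PaB n) :
    (s.stab a).FiniteIndex := by
  have := s.finite a a
  rw [Subgroup.finiteIndex_iff_finite_quotient]
  refine Finite.of_injective (β := Quotient (s.setoid a a))
    (Quotient.lift (fun g : PB n => Quotient.mk (s.setoid a a) (a.pure g)) fun g h hgh => ?_) ?_
  · refine Quotient.sound (s := s.setoid a a) ?_
    have h1 := s.comp_right (a.pure g) (QuotientGroup.leftRel_apply.1 hgh)
    rw [Category.id_comp, show a.pure (g⁻¹ * h) ≫ a.pure g = a.pure h from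
      ou_ext (mul_inv_cancel_left _ _)] at h1
    exact (s.setoid a a).symm h1
  · intro x y
    induction x using QuotientGroup.induction_on with | _ g
    induction y using QuotientGroup.induction_on with | _ h
    intro hgh
    refine QuotientGroup.eq.2 ?_
    have h1 := s.comp_right (a.pure g⁻¹) (Quotient.exact (s := s.setoid a a) hgh)
    rw [show a.pure g ≫ a.pure g⁻¹ = 𝟙 a from ou_ext (inv_mul_cancel _)] at h1
    exact (s.setoid a a).symm h1

/-- The relations given by operadic congruences are cofinal. -/
theorem OpCongr.exists_finer {n : ℕ} (s : FinCongr (PaB n)) : ∃ 𝒩 : OpCongr, (𝒩.congr n).Finer s := by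
  by_cases hne : Nonempty (PaB n)
  · obtain ⟨c⟩ := hne
    let H := (s.stab c).map (PB n).subtype
    have hH : H.FiniteIndex := ⟨by
      rw [Subgroup.index_map_subtype]
      exact mul_ne_zero (s.stab_finiteIndex c).index_ne_zero (PB_finiteIndex n).index_ne_zero⟩
    -- The stabilizer at one object is enough: the groupoid is connected, and conjugation by a
    -- morphism `δ : a ⟶ c` carries `(ou γ)⁻¹ * ou η` to an endomorphism of `c`. The normal core is
    -- stable under this conjugation.
    refine ⟨OpCongr.ofTop n H.normalCore, fun a b γ η h => ?_⟩
    obtain ⟨u, hu⟩ := ρ_surjective n ((𝔭 c)⁻¹ * 𝔭 a)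
    let δ : a ⟶ c := Hom.mk u hu
    have h1 : (ou γ)⁻¹ * ou η ∈ H.normalCore := mem_of_mem_topSubgroup n _ (OpCongr.q_eq_iff _ |>.1 h)
    obtain ⟨g, hg, hg2⟩ := H.normalCore_le (H.normalCore_normal.conj_mem _ h1 u)
    have h2 := s.comp_right (inv δ ≫ γ) (s.comp_left δ hg)
    rw [Category.comp_id, IsIso.hom_inv_id_assoc] at h2
    have h3 : (δ ≫ c.pure g) ≫ inv δ ≫ γ = η := by
      rw [← Groupoid.inv_eq_inv]
      apply ou_ext
      change (ou γ * u⁻¹) * ((g : Braid n) * u) = ou η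
      rw [show (g : Braid n) = u * ((ou γ)⁻¹ * ou η) * u⁻¹ from hg2]
      group
    rw [h3] at h2
    exact (s.setoid a b).symm h2
  · exact ⟨OpCongr.ofTop 0 ⊤, fun a => absurd ⟨a⟩ hne⟩

theorem HatHom.ext_lev {n : ℕ} {a b : PaB n} {x y : HatHom a b} (h : ∀ 𝒩 : OpCongr, 𝒩.lev x = 𝒩.lev y) :
    x = y := by
  refine HatHom.ext' fun s => ?_
  obtain ⟨𝒩, h𝒩⟩ := OpCongr.exists_finer s
  exact val_eq_of_finer h𝒩 (OpCongr.val_eq_of_lev_eq (h 𝒩))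

theorem OpCongr.isOpen_lev {n : ℕ} {a b : PaB n} (𝒩 : OpCongr) (x : HatHom a b) :
    IsOpen {y : HatHom a b | 𝒩.lev y = 𝒩.lev x} := by
  have h1 : Continuous fun y : HatHom a b => y.val (𝒩.congr n) :=
    (continuous_apply (𝒩.congr n)).comp continuous_induced_dom
  have h2 : IsOpen {v : (𝒩.congr n).QHom a b | v = x.val (𝒩.congr n)} := isOpen_mk.2 trivial
  convert h2.preimage h1 using 1
  ext y
  exact ⟨OpCongr.val_eq_of_lev_eq, OpCongr.lev_eq_of_val_eq⟩

theorem OpCongr.exists_finer_of_finite {n : ℕ} {I : Set (FinCongr (PaB n))} (hI : I.Finite) :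
    ∃ 𝒩 : OpCongr, ∀ s ∈ I, (𝒩.congr n).Finer s := by
  induction I, hI using Set.Finite.induction_on with
  | empty => exact ⟨OpCongr.ofTop 0 ⊤, fun _ h => absurd h (Set.notMem_empty _)⟩
  | @insert s I _ _ ih =>
    obtain ⟨𝒩, h𝒩⟩ := ih
    obtain ⟨𝒦, h𝒦⟩ := OpCongr.exists_finer s
    refine ⟨𝒩 ⊓ 𝒦, ?_⟩
    rintro t (rfl | ht) a b f g h
    · exact h𝒦 _ _ _ _ (OpCongr.congr_finer (OpCongr.inf_le_right' n) _ _ _ _ h)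
    · exact h𝒩 t ht _ _ _ _ (OpCongr.congr_finer (OpCongr.inf_le_left' n) _ _ _ _ h)

theorem HatHom.exists_lev_subset {n : ℕ} {a b : PaB n} {x : HatHom a b} {U : Set (HatHom a b)}
    (hU : U ∈ nhds x) : ∃ 𝒩 : OpCongr, ∀ y, 𝒩.lev y = 𝒩.lev x → y ∈ U := by
  rw [nhds_induced, nhds_pi, Filter.mem_comap] at hU
  obtain ⟨V, hV, hVU⟩ := hU
  obtain ⟨I, hI, t, ht, htV⟩ := Filter.mem_pi.1 hV
  obtain ⟨𝒩, h𝒩⟩ := OpCongr.exists_finer_of_finite hI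
  refine ⟨𝒩, fun y hy => hVU (htV fun s hs => ?_)⟩
  rw [val_eq_of_finer (h𝒩 s hs) (OpCongr.val_eq_of_lev_eq hy)]
  exact mem_of_mem_nhds (ht s)

theorem HatHom.continuous_of_lev {n k : ℕ} {a b : PaB n} {c d : PaB k} {F : HatHom a b → HatHom c d}
    (h : ∀ 𝒩 : OpCongr, ∃ 𝒦 : OpCongr, ∀ x y, 𝒦.lev x = 𝒦.lev y → 𝒩.lev (F x) = 𝒩.lev (F y)) :
    Continuous F := by
  rw [continuous_iff_continuousAt]
  intro x U hU
  obtain ⟨𝒩, h𝒩⟩ := HatHom.exists_lev_subset hU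
  obtain ⟨𝒦, h𝒦⟩ := h 𝒩
  exact Filter.mem_map.2 (Filter.mem_of_superset ((𝒦.isOpen_lev x).mem_nhds rfl) fun y hy =>
    h𝒩 _ (h𝒦 _ _ hy))

/-- A continuous map is approximated by its values on the image of `PaB(n)`. -/
theorem HatHom.exists_lev_ι_of_continuous {n k : ℕ} {a b : PaB n} {c d : PaB k}
    {F : HatHom a b → HatHom c d} (hF : Continuous F) (𝒩 𝒦 : OpCongr) (x : HatHom a b) :
    ∃ γ : a ⟶ b, 𝒦.lev x = 𝒦.lev (ι γ) ∧ 𝒩.lev (F x) = 𝒩.lev (F (ι γ)) := by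
  obtain ⟨ℳ, hℳ⟩ := HatHom.exists_lev_subset (((𝒩.isOpen_lev (F x)).preimage hF).mem_nhds rfl)
  obtain ⟨γ, h1, h2⟩ := ℳ.exists_lev_ι₂ 𝒦 x
  exact ⟨γ, h2, (hℳ _ h1.symm).symm⟩

/-- Compatible families of classes are given by elements of the profinite completion. -/
theorem HatHom.exists_of_lev {n : ℕ} {a b : PaB n} (v : ∀ 𝒩 : OpCongr, Braid n ⧸ 𝒩.N n)
    (hρ : ∀ 𝒩 : OpCongr, 𝒩.ρQ n (v 𝒩) = (𝔭 b)⁻¹ * 𝔭 a)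
    (hv : ∀ (𝒦 𝒩 : OpCongr) (h : ∀ k, 𝒦.N k ≤ 𝒩.N k), OpCongr.red (h n) (v 𝒦) = v 𝒩) :
    ∃ x : HatHom a b, ∀ 𝒩 : OpCongr, 𝒩.lev x = v 𝒩 := by
  have h1 : ∀ 𝒩 : OpCongr, ∃ γ : a ⟶ b, 𝒩.q n (ou γ) = v 𝒩 := by
    intro 𝒩
    obtain ⟨g, hg⟩ := 𝒩.q_surjective n (v 𝒩)
    have h2 := hρ 𝒩
    rw [← hg, 𝒩.ρQ_q] at h2
    exact ⟨Hom.mk g h2, hg⟩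
  choose γ hγ using h1
  choose 𝒯 h𝒯 using fun s : FinCongr (PaB n) => OpCongr.exists_finer s
  have hle : ∀ (𝒦 𝒩 : OpCongr), (∀ k, 𝒦.N k ≤ 𝒩.N k) → 𝒩.q n (ou (γ 𝒦)) = 𝒩.q n (ou (γ 𝒩)) := by
    intro 𝒦 𝒩 h
    rw [hγ, ← hv 𝒦 𝒩 h, ← hγ]; rfl
  have hs : ∀ (s : FinCongr (PaB n)) (𝒩 : OpCongr),
      (s.setoid a b).r (γ (𝒯 s)) (γ (𝒯 s ⊓ 𝒩)) := fun s 𝒩 =>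
    h𝒯 s _ _ _ _ (hle _ _ OpCongr.inf_le_left').symm
  -- The class at `s` is read off at a chosen congruence `𝒯 s` finer than `s`; different choices are
  -- compared at intersections.
  refine ⟨⟨fun s => Quotient.mk (s.setoid a b) (γ (𝒯 s)), fun s t h => ?_⟩, fun 𝒩 => ?_⟩
  · refine Quotient.sound (s := t.setoid a b) ((t.setoid a b).trans (h _ _ _ _ (hs s (𝒯 t))) ?_)
    exact h𝒯 t _ _ _ _ (hle _ _ OpCongr.inf_le_right')
  · rw [← hγ 𝒩]
    exact (hs (𝒩.congr n) 𝒩).trans (hle _ _ OpCongr.inf_le_right')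

open PaB HatHom

/-! ### Operadic maps with the same data -/

namespace OpMap

variable {𝒩 : OpCongr} {T T' : OpMap 𝒩} {m m' : ℤ} {f f' : Braid 3}

theorem IsData.of_eq (h : T'.IsData m f) (e : ∀ {n : ℕ} {a b : PaB n} (γ : a ⟶ b), T.T γ = T'.T γ) :
    T.IsData m f :=
  ⟨fun _ _ γ ha hb hγ => (e γ).trans (h.alpha γ ha hb hγ),
    fun _ _ γ ha hb hγ => (e γ).trans (h.beta γ ha hb hγ)⟩

theorem IsData.unique (h : T.IsData m f) (h' : T.IsData m' f') :
    𝒩.q 2 (lam m (σ 2 0)) = 𝒩.q 2 (lam m' (σ 2 0)) ∧ 𝒩.q 3 f = 𝒩.q 3 f' := by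
  obtain ⟨a, b, α, ha, hb, hα, -⟩ := exists_mor (n := 3)
    (w := .node (.node .leaf .leaf) .leaf) (w' := .node .leaf (.node .leaf .leaf)) rfl rfl 1 1
  obtain ⟨c, d, β, hc, hd, hβ, -⟩ := exists_mor (n := 2)
    (w := .node .leaf .leaf) (w' := .node .leaf .leaf) rfl rfl 1 (σ 2 0)
  exact ⟨(h.beta β hc hd hβ).symm.trans (h'.beta β hc hd hβ),
    (h.alpha α ha hb hα).symm.trans (h'.alpha α ha hb hα)⟩

end OpMap

theorem IsPair.Θ_lam {𝒩 : OpCongr} {m : ℤ} {f : PB 3} (h : IsPair 𝒩 m f) (m₁ : ℤ) :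
    h.Θ 2 (lam m₁ (σ 2 0)) = 𝒩.q 2 (lam (2 * m₁ * m + m₁ + m) (σ 2 0)) := by
  rw [map_lam, h.Θ_σ (by omega), tgen_zero, ← map_lam, lam_lam]

/-! ### The shadows of an element of the profinite Grothendieck-Teichmueller group -/

namespace GThat

variable (T U : GThat) (𝒩 : OpCongr)

/-- The operadic map induced by an element of `GThat`. -/
def opMap : OpMap 𝒩 where
  T {n a b} γ := 𝒩.lev (T.1 n a b (ι γ))
  ρ_T γ := by rw [𝒩.ρQ_lev, ρ_ou]
  T_comp γ η := by rw [ι_comp, T.2.1, 𝒩.lev_comp]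
  T_perm θ a b γ := by rw [← map_ι, T.2.2.1, 𝒩.lev_perm]
  T_insert i a b γ c d η x y hx hy := by
    refine (congrArg (fun z => 𝒩.lev (T.1 _ _ _ z)) (ι_insMor i γ η).symm).trans ?_
    refine (congrArg 𝒩.lev (T.2.2.2 _ _ i _ _ _ _ (ι γ) (ι η))).trans ?_
    exact 𝒩.lev_map₂ i hx hy

variable {T U 𝒩} {𝒦 : OpCongr} {m : ℤ} {f : PB 3}

/-- By continuity it suffices to know `T` on the image of `PaB`, where it is the operadic map of
`(m, f)`. So the level `𝒩` of the result depends only on a level contained in the kernels of `Θ`. -/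
theorem lev_apply (h : IsPair 𝒩 m f) (hd : (opMap T 𝒩).IsData m f) (hK : ∀ n, 𝒦.N n ≤ (h.Θ n).ker)
    {n : ℕ} {a b : PaB n} (x : HatHom a b) : 𝒩.lev (T.1 n a b x) =
      (𝒩.q n (Phi f n 0 b.sh))⁻¹ * h.ΘQ hK n (𝒦.lev x) * 𝒩.q n (Phi f n 0 a.sh) := by
  obtain ⟨γ, h1, h2⟩ := HatHom.exists_lev_ι_of_continuous (T.1 n a b).continuous 𝒩 𝒦 x
  rw [h2, h1]
  exact h.T_eq hd γ

theorem opMap_mul (h : IsPair 𝒩 m f) (hd : (opMap T 𝒩).IsData m f) (hK : ∀ n, 𝒦.N n ≤ (h.Θ n).ker)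
    {n : ℕ} {a b : PaB n} (γ : a ⟶ b) :
    (opMap (T * U) 𝒩).T γ = (h.comp hK (opMap U 𝒦)).T γ := lev_apply h hd hK (U.1 n a b (ι γ))

theorem isData_mono (h2 : 𝒦.N 2 ≤ 𝒩.N 2) (h3 : 𝒦.N 3 ≤ 𝒩.N 3) (hd : (opMap T 𝒦).IsData m f) :
    (opMap T 𝒩).IsData m f := by
  refine ⟨fun a b γ ha hb hγ => ?_, fun a b γ ha hb hγ => ?_⟩
  · exact (𝒩.red_lev 𝒦 h3 _).symm.trans (congrArg (OpCongr.red h3) (hd.alpha γ ha hb hγ))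
  · exact (𝒩.red_lev 𝒦 h2 _).symm.trans (congrArg (OpCongr.red h2) (hd.beta γ ha hb hγ))

theorem commutator (hd : (opMap T 𝒩).IsData m f) : ∃ c ∈ ⁅F2, F2⁆, 𝒩.q 3 f = 𝒩.q 3 c := by
  -- `𝒩` need not be stable under deleting strands. An element of `GThat` also has data at the finer
  -- level that is, and these reduce to those at `𝒩`.
  obtain ⟨m', f', hd'⟩ := (opMap T (OpCongr.ofTop 3 (𝒩.N 3) ⊓ 𝒩)).exists_isData
  have h' : IsPair (OpCongr.ofTop 3 (𝒩.N 3)) m' f' :=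
    (OpMap.isPair_of_isData hd').mono (OpCongr.inf_le_left' 3) (OpCongr.inf_le_left' 4)
  have hu := hd.unique (isData_mono (OpCongr.inf_le_right' 2) (OpCongr.inf_le_right' 3) hd')
  rw [hu.2]
  exact exists_commutator h'

/-- The data of `T⁻¹` at the level of the kernels of `Θ` form a pair whose composite with `(m, f)`
has the data of `T * T⁻¹`; on left-normed words this says that the homomorphisms compose to the
projection. -/
theorem charm (hd : (opMap T 𝒩).IsData m f) : ∃ h : IsPair 𝒩 m f, h.Charm := by
  have h := OpMap.isPair_of_isData hd
  obtain ⟨m₁, f₁, hd₁⟩ := (opMap T⁻¹ h.ker).exists_isData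
  have h₁ := OpMap.isPair_of_isData hd₁
  refine ⟨h, h.charm_of_inverse (fun _ => le_rfl) h₁ (fun n => ?_) (commutator hd) (commutator hd₁)⟩
  refine MonoidHom.ext fun g => ?_
  cases n with
  | zero => rw [braid_eq_one (by omega) g, map_one, map_one]
  | succ n =>
    obtain ⟨a, b, γ, ha, hb, rfl⟩ := IsPair.exists_comb_mor g
    have e1 : (opMap (T * T⁻¹) 𝒩).T γ = 𝒩.q (n + 1) (ou γ) := by rw [mul_inv_cancel]; rfl
    rw [opMap_mul (𝒦 := h.ker) h hd (fun _ => le_rfl)] at e1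
    change (𝒩.q _ (Phi f _ 0 b.sh))⁻¹ * h.ΘQ _ _ ((opMap T⁻¹ h.ker).T γ) *
      𝒩.q _ (Phi f _ 0 a.sh) = _ at e1
    rw [h₁.T_comb hd₁ γ ha hb, ha, hb, Phi_comb, map_one, inv_one, one_mul, mul_one] at e1
    exact e1

theorem exists_shadow (T : GThat) (N : NFI) : ∃ s : GTcharm N, (opMap T N.oc).IsData s.m s.f := by
  obtain ⟨m, f, hd⟩ := (opMap T N.oc).exists_isData
  obtain ⟨h, hc⟩ := charm hd
  exact ⟨GTcharm.mk h hc, IsPair.isData_congr hd (GTcharm.L_mk h hc).symm (GTcharm.F_mk h hc).symm⟩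

/-- The charming GT-shadow given by an element of `GThat`. -/
noncomputable def shadow (T : GThat) (N : NFI) : GTcharm N := (exists_shadow T N).choose

theorem isData_shadow (T : GThat) (N : NFI) :
    (opMap T N.oc).IsData (shadow T N).m (shadow T N).f := (exists_shadow T N).choose_spec

theorem shadow_eq {N : NFI} {s : GTcharm N} {m : ℤ} {f : Braid 3} (hd : (opMap T N.oc).IsData m f)
    (hL : s.L = N.oc.q 2 (lam m (σ 2 0))) (hF : s.F = N.oc.q 3 f) : shadow T N = s := by
  have hu := (isData_shadow T N).unique hd
  exact GTcharm.ext (hu.1.trans hL.symm) (hu.2.trans hF.symm)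

/-- For isolated `N` the kernels of `Θ` are the subgroups of `N` itself, so both factors are read at
the same level. -/
theorem shadow_mul (T U : GThat) (N : Isolated) :
    shadow (T * U) N.1 = shadow T N.1 * shadow U N.1 := by
  have hK : ∀ n, N.1.oc.N n ≤ ((shadow T N.1).isPair.Θ n).ker :=
    fun n => (GTcharm.ker_Θ N.2 (shadow T N.1) n).ge
  obtain ⟨g, hg⟩ := (shadow T N.1).isPair.exists_rep (shadow U N.1).f
  have hd := (shadow T N.1).isPair.comp_isData hK (isData_shadow U N.1) hg
  refine shadow_eq (hd.of_eq fun γ => opMap_mul _ (isData_shadow T N.1) hK γ) ?_ ?_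
  · rw [GTcharm.mul_eq, GTcharm.L_mul, GTcharm.L, GTcharm.ΘQ_q]
    exact IsPair.Θ_lam _ _
  · rw [GTcharm.mul_eq, GTcharm.F_mul, hg]
    rfl

theorem red_shadow (T : GThat) {K N : NFI} (hKN : K ≤ N) :
    GTcharm.red hKN (shadow T K) = shadow T N := by
  refine (shadow_eq (isData_mono (NFI.oc_mono hKN 2) (NFI.oc_mono hKN 3) (isData_shadow T K)) ?_ ?_).symm
  · rw [GTcharm.L_red]; rfl
  · rw [GTcharm.F_red]; rfl

end GThat

/-- Every operadic congruence contains, for at most four strands, that of an isolated element. -/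
theorem OpCongr.exists_isolated (𝒩 : OpCongr) :
    ∃ N : Isolated, N.1.oc.N 2 ≤ 𝒩.N 2 ∧ N.1.oc.N 3 ≤ 𝒩.N 3 ∧ N.1.oc.N 4 ≤ 𝒩.N 4 := by
  obtain ⟨N, h2, h3, h4⟩ := 𝒩.exists_NFI
  have h := NFI.oc_mono N.isolate_le
  exact ⟨⟨N.isolate, N.isIsolated_isolate⟩, (h 2).trans h2, (h 3).trans h3, (h 4).trans h4⟩

/-- Below any congruence there is an isolated element on 2 and 3 strands, so the data of `T` are
trivial at every level. The data determine `T` on the image of `PaB`, and continuity does the rest.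
-/
theorem GThat.eq_one_of_shadow {T : GThat} (h : ∀ N : Isolated, shadow T N.1 = 1) : T = 1 := by
  refine Subtype.ext (funext fun n => funext fun a => funext fun b => Homeomorph.ext fun x => ?_)
  refine HatHom.ext_lev fun 𝒩 => ?_
  change 𝒩.lev (T.1 n a b x) = 𝒩.lev x
  obtain ⟨K, h2, h3, -⟩ := 𝒩.exists_isolated
  have hd := isData_shadow T K.1
  rw [h K] at hd
  have hd' : (opMap T K.1.oc).IsData 0 ((1 : PB 3) : Braid 3) :=
    IsPair.isData_congr hd (GTcharm.L_one.trans (by simp [lam])) (GTcharm.F_one.trans (map_one _).symm)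
  obtain ⟨γ, e1, e2⟩ := HatHom.exists_lev_ι_of_continuous (T.1 n a b).continuous 𝒩 𝒩 x
  rw [e1, e2]
  exact OpMap.ext_of_isData (isData_mono h2 h3 hd') (OpMap.proj_isData 𝒩) γ

open PaB HatHom

/-! ### Compatible families of pairs -/

/-- A compatible family of solutions of the hexagon and pentagon relations modulo the operadic
congruences. -/
structure HatPair where
  m : OpCongr → ℤ
  f : OpCongr → PB 3
  isPair : ∀ 𝒩, IsPair 𝒩 (m 𝒩) (f 𝒩)
  compat_m : ∀ {𝒦 𝒩 : OpCongr}, (∀ n, 𝒦.N n ≤ 𝒩.N n) →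
    𝒩.q 2 (lam (m 𝒦) (σ 2 0)) = 𝒩.q 2 (lam (m 𝒩) (σ 2 0))
  compat_f : ∀ {𝒦 𝒩 : OpCongr}, (∀ n, 𝒦.N n ≤ 𝒩.N n) → 𝒩.q 3 (f 𝒦) = 𝒩.q 3 (f 𝒩)

namespace HatPair

variable (P Q R : HatPair)

/-- The kernel of the homomorphisms given by a compatible family. -/
def ker (𝒩 : OpCongr) : OpCongr := (P.isPair 𝒩).ker

/-- The operadic map given by a compatible family. -/
def opMap (𝒩 : OpCongr) : OpMap 𝒩 := (P.isPair 𝒩).opMap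

variable {n : ℕ} {a b c : PaB n}

/-- The level of the image of `x` under the operadic map given by a compatible family. -/
def lev (𝒩 : OpCongr) (x : HatHom a b) : Braid n ⧸ 𝒩.N n :=
  (𝒩.q n (Phi (P.f 𝒩) n 0 b.sh))⁻¹ * (P.isPair 𝒩).ΘQ (𝒦 := P.ker 𝒩) (fun _ => le_rfl) n ((P.ker 𝒩).lev x) *
    𝒩.q n (Phi (P.f 𝒩) n 0 a.sh)

theorem lev_congr {𝒩 : OpCongr} {x y : HatHom a b} (h : (P.ker 𝒩).lev x = (P.ker 𝒩).lev y) :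
    P.lev 𝒩 x = P.lev 𝒩 y := by rw [lev, h, lev]

theorem lev_ι (𝒩 : OpCongr) (γ : a ⟶ b) : P.lev 𝒩 (ι γ) = (P.opMap 𝒩).T γ := rfl

theorem red_opMap {𝒦 𝒩 : OpCongr} (h : ∀ k, 𝒦.N k ≤ 𝒩.N k) (γ : a ⟶ b) :
    OpCongr.red (h n) ((P.opMap 𝒦).T γ) = (P.opMap 𝒩).T γ := by
  have h' : IsPair 𝒩 (P.m 𝒦) (P.f 𝒦) := (P.isPair 𝒦).mono (h 3) (h 4)
  have e : OpCongr.red (h n) ((P.opMap 𝒦).T γ) = h'.opMap.T γ := by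
    rw [opMap, IsPair.opMap_T, IsPair.opMap_T, map_mul, map_mul, map_inv,
      ← (P.isPair 𝒦).red_Θ h' (h n)]
    rfl
  rw [e]
  exact OpMap.ext_of_isData (IsPair.isData_congr h'.opMap_isData (P.compat_m h) (P.compat_f h))
    (P.isPair 𝒩).opMap_isData γ

/-- At each level the result depends only on the class of `x` modulo the kernel; the levels fit
together because equivalent data give the same operadic map. -/
theorem exists_hat (x : HatHom a b) : ∃ y : HatHom a b, ∀ 𝒩 : OpCongr, 𝒩.lev y = P.lev 𝒩 x := by
  refine HatHom.exists_of_lev (fun 𝒩 => P.lev 𝒩 x) (fun 𝒩 => ?_) fun 𝒦 𝒩 h => ?_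
  · obtain ⟨γ, hγ⟩ := (P.ker 𝒩).exists_lev_ι x
    rw [P.lev_congr hγ, P.lev_ι, (P.opMap 𝒩).ρ_T, ρ_ou]
  · obtain ⟨γ, h1, h2⟩ := (P.ker 𝒦).exists_lev_ι₂ (P.ker 𝒩) x
    rw [P.lev_congr h1, P.lev_congr h2, P.lev_ι, P.lev_ι, P.red_opMap]

/-- The endomorphism of the completed operad given by a compatible family. -/
noncomputable def hat (x : HatHom a b) : HatHom a b := (P.exists_hat x).choose

theorem lev_hat (𝒩 : OpCongr) (x : HatHom a b) : 𝒩.lev (P.hat x) = P.lev 𝒩 x :=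
  (P.exists_hat x).choose_spec 𝒩

theorem hat_comp (x : HatHom a b) (y : HatHom b c) : P.hat (x.comp y) = (P.hat x).comp (P.hat y) := by
  refine HatHom.ext_lev fun 𝒩 => ?_
  rw [𝒩.lev_comp, lev_hat, lev_hat, lev_hat, lev, lev, lev, OpCongr.lev_comp, map_mul]
  group

theorem hat_perm (θ : Equiv.Perm (Fin n)) (x : HatHom a b) :
    P.hat (map (perm_functor θ) x) = map (perm_functor θ) (P.hat x) := by
  refine HatHom.ext_lev fun 𝒩 => ?_
  rw [lev_hat, 𝒩.lev_perm, lev_hat]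
  obtain ⟨γ, hγ⟩ := (P.ker 𝒩).exists_lev_ι x
  rw [P.lev_congr hγ, P.lev_congr (y := ι ((perm_functor θ).map γ)) (by
    rw [OpCongr.lev_perm, hγ]; rfl), P.lev_ι, P.lev_ι, OpMap.T_perm]

theorem hat_insert {k : ℕ} (i : Fin n) {c d : PaB k} (x : HatHom a b) (y : HatHom c d) :
    P.hat (map₂ (insertFunctor n k i) x y) = map₂ (insertFunctor n k i) (P.hat x) (P.hat y) := by
  refine HatHom.ext_lev fun 𝒩 => ?_
  obtain ⟨γ, hγ⟩ := (P.ker 𝒩).exists_lev_ι x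
  obtain ⟨η, hη⟩ := (P.ker 𝒩).exists_lev_ι y
  obtain ⟨u, hu⟩ := 𝒩.q_surjective n ((P.opMap 𝒩).T γ)
  obtain ⟨v, hv⟩ := 𝒩.q_surjective k ((P.opMap 𝒩).T η)
  have h1 : (P.ker 𝒩).lev (map₂ (insertFunctor n k i) x y) = (P.ker 𝒩).lev (ι (insMor i γ η)) :=
    ((P.ker 𝒩).lev_map₂ i hγ hη).trans ((OpMap.proj (P.ker 𝒩)).T_insert i γ η rfl rfl).symm
  have h2 : 𝒩.lev (P.hat x) = 𝒩.q n u := by rw [lev_hat, P.lev_congr hγ, P.lev_ι, hu]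
  have h3 : 𝒩.lev (P.hat y) = 𝒩.q k v := by rw [lev_hat, P.lev_congr hη, P.lev_ι, hv]
  refine (P.lev_hat 𝒩 _).trans ((P.lev_congr h1).trans (Eq.trans ?_ (𝒩.lev_map₂ i h2 h3).symm))
  exact (P.opMap 𝒩).T_insert i γ η hu.symm hv.symm

theorem continuous_hat : Continuous (P.hat : HatHom a b → HatHom a b) :=
  HatHom.continuous_of_lev fun 𝒩 => ⟨P.ker 𝒩, fun x y h => by
    rw [lev_hat, lev_hat, P.lev_congr h]⟩

/-- The relation `R = P ∘ Q`. -/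
structure IsComp : Prop where
  m_eq : ∀ 𝒩 : OpCongr, 𝒩.q 2 (lam (R.m 𝒩) (σ 2 0)) =
    (P.isPair 𝒩).Θ 2 (lam (Q.m (P.ker 𝒩)) (σ 2 0))
  f_eq : ∀ 𝒩 : OpCongr, 𝒩.q 3 (R.f 𝒩) = 𝒩.q 3 (P.f 𝒩) * (P.isPair 𝒩).Θ 3 (Q.f (P.ker 𝒩))

variable {P Q R}

/-- At a fixed level both sides are operadic maps applied to one morphism that approximates `x`, and
`comp_isData` shows that they have the same data. -/
theorem IsComp.hat_hat (h : IsComp P Q R) (x : HatHom a b) : P.hat (Q.hat x) = R.hat x := by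
  refine HatHom.ext_lev fun 𝒩 => ?_
  obtain ⟨γ, h1, h2⟩ := (Q.ker (P.ker 𝒩)).exists_lev_ι₂ (R.ker 𝒩) x
  have hd := (P.isPair 𝒩).comp_isData (𝒦 := P.ker 𝒩) (fun _ => le_rfl)
    (Q.isPair (P.ker 𝒩)).opMap_isData (h.f_eq 𝒩)
  have hd' := (R.isPair 𝒩).opMap_isData
  have e := IsPair.isData_congr (f₁ := R.f 𝒩) hd
    (((P.isPair 𝒩).Θ_lam _).symm.trans (h.m_eq 𝒩).symm) rfl
  rw [lev_hat, lev_hat, R.lev_congr h2, R.lev_ι, lev, lev_hat, Q.lev_congr h1, Q.lev_ι]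
  exact OpMap.ext_of_isData e hd' γ

theorem hat_eq_self (hm : ∀ 𝒩 : OpCongr, 𝒩.q 2 (lam (P.m 𝒩) (σ 2 0)) = 𝒩.q 2 (σ 2 0))
    (hf : ∀ 𝒩 : OpCongr, 𝒩.q 3 (P.f 𝒩) = 1) (x : HatHom a b) : P.hat x = x := by
  refine HatHom.ext_lev fun 𝒩 => ?_
  obtain ⟨γ, h1, h2⟩ := 𝒩.exists_lev_ι₂ (P.ker 𝒩) x
  have e := IsPair.isData_congr (m₁ := 0) (f₁ := 1) (P.isPair 𝒩).opMap_isData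
    ((hm 𝒩).trans (by simp [lam])) ((hf 𝒩).trans (map_one _).symm)
  rw [lev_hat, P.lev_congr h2, P.lev_ι, h1]
  exact OpMap.ext_of_isData e (OpMap.proj_isData 𝒩) γ

/-- The element of `GThat` given by two mutually inverse compatible families. -/
noncomputable def toGThat (P Q : HatPair)
    (h₁ : ∀ {n : ℕ} {a b : PaB n} (x : HatHom a b), P.hat (Q.hat x) = x)
    (h₂ : ∀ {n : ℕ} {a b : PaB n} (x : HatHom a b), Q.hat (P.hat x) = x) : GThat :=
  ⟨fun _ _ _ => ⟨⟨P.hat, Q.hat, h₂, h₁⟩, P.continuous_hat, Q.continuous_hat⟩,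
    fun _ _ _ _ x y => P.hat_comp x y, fun _ θ _ _ x => P.hat_perm θ x,
    fun _ _ i _ _ _ _ x y => P.hat_insert i x y⟩

theorem toGThat_isData (P Q : HatPair)
    (h₁ : ∀ {n : ℕ} {a b : PaB n} (x : HatHom a b), P.hat (Q.hat x) = x)
    (h₂ : ∀ {n : ℕ} {a b : PaB n} (x : HatHom a b), Q.hat (P.hat x) = x) (𝒩 : OpCongr) :
    (GThat.opMap (toGThat P Q h₁ h₂) 𝒩).IsData (P.m 𝒩) (P.f 𝒩) :=
  (P.isPair 𝒩).opMap_isData.of_eq fun γ => P.lev_hat 𝒩 (ι γ)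

end HatPair

/-! ### Compatible families of charming GT-shadows -/

/-- The compatible families of charming GT-shadows of isolated elements. -/
def Coherent (s : ∀ N : Isolated, GTcharm N.1) : Prop :=
  ∀ (K N : Isolated) (h : K ≤ N), GTcharm.redHom h (s K) = s N

namespace Coherent

/-- An isolated element below a given operadic congruence. -/
noncomputable def iso (𝒩 : OpCongr) : Isolated := 𝒩.exists_isolated.choose

theorem iso_le₂ (𝒩 : OpCongr) : (iso 𝒩).1.oc.N 2 ≤ 𝒩.N 2 := 𝒩.exists_isolated.choose_spec.1

theorem iso_le₃ (𝒩 : OpCongr) : (iso 𝒩).1.oc.N 3 ≤ 𝒩.N 3 := 𝒩.exists_isolated.choose_spec.2.1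

theorem iso_le₄ (𝒩 : OpCongr) : (iso 𝒩).1.oc.N 4 ≤ 𝒩.N 4 := 𝒩.exists_isolated.choose_spec.2.2

variable {s t : ∀ N : Isolated, GTcharm N.1}

/-- The class of `s` modulo an operadic congruence does not depend on the isolated element. -/
theorem q_eq (hs : Coherent s) {𝒩 : OpCongr} {K M : Isolated} (hK₂ : K.1.oc.N 2 ≤ 𝒩.N 2)
    (hK₃ : K.1.oc.N 3 ≤ 𝒩.N 3) (hM₂ : M.1.oc.N 2 ≤ 𝒩.N 2) (hM₃ : M.1.oc.N 3 ≤ 𝒩.N 3) :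
    𝒩.q 2 (lam (s K).m (σ 2 0)) = 𝒩.q 2 (lam (s M).m (σ 2 0)) ∧
      𝒩.q 3 (s K).f = 𝒩.q 3 (s M).f := by
  have key : ∀ {I K : Isolated}, I ≤ K → K.1.oc.N 2 ≤ 𝒩.N 2 → K.1.oc.N 3 ≤ 𝒩.N 3 →
      𝒩.q 2 (lam (s I).m (σ 2 0)) = 𝒩.q 2 (lam (s K).m (σ 2 0)) ∧
        𝒩.q 3 (s I).f = 𝒩.q 3 (s K).f := by
    intro I K h h2 h3
    have hL := congrArg GTcharm.L (hs I K h)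
    have hF := congrArg GTcharm.F (hs I K h)
    exact ⟨congrArg (OpCongr.red h2) ((GTcharm.L_red h (s I)).symm.trans hL),
      congrArg (OpCongr.red h3) ((GTcharm.F_red h (s I)).symm.trans hF)⟩
  have := K.1.finiteIndex
  have := M.1.finiteIndex
  -- An intersection of isolated elements need not be known to be isolated; replacing it by
  -- `isolate` gives an isolated element below both.
  let J : NFI := ⟨K.1.N ⊓ M.1.N, inferInstance, inferInstance, inf_le_left.trans K.1.le_PB⟩
  let I : Isolated := ⟨J.isolate, J.isIsolated_isolate⟩
  have h1 : I ≤ K := J.isolate_le.trans (inf_le_left : K.1.N ⊓ M.1.N ≤ K.1.N)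
  have h2 : I ≤ M := J.isolate_le.trans (inf_le_right : K.1.N ⊓ M.1.N ≤ M.1.N)
  have e1 := key h1 hK₂ hK₃
  have e2 := key h2 hM₂ hM₃
  exact ⟨e1.1.symm.trans e2.1, e1.2.symm.trans e2.2⟩

/-- The compatible family of pairs given by a compatible family of charming GT-shadows. -/
noncomputable def toHatPair (hs : Coherent s) : HatPair where
  m 𝒩 := (s (iso 𝒩)).m
  f 𝒩 := (s (iso 𝒩)).f
  isPair 𝒩 := (s (iso 𝒩)).isPair.mono (iso_le₃ 𝒩) (iso_le₄ 𝒩)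
  compat_m {𝒦 𝒩} h := (hs.q_eq ((iso_le₂ 𝒦).trans (h 2)) ((iso_le₃ 𝒦).trans (h 3)) (iso_le₂ 𝒩)
    (iso_le₃ 𝒩)).1
  compat_f {𝒦 𝒩} h := (hs.q_eq ((iso_le₂ 𝒦).trans (h 2)) ((iso_le₃ 𝒦).trans (h 3)) (iso_le₂ 𝒩)
    (iso_le₃ 𝒩)).2

/-- All data involved can be computed at a single isolated `K` below both `𝒩` and the congruence of
kernels. There the claim is the composition law of shadows for `K`, reduced modulo `𝒩`. -/
theorem isComp (hs : Coherent s) (ht : Coherent t) (hst : Coherent (s * t)) :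
    HatPair.IsComp hs.toHatPair ht.toHatPair hst.toHatPair := by
  have key : ∀ 𝒩 : OpCongr, 𝒩.q 2 (lam (hst.toHatPair.m 𝒩) (σ 2 0)) =
      (hs.toHatPair.isPair 𝒩).Θ 2 (lam (ht.toHatPair.m (hs.toHatPair.ker 𝒩)) (σ 2 0)) ∧
      𝒩.q 3 (hst.toHatPair.f 𝒩) = 𝒩.q 3 (hs.toHatPair.f 𝒩) *
        (hs.toHatPair.isPair 𝒩).Θ 3 (ht.toHatPair.f (hs.toHatPair.ker 𝒩)) := by
    intro 𝒩
    obtain ⟨K, h2, h3, h4⟩ := (𝒩 ⊓ hs.toHatPair.ker 𝒩).exists_isolated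
    have l2 : K.1.oc.N 2 ≤ 𝒩.N 2 := h2.trans inf_le_left
    have l3 : K.1.oc.N 3 ≤ 𝒩.N 3 := h3.trans inf_le_left
    have l4 : K.1.oc.N 4 ≤ 𝒩.N 4 := h4.trans inf_le_left
    have e1 := hst.q_eq (iso_le₂ 𝒩) (iso_le₃ 𝒩) l2 l3
    have e2 := hs.q_eq (iso_le₂ 𝒩) (iso_le₃ 𝒩) l2 l3
    have e3 := ht.q_eq (iso_le₂ (hs.toHatPair.ker 𝒩)) (iso_le₃ (hs.toHatPair.ker 𝒩))
      (h2.trans inf_le_right) (h3.trans inf_le_right)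
    have hp : IsPair 𝒩 (s K).m (s K).f := (s K).isPair.mono l3 l4
    have hΘ : ∀ n, (hs.toHatPair.isPair 𝒩).Θ n = hp.Θ n := fun n => IsPair.Θ_congr _ hp e2.1 e2.2 n
    have hL : (s K * t K).L = (s K).Θ 2 (lam (t K).m (σ 2 0)) := by
      rw [GTcharm.mul_eq, GTcharm.L_mul]; rfl
    have hF : (s K * t K).F = (s K).F * (s K).Θ 3 (t K).f := by
      rw [GTcharm.mul_eq, GTcharm.F_mul]; rfl
    constructor
    · refine e1.1.trans ?_
      have e4 : (hs.toHatPair.isPair 𝒩).Θ 2 (lam (ht.toHatPair.m (hs.toHatPair.ker 𝒩)) (σ 2 0)) =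
          (hs.toHatPair.isPair 𝒩).Θ 2 (lam (t K).m (σ 2 0)) :=
        congrArg ((hs.toHatPair.isPair 𝒩).ΘQ (𝒦 := hs.toHatPair.ker 𝒩) (fun _ => le_rfl) 2) e3.1
      refine Eq.trans ?_ e4.symm
      rw [hΘ, ← (s K).isPair.red_Θ hp l2]
      exact congrArg (OpCongr.red l2) hL
    · refine e1.2.trans ?_
      have e4 : (hs.toHatPair.isPair 𝒩).Θ 3 (ht.toHatPair.f (hs.toHatPair.ker 𝒩)) =
          (hs.toHatPair.isPair 𝒩).Θ 3 (t K).f :=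
        congrArg ((hs.toHatPair.isPair 𝒩).ΘQ (𝒦 := hs.toHatPair.ker 𝒩) (fun _ => le_rfl) 3) e3.2
      refine Eq.trans ?_ (congrArg₂ (· * ·) e2.2.symm e4.symm)
      rw [hΘ, ← (s K).isPair.red_Θ hp l3]
      exact (congrArg (OpCongr.red l3) hF).trans (map_mul _ _ _)
  exact ⟨fun 𝒩 => (key 𝒩).1, fun 𝒩 => (key 𝒩).2⟩

theorem mul (hs : Coherent s) (ht : Coherent t) : Coherent (s * t) := fun K N h => by
  rw [Pi.mul_apply, map_mul, hs K N h, ht K N h]; rfl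

theorem inv (hs : Coherent s) : Coherent s⁻¹ := fun K N h => by
  rw [Pi.inv_apply, map_inv, hs K N h]; rfl

theorem hat_hat (hs : Coherent s) (ht : Coherent t) (hst : s * t = 1) {n : ℕ} {a b : PaB n}
    (x : HatHom a b) : hs.toHatPair.hat (ht.toHatPair.hat x) = x := by
  rw [(isComp hs ht (hs.mul ht)).hat_hat]
  have h1 : ∀ K, (s * t) K = 1 := fun K => congrFun hst K
  refine HatPair.hat_eq_self (fun 𝒩 => ?_) (fun 𝒩 => ?_) x
  · have := congrArg (OpCongr.red (iso_le₂ 𝒩)) ((congrArg GTcharm.L (h1 (iso 𝒩))).trans GTcharm.L_one)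
    exact this
  · have := congrArg (OpCongr.red (iso_le₃ 𝒩)) ((congrArg GTcharm.F (h1 (iso 𝒩))).trans GTcharm.F_one)
    exact this.trans (map_one _)

/-- The families of shadows and of inverse shadows give mutually inverse endomorphisms of the
completed operad, and both are continuous. -/
theorem exists_shadow_eq (hs : Coherent s) : ∃ T : GThat, ∀ N : Isolated, GThat.shadow T N.1 = s N := by
  refine ⟨HatPair.toGThat hs.toHatPair hs.inv.toHatPair (hat_hat hs hs.inv (mul_inv_cancel s))
    (hat_hat hs.inv hs (inv_mul_cancel s)), fun N => ?_⟩
  have e := hs.q_eq (iso_le₂ N.1.oc) (iso_le₃ N.1.oc) (M := N) le_rfl le_rfl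
  exact GThat.shadow_eq (HatPair.toGThat_isData _ _ _ _ N.1.oc) e.1.symm e.2.symm

end Coherent

/-! ### The limit -/

/-- The homomorphism to the group of charming GT-shadows of an isolated element. -/
noncomputable def GThat.shadowHom (N : Isolated) : GThat →* GTcharm N.1 :=
  MonoidHom.mk' (fun T => shadow T N.1) fun T U => shadow_mul T U N

/-- The cone given by the charming GT-shadows of the elements of `GThat`. -/
noncomputable def GThat.cone : Limits.Cone (ML ⋙ finToGrp) where
  pt := GrpCat.of GThat
  π :=
    { app := fun N => GrpCat.ofHom (shadowHom N)
      naturality := fun K N h => by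
        ext T
        exact (red_shadow T (leOfHom h)).symm }

/-- An element of the limit is a coherent family of shadows, so surjectivity is `exists_shadow_eq`;
an element with trivial image has trivial shadows, so injectivity is `eq_one_of_shadow`. -/
theorem GThat.lift_bijective : Function.Bijective (Limits.limit.lift (ML ⋙ finToGrp) GThat.cone) := by
  have hπ : ∀ (T : GThat) (N : Isolated), Limits.limit.π (ML ⋙ finToGrp) N
      (Limits.limit.lift (ML ⋙ finToGrp) GThat.cone T) = shadow T N.1 := fun T N =>
    congrArg (fun φ => φ.hom T) (Limits.limit.lift_π GThat.cone N)
  constructor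
  · refine (injective_iff_map_eq_one (Limits.limit.lift (ML ⋙ finToGrp) GThat.cone).hom).2 fun T hT => ?_
    refine GThat.eq_one_of_shadow fun N => (hπ T N).symm.trans ?_
    exact (congrArg _ hT).trans (map_one (Limits.limit.π (ML ⋙ finToGrp) N).hom)
  · intro z
    have hs : Coherent fun N => Limits.limit.π (ML ⋙ finToGrp) N z := fun K N h =>
      congrArg (fun φ => φ.hom z) (Limits.limit.w (ML ⋙ finToGrp) (homOfLE h))
    obtain ⟨T, hT⟩ := hs.exists_shadow_eq
    refine ⟨T, Limits.Concrete.limit_ext (ML ⋙ finToGrp) _ _ fun N => ?_⟩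
    exact (hπ T N).trans (hT N)

end GTShadows

theorem theorem3p9 :
    ∃ (ML : Isolated ⥤ FiniteGrp.{0}) (e : ∀ N : Isolated, ML.obj N ≃ GTcharm N.1),
      (∀ (N : Isolated) (s t : ML.obj N), IsComposite N.1 (e N s) (e N t) (e N (s * t))) ∧
      (∀ (K N : Isolated) (h : K ⟶ N) (s : ML.obj K), IsReduction (e K s) (e N (ML.map h s))) ∧
      Nonempty (GrpCat.of GThat ≅ Limits.limit (ML ⋙ finToGrp)) := by
  refine ⟨ML, fun _ => Equiv.refl _, GTcharm.isComposite_mul,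
    fun K N h s => GTcharm.isReduction_red (leOfHom h) s, ⟨MulEquiv.toGrpIso ?_⟩⟩
  exact MulEquiv.ofBijective (Limits.limit.lift (ML ⋙ finToGrp) GThat.cone).hom GThat.lift_bijective
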